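/- Let $\Gamma$ be a finitely generated group, with a surjection $\pi: F_p\to\Gamma$ from a free group, and let $G$ be a (finite-dimensional) complex Lie group with Lie algebra $\mathfrak g$. Let $X=\mathrm{Hom}(\Gamma,G)\subset G^p$ be the (possibly non-reduced) complex space defined by the equations $w(y)=1$, $w\in\ker\pi$, let $\Omega^n_X$ be its sheaf of Kähler $n$-forms, and let $\Omega^n_{\mathrm{bas}}\subset H^0(X,\Omega^n_X)$ be the space of basic forms: those $\omega$ with $i_{\mathbf v}\omega=0$ and $i_{\mathbf v}d\omega=0$ for all $v\in\mathfrak g$, where $\mathbf v$ is the vector field of $v$ for the conjugation action of $G$. It is the space of $n$-forms on the character stack $\underline\chi_G(\Gamma)$. For a complex vector space $V$, let $H^n(\Gamma,V)$ be group cohomology with trivial action on $V$. An $H^n(\Gamma,\mathbb C)$-valued basic $n$-form is understood to be an element of $H^n(\Gamma,\Omega^n_{\mathrm{bas}})$. The canonical map $\Omega^n_{\mathrm{bas}}\otimes H^n(\Gamma,\mathbb C)\to H^n(\Gamma,\Omega^n_{\mathrm{bas}})$ is injective. There are linear maps $\eta:\mathbb C[\mathfrak g]^G_n\to H^n(\Gamma,\Omega^n_{\mathrm{bas}})$,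 $\Phi\mapsto\eta_\Phi$, $n\ge 0$, on the $G$-invariant homogeneous polynomials of degree $n$ with the following properties. 1. Let $\sigma(\gamma)=d\rho(\gamma)\,\rho(\gamma)^{-1}$ be the tautological 1-cocycle of $\Gamma$ with values in $\mathfrak g$-valued 1-forms on $X$. The image of $\eta_\Phi$ in $H^n(\Gamma,H^0(X,\Omega^n_X))$ is $\Phi$ applied to the $n$-fold cup power of $\sigma$, i.e. the class of the cocycle $(\gamma_1,\dots,\gamma_n)\mapsto\Phi\big(\sigma(\gamma_1)\wedge \mathrm{Ad}\rho(\gamma_1)\sigma(\gamma_2)\wedge\cdots\wedge\mathrm{Ad}\rho(\gamma_1\cdots\gamma_{n-1})\sigma(\gamma_n)\big)$, where $\Phi$ is regarded as a symmetric $n$-linear form with $\Phi(v,\dots,v)=\Phi(v)$. 2. At each $\rho\in X$, $\Phi$ and the cup product give an alternating map $H^1(\Gamma,\mathrm{Ad}\rho)^n\to H^n(\Gamma,(\mathrm{Ad}\rho)^{\otimes n})\to H^n(\Gamma,\mathbb C)$, where $\Phi$ is now read as its full polarization (the $n$-th derivative $D^n\Phi(0)$, which is $n!$ times the form in 1), and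 the values of $\eta_\Phi$ at $\rho$ on tangent vectors $s_1,\dots,s_n\in Z^1(\Gamma,\mathrm{Ad}\rho)=T_\rho X$ are the values of this map on their classes. 3. $\eta_\Phi$ is $\mathrm{Aut}(\Gamma)$-invariant: for every $\alpha\in\mathrm{Aut}(\Gamma)$, the pullback of forms along $\rho\mapsto\rho\circ\alpha$ maps $\eta_\Phi$ to $\alpha^*\eta_\Phi$, where $\alpha^*$ is the action on group cohomology. 4. $\eta$ is a homomorphism of graded $\mathbb C$-algebras from $\mathbb C[\mathfrak g]^G$ to $\bigoplus_n H^n(\Gamma,\Omega^n_{\mathrm{bas}})^{\mathrm{Aut}(\Gamma)}$ with the product given by the wedge product of forms and the cup product: $\eta_1=1$ and $\eta_{\Phi\Psi}=\eta_\Phi\cdot\eta_\Psi$. 5. If $H^n(\Gamma,\mathbb C)$ is finite-dimensional, then $\eta_\Phi\in\Omega^n_{\mathrm{bas}}\otimes H^n(\Gamma,\mathbb C)$ for $\Phi\in\mathbb C[\mathfrak g]^G_n$, so that, if this holds for all $n$, $\eta$ is a graded algebra homomorphism $\mathbb C[\mathfrak g]^G\to\bigoplus_n\big(\Omega^n_{\mathrm{bas}}\otimes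 H^n(\Gamma,\mathbb C)\big)^{\mathrm{Aut}(\Gamma)}$. -/

import Mathlib

open scoped Manifold ContDiff Topology TensorProduct
open Filter

noncomputable section

namespace CharStack

/-! ### Group cohomology with constant coefficients -/

section Cohomology

variable {Γ : Type} [Group Γ] {V W : Type} [AddCommGroup V] [Module ℂ V] [AddCommGroup W]
  [Module ℂ W] {n : ℕ}

variable (Γ V n) in
/-- `H^n(Γ, V)`, where `Γ` acts trivially on the complex vector space `V`. -/
abbrev H : ModuleCat ℂ := groupCohomology (Rep.trivial ℂ Γ V) n

/-- The inhomogeneous cochain `c` is a cocycle and its class is `x`. -/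
def Represents (c : (Fin n → Γ) → V) (x : H Γ V n) : Prop :=
  ∃ z : groupCohomology.cocycles (Rep.trivial ℂ Γ V) n,
    groupCohomology.iCocycles (Rep.trivial ℂ Γ V) n z = c ∧
    groupCohomology.π (Rep.trivial ℂ Γ V) n z = x

variable (Γ n) in
/-- The map `H^n(Γ, V) → H^n(Γ, W)` induced by a linear map `V → W`. -/
def coeffMap (f : V →ₗ[ℂ] W) : H Γ V n →ₗ[ℂ] H Γ W n :=
  (groupCohomology.map (MonoidHom.id Γ)
    (Rep.ofHom ⟨f, fun _ => rfl⟩ : Rep.trivial ℂ Γ V ⟶ Rep.trivial ℂ Γ W) n).hom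

variable (V n) in
/-- The map `α^* : H^n(Γ, V) → H^n(Γ, V)` for an automorphism `α` of `Γ`, which is induced by
`c ↦ c ∘ α`. -/
def autMap (α : Γ ≃* Γ) : H Γ V n →ₗ[ℂ] H Γ V n :=
  (groupCohomology.map α.toMonoidHom
    (Rep.ofHom ⟨LinearMap.id, fun _ => rfl⟩ :
      Rep.res α.toMonoidHom (Rep.trivial ℂ Γ V) ⟶ Rep.trivial ℂ Γ V) n).hom

theorem exists_represents (x : H Γ V n) : ∃ c : (Fin n → Γ) → V, Represents c x := by
  induction x using groupCohomology_induction_on with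
  | h z => exact ⟨_, z, rfl, rfl⟩

theorem Represents.unique {c : (Fin n → Γ) → V} {x y : H Γ V n} (hx : Represents c x)
    (hy : Represents c y) : x = y := by
  obtain ⟨z, hz, rfl⟩ := hx
  obtain ⟨w, hw, rfl⟩ := hy
  rw [(ModuleCat.mono_iff_injective (groupCohomology.iCocycles (Rep.trivial ℂ Γ V) n)).1
    inferInstance (hz.trans hw.symm)]

theorem Represents.add {c c' : (Fin n → Γ) → V} {x x' : H Γ V n}
    (h : Represents c x) (h' : Represents c' x') : Represents (c + c') (x + x') := by
  obtain ⟨z, rfl, rfl⟩ := h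
  obtain ⟨z', rfl, rfl⟩ := h'
  exact ⟨z + z', map_add _ _ _, map_add _ _ _⟩

theorem Represents.smul {c : (Fin n → Γ) → V} {x : H Γ V n} (t : ℂ)
    (h : Represents c x) : Represents (t • c) (t • x) := by
  obtain ⟨z, rfl, rfl⟩ := h
  exact ⟨t • z, map_smul _ _ _, map_smul _ _ _⟩

theorem Represents.map {c : (Fin n → Γ) → V} {x : H Γ V n} (f : V →ₗ[ℂ] W)
    (h : Represents c x) : Represents (fun γ => f (c γ)) (coeffMap Γ n f x) := by
  obtain ⟨z, rfl, rfl⟩ := h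
  let F : Rep.res (MonoidHom.id Γ) (Rep.trivial ℂ Γ V) ⟶ Rep.trivial ℂ Γ W :=
    Rep.ofHom ⟨f, fun _ => rfl⟩
  have h1 := HomologicalComplex.cyclesMap_i (groupCohomology.cochainsMap (MonoidHom.id Γ) F) n
  have h2 := groupCohomology.π_map_apply (MonoidHom.id Γ) F n z
  refine ⟨(groupCohomology.cocyclesMap (MonoidHom.id Γ) F n).hom z, ?_, h2.symm⟩
  exact congrArg (fun T => (ModuleCat.Hom.hom T) z) h1

theorem coeffMap_add (f g : V →ₗ[ℂ] W) : coeffMap Γ n (f + g) = coeffMap Γ n f + coeffMap Γ n g := by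
  refine LinearMap.ext fun x => ?_
  obtain ⟨c, hc⟩ := exists_represents x
  exact (hc.map (f + g)).unique ((hc.map f).add (hc.map g))

theorem coeffMap_smul (t : ℂ) (f : V →ₗ[ℂ] W) : coeffMap Γ n (t • f) = t • coeffMap Γ n f := by
  refine LinearMap.ext fun x => ?_
  obtain ⟨c, hc⟩ := exists_represents x
  exact (hc.map (t • f)).unique ((hc.map f).smul t)

variable (Γ V n) in
/-- The canonical map `V ⊗ H^n(Γ, ℂ) → H^n(Γ, V)`. -/
def tensorMap : V ⊗[ℂ] H Γ ℂ n →ₗ[ℂ] H Γ V n :=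
  TensorProduct.lift
    { toFun := fun v => coeffMap Γ n (LinearMap.toSpanSingleton ℂ V v)
      map_add' := fun v w => by rw [← coeffMap_add, LinearMap.toSpanSingleton_add]
      map_smul' := fun t v => by rw [RingHom.id_apply, ← coeffMap_smul, LinearMap.toSpanSingleton_smul] }

end Cohomology

/-! ### Germs of holomorphic forms -/

section Local

variable {V : Type} [NormedAddCommGroup V] [NormedSpace ℂ V]

/-- The ring `𝒪_a` of germs at `a` of holomorphic functions. -/
def HolGerm (a : V) : Subring (Germ (𝓝 a) ℂ) where
  carrier := {φ | ∃ f : V → ℂ, AnalyticAt ℂ f a ∧ (f : Germ (𝓝 a) ℂ) = φ}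
  mul_mem' := by
    rintro _ _ ⟨f, hf, rfl⟩ ⟨g, hg, rfl⟩
    exact ⟨f * g, hf.mul hg, rfl⟩
  add_mem' := by
    rintro _ _ ⟨f, hf, rfl⟩ ⟨g, hg, rfl⟩
    exact ⟨f + g, hf.add hg, rfl⟩
  one_mem' := ⟨fun _ => 1, analyticAt_const, rfl⟩
  zero_mem' := ⟨fun _ => 0, analyticAt_const, rfl⟩
  neg_mem' := by
    rintro _ ⟨f, hf, rfl⟩
    exact ⟨-f, hf.neg, rfl⟩

instance (a : V) : Algebra ℂ (HolGerm a) :=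
  RingHom.toAlgebra
    { toFun := fun z => ⟨((fun _ => z : V → ℂ) : Germ (𝓝 a) ℂ), _, analyticAt_const, rfl⟩
      map_one' := rfl
      map_mul' := fun _ _ => rfl
      map_zero' := rfl
      map_add' := fun _ _ => rfl }

/-- The `𝒪_a`-module `Ω¹_a` of germs at `a` of holomorphic 1-forms. -/
def FormGerm (a : V) : Submodule (HolGerm a) (Germ (𝓝 a) (V →L[ℂ] ℂ)) where
  carrier := {φ | ∃ θ : V → V →L[ℂ] ℂ, AnalyticAt ℂ θ a ∧ (θ : Germ (𝓝 a) (V →L[ℂ] ℂ)) = φ}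
  add_mem' := by
    rintro _ _ ⟨f, hf, rfl⟩ ⟨g, hg, rfl⟩
    exact ⟨f + g, hf.add hg, rfl⟩
  zero_mem' := ⟨fun _ => 0, analyticAt_const, rfl⟩
  smul_mem' := by
    rintro ⟨_, f, hf, rfl⟩ _ ⟨g, hg, rfl⟩
    exact ⟨f • g, hf.smul hg, rfl⟩

instance (a : V) : Module ℂ (FormGerm a) := Module.compHom _ (algebraMap ℂ (HolGerm a))

instance (a : V) : IsScalarTower ℂ (HolGerm a) (FormGerm a) :=
  IsScalarTower.of_algebraMap_smul fun _ _ => rfl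

open Classical in
/-- The germ at `a` of a function that is holomorphic at `a` (and `0` for any other function). -/
def holGerm (a : V) (f : V → ℂ) : HolGerm a :=
  if h : AnalyticAt ℂ f a then ⟨f, f, h, rfl⟩ else 0

open Classical in
/-- The germ at `a` of a 1-form that is holomorphic at `a` (and `0` for any other 1-form). -/
def formGerm (a : V) (θ : V → V →L[ℂ] ℂ) : FormGerm a :=
  if h : AnalyticAt ℂ θ a then ⟨θ, θ, h, rfl⟩ else 0

/-- The algebra `Ω^•_a` of germs at `a` of holomorphic differential forms: the exterior algebra
of the free `𝒪_a`-module `Ω¹_a`. -/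
abbrev DR (a : V) : Type := ExteriorAlgebra (HolGerm a) (FormGerm a)

/-- The element `f dg₁ ∧ ⋯ ∧ dgₙ` of `Ω^n_a`. -/
def monomial (a : V) {n : ℕ} (f : V → ℂ) (g : Fin n → V → ℂ) : DR a :=
  algebraMap (HolGerm a) (DR a) (holGerm a f) *
    (List.ofFn fun k => ExteriorAlgebra.ι (HolGerm a) (formGerm a (fderiv ℂ (g k)))).prod

/-- The graph of the exterior derivative `d : Ω^•_a → Ω^•_a`: the span of the pairs
`(f dg₁ ∧ ⋯ ∧ dgₙ, df ∧ dg₁ ∧ ⋯ ∧ dgₙ)`. -/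
def dGraph (a : V) : Submodule ℂ (DR a × DR a) :=
  Submodule.span ℂ {q | ∃ (n : ℕ) (f : V → ℂ) (g : Fin n → V → ℂ), AnalyticAt ℂ f a ∧
    (∀ k, AnalyticAt ℂ (g k) a) ∧
    q = (monomial a f g, monomial a (fun _ => 1) (Fin.cons f g : Fin (n + 1) → V → ℂ))}

/-- The pairing of holomorphic 1-forms with a vector field that is holomorphic at `a`. -/
def pairing (a : V) (X : V → V) (hX : AnalyticAt ℂ X a) :
    FormGerm a →ₗ[HolGerm a] HolGerm a where
  toFun φ := ⟨Germ.map₂ (fun (l : V →L[ℂ] ℂ) x => l x) φ.1 (X : Germ (𝓝 a) V), by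
    obtain ⟨_, θ, hθ, rfl⟩ := φ
    exact ⟨fun e => θ e (X e), ((ContinuousLinearMap.id ℂ (V →L[ℂ] ℂ)).analyticAt_bilinear _).comp₂ hθ hX, rfl⟩⟩
  map_add' := by
    rintro ⟨_, θ, hθ, rfl⟩ ⟨_, θ', hθ', rfl⟩
    rfl
  map_smul' := by
    rintro ⟨_, f, hf, rfl⟩ ⟨_, θ, hθ, rfl⟩
    rfl

open Classical in
/-- The contraction `i_X : Ω^•_a → Ω^•_a` with a vector field that is holomorphic at `a`. -/
def contract (a : V) (X : V → V) : DR a →ₗ[HolGerm a] DR a :=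
  if hX : AnalyticAt ℂ X a then CliffordAlgebra.contractLeft (pairing a X hX) else 0

/-- The value at `a` of the degree `n` component of a germ of a form on the tangent vectors
`ξ₁, …, ξₙ`, normalized by `(λ₁ ∧ ⋯ ∧ λₙ)(ξ₁, …, ξₙ) = det (λᵢ(ξⱼ))`. -/
def evalAt (a : V) {n : ℕ} (ξ : Fin n → V) (θ : DR a) : ℂ :=
  Germ.value (ExteriorAlgebra.liftAlternating (R := HolGerm a) (Pi.single n
    ((Matrix.detRowAlternating (R := HolGerm a) (n := Fin n)).compLinearMap
      (LinearMap.pi fun j => pairing a (fun _ => ξ j) analyticAt_const))) θ).1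

end Local

/-! ### The complex space `Hom(Γ, G)` and forms on it -/

section Hom

variable {E : Type} [NormedAddCommGroup E] [NormedSpace ℂ E]
  {G : Type} [TopologicalSpace G] [ChartedSpace E G] [Group G]
  {Γ : Type} [Group Γ] {p : ℕ}

/-- The Lie algebra `𝔤` of `G` is the tangent space of `G` at `1`, that is, the model space `E`.
This is the adjoint action of `g ∈ G` on it, the derivative at `1` of `h ↦ g h g⁻¹`. -/
def Ad (g : G) : E →L[ℂ] E :=
  mfderiv 𝓘(ℂ, E) 𝓘(ℂ, E) (fun h : G => g * h * g⁻¹) 1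

/-- The coordinates of the point `y` of `G^p` in the product chart of `G^p` at `y`. -/
def center (y : Fin p → G) : Fin p → E := fun i => chartAt E (y i) (y i)

/-- The inverse of the product chart of `G^p` at `y`. -/
def param (y : Fin p → G) (e : Fin p → E) : Fin p → G := fun i => (chartAt E (y i)).symm (e i)

/-- The evaluation of a word `w` at a point of `G^p = Hom(F_p, G)`. -/
def ev (w : FreeGroup (Fin p)) (y : Fin p → G) : G := FreeGroup.lift y w

/-- The function `f` on `G^p` is holomorphic at `y`. -/
def HolAt (f : (Fin p → G) → ℂ) (y : Fin p → G) : Prop :=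
  AnalyticAt ℂ (fun e : Fin p → E => f (param y e)) (center y)

variable (π : FreeGroup (Fin p) →* Γ)

/-- The embedding of `Hom(Γ, G)` in `G^p` given by the generators `π(x_i)` of `Γ`. -/
def pt (ρ : Γ →* G) : Fin p → G := fun i => ρ (π (FreeGroup.of i))

/-- The relations `φ = 0` and `dφ = 0`, where `φ` runs through generators of the ideal of the
complex space `Hom(Γ, G)` in the local ring of `G^p` at `ρ`: the functions `φ(y) = f(w(y))`, where
the word `w` is in the kernel of `π`, and `f` is holomorphic at `1 ∈ G` with `f(1) = 0`. -/
inductive StalkRel (ρ : Γ →* G) :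
    DR (center (E := E) (pt π ρ)) → DR (center (E := E) (pt π ρ)) → Prop
  | zero (w : FreeGroup (Fin p)) (f : G → ℂ) : π w = 1 → f 1 = 0 →
      AnalyticAt ℂ (fun e : E => f ((chartAt E (1 : G)).symm e)) (chartAt E (1 : G) 1) →
      StalkRel ρ (algebraMap _ _ (holGerm (center (E := E) (pt π ρ))
        fun e => f (ev w (param (pt π ρ) e)))) 0
  | dzero (w : FreeGroup (Fin p)) (f : G → ℂ) : π w = 1 → f 1 = 0 →
      AnalyticAt ℂ (fun e : E => f ((chartAt E (1 : G)).symm e)) (chartAt E (1 : G) 1) →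
      StalkRel ρ (ExteriorAlgebra.ι _ (formGerm (center (E := E) (pt π ρ))
        (fderiv ℂ fun e => f (ev w (param (pt π ρ) e))))) 0

variable (E) in
/-- The stalk at `ρ` of the sheaf `Ω^•` of (Kähler) differential forms on the complex space
`X = Hom(Γ, G)`: the quotient of the stalk of `Ω^•` of `G^p` by the two-sided ideal generated by
the ideal of `X` and the differentials of its elements. -/
def Stalk (ρ : Γ →* G) : Type := RingQuot (StalkRel (E := E) π ρ)

instance (ρ : Γ →* G) : Ring (Stalk E π ρ) := inferInstanceAs (Ring (RingQuot _))

instance (ρ : Γ →* G) : Algebra ℂ (Stalk E π ρ) := inferInstanceAs (Algebra ℂ (RingQuot _))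

/-- The restriction to `Hom(Γ, G)` of germs of forms on `G^p`. -/
def res (ρ : Γ →* G) : DR (center (E := E) (pt π ρ)) →ₐ[ℂ] Stalk E π ρ :=
  RingQuot.mkAlgHom ℂ _

variable (E) in
/-- The germ at `ρ` of the form `f dg₁ ∧ ⋯ ∧ dgₙ` on `Hom(Γ, G)`, for functions on `G^p` that
are holomorphic at `ρ`. -/
def mono (ρ : Γ →* G) {n : ℕ} (f : (Fin p → G) → ℂ) (g : Fin n → (Fin p → G) → ℂ) : Stalk E π ρ :=
  res π ρ (monomial _ (fun e => f (param (pt π ρ) e)) (fun k e => g k (param (pt π ρ) e)))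

variable (E G) in
/-- Families of germs of forms on `Hom(Γ, G)`. -/
abbrev Germs : Type := (ρ : Γ →* G) → Stalk E π ρ

variable (E) in
/-- The families that are given on the open subset `U` of `G^p` by a sum of expressions
`f dg₁ ∧ ⋯ ∧ dgₙ` with `f`, `gₖ` holomorphic on `U`. -/
def formsOn (n : ℕ) (U : Set (Fin p → G)) : Submodule ℂ (Germs E G π) :=
  Submodule.span ℂ {s | ∃ (f : (Fin p → G) → ℂ) (g : Fin n → (Fin p → G) → ℂ),
    (∀ y ∈ U, HolAt (E := E) f y ∧ ∀ k, HolAt (E := E) (g k) y) ∧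
    ∀ ρ : Γ →* G, pt π ρ ∈ U → s ρ = mono E π ρ f g}

variable (E G) in
/-- `H⁰(X, Ω^n)` for the complex space `X = Hom(Γ, G)`: the space of `n`-forms on `X`. -/
def Forms (n : ℕ) : Submodule ℂ (Germs E G π) where
  carrier := {s | ∀ ρ : Γ →* G, ∃ U : Set (Fin p → G), IsOpen U ∧ pt π ρ ∈ U ∧
    s ∈ formsOn E π n U}
  zero_mem' := fun _ => ⟨Set.univ, isOpen_univ, trivial, Submodule.zero_mem _⟩
  add_mem' := by
    intro s t hs ht ρ
    obtain ⟨U, hU, hxU, hsU⟩ := hs ρ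
    obtain ⟨W, hW, hxW, htW⟩ := ht ρ
    refine ⟨U ∩ W, hU.inter hW, ⟨hxU, hxW⟩, Submodule.add_mem _ ?_ ?_⟩
    · refine Submodule.span_mono ?_ hsU
      rintro r ⟨f, g, hfg, hr⟩
      exact ⟨f, g, fun y hy => hfg y hy.1, fun ρ hρ => hr ρ hρ.1⟩
    · refine Submodule.span_mono ?_ htW
      rintro r ⟨f, g, hfg, hr⟩
      exact ⟨f, g, fun y hy => hfg y hy.2, fun ρ hρ => hr ρ hρ.2⟩
  smul_mem' := by
    intro c s hs ρ
    obtain ⟨U, hU, hxU, hsU⟩ := hs ρ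
    exact ⟨U, hU, hxU, Submodule.smul_mem _ c hsU⟩

/-- In the product chart at `x`, the vector field on `G^p` given by `v ∈ 𝔤` and the action of
`G` on `G^p` by simultaneous conjugation. -/
def conjField (x : Fin p → G) (v : E) (e : Fin p → E) : Fin p → E := fun i =>
  (mfderiv 𝓘(ℂ, E) 𝓘(ℂ, E) (fun h : G => chartAt E (x i) (h * param x e i * h⁻¹)) 1 : E →L[ℂ] E) v

/-- For the germ `z` of a form at `ρ`: `i_v z = 0` and `i_v dz = 0`. Here `z` is the restriction of
the germ `q.1` of a form on `G^p`, and `q.2` is the exterior derivative of `q.1`; the conditions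
do not depend on the choice of `q.1`. -/
def BasicAt (ρ : Γ →* G) (v : E) (z : Stalk E π ρ) : Prop :=
  ∃ q ∈ dGraph (center (pt π ρ)),
    res π ρ q.1 = z ∧ res π ρ (contract _ (conjField (pt π ρ) v) q.1) = 0 ∧
    res π ρ (contract _ (conjField (pt π ρ) v) q.2) = 0

theorem BasicAt.zero (ρ : Γ →* G) (v : E) : BasicAt π ρ v 0 := by
  refine ⟨0, Submodule.zero_mem _, map_zero _, ?_, ?_⟩
  · rw [Prod.fst_zero, map_zero, map_zero]
  · rw [Prod.snd_zero, map_zero, map_zero]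

variable {π} in
theorem BasicAt.add {ρ : Γ →* G} {v : E} {z z' : Stalk E π ρ} (h : BasicAt π ρ v z)
    (h' : BasicAt π ρ v z') : BasicAt π ρ v (z + z') := by
  obtain ⟨q, hq, h1, h2, h3⟩ := h
  obtain ⟨r, hr, k1, k2, k3⟩ := h'
  refine ⟨q + r, Submodule.add_mem _ hq hr, ?_, ?_, ?_⟩
  · rw [Prod.fst_add, map_add, h1, k1]
  · rw [Prod.fst_add, map_add, map_add, h2, k2, add_zero]
  · rw [Prod.snd_add, map_add, map_add, h3, k3, add_zero]

variable {π} in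
theorem BasicAt.smul {ρ : Γ →* G} {v : E} {z : Stalk E π ρ} (c : ℂ) (h : BasicAt π ρ v z) :
    BasicAt π ρ v (c • z) := by
  obtain ⟨q, hq, h1, h2, h3⟩ := h
  refine ⟨c • q, Submodule.smul_mem _ c hq, ?_, ?_, ?_⟩
  · rw [Prod.smul_fst, map_smul, h1]
  · rw [Prod.smul_fst, LinearMap.map_smul_of_tower, map_smul, h2, smul_zero]
  · rw [Prod.smul_snd, LinearMap.map_smul_of_tower, map_smul, h3, smul_zero]

variable (E G) in
/-- The space of basic `n`-forms on `Hom(Γ, G)`: the forms `s` such that `i_v s = 0` and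
`i_v ds = 0` for all `v ∈ 𝔤`. This is the space of `n`-forms on the character stack. -/
def BasicForms (n : ℕ) : Submodule ℂ (Germs E G π) where
  carrier := {s | s ∈ Forms E G π n ∧ ∀ (ρ : Γ →* G) (v : E), BasicAt π ρ v (s ρ)}
  zero_mem' := ⟨Submodule.zero_mem _, fun ρ v => BasicAt.zero π ρ v⟩
  add_mem' := fun hs ht =>
    ⟨Submodule.add_mem _ hs.1 ht.1, fun ρ v => (hs.2 ρ v).add (ht.2 ρ v)⟩
  smul_mem' := fun c _ hs => ⟨Submodule.smul_mem _ c hs.1, fun ρ v => (hs.2 ρ v).smul c⟩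

theorem basicForms_le (n : ℕ) : BasicForms E G π n ≤ Forms E G π n := fun _ h => h.1

/-- `s'` is the pullback of the family of germs `s` along the automorphism `ρ ↦ ρ ∘ α` of
`Hom(Γ, G)`. If the words `wᵢ` lift the elements `α(π(xᵢ))`, then this automorphism is the
restriction of `A : G^p → G^p`, `A(y)ᵢ = wᵢ(y)`, and the pullback of `f dg₁ ∧ ⋯ ∧ dgₙ` is
`(f ∘ A) d(g₁ ∘ A) ∧ ⋯ ∧ d(gₙ ∘ A)`. -/
def IsPullback (α : Γ ≃* Γ) (s s' : Germs E G π) : Prop :=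
  ∀ w : Fin p → FreeGroup (Fin p), (∀ i, π (w i) = α (π (FreeGroup.of i))) →
    ∀ ρ : Γ →* G, (s (ρ.comp α.toMonoidHom), s' ρ) ∈
      Submodule.span ℂ {q : Stalk E π (ρ.comp α.toMonoidHom) × Stalk E π ρ |
        ∃ (n : ℕ) (f : (Fin p → G) → ℂ) (g : Fin n → (Fin p → G) → ℂ),
          HolAt (E := E) f (pt π (ρ.comp α.toMonoidHom)) ∧
          (∀ k, HolAt (E := E) (g k) (pt π (ρ.comp α.toMonoidHom))) ∧
          q = (mono E π (ρ.comp α.toMonoidHom) f g,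
            mono E π ρ (fun y => f fun i => ev (w i) y) fun k y => g k fun i => ev (w i) y)}

/-! ### Invariant polynomials and the form `η_Φ` -/

variable (E G) in
/-- The homogeneous part of degree `n` of `ℂ[𝔤]^G`. -/
def InvPoly (n : ℕ) : Submodule ℂ (E → ℂ) where
  carrier := {Φ | Φ ∈ Algebra.adjoin ℂ (Set.range fun l : E →L[ℂ] ℂ => (l : E → ℂ)) ∧
    (∀ (t : ℂ) (v : E), Φ (t • v) = t ^ n * Φ v) ∧ ∀ (g : G) (v : E), Φ (Ad g v) = Φ v}
  zero_mem' := ⟨Subalgebra.zero_mem _, by simp, by simp⟩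
  add_mem' := by
    rintro Φ Ψ ⟨h1, h2, h3⟩ ⟨k1, k2, k3⟩
    exact ⟨Subalgebra.add_mem _ h1 k1, fun t v => by simp [h2, k2, mul_add],
      fun g v => by simp [h3, k3]⟩
  smul_mem' := by
    rintro c Φ ⟨h1, h2, h3⟩
    exact ⟨Subalgebra.smul_mem _ h1 c, fun t v => by simp [h2, mul_left_comm],
      fun g v => by simp [h3]⟩

instance : SetLike.GradedMonoid (InvPoly E G) where
  one_mem := ⟨Subalgebra.one_mem _, by simp, by simp⟩
  mul_mem := by
    rintro n m Φ Ψ ⟨h1, h2, h3⟩ ⟨k1, k2, k3⟩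
    exact ⟨Subalgebra.mul_mem _ h1 k1, fun t v => by simp only [Pi.mul_apply, h2, k2]; ring,
      fun g v => by simp [h3, k3]⟩

/-- The product of the first `k` entries of a tuple. -/
def prefixProd {M : Type} [Monoid M] {n : ℕ} (m : Fin n → M) (k : Fin n) : M :=
  ((List.ofFn m).take k).prod

/-- The `𝔤`-valued 1-form `dw · w⁻¹` on `G^p` for a word `w`, in the product chart at `x`. On
`Hom(Γ, G)`, this is the tautological cocycle `γ ↦ σ(γ) = dρ(γ) ρ(γ)⁻¹` at `γ = π(w)`. -/
def mcForm (x : Fin p → G) (w : FreeGroup (Fin p)) (e : Fin p → E) : (Fin p → E) →L[ℂ] E :=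
  mfderiv 𝓘(ℂ, Fin p → E) 𝓘(ℂ, E) (fun e' => ev w (param x e') * (ev w (param x e))⁻¹) e

/-- The `n`-form `Φ(σ(w₁) ∧ Ad(w₁) σ(w₂) ∧ ⋯ ∧ Ad(w₁ ⋯ wₙ₋₁) σ(wₙ))` on `G^p`, with `σ(w)` the
`𝔤`-valued 1-form `dw · w⁻¹` and `Φ` read as the symmetric `n`-linear form `Φ` with
`Φ(v, …, v) = Φ(v)`. -/
def etaForm [FiniteDimensional ℂ E] (x : Fin p → G) {n : ℕ} (Φ : E → ℂ)
    (w : Fin n → FreeGroup (Fin p)) : DR (center (E := E) x) :=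
  ∑ b : Fin n → Fin (Module.finrank ℂ E),
    ((n.factorial : ℂ)⁻¹ * iteratedFDeriv ℂ n Φ 0 fun k => Module.finBasis ℂ E (b k)) •
      (List.ofFn fun k => ExteriorAlgebra.ι (HolGerm (center (E := E) x)) (formGerm _ fun e =>
        (LinearMap.toContinuousLinearMap ((Module.finBasis ℂ E).coord (b k))).comp
          ((Ad (ev (prefixProd w k) (param x e))).comp (mcForm x (w k) e)))).prod

/-- The inhomogeneous cochain of `Γ` with values in forms on `Hom(Γ, G)` that represents `η_Φ`:
it is `Φ` applied to the `n`-fold cup power of the tautological cocycle `σ`. The elements of `Γ`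
are written as words by means of a section `lift` of `π`. -/
def etaCochain [FiniteDimensional ℂ E] (lift : Γ → FreeGroup (Fin p)) (n : ℕ) (Φ : E → ℂ)
    (γ : Fin n → Γ) : Germs E G π :=
  fun ρ => res π ρ (etaForm (pt π ρ) Φ fun k => lift (γ k))

/-- The tangent vector at `ρ` given by a 1-cocycle `s` with values in `Ad ρ`: the derivative of
`exp(t s(π(xᵢ))) ρ(π(xᵢ))` at `t = 0`, in the product chart. -/
def tangent (ρ : Γ →* G) (s : Γ → E) : Fin p → E := fun i =>
  (mfderiv 𝓘(ℂ, E) 𝓘(ℂ, E) (fun h : G => chartAt E (pt π ρ i) (h * pt π ρ i)) 1 : E →L[ℂ] E)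
    (s (π (FreeGroup.of i)))

theorem Ad_one : Ad (E := E) (1 : G) = ContinuousLinearMap.id ℂ E := by
  have : (fun h : G => 1 * h * (1 : G)⁻¹) = id := by ext; simp
  unfold Ad
  rw [this]
  exact mfderiv_id

section Adjoint

variable [LieGroup 𝓘(ℂ, E) ω G]

theorem Ad_mul (g h : G) : Ad (E := E) (g * h) = (Ad g).comp (Ad h) := by
  have hc : ∀ g : G, MDifferentiable 𝓘(ℂ, E) 𝓘(ℂ, E) (fun k : G => g * k * g⁻¹) := fun g =>
    ((contMDiff_mul_right (I := 𝓘(ℂ, E)) (n := ω) (a := g⁻¹)).comp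
      (contMDiff_mul_left (I := 𝓘(ℂ, E)) (n := ω) (a := g))).mdifferentiable (by simp)
  have h1 : (fun k : G => g * h * k * (g * h)⁻¹) = (fun k => g * k * g⁻¹) ∘ fun k => h * k * h⁻¹ := by
    ext; simp [mul_assoc]
  have h2 : ∀ y : G, y = 1 → (mfderiv 𝓘(ℂ, E) 𝓘(ℂ, E) (fun k : G => g * k * g⁻¹) y : E →L[ℂ] E) =
      mfderiv 𝓘(ℂ, E) 𝓘(ℂ, E) (fun k : G => g * k * g⁻¹) 1 := by
    rintro _ rfl; rfl
  unfold Ad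
  rw [h1, mfderiv_comp (1 : G) (hc g _) (hc h _)]
  exact congrArg (fun T : E →L[ℂ] E => T.comp
    (mfderiv 𝓘(ℂ, E) 𝓘(ℂ, E) (fun k : G => h * k * h⁻¹) 1 : E →L[ℂ] E)) (h2 _ (by simp))

/-- The `Γ`-module `Ad ρ`. -/
def AdRep (ρ : Γ →* G) : Rep ℂ Γ :=
  Rep.of (X := E)
    { toFun := fun γ => (Ad (E := E) (ρ γ)).toLinearMap
      map_one' := by rw [map_one, Ad_one]; rfl
      map_mul' := fun γ δ => by rw [map_mul, Ad_mul]; rfl }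

end Adjoint

/-- The cup product of inhomogeneous cochains with values in forms on `Hom(Γ, G)`. -/
def cup {n m : ℕ} (a : (Fin n → Γ) → Germs E G π) (b : (Fin m → Γ) → Germs E G π)
    (γ : Fin (n + m) → Γ) : Germs E G π :=
  a (fun k => γ (Fin.castAdd m k)) * b (fun k => γ (Fin.natAdd n k))

/-- `z` is the product of `x` and `y` for the wedge product of forms and the cup product: for any
cocycles `a` and `b` with classes `x` and `y`, the class of `a ∪ b` is `z`. -/
def IsProduct {n m : ℕ} (x : H Γ (BasicForms E G π n) n) (y : H Γ (BasicForms E G π m) m)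
    (z : H Γ (BasicForms E G π (n + m)) (n + m)) : Prop :=
  ∀ (a : (Fin n → Γ) → BasicForms E G π n) (b : (Fin m → Γ) → BasicForms E G π m),
    Represents a x → Represents b y → ∃ c : (Fin (n + m) → Γ) → BasicForms E G π (n + m),
      (∀ γ, (c γ : Germs E G π) = cup π (fun γ => a γ) (fun γ => b γ) γ) ∧ Represents c z

/-- `x` is the class of the constant function `1`. -/
def IsOne (x : H Γ (BasicForms E G π 0) 0) : Prop :=
  ∃ c : (Fin 0 → Γ) → BasicForms E G π 0, (∀ γ, (c γ : Germs E G π) = 1) ∧ Represents c x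

/-- The element `x` of `H^n(Γ, Ω^n)` is invariant under the diagonal action of `Aut(Γ)`: for each
automorphism `α` of `Γ`, the pullback of the forms along `ρ ↦ ρ ∘ α` has the same effect on `x` as
`α^*` on the group cohomology. -/
def AutInvariant {n : ℕ} (x : H Γ (BasicForms E G π n) n) : Prop :=
  ∀ α : Γ ≃* Γ, ∃ c c' : (Fin n → Γ) → BasicForms E G π n, Represents c x ∧
    (∀ γ, IsPullback π α (c γ : Germs E G π) (c' γ)) ∧
    Represents c' (autMap (BasicForms E G π n) n α x)

/-- The element `z` of `H^n(Γ, ℂ)` is the value at `ρ` of the `H^n(Γ, ℂ)`-valued form `x` on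
tangent vectors `ξ₁, …, ξₙ` of `Hom(Γ, G)` at `ρ`. -/
def HasValue {n : ℕ} (x : H Γ (BasicForms E G π n) n) (ρ : Γ →* G) (ξ : Fin n → Fin p → E)
    (z : H Γ ℂ n) : Prop :=
  ∃ (c : (Fin n → Γ) → BasicForms E G π n) (v : (Fin n → Γ) → ℂ), Represents c x ∧
    (∀ γ, ∃ θ : DR (center (pt π ρ)),
      res π ρ θ = (c γ : Germs E G π) ρ ∧ evalAt (center (pt π ρ)) ξ θ = v γ) ∧
    Represents v z

end Hom

end CharStack

end

noncomputable section

namespace CharStack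

/-! ### The differential of inhomogeneous cochains with constant coefficients -/

section Delta

/-! The tautological forms `σ(w) = dw · w⁻¹` satisfy `σ(ww') = σ(w) + Ad(w) σ(w')`. On the stalks of
`Hom(Γ, G)` both `σ(w)` and `Ad(w) - 1` vanish for `w ∈ ker π`: their coefficients lie in the ideal
generated by the functions `f ∘ w` with `f(1) = 0` and by their differentials (`wordForm_eq_zero`,
`algebraMap_adGerm`). So `σ` becomes a 1-cocycle of `Γ` with values in `Ad`, and the cup power `Φ(σ
∪ ⋯ ∪ σ)` is a cocycle because `Φ` is invariant (`delta_cupC`). It has values in all forms, not in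
the basic ones; the point is that its class comes from a unique class of basic forms.

`Γ` acts trivially on the forms and the coefficients are vector spaces, so every injection splits
and cohomology commutes with products. Hence `H^n(Γ, Ω_bas) → H^n(Γ, Ω)` is injective, and a class
lifts as soon as it dies in `H^n` of each quotient of a stalk by the germs that are basic for one
`v`. A form modulo those germs depends linearly on its contractions `i_v` and `i_v d` (`isCob_mkQ`),
so it suffices that both contractions of the cocycle are coboundaries. Differentiating `w(hyh⁻¹) = h
w(y) h⁻¹` at `h = 1` gives `i_v σ(w) = v - Ad(w) v` (`mcForm_conjField`), the coboundary of a
constant; thus `i_v` of the cup power is a sum of cup products each having a coboundary as one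
factor (`isCob_cupC`). The same identity gives `L_v σ = ad(v) σ` (`lie_mcForm`), so `L_v` kills the
cup power by infinitesimal invariance of `Φ` (`sum_polar_ad`), and Cartan's formula turns `i_v d`
into `-d i_v`. This is `exists_eta`. By the same splitting, representing `η_Φ` can be tested on each
stalk separately (`represents_eta_iff`), and the other properties are checked there.

Values and products rest on the graded commutativity of cup products of 1-cocycles
(`isCob_cupP_sub`). Evaluating the form at `n` tangent vectors gives the signed sum of all orders of
the cup product `Φ(s₁ ∪ ⋯ ∪ sₙ)`; each term is cohomologous to the first one, whence the factor
`n!`. The symmetric form of `ΦΨ` is the average over permutations of the product of the two forms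
(`polar_mul`); the sign of the wedge product and the sign of the cup product cancel, so all terms
have the class `η_Φ · η_Ψ`.

For `α ∈ Aut(Γ)`, words that lift `α(π(xᵢ))` define a map `G^p → G^p` which carries the cocycle at
`ρ ∘ α` to the cocycle at `ρ` evaluated on `α(γ)`. That the pullback on the stalks does not depend
on the words follows from Hadamard's lemma (`exists_hadamard`, `holGerm_sub_mem_relIdeal`).

The tensor statements are linear algebra: coordinate functionals detect elements of `V ⊗ H^n(Γ, ℂ)`,
and a class in `H^n(Γ, V)` is a linear map from the cycles modulo the boundaries of the bar complex
to `V`; that quotient is finite-dimensional when `H^n(Γ, ℂ)`, which is its dual, is. -/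

/-- The alternating sum of the faces of the tuple `(g, γ)` other than the first one. -/
def face {Γ W : Type} [Mul Γ] [AddCommGroup W] :
    {n : ℕ} → ((Fin n → Γ) → W) → Γ → (Fin n → Γ) → W
  | 0, f, _, γ => f γ
  | _ + 1, f, g, γ => f (Fin.cons (g * γ 0) (Fin.tail γ)) -
      face (fun δ => f (Fin.cons g δ)) (γ 0) (Fin.tail γ)

/-- The differential of inhomogeneous cochains with constant coefficients. -/
def delta {Γ W : Type} [Mul Γ] [AddCommGroup W] {n : ℕ} (f : (Fin n → Γ) → W)
    (γ : Fin (n + 1) → Γ) : W :=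
  f (Fin.tail γ) - face f (γ 0) (Fin.tail γ)

variable {Γ : Type} [Group Γ] {V W : Type} [AddCommGroup V] [Module ℂ V] [AddCommGroup W]
  [Module ℂ W] {n : ℕ}

omit [Group Γ] in
theorem contractNth_zero_cons (op : Γ → Γ → Γ) (g : Γ) (γ : Fin (n + 1) → Γ) :
    Fin.contractNth 0 op (Fin.cons g γ : Fin (n + 2) → Γ) = Fin.cons (op g (γ 0)) (Fin.tail γ) := by
  funext k
  refine Fin.cases ?_ (fun k => ?_) k
  · rw [Fin.contractNth_apply_of_eq _ _ _ _ (by simp)]; simp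
  · rw [Fin.contractNth_apply_of_gt _ _ _ _ (by simp)]; simp [Fin.tail]

omit [Group Γ] in
theorem contractNth_succ_cons (j : Fin (n + 1)) (op : Γ → Γ → Γ) (g : Γ) (γ : Fin (n + 1) → Γ) :
    Fin.contractNth j.succ op (Fin.cons g γ : Fin (n + 2) → Γ) =
      Fin.cons g (Fin.contractNth j op γ) := by
  funext k
  refine Fin.cases ?_ (fun k => ?_) k
  · rw [Fin.contractNth_apply_of_lt _ _ _ _ (by simp)]; simp
  · rcases lt_trichotomy (k : ℕ) j with h | h | h
    · rw [Fin.contractNth_apply_of_lt _ _ _ _ (by simpa using h)]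
      simp [Fin.contractNth_apply_of_lt _ _ _ _ h]
    · rw [Fin.contractNth_apply_of_eq _ _ _ _ (by simpa using h)]
      simp [Fin.contractNth_apply_of_eq _ _ _ _ h]
    · rw [Fin.contractNth_apply_of_gt _ _ _ _ (by simpa using h)]
      simp [Fin.contractNth_apply_of_gt _ _ _ _ h]

/-- Contraction at 0 merges `g` with the next entry, and all others keep `g` in front. The shift of
the index by one accounts for the minus sign in the recursion of `face`. -/
theorem sum_contractNth (f : (Fin n → Γ) → V) (g : Γ) (γ : Fin n → Γ) :
    ∑ j : Fin (n + 1), (-1 : ℂ) ^ ((j : ℕ) + 1) •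
      f (Fin.contractNth j (· * ·) (Fin.cons g γ : Fin (n + 1) → Γ)) = - face f g γ := by
  induction n generalizing g with
  | zero => simp [face, Subsingleton.elim _ γ]
  | succ n ih =>
    rw [Fin.sum_univ_succ, face, contractNth_zero_cons]
    have h := ih (fun δ => f (Fin.cons g δ)) (γ 0) (Fin.tail γ)
    rw [Fin.cons_self_tail] at h
    have h2 : ∀ j : Fin (n + 1), (-1 : ℂ) ^ ((j.succ : ℕ) + 1) •
        f (Fin.contractNth j.succ (· * ·) (Fin.cons g γ : Fin (n + 2) → Γ)) =
        - ((-1 : ℂ) ^ ((j : ℕ) + 1) • f (Fin.cons g (Fin.contractNth j (· * ·) γ))) := by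
      intro j
      rw [contractNth_succ_cons, Fin.val_succ, pow_succ (-1 : ℂ) ((j : ℕ) + 1)]
      simp
    rw [Finset.sum_congr rfl fun j _ => h2 j, Finset.sum_neg_distrib, h]
    simp
    abel

/-- This makes the differential accessible to recursion on the length of the tuple, which is how all
cup product identities below are proved. -/
theorem d_eq_delta (f : (Fin n → Γ) → V) :
    (groupCohomology.inhomogeneousCochains (Rep.trivial ℂ Γ V)).d n (n + 1) f = delta f := by
  rw [groupCohomology.inhomogeneousCochains.d_def]
  funext γ
  have h := sum_contractNth f (γ 0) (Fin.tail γ)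
  rw [Fin.cons_self_tail] at h
  rw [inhomogeneousCochains.d_hom_apply]
  rw [show delta f γ = f (Fin.tail γ) + - face f (γ 0) (Fin.tail γ) from sub_eq_add_neg _ _, ← h]
  rfl

variable (Γ V n) in
/-- The differential as a linear map. -/
def deltaL : ((Fin n → Γ) → V) →ₗ[ℂ] ((Fin (n + 1) → Γ) → V) :=
  ((groupCohomology.inhomogeneousCochains (Rep.trivial ℂ Γ V)).d n (n + 1)).hom

theorem deltaL_apply (f : (Fin n → Γ) → V) : deltaL Γ V n f = delta f := d_eq_delta f

/-- The cochain is a coboundary. -/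
def IsCob : {n : ℕ} → ((Fin n → Γ) → V) → Prop
  -- There are no cochains in degree -1.
  | 0, c => c = 0
  | _ + 1, c => ∃ b, c = delta b

theorem delta_delta (f : (Fin n → Γ) → V) : delta (delta f) = 0 := by
  rw [← d_eq_delta (delta f), ← d_eq_delta f, ← ModuleCat.comp_apply,
    HomologicalComplex.d_comp_d]
  rfl

theorem exists_represents_of_delta {c : (Fin n → Γ) → V} (h : delta c = 0) :
    ∃ x : H Γ V n, Represents c x := by
  have h' : inhomogeneousCochains.d (Rep.trivial ℂ Γ V) n c = 0 := by
    rw [← groupCohomology.inhomogeneousCochains.d_def, d_eq_delta, h]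
  exact ⟨_, groupCohomology.cocyclesMk (A := Rep.trivial ℂ Γ V) c h',
    groupCohomology.iCocycles_mk _ _, rfl⟩

theorem Represents.delta {c : (Fin n → Γ) → V} {x : H Γ V n} (h : Represents c x) :
    delta c = 0 := by
  obtain ⟨z, rfl, -⟩ := h
  rw [← d_eq_delta, ← ModuleCat.comp_apply, HomologicalComplex.iCycles_d]
  rfl

theorem represents_delta (b : (Fin n → Γ) → V) : Represents (CharStack.delta b) (0 : H Γ V (n + 1)) := by
  refine ⟨(groupCohomology.toCocycles (Rep.trivial ℂ Γ V) n (n + 1)).hom b, ?_, ?_⟩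
  · rw [← d_eq_delta]
    exact congrArg (fun T => (ModuleCat.Hom.hom T) b)
      (HomologicalComplex.toCycles_i (groupCohomology.inhomogeneousCochains (Rep.trivial ℂ Γ V)) n (n + 1))
  · exact congrArg (fun T => (ModuleCat.Hom.hom T) b)
      (HomologicalComplex.toCycles_comp_homologyπ (groupCohomology.inhomogeneousCochains (Rep.trivial ℂ Γ V)) n (n + 1))

theorem Represents.isCob {c : (Fin n → Γ) → V} (h : Represents c (0 : H Γ V n)) : IsCob c := by
  obtain ⟨z, rfl, hz⟩ := h
  cases n with
  | zero =>
    -- Nothing maps into the cocycles of degree 0, so their projection to cohomology is an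
    -- isomorphism.
    have : (groupCohomology.inhomogeneousCochains (Rep.trivial ℂ Γ V)).toCycles
        ((ComplexShape.up ℕ).prev 0) 0 = 0 :=
      HomologicalComplex.toCycles_eq_zero _ (by simp)
    have hi : CategoryTheory.IsIso (groupCohomology.π (Rep.trivial ℂ Γ V) 0) :=
      HomologicalComplex.isIso_homologyπ _ _ 0 rfl (by
        apply (groupCohomology.inhomogeneousCochains (Rep.trivial ℂ Γ V)).shape; simp)
    have h2 : Function.Injective (groupCohomology.π (Rep.trivial ℂ Γ V) 0).hom :=
      (ModuleCat.mono_iff_injective _).1 inferInstance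
    have : z = 0 := h2 (by rw [hz, map_zero])
    rw [this]
    exact map_zero _
  | succ n =>
    let K := groupCohomology.inhomogeneousCochains (Rep.trivial ℂ Γ V)
    have hS := (K.sc' n (n + 1) (n + 2)).moduleCat_exact_iff
    have hz' : (K.homologyπ (n + 1)) z = 0 := hz
    have hc := K.homologyIsCokernel n (n + 1) (by simp)
    -- Homology is the cokernel of the map from cochains to cocycles, so a cocycle of class 0 is the
    -- image of a cochain.
    have ex : (CategoryTheory.ShortComplex.mk (K.toCycles n (n+1)) (K.homologyπ (n+1)) (by simp)).Exact :=
      CategoryTheory.ShortComplex.exact_of_g_is_cokernel _ hc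
    obtain ⟨b, hb⟩ := ((CategoryTheory.ShortComplex.moduleCat_exact_iff _).1 ex) z hz'
    refine ⟨b, ?_⟩
    rw [← d_eq_delta, ← hb]
    exact congrArg (fun T => (ModuleCat.Hom.hom T) b) (HomologicalComplex.toCycles_i K n (n + 1))

theorem IsCob.represents {c : (Fin n → Γ) → V} (h : IsCob c) : Represents c (0 : H Γ V n) := by
  cases n with
  | zero =>
    rw [show c = 0 from h]
    exact ⟨0, map_zero _, map_zero _⟩
  | succ n =>
    obtain ⟨b, rfl⟩ := h
    exact represents_delta b

theorem Represents.neg {c : (Fin n → Γ) → V} {x : H Γ V n} (h : Represents c x) :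
    Represents (-c) (-x) := by
  simpa using h.smul (-1)

theorem Represents.sub {c c' : (Fin n → Γ) → V} {x x' : H Γ V n} (h : Represents c x)
    (h' : Represents c' x') : Represents (c - c') (x - x') := by
  simpa [sub_eq_add_neg] using h.add h'.neg

theorem Represents.eq_of_isCob {c c' : (Fin n → Γ) → V} {x x' : H Γ V n} (h : Represents c x)
    (h' : Represents c' x') (hc : IsCob (c - c')) : x = x' :=
  sub_eq_zero.1 ((h.sub h').unique hc.represents)

theorem Represents.congr {c c' : (Fin n → Γ) → V} {x : H Γ V n} (h : Represents c x)
    (hc : IsCob (c' - c)) : Represents c' x := by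
  simpa using hc.represents.add h

theorem Represents.isCob_sub {c c' : (Fin n → Γ) → V} {x : H Γ V n} (h : Represents c x)
    (h' : Represents c' x) : IsCob (c - c') := by
  have := h.sub h'
  rw [sub_self] at this
  exact this.isCob

theorem IsCob.add {c c' : (Fin n → Γ) → V} (h : IsCob c) (h' : IsCob c') : IsCob (c + c') := by
  have := h.represents.add h'.represents
  rw [add_zero] at this
  exact this.isCob

theorem IsCob.smul {c : (Fin n → Γ) → V} (t : ℂ) (h : IsCob c) : IsCob (t • c) := by
  have := h.represents.smul t
  rw [smul_zero] at this
  exact this.isCob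

theorem IsCob.zero : IsCob (0 : (Fin n → Γ) → V) := by
  have : Represents (0 : (Fin n → Γ) → V) (0 : H Γ V n) := ⟨0, map_zero _, map_zero _⟩
  exact this.isCob

theorem IsCob.neg {c : (Fin n → Γ) → V} (h : IsCob c) : IsCob (-c) := by
  simpa using h.smul (-1)

theorem IsCob.sub {c c' : (Fin n → Γ) → V} (h : IsCob c) (h' : IsCob c') : IsCob (c - c') := by
  simpa [sub_eq_add_neg] using h.add h'.neg

theorem IsCob.sum {ι : Type*} (s : Finset ι) {c : ι → (Fin n → Γ) → V} (h : ∀ i ∈ s, IsCob (c i)) :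
    IsCob (∑ i ∈ s, c i) :=
  Finset.sum_induction _ IsCob (fun _ _ => IsCob.add) IsCob.zero h

theorem delta_map (f : V →ₗ[ℂ] W) (c : (Fin n → Γ) → V) :
    CharStack.delta (fun γ => f (c γ)) = fun γ => f (CharStack.delta c γ) := by
  funext γ
  have key : ∀ {n : ℕ} (c : (Fin n → Γ) → V) (g : Γ) (γ : Fin n → Γ),
      face (fun γ => f (c γ)) g γ = f (face c g γ) := by
    intro n
    induction n with
    | zero => intros; rfl
    | succ n ih => intro c g γ; simp only [face, map_sub, ih (fun δ => c (Fin.cons g δ))]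
  simp only [CharStack.delta, map_sub, key]

theorem IsCob.map (f : V →ₗ[ℂ] W) {c : (Fin n → Γ) → V} (h : IsCob c) :
    IsCob (fun γ => f (c γ)) := by
  have := h.represents.map f
  rw [map_zero] at this
  exact this.isCob

/-- A cochain with values in a product is a coboundary if its components are. -/
theorem IsCob.pi {ι : Type} {U : ι → Type} [∀ i, AddCommGroup (U i)] [∀ i, Module ℂ (U i)]
    {c : (Fin n → Γ) → ∀ i, U i} (h : ∀ i, IsCob fun γ => c γ i) : IsCob c := by
  cases n with
  | zero => funext γ i; exact congrFun (h i) γ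
  | succ n =>
    choose b hb using h
    refine ⟨fun γ i => b i γ, ?_⟩
    funext γ i
    have := congrFun (delta_map (LinearMap.proj i : (∀ i, U i) →ₗ[ℂ] U i) fun γ i => b i γ) γ
    exact (congrFun (hb i) γ).trans this

/-- An injective linear map of vector spaces has a left inverse, and with trivial action any linear
map may be applied to a coboundary. -/
theorem IsCob.of_map {f : V →ₗ[ℂ] W} (hf : Function.Injective f) {c : (Fin n → Γ) → V}
    (h : IsCob fun γ => f (c γ)) : IsCob c := by
  obtain ⟨g, hg⟩ := f.exists_leftInverse_of_injective (LinearMap.ker_eq_bot.2 hf)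
  have := h.map g
  simp_rw [← LinearMap.comp_apply, hg] at this
  exact this

theorem delta_of_map {f : V →ₗ[ℂ] W} (hf : Function.Injective f) {c : (Fin n → Γ) → V}
    (h : CharStack.delta (fun γ => f (c γ)) = 0) : CharStack.delta c = 0 := by
  rw [delta_map] at h
  funext γ
  exact hf ((congrFun h γ).trans (map_zero f).symm)

/-- For the inclusion of basic forms in all forms, this makes `η_Φ` unique and `Φ ↦ η_Φ` linear. -/
theorem coeffMap_injective {f : V →ₗ[ℂ] W} (hf : Function.Injective f) :
    Function.Injective (coeffMap Γ n f) := by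
  rw [injective_iff_map_eq_zero]
  intro x hx
  obtain ⟨c, hc⟩ := exists_represents x
  have := hc.map f
  rw [hx] at this
  exact hc.unique (this.isCob.of_map hf).represents

/-- If the composite of a cocycle with a linear map is a coboundary, then the cocycle is
cohomologous to a cocycle with values in the kernel. -/
theorem exists_cohomologous_ker {f : V →ₗ[ℂ] W} {c : (Fin n → Γ) → V}
    (h : IsCob fun γ => f (c γ)) :
    ∃ c' : (Fin n → Γ) → V, (∀ γ, f (c' γ) = 0) ∧ IsCob (c' - c) := by
  -- A potential can be chosen with values in the range of `f`, over which `f` has a linear section;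
  -- the lifted potential corrects `c`.
  have h2 : IsCob fun γ => f.rangeRestrict (c γ) :=
    IsCob.of_map (f := (LinearMap.range f).subtype) Subtype.val_injective h
  cases n with
  | zero =>
    refine ⟨c, fun γ => congrFun h γ, ?_⟩
    rw [sub_self]
    exact IsCob.zero
  | succ n =>
    obtain ⟨b, hb⟩ := h2
    obtain ⟨g, hg⟩ := f.rangeRestrict.exists_rightInverse_of_surjective f.range_rangeRestrict
    have hg' : ∀ y, f.rangeRestrict (g y) = y := fun y => LinearMap.congr_fun hg y
    refine ⟨c - CharStack.delta (fun γ => g (b γ)), fun γ => ?_, ⟨-fun γ => g (b γ), ?_⟩⟩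
    · have h1 := congrFun hb γ
      have h3 := congrFun (delta_map g b) γ
      have h4 : f (g (f.rangeRestrict (c γ))) = f (c γ) := congrArg Subtype.val (hg' _)
      rw [Pi.sub_apply, map_sub, h3, ← h1, h4, sub_self]
    · rw [← deltaL_apply, ← deltaL_apply, map_neg]
      abel

/-! ### Vector spaces of coefficients -/

theorem coeffMap_comp {U : Type} [AddCommGroup U] [Module ℂ U] (f : V →ₗ[ℂ] W) (g : W →ₗ[ℂ] U)
    (x : H Γ V n) : coeffMap Γ n g (coeffMap Γ n f x) = coeffMap Γ n (g ∘ₗ f) x := by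
  obtain ⟨c, hc⟩ := exists_represents x
  exact ((hc.map f).map g).unique (hc.map (g ∘ₗ f))

theorem coeffMap_id (x : H Γ V n) : coeffMap Γ n LinearMap.id x = x := by
  obtain ⟨c, hc⟩ := exists_represents x
  exact (hc.map LinearMap.id).unique hc

theorem tensorMap_tmul (v : V) (x : H Γ ℂ n) :
    tensorMap Γ V n (v ⊗ₜ x) = coeffMap Γ n (LinearMap.toSpanSingleton ℂ V v) x := rfl

theorem coeffMap_tensorMap (l : V →ₗ[ℂ] ℂ) (t : V ⊗[ℂ] H Γ ℂ n) :
    coeffMap Γ n l (tensorMap Γ V n t) = TensorProduct.lid ℂ _ (LinearMap.rTensor _ l t) := by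
  induction t with
  | zero => simp
  | add x y hx hy => simp only [map_add, hx, hy]
  | tmul v x =>
    have : l ∘ₗ LinearMap.toSpanSingleton ℂ V v = l v • LinearMap.id := by
      ext; simp
    rw [tensorMap_tmul, coeffMap_comp, this, coeffMap_smul, LinearMap.smul_apply, coeffMap_id]
    simp

/-- The coordinates of a tensor for a basis of `V` are recovered from its image by the coordinate
functionals, by `coeffMap_tensorMap`. -/
theorem tensorMap_injective : Function.Injective (tensorMap Γ V n) := by
  rw [injective_iff_map_eq_zero]
  classical
  intro t ht
  let B := Module.Basis.ofVectorSpace ℂ V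
  apply (TensorProduct.equivFinsuppOfBasisLeft (N := H Γ ℂ n) B).injective
  rw [map_zero]
  ext i
  have := coeffMap_tensorMap (Γ := Γ) (n := n) (B.coord i) t
  rw [ht, map_zero] at this
  rw [TensorProduct.equivFinsuppOfBasisLeft_apply]
  exact this.symm

/-! ### The bar complex and its duality with cochains -/

variable (Γ n) in
/-- The boundary map of the bar complex. -/
def barBoundary : ((Fin (n + 1) → Γ) →₀ ℂ) →ₗ[ℂ] ((Fin n → Γ) →₀ ℂ) :=
  Finsupp.lift _ ℂ _ (CharStack.delta fun γ => Finsupp.single γ 1)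

/-- Every cochain is the image of the universal cochain `γ ↦ single γ 1` under a linear map, and
`delta` commutes with linear maps. -/
theorem lift_comp_barBoundary (f : (Fin n → Γ) → V) :
    Finsupp.lift V ℂ _ f ∘ₗ barBoundary Γ n = Finsupp.lift V ℂ _ (CharStack.delta f) := by
  refine Finsupp.lhom_ext' fun γ => LinearMap.ext_ring ?_
  have := congrFun (delta_map (Finsupp.lift V ℂ _ f) fun γ => Finsupp.single γ 1) γ
  simp only [LinearMap.comp_apply, Finsupp.lsingle_apply, barBoundary]
  simpa using this.symm

/-- Used to extend functionals from boundaries to chains, and in `isCob_mkQ` to see that a form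
modulo basic germs depends only on its contractions. -/
theorem exists_comp_eq {U₁ U₂ U₃ : Type*} [AddCommGroup U₁] [Module ℂ U₁] [AddCommGroup U₂]
    [Module ℂ U₂] [AddCommGroup U₃] [Module ℂ U₃] (f : U₁ →ₗ[ℂ] U₂) (g : U₁ →ₗ[ℂ] U₃)
    (h : ∀ x, f x = 0 → g x = 0) : ∃ k : U₂ →ₗ[ℂ] U₃, k ∘ₗ f = g := by
  obtain ⟨r, hr⟩ := f.rangeRestrict.exists_rightInverse_of_surjective f.range_rangeRestrict
  obtain ⟨k, hk⟩ := (g ∘ₗ r).exists_extend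
  refine ⟨k, LinearMap.ext fun x => ?_⟩
  have h1 : f (r (f.rangeRestrict x)) = f x := congrArg Subtype.val (LinearMap.congr_fun hr _)
  have h2 : k (f x) = g (r (f.rangeRestrict x)) := LinearMap.congr_fun hk (f.rangeRestrict x)
  rw [LinearMap.comp_apply, h2, ← sub_eq_zero, ← map_sub]
  exact h _ (by rw [map_sub, h1, sub_self])

theorem exists_projection {U : Type*} [AddCommGroup U] [Module ℂ U] (Z : Submodule ℂ U) :
    ∃ P : U →ₗ[ℂ] Z, ∀ z : Z, P z = z := by
  obtain ⟨P, hP⟩ := Z.subtype.exists_leftInverse_of_injective Z.ker_subtype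
  exact ⟨P, fun z => LinearMap.congr_fun hP z⟩

variable (Γ n) in
/-- The cycles of the bar complex. -/
def barCycles : Submodule ℂ ((Fin n → Γ) →₀ ℂ) :=
  match n with
  | 0 => ⊤
  | n + 1 => LinearMap.ker (barBoundary Γ n)

/-- A functional that vanishes on the kernel of the boundary map factors through that map; the
factor is the potential. In degree 0 every chain is a cycle, in agreement with the convention that
only 0 is a coboundary. -/
theorem isCob_iff (b : (Fin n → Γ) → V) :
    IsCob b ↔ ∀ z ∈ barCycles Γ n, Finsupp.lift V ℂ _ b z = 0 := by
  cases n with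
  | zero =>
    constructor
    · intro h z _
      rw [show b = 0 from h, map_zero, LinearMap.zero_apply]
    · intro h
      funext γ
      simpa using h (Finsupp.single γ 1) Submodule.mem_top
  | succ n =>
    constructor
    · rintro ⟨a, rfl⟩ z hz
      rw [← lift_comp_barBoundary, LinearMap.comp_apply, LinearMap.mem_ker.1 hz, map_zero]
    · intro h
      obtain ⟨k, hk⟩ := exists_comp_eq (barBoundary Γ n) (Finsupp.lift V ℂ _ b)
        fun x hx => h x (LinearMap.mem_ker.2 hx)
      refine ⟨fun γ => k (Finsupp.single γ 1), ?_⟩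
      rw [delta_map k]
      funext γ
      have := LinearMap.congr_fun hk (Finsupp.single γ 1)
      simp only [LinearMap.comp_apply, barBoundary] at this
      simpa using this.symm

theorem range_barBoundary_le : LinearMap.range (barBoundary Γ n) ≤ barCycles Γ n := by
  cases n with
  | zero => exact le_top
  | succ n =>
    rintro _ ⟨x, rfl⟩
    rw [barCycles, LinearMap.mem_ker, ← LinearMap.comp_apply]
    have := lift_comp_barBoundary (CharStack.delta fun γ : Fin n → Γ => Finsupp.single γ (1 : ℂ))
    rw [delta_delta, map_zero] at this
    exact LinearMap.congr_fun this x

theorem delta_eq_zero_iff (c : (Fin n → Γ) → V) :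
    CharStack.delta c = 0 ↔ ∀ x, Finsupp.lift V ℂ _ c (barBoundary Γ n x) = 0 := by
  constructor
  · intro h x
    rw [← LinearMap.comp_apply, lift_comp_barBoundary, h, map_zero, LinearMap.zero_apply]
  · intro h
    funext γ
    have := h (Finsupp.single γ 1)
    rw [← LinearMap.comp_apply, lift_comp_barBoundary] at this
    simpa using this

theorem Represents.sum {ι : Type*} (s : Finset ι) {c : ι → (Fin n → Γ) → V} {x : ι → H Γ V n}
    (h : ∀ i ∈ s, Represents (c i) (x i)) : Represents (∑ i ∈ s, c i) (∑ i ∈ s, x i) := by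
  classical
  induction s using Finset.induction_on with
  | empty => exact IsCob.zero.represents
  | insert a s ha ih =>
    rw [Finset.sum_insert ha, Finset.sum_insert ha]
    exact (h a (by simp)).add (ih fun i hi => h i (by simp [hi]))

/-- If the functionals that vanish on `B`, modulo those that vanish on `Z ⊇ B`, form a space of finite
dimension, then `Z ⧸ B` has a finite basis. -/
theorem exists_dual_pair {C D : Type*} [AddCommGroup C] [Module ℂ C] [AddCommGroup D] [Module ℂ D]
    [FiniteDimensional ℂ D] (Z B : Submodule ℂ C) (hBZ : B ≤ Z) (T : B.dualAnnihilator →ₗ[ℂ] D)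
    (hT : ∀ l, T l = 0 → ∀ z ∈ Z, l.1 z = 0) :
    ∃ (m : ℕ) (φ : Fin m → C →ₗ[ℂ] ℂ) (q : Fin m → C), (∀ i, φ i ∈ B.dualAnnihilator) ∧
      ∀ (U : Type) [AddCommGroup U] [Module ℂ U] (f : C →ₗ[ℂ] U), (∀ x ∈ B, f x = 0) →
        ∀ z ∈ Z, f z = ∑ i, φ i z • f (q i) := by
  obtain ⟨P, hP⟩ := exists_projection Z
  let B' : Submodule ℂ Z := B.comap Z.subtype
  have hPB : ∀ x ∈ B, B'.mkQ (P x) = 0 := by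
    intro x hx
    rw [show P x = ⟨x, hBZ hx⟩ from hP ⟨x, hBZ hx⟩, Submodule.mkQ_apply,
      Submodule.Quotient.mk_eq_zero]
    exact hx
  -- The projection `P` extends functionals on `Z ⧸ B'` to functionals on `C` that vanish on `B`. An
  -- extension killed by `T` vanishes on `Z`, so `T ∘ₗ S` is injective and the dual of `Z ⧸ B'` is
  -- finite-dimensional.
  let S : Module.Dual ℂ (Z ⧸ B') →ₗ[ℂ] B.dualAnnihilator :=
    (LinearMap.lcomp ℂ ℂ (B'.mkQ ∘ₗ P)).codRestrict _ fun l => by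
      rw [Submodule.mem_dualAnnihilator]
      intro x hx
      change l (B'.mkQ (P x)) = 0
      rw [hPB x hx, map_zero]
  have hS : Function.Injective (T ∘ₗ S) := by
    rw [injective_iff_map_eq_zero]
    intro l hl
    refine LinearMap.ext fun y => ?_
    obtain ⟨z, rfl⟩ := B'.mkQ_surjective y
    have h3 : l (B'.mkQ (P z)) = 0 := hT _ hl z z.2
    rwa [hP] at h3
  have h1 : FiniteDimensional ℂ (Module.Dual ℂ (Z ⧸ B')) := FiniteDimensional.of_injective _ hS
  have h2 : FiniteDimensional ℂ (Z ⧸ B') := (Module.finite_dual_iff ℂ).1 h1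
  let bas := Module.finBasis ℂ (Z ⧸ B')
  choose q hq using fun i => B'.mkQ_surjective (bas i)
  refine ⟨_, fun i => (S (bas.coord i)).1, fun i => (q i : C), fun i => (S _).2, ?_⟩
  intro U _ _ f hf z hz
  let fbar : (Z ⧸ B') →ₗ[ℂ] U := B'.liftQ (f ∘ₗ Z.subtype) fun x hx => hf _ hx
  have h3 : f z = fbar (B'.mkQ (P z)) := by
    rw [show P z = ⟨z, hz⟩ from hP ⟨z, hz⟩]
    rfl
  have h4 : ∀ i, f (q i) = fbar (bas i) := fun i => by
    rw [← hq]
    rfl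
  rw [h3]
  conv_lhs => rw [← bas.sum_repr (B'.mkQ (P z)), map_sum]
  refine Finset.sum_congr rfl fun i _ => ?_
  rw [map_smul, h4]
  rfl

omit [Group Γ] in
theorem lift_comp_single {C : Type} [AddCommGroup C] [Module ℂ C]
    (l : ((Fin n → Γ) →₀ ℂ) →ₗ[ℂ] C) :
    Finsupp.lift C ℂ _ (fun γ => l (Finsupp.single γ 1)) = l := by
  refine Finsupp.lhom_ext' fun γ => LinearMap.ext_ring ?_
  simp

/-- Cycles modulo boundaries have a finite basis, represented by chains `q i`, with dual functionals
`φ i` that are cocycles. A cocycle `c` agrees on cycles with the sum of `c(q i) φ i`, and cocycles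
that agree on cycles are cohomologous. -/
theorem tensorMap_surjective [FiniteDimensional ℂ (H Γ ℂ n)] :
    Function.Surjective (tensorMap Γ V n) := by
  have hcoc : ∀ l : (LinearMap.range (barBoundary Γ n)).dualAnnihilator,
      CharStack.delta (fun γ => l.1 (Finsupp.single γ 1)) = 0 := by
    intro l
    rw [delta_eq_zero_iff, lift_comp_single]
    exact fun x => (Submodule.mem_dualAnnihilator _).1 l.2 _ ⟨x, rfl⟩
  choose cl hcl using fun l => exists_represents_of_delta (hcoc l)
  let T : (LinearMap.range (barBoundary Γ n)).dualAnnihilator →ₗ[ℂ] H Γ ℂ n :=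
    { toFun := cl
      map_add' := fun l m => (hcl (l + m)).unique ((hcl l).add (hcl m))
      map_smul' := fun t l => (hcl (t • l)).unique ((hcl l).smul t) }
  obtain ⟨m, φ, q, hφ, hq⟩ := exists_dual_pair (barCycles Γ n) _ range_barBoundary_le T (by
    intro l hl
    have h1 := hcl l
    rw [show cl l = 0 from hl] at h1
    have h2 := (isCob_iff _).1 h1.isCob
    rwa [lift_comp_single] at h2)
  intro x
  obtain ⟨c, hc⟩ := exists_represents x
  refine ⟨∑ i, Finsupp.lift V ℂ _ c (q i) ⊗ₜ cl ⟨φ i, hφ i⟩, ?_⟩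
  rw [map_sum]
  refine (Represents.sum Finset.univ fun i _ => (hcl ⟨φ i, hφ i⟩).map
    (LinearMap.toSpanSingleton ℂ V (Finsupp.lift V ℂ _ c (q i)))).eq_of_isCob hc ?_
  rw [isCob_iff]
  intro z hz
  have h1 := hq V (Finsupp.lift V ℂ _ c) (by
    rintro _ ⟨y, rfl⟩
    exact (delta_eq_zero_iff c).1 hc.delta y) z hz
  rw [map_sub, LinearMap.sub_apply, sub_eq_zero, h1, map_sum, LinearMap.sum_apply]
  refine Finset.sum_congr rfl fun i _ => ?_
  have h2 := lift_comp_single (LinearMap.toSpanSingleton ℂ V (Finsupp.lift V ℂ _ c (q i)) ∘ₗ φ i)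
  exact LinearMap.congr_fun h2 z

end Delta

/-! ### Cup products of 1-cocycles -/

section Cup

theorem prefixProd_zero {M : Type} [Monoid M] {n : ℕ} (m : Fin (n + 1) → M) :
    prefixProd m 0 = 1 := by
  simp [prefixProd]

theorem prefixProd_cons_succ {M : Type} [Monoid M] {n : ℕ} (g : M) (m : Fin n → M) (k : Fin n) :
    prefixProd (Fin.cons g m : Fin (n + 1) → M) k.succ = g * prefixProd m k := by
  simp [prefixProd, List.ofFn_succ]

theorem map_prefixProd {M N : Type} [Monoid M] [Monoid N] (f : M →* N) {n : ℕ} (m : Fin n → M)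
    (k : Fin n) : f (prefixProd m k) = prefixProd (fun i => f (m i)) k := by
  simp only [prefixProd, map_list_prod, List.map_take, List.map_ofFn]
  rfl

variable {Γ : Type} [Group Γ] {V W : Type} [AddCommGroup V] [Module ℂ V] [AddCommGroup W]
  [Module ℂ W] (A : Γ →* Module.End ℂ V) {n : ℕ}

/-- The multilinear map `(v₁, …, vₙ) ↦ F (x, T v₁, …, T vₙ)`. -/
def twist (F : MultilinearMap ℂ (fun _ : Fin (n + 1) => V) W) (x : V) (T : Module.End ℂ V) :
    MultilinearMap ℂ (fun _ : Fin n => V) W :=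
  (F.curryLeft x).compLinearMap fun _ => T

theorem twist_apply (F : MultilinearMap ℂ (fun _ : Fin (n + 1) => V) W) (x : V)
    (T : Module.End ℂ V) (v : Fin n → V) : twist F x T v = F (Fin.cons x fun k => T (v k)) := rfl

/-- The cochain `F (s₁ ∪ ⋯ ∪ sₙ)`, with the slots filled in the order given by `τ`. -/
def cupP (F : MultilinearMap ℂ (fun _ : Fin n => V) W) (s : Fin n → Γ → V) (τ : Fin n → Fin n)
    (γ : Fin n → Γ) : W :=
  F fun k => A (prefixProd γ (τ k)) (s k (γ (τ k)))

/-- The cochain `F (s₁ ∪ ⋯ ∪ sₙ)`. -/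
abbrev cupC (F : MultilinearMap ℂ (fun _ : Fin n => V) W) (s : Fin n → Γ → V) :
    (Fin n → Γ) → W :=
  cupP A F s id

/-- The first group element is absorbed into the form: its cochain value fills the first slot, and
`A g` moves onto the remaining slots. The recursion leaves the class of invariant forms, which is
why the identities below are stated for arbitrary `F`. -/
theorem cupP_cons (F : MultilinearMap ℂ (fun _ : Fin (n + 1) => V) W) (s : Fin (n + 1) → Γ → V)
    {τ : Fin (n + 1) → Fin (n + 1)} {τ' : Fin n → Fin n} (h0 : τ 0 = 0)
    (h : ∀ k, τ k.succ = (τ' k).succ) (g : Γ) (γ : Fin n → Γ) :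
    cupP A F s τ (Fin.cons g γ) = cupP A (twist F (s 0 g) (A g)) (Fin.tail s) τ' γ := by
  rw [cupP, cupP, twist_apply]
  congr 1
  funext k
  refine Fin.cases ?_ (fun k => ?_) k
  · simp [h0, prefixProd_zero]
  · simp only [h, prefixProd_cons_succ, Fin.cons_succ, map_mul]
    rfl

theorem cupC_cons (F : MultilinearMap ℂ (fun _ : Fin (n + 1) => V) W) (s : Fin (n + 1) → Γ → V)
    (g : Γ) (γ : Fin n → Γ) :
    cupC A F s (Fin.cons g γ) = cupC A (twist F (s 0 g) (A g)) (Fin.tail s) γ :=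
  cupP_cons A F s rfl (fun _ => rfl) g γ

theorem cupC_sub (F F' : MultilinearMap ℂ (fun _ : Fin n => V) W) (s : Fin n → Γ → V)
    (γ : Fin n → Γ) : cupC A (F - F') s γ = cupC A F s γ - cupC A F' s γ := rfl

theorem comp_cons (F : MultilinearMap ℂ (fun _ : Fin (n + 1) => V) W) (T : Module.End ℂ V) (x : V)
    (v : Fin n → V) : F.compLinearMap (fun _ => T) (Fin.cons x v) =
      F (Fin.cons (T x) fun k => T (v k)) := by
  rw [MultilinearMap.compLinearMap_apply]
  congr 1
  funext k
  refine Fin.cases ?_ (fun k => ?_) k <;> simp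

theorem twist_comp (F : MultilinearMap ℂ (fun _ : Fin (n + 1) => V) W) (x : V)
    (T T' : Module.End ℂ V) :
    twist (F.compLinearMap fun _ => T) x T' = twist F (T x) (T * T') := by
  ext v
  rw [twist_apply, twist_apply, comp_cons]
  rfl

theorem comp_twist (F : MultilinearMap ℂ (fun _ : Fin (n + 1) => V) W) (x : V)
    (T T' : Module.End ℂ V) :
    (twist F x T).compLinearMap (fun _ => T') = twist F x (T * T') := rfl

theorem twist_sub (F : MultilinearMap ℂ (fun _ : Fin (n + 1) => V) W) (x y : V)
    (T : Module.End ℂ V) : twist F (x - y) T = twist F x T - twist F y T := by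
  ext v
  simp only [twist, map_sub]
  rfl

theorem twist_add (F : MultilinearMap ℂ (fun _ : Fin (n + 1) => V) W) (x y : V)
    (T : Module.End ℂ V) : twist F (x + y) T = twist F x T + twist F y T := by
  ext v
  simp only [twist, map_add]
  rfl

-- Peeling off two elements produces `F` with first slot `s(gh) - s(g)`, which is `A g (s h)` by the
-- cocycle identity. So taking the faces amounts to twisting all slots by `A g`; for invariant `F`
-- this cancels the first face.
variable {A} in
theorem face_cupC {F : MultilinearMap ℂ (fun _ : Fin n => V) W} {s : Fin n → Γ → V}
    (hs : ∀ k g h, s k (g * h) = s k g + A g (s k h)) (g : Γ) (γ : Fin n → Γ) :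
    face (cupC A F s) g γ = cupC A (F.compLinearMap fun _ => A g) s γ := by
  induction n generalizing g with
  | zero => exact congrArg F (Subsingleton.elim _ _)
  | succ n ih =>
    rw [face, cupC_cons]
    conv_rhs => rw [← Fin.cons_self_tail γ, cupC_cons]
    simp_rw [cupC_cons A F s g]
    have := ih (F := twist F (s 0 g) (A g)) (s := Fin.tail s) (fun k => hs k.succ) (γ 0) (Fin.tail γ)
    change _ - face (cupC A (twist F (s 0 g) (A g)) (Fin.tail s)) (γ 0) (Fin.tail γ) = _
    rw [this, comp_twist, twist_comp, ← cupC_sub, hs, map_mul, ← twist_sub]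
    congr 2
    abel

/-- The cochain `F (s₁ ∪ ⋯ ∪ m ∪ ⋯ ∪ sₙ)` with a 0-cochain in one slot. -/
def insC (m : V) : (k : ℕ) → {n : ℕ} → MultilinearMap ℂ (fun _ : Fin (n + 1) => V) W →
    (Fin (n + 1) → Γ → V) → (Fin n → Γ) → W
  | 0, _, F, s, γ => cupC A (F.curryLeft m) (Fin.tail s) γ
  -- The slot is out of range here, so the value is immaterial.
  | _ + 1, 0, _, _, _ => 0
  | k + 1, _ + 1, F, s, γ =>
    insC m k (twist F (s 0 (γ 0)) (A (γ 0))) (Fin.tail s) (Fin.tail γ)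

theorem insC_sub (m : V) (k : ℕ) (F F' : MultilinearMap ℂ (fun _ : Fin (n + 1) => V) W)
    (s : Fin (n + 1) → Γ → V) (γ : Fin n → Γ) :
    insC A m k (F - F') s γ = insC A m k F s γ - insC A m k F' s γ := by
  induction k generalizing n with
  | zero => rfl
  | succ k ih =>
    cases n with
    | zero => simp [insC]
    | succ n => exact ih (twist F (s 0 (γ 0)) (A (γ 0))) (twist F' (s 0 (γ 0)) (A (γ 0))) _ _

-- For invariant `F` the left-hand side is the differential of `insC`. The general form, with `F`
-- twisted by `A g`, is what survives the induction; the sign comes from moving the differential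
-- past `k` cochains of degree 1.
variable {A} in
theorem insC_comp_sub_face {F : MultilinearMap ℂ (fun _ : Fin (n + 1) => V) W}
    {s : Fin (n + 1) → Γ → V} (hs : ∀ k g h, s k (g * h) = s k g + A g (s k h)) (k : Fin (n + 1))
    (m : V) (hm : ∀ g, s k g = A g m - m) (g : Γ) (γ : Fin n → Γ) :
    insC A m k (F.compLinearMap fun _ => A g) s γ - face (insC A m k F s) g γ =
      (-1 : ℂ) ^ (k : ℕ) • cupC A F s (Fin.cons g γ) := by
  -- With the 0-cochain in front, the two terms differ only in the first slot, which holds `A g m`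
  -- and `m`, and the difference of these is `s 0 g`.
  have base : ∀ {n : ℕ} {F : MultilinearMap ℂ (fun _ : Fin (n + 1) => V) W}
      {s : Fin (n + 1) → Γ → V} (_ : ∀ k g h, s k (g * h) = s k g + A g (s k h))
      (_ : ∀ g, s 0 g = A g m - m) (g : Γ) (γ : Fin n → Γ),
      insC A m 0 (F.compLinearMap fun _ => A g) s γ - face (insC A m 0 F s) g γ =
        cupC A F s (Fin.cons g γ) := by
    intro n F s hs hm g γ
    have := face_cupC (A := A) (F := F.curryLeft m) (s := Fin.tail s) (fun k => hs k.succ) g γ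
    change cupC A _ (Fin.tail s) γ - face (cupC A (F.curryLeft m) (Fin.tail s)) g γ = _
    rw [this, ← cupC_sub, cupC_cons, hm, twist_sub]
    congr 2
    ext v
    rw [MultilinearMap.curryLeft_apply, comp_cons]
    rfl
  induction n generalizing g with
  | zero =>
    obtain rfl : k = 0 := Fin.eq_zero k
    simpa using base hs hm g γ
  | succ n ih =>
    refine Fin.cases (fun hm => ?_) (fun k hm => ?_) k hm
    · simpa using base hs hm g γ
    · rw [face]
      simp only [Fin.val_succ, insC, Fin.cons_zero, Fin.tail_cons]
      have := ih (F := twist F (s 0 g) (A g)) (s := Fin.tail s) (fun k => hs k.succ) k hm (γ 0) (Fin.tail γ)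
      rw [Fin.cons_self_tail, comp_twist] at this
      rw [cupC_cons, pow_succ, mul_neg_one, neg_smul, ← this, twist_comp, hs, map_mul, twist_add]
      rw [show twist F (s 0 g) (A g * A (γ 0)) + twist F (A g (s 0 (γ 0))) (A g * A (γ 0)) =
        twist F (A g (s 0 (γ 0))) (A g * A (γ 0)) - (- twist F (s 0 g) (A g * A (γ 0))) by abel,
        insC_sub]
      have h2 := insC_sub A m k 0 (twist F (s 0 g) (A g * A (γ 0))) (Fin.tail s) (Fin.tail γ)
      have h3 := insC_sub A m k (0 : MultilinearMap ℂ (fun _ : Fin (n + 1) => V) W) 0 (Fin.tail s) (Fin.tail γ)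
      rw [sub_self, sub_self] at h3
      rw [zero_sub, h3, zero_sub] at h2
      rw [h2]
      change _ - (_ - face (insC A m k (twist F (s 0 g) (A g)) (Fin.tail s)) (γ 0) (Fin.tail γ)) = _
      abel

/-- The cochain `F (s₁ ∪ ⋯ ∪ q ∪ ⋯ ∪ sₙ)`, where two adjacent slots are filled with the 1-cochain
`q(γ) = sₖ(γ) ⊗ sₖ₊₁(γ)`. -/
def swapC : (k : ℕ) → {n : ℕ} → MultilinearMap ℂ (fun _ : Fin (n + 2) => V) W →
    (Fin (n + 2) → Γ → V) → (Fin (n + 1) → Γ) → W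
  | 0, _, F, s, γ => cupC A (twist (F.curryLeft (s 0 (γ 0))) (s 1 (γ 0)) (A (γ 0)))
      (Fin.tail (Fin.tail s)) (Fin.tail γ)
  | _ + 1, 0, _, _, _ => 0
  | k + 1, _ + 1, F, s, γ =>
    swapC k (twist F (s 0 (γ 0)) (A (γ 0))) (Fin.tail s) (Fin.tail γ)

theorem swapC_sub (k : ℕ) (F F' : MultilinearMap ℂ (fun _ : Fin (n + 2) => V) W)
    (s : Fin (n + 2) → Γ → V) (γ : Fin (n + 1) → Γ) :
    swapC A k (F - F') s γ = swapC A k F s γ - swapC A k F' s γ := by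
  induction k generalizing n with
  | zero => rfl
  | succ k ih =>
    cases n with
    | zero => simp [swapC]
    | succ n => exact ih (twist F (s 0 (γ 0)) (A (γ 0))) (twist F' (s 0 (γ 0)) (A (γ 0))) _ _

theorem cupP_swap_zero (F : MultilinearMap ℂ (fun _ : Fin (n + 2) => V) W)
    (s : Fin (n + 2) → Γ → V) (g h : Γ) (γ : Fin n → Γ) :
    cupP A F s (Equiv.swap 0 1) (Fin.cons g (Fin.cons h γ)) =
      cupC A (twist (F.curryLeft (A g (s 0 h))) (s 1 g) (A (g * h)))
      (Fin.tail (Fin.tail s)) γ := by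
  change F _ = F _
  congr 1
  funext k
  refine Fin.cases ?_ (fun k => Fin.cases ?_ (fun k => ?_) k) k
  · rw [Equiv.swap_apply_left, ← Fin.succ_zero_eq_one, prefixProd_cons_succ, prefixProd_zero]
    simp
  · rw [Fin.succ_zero_eq_one, Equiv.swap_apply_right, prefixProd_zero]
    simp
  · rw [Equiv.swap_apply_of_ne_of_ne (Fin.succ_ne_zero _) (by simp [Fin.ext_iff]),
      prefixProd_cons_succ, prefixProd_cons_succ]
    simp only [map_mul, Fin.cons_succ, Module.End.mul_apply]
    rfl

theorem cupC_cons_cons (F : MultilinearMap ℂ (fun _ : Fin (n + 2) => V) W)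
    (s : Fin (n + 2) → Γ → V) (g h : Γ) (γ : Fin n → Γ) :
    cupC A F s (Fin.cons g (Fin.cons h γ)) =
      cupC A (twist (F.curryLeft (s 0 g)) (A g (s 1 h)) (A (g * h)))
      (Fin.tail (Fin.tail s)) γ := by
  rw [cupC_cons, cupC_cons, map_mul, ← twist_comp]
  rfl

-- In the first two slots, `s₀(gh) ⊗ s₁(gh)` expands by the cocycle identity into four terms. The
-- two pure ones cancel against the other faces, and the two mixed ones are the cup product and the
-- cup product with exchanged factors.
variable {A} in
theorem swapC_comp_sub_face {F : MultilinearMap ℂ (fun _ : Fin (n + 2) => V) W}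
    {s : Fin (n + 2) → Γ → V} (hs : ∀ k g h, s k (g * h) = s k g + A g (s k h)) (k : Fin (n + 1))
    (g : Γ) (γ : Fin (n + 1) → Γ) :
    swapC A k (F.compLinearMap fun _ => A g) s γ - face (swapC A k F s) g γ =
      (-1 : ℂ) ^ (k + 1 : ℕ) • (cupC A F s (Fin.cons g γ) +
        cupP A F s (Equiv.swap k.castSucc k.succ) (Fin.cons g γ)) := by
  have base : ∀ {n : ℕ} {F : MultilinearMap ℂ (fun _ : Fin (n + 2) => V) W}
      {s : Fin (n + 2) → Γ → V} (hs : ∀ k g h, s k (g * h) = s k g + A g (s k h))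
      (g : Γ) (γ : Fin (n + 1) → Γ),
      swapC A 0 (F.compLinearMap fun _ => A g) s γ - face (swapC A 0 F s) g γ =
      - (cupC A F s (Fin.cons g γ) + cupP A F s (Equiv.swap 0 1) (Fin.cons g γ)) := by
    intro n F s hs g γ
    rw [face]
    obtain ⟨h, t, rfl⟩ : ∃ h t, γ = Fin.cons h t := ⟨_, _, (Fin.cons_self_tail γ).symm⟩
    simp only [swapC, Fin.cons_zero, Fin.tail_cons]
    have h1 := face_cupC (A := A) (F := twist (F.curryLeft (s 0 g)) (s 1 g) (A g))
      (s := Fin.tail (Fin.tail s)) (fun k => hs k.succ.succ) h t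
    rw [h1, cupP_swap_zero, cupC_cons_cons, comp_twist, hs, hs, map_mul]
    have h2 : twist ((F.compLinearMap fun _ => A g).curryLeft (s 0 h)) (s 1 h) (A h) =
        twist (F.curryLeft (A g (s 0 h))) (A g (s 1 h)) (A g * A h) := by
      ext v
      rw [twist_apply, twist_apply, MultilinearMap.curryLeft_apply, comp_cons,
        MultilinearMap.curryLeft_apply]
      congr 2
      funext k
      refine Fin.cases ?_ (fun k => ?_) k <;> simp
    rw [h2, map_add]
    have h3 : ∀ (X Y : MultilinearMap ℂ (fun _ : Fin (n + 1) => V) W) x y T,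
        twist (X + Y) (x + y) T = twist X x T + twist X y T + (twist Y x T + twist Y y T) := by
      intro X Y x y T
      rw [← twist_add, ← twist_add]
      rfl
    rw [h3]
    have h4 : ∀ (X Y : MultilinearMap ℂ (fun _ : Fin n => V) W) s γ,
      cupC A (X + Y) s γ = cupC A X s γ + cupC A Y s γ := fun _ _ _ _ => rfl
    simp only [h4]
    abel
  induction n generalizing g with
  | zero =>
    obtain rfl : k = 0 := Fin.eq_zero k
    have e : (-1 : ℂ) ^ (0 + 1) = -1 := by norm_num
    rw [Fin.val_zero, e, neg_one_smul]
    exact base hs g γ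
  | succ n ih =>
    refine Fin.cases ?_ (fun k => ?_) k
    · have e : (-1 : ℂ) ^ (0 + 1) = -1 := by norm_num
      rw [Fin.val_zero, e, neg_one_smul]
      exact base hs g γ
    · rw [face]
      simp only [Fin.val_succ, swapC, Fin.cons_zero, Fin.tail_cons]
      have := ih (F := twist F (s 0 g) (A g)) (s := Fin.tail s) (fun k => hs k.succ) k (γ 0) (Fin.tail γ)
      rw [Fin.cons_self_tail, comp_twist] at this
      have hc : cupP A F s (Equiv.swap k.succ.castSucc k.succ.succ) (Fin.cons g γ) =
          cupP A (twist F (s 0 g) (A g)) (Fin.tail s) (Equiv.swap k.castSucc k.succ) γ := by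
        refine cupP_cons A F s ?_ (fun j => ?_) g γ
        · rw [← Fin.succ_castSucc]
          exact Equiv.swap_apply_of_ne_of_ne (Fin.succ_ne_zero _).symm (Fin.succ_ne_zero _).symm
        · rw [← Fin.succ_castSucc]
          exact ((Fin.succ_injective _).swap_apply _ _ _)
      rw [cupC_cons, hc, pow_succ, mul_neg_one, neg_smul]
      erw [← this]
      rw [twist_comp, hs, map_mul, twist_add]
      rw [show twist F (s 0 g) (A g * A (γ 0)) + twist F (A g (s 0 (γ 0))) (A g * A (γ 0)) =
        twist F (A g (s 0 (γ 0))) (A g * A (γ 0)) - (- twist F (s 0 g) (A g * A (γ 0))) by abel,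
        swapC_sub]
      have h2 := swapC_sub A k 0 (twist F (s 0 g) (A g * A (γ 0))) (Fin.tail s) (Fin.tail γ)
      have h3 := swapC_sub A k (0 : MultilinearMap ℂ (fun _ : Fin (n + 2) => V) W) 0 (Fin.tail s) (Fin.tail γ)
      rw [sub_self, sub_self] at h3
      rw [zero_sub, h3, zero_sub] at h2
      rw [h2]
      change _ - (_ - face (swapC A k (twist F (s 0 g) (A g)) (Fin.tail s)) (γ 0) (Fin.tail γ)) = _
      abel

variable {A}

theorem delta_cupC {F : MultilinearMap ℂ (fun _ : Fin n => V) W} {s : Fin n → Γ → V}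
    (hF : ∀ g, F.compLinearMap (fun _ => A g) = F)
    (hs : ∀ k g h, s k (g * h) = s k g + A g (s k h)) : delta (cupC A F s) = 0 := by
  funext γ
  rw [delta, face_cupC hs, hF]
  exact sub_self _

/-- The cup product is a coboundary if one of the factors is the coboundary of `m`. -/
theorem isCob_cupC {F : MultilinearMap ℂ (fun _ : Fin n => V) W} {s : Fin n → Γ → V}
    (hF : ∀ g, F.compLinearMap (fun _ => A g) = F)
    (hs : ∀ k g h, s k (g * h) = s k g + A g (s k h)) (k : Fin n)
    (m : V) (hm : ∀ g, s k g = A g m - m) : IsCob (cupC A F s) := by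
  cases n with
  | zero => exact k.elim0
  | succ n =>
    have : IsCob ((-1 : ℂ) ^ (k : ℕ) • cupC A F s) := by
      -- For invariant `F`, the homotopy identity exhibits `insC` as a potential, up to a sign that
      -- is removed afterwards.
      refine ⟨insC A m k F s, ?_⟩
      funext γ
      have h := insC_comp_sub_face (F := F) hs k m hm (γ 0) (Fin.tail γ)
      rw [hF, Fin.cons_self_tail] at h
      exact h.symm
    have h2 := this.smul ((-1 : ℂ) ^ (k : ℕ))
    rwa [smul_smul, ← mul_pow, neg_one_mul, neg_neg, one_pow, one_smul] at h2

theorem isCob_cupP_swap {F : MultilinearMap ℂ (fun _ : Fin (n + 1) => V) W}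
    {s : Fin (n + 1) → Γ → V} (hF : ∀ g, F.compLinearMap (fun _ => A g) = F)
    (hs : ∀ k g h, s k (g * h) = s k g + A g (s k h)) (k : Fin n) :
    IsCob (cupC A F s + cupP A F s (Equiv.swap k.castSucc k.succ)) := by
  cases n with
  | zero => exact k.elim0
  | succ n =>
    have : IsCob ((-1 : ℂ) ^ (k + 1 : ℕ) •
        (cupC A F s + cupP A F s (Equiv.swap k.castSucc k.succ))) := by
      refine ⟨swapC A k F s, ?_⟩
      funext γ
      have h := swapC_comp_sub_face (F := F) hs k (γ 0) (Fin.tail γ)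
      rw [hF, Fin.cons_self_tail] at h
      exact h.symm
    have h2 := this.smul ((-1 : ℂ) ^ (k + 1 : ℕ))
    rwa [smul_smul, ← mul_pow, neg_one_mul, neg_neg, one_pow, one_smul] at h2

/-- The cup product of 1-cocycles is graded commutative up to coboundaries. -/
theorem isCob_cupP_sub {F : MultilinearMap ℂ (fun _ : Fin n => V) W} {s : Fin n → Γ → V}
    (hF : ∀ g, F.compLinearMap (fun _ => A g) = F)
    (hs : ∀ k g h, s k (g * h) = s k g + A g (s k h)) (τ : Equiv.Perm (Fin n)) :
    IsCob (cupP A F s τ - ((Equiv.Perm.sign τ : ℤ) : ℂ) • cupC A F s) := by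
  cases n with
  | zero =>
    rw [Subsingleton.elim τ 1]
    simpa using IsCob.zero
  | succ n =>
    -- Adjacent transpositions generate the symmetric group, and each of them costs one sign.
    have hτ : τ ∈ Submonoid.closure (Set.range fun i : Fin n => Equiv.swap i.castSucc i.succ) := by
      rw [Equiv.Perm.mclosure_swap_castSucc_succ]
      trivial
    induction hτ using Submonoid.closure_induction_left with
    | one => simpa using IsCob.zero
    | mul_left σ hσ τ _ ih =>
      obtain ⟨i, rfl⟩ := hσ
      -- Reordering the slots of `F` and the cocycles by `τ` turns the order `τ` into the identity,
      -- so that the adjacent case applies to it.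
      have h := isCob_cupP_swap (A := A) (F := F.domDomCongr τ) (s := fun k => s (τ.symm k)) (by
        intro g
        ext v
        exact DFunLike.congr_fun (hF g) fun i => v (τ i)) (fun k => hs _) i
      have e1 : cupC A (F.domDomCongr τ) (fun k => s (τ.symm k)) = cupP A F s τ := by
        funext γ
        change F _ = F _
        congr 1
        funext j
        simp
      have e2 : cupP A (F.domDomCongr τ) (fun k => s (τ.symm k)) (Equiv.swap i.castSucc i.succ) =
          cupP A F s (Equiv.swap i.castSucc i.succ * τ : Equiv.Perm (Fin (n + 1))) := by
        funext γ
        change F _ = F _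
        congr 1
        funext j
        simp
      rw [e1, e2] at h
      convert h.sub ih using 1
      rw [map_mul, Equiv.Perm.sign_swap (Fin.castSucc_lt_succ).ne]
      simp only [neg_mul, one_mul, Units.val_neg, Int.cast_neg, neg_smul]
      abel

end Cup

/-! ### Cup products of cochains with values in a ring -/

section RingCup

/-- The function on lists given by a cochain. -/
def ofTuple {Γ W : Type} [Zero W] {n : ℕ} (a : (Fin n → Γ) → W) (l : List Γ) : W :=
  if h : l.length = n then a fun i => l.get (i.cast h.symm) else 0

theorem ofTuple_ofFn {Γ W : Type} [Zero W] {n : ℕ} (a : (Fin n → Γ) → W) (γ : Fin n → Γ) :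
    ofTuple a (List.ofFn γ) = a γ := by
  rw [ofTuple, dif_pos (List.length_ofFn)]
  congr 1
  funext i
  simp

/-- The alternating sum of the faces of a list other than the first one. -/
def faceL {Γ W : Type} [Mul Γ] [AddCommGroup W] : (List Γ → W) → Γ → List Γ → W
  | f, _, [] => f []
  | f, g, h :: t => f (g * h :: t) - faceL (fun l => f (g :: l)) h t

/-- On lists, a tuple of length `n + m` can be cut in two without casts between index types. -/
theorem face_ofFn {Γ W : Type} [Mul Γ] [AddCommGroup W] {n : ℕ} (f : List Γ → W) (g : Γ)
    (γ : Fin n → Γ) : face (fun γ => f (List.ofFn γ)) g γ = faceL f g (List.ofFn γ) := by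
  induction n generalizing f g with
  | zero => rfl
  | succ n ih =>
    have := ih (fun l => f (g :: l)) (γ 0) (Fin.tail γ)
    rw [List.ofFn_succ]
    simp only [face, List.ofFn_cons, faceL, this]
    rfl

theorem exists_ofFn {Γ : Type} {n : ℕ} {l : List Γ} (hl : l.length = n) :
    ∃ γ : Fin n → Γ, l = List.ofFn γ := by
  subst hl
  exact ⟨_, (List.ofFn_get l).symm⟩

theorem ofTuple_zero {Γ W : Type} [Zero W] {n : ℕ} (l : List Γ) :
    ofTuple (0 : (Fin n → Γ) → W) l = 0 := by
  rw [ofTuple]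
  split_ifs <;> rfl

theorem exists_append {Γ : Type} {n m : ℕ} {l : List Γ} (hl : l.length = n + m) :
    ∃ l₁ l₂ : List Γ, l = l₁ ++ l₂ ∧ l₁.length = n ∧ l₂.length = m :=
  ⟨l.take n, l.drop n, (List.take_append_drop n l).symm, by simp [hl], by simp [hl]⟩

variable {Γ R : Type} [Group Γ] [Ring R] {n m : ℕ}

theorem faceL_mul_left (x : R) (b : List Γ → R) (g : Γ) (l : List Γ) :
    faceL (fun l => x * b l) g l = x * faceL b g l := by
  induction l generalizing b g with
  | nil => rfl
  | cons h t ih => simp only [faceL, mul_sub, ih fun l => b (g :: l)]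

/-- The cup product of functions on lists. -/
def cupL (n : ℕ) (a b : List Γ → R) (l : List Γ) : R := a (l.take n) * b (l.drop n)

/-- This is the graded Leibniz rule without the first face: the faces inside the first block
differentiate `a`, those beyond it differentiate `b`. The last entry of the first block then serves
as the leading element for `b`, which explains `dropLast` and `getLast`. -/
theorem faceL_cupL (a b : List Γ → R) (g : Γ) (l₁ l₂ : List Γ) :
    faceL (cupL l₁.length a b) g (l₁ ++ l₂) = faceL a g l₁ * b l₂ - (-1) ^ l₁.length *
      (a ((g :: l₁).dropLast) * (b l₂ - faceL b ((g :: l₁).getLast (List.cons_ne_nil g l₁)) l₂)) := by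
  induction l₁ generalizing a g with
  | nil =>
    have := faceL_mul_left (a []) b g l₂
    change faceL (fun l => a [] * b l) g l₂ = _
    rw [this]
    simp [faceL, mul_sub]
  | cons h t ih =>
    have := ih (fun l => a (g :: l)) h
    simp only [List.cons_append, List.length_cons, faceL]
    change cupL _ a b _ - faceL (cupL t.length (fun l => a (g :: l)) b) h (t ++ l₂) = _
    rw [this, cupL]
    simp only [List.take_succ_cons, List.take_left, List.drop_succ_cons, List.drop_left,
      List.dropLast_cons_cons, List.getLast_cons_cons, pow_succ, sub_mul]
    noncomm_ring

theorem delta_ofTuple (b : (Fin n → Γ) → R) (g : Γ) {l : List Γ} (hl : l.length = n) :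
    ofTuple (delta b) (g :: l) = ofTuple b l - faceL (ofTuple b) g l := by
  obtain ⟨γ, rfl⟩ := exists_ofFn hl
  have h := face_ofFn (ofTuple b) g γ
  simp only [ofTuple_ofFn] at h
  have h2 : g :: List.ofFn γ = List.ofFn (Fin.cons g γ : Fin (n + 1) → Γ) := by simp
  rw [h2, ofTuple_ofFn, ofTuple_ofFn, ← h, delta]
  simp

/-- The equation `N = M + 1` absorbs degrees such as `n + 1 + m`, which are not successors by
definition. -/
theorem isCob_of_faceL {N M : ℕ} (h : N = M + 1) {c : (Fin N → Γ) → R} (f : List Γ → R)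
    (hc : ∀ g l, l.length = M → ofTuple c (g :: l) = f l - faceL f g l) : IsCob c := by
  subst h
  refine ⟨fun γ => f (List.ofFn γ), ?_⟩
  funext γ
  rw [delta, face_ofFn, ← hc _ _ (by simp), ← ofTuple_ofFn c γ, List.ofFn_succ]
  rfl

/-- The cup product of cochains with values in a ring. -/
def cupR (a : (Fin n → Γ) → R) (b : (Fin m → Γ) → R) (γ : Fin (n + m) → Γ) : R :=
  a (fun k => γ (Fin.castAdd m k)) * b (fun k => γ (Fin.natAdd n k))

omit [Group Γ] in
theorem ofTuple_cupR (a : (Fin n → Γ) → R) (b : (Fin m → Γ) → R) {l : List Γ}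
    (hl : l.length = n + m) : ofTuple (cupR a b) l = cupL n (ofTuple a) (ofTuple b) l := by
  obtain ⟨γ, rfl⟩ := exists_ofFn hl
  rw [ofTuple_ofFn, cupL, cupR]
  have h : List.ofFn γ = List.ofFn (fun k => γ (Fin.castAdd m k)) ++
      List.ofFn (fun k => γ (Fin.natAdd n k)) := by
    rw [← List.ofFn_fin_append]
    congr 1
    funext k
    refine Fin.addCases (fun i => ?_) (fun i => ?_) k <;> simp
  rw [h, List.take_left' (by simp), List.drop_left' (by simp), ofTuple_ofFn, ofTuple_ofFn]

variable [Algebra ℂ R]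

theorem IsCob.cupR_left {a : (Fin n → Γ) → R} {b : (Fin m → Γ) → R} (ha : IsCob a)
    (hb : delta b = 0) : IsCob (cupR a b) := by
  cases n with
  | zero =>
    rw [show a = 0 from ha, show cupR 0 b = 0 from funext fun γ => zero_mul _]
    exact IsCob.zero
  | succ n =>
    obtain ⟨a, rfl⟩ := ha
    refine isCob_of_faceL (N := n + 1 + m) (M := n + m) (by omega)
      (cupL n (ofTuple a) (ofTuple b)) fun g l hl => ?_
    rw [ofTuple_cupR _ _ (by simp [hl]; omega)]
    obtain ⟨l₁, l₂, rfl, rfl, h2⟩ := exists_append hl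
    have h3 := delta_ofTuple b ((g :: l₁).getLast (List.cons_ne_nil g l₁)) h2
    rw [hb] at h3
    rw [faceL_cupL, ← h3, cupL, cupL]
    simp only [List.take_succ_cons, List.take_left, List.drop_succ_cons, List.drop_left]
    rw [delta_ofTuple a g rfl]
    rw [ofTuple_zero]
    simp [sub_mul]

theorem IsCob.cupR_right {a : (Fin n → Γ) → R} {b : (Fin m → Γ) → R} (ha : delta a = 0)
    (hb : IsCob b) : IsCob (cupR a b) := by
  cases m with
  | zero =>
    rw [show b = 0 from hb, show cupR a 0 = 0 from funext fun γ => mul_zero _]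
    exact IsCob.zero
  | succ m =>
    obtain ⟨b, rfl⟩ := hb
    -- For a cocycle `a` of degree `n`, the differential of `a ∪ b` is `(-1)^n` times `a ∪ δb`,
    -- hence the sign in the potential.
    refine isCob_of_faceL (N := n + m + 1) (M := n + m) rfl
      (fun l => (-1) ^ n * cupL n (ofTuple a) (ofTuple b) l) fun g l hl => ?_
    rw [faceL_mul_left, ← mul_sub, ofTuple_cupR _ _ (by simp [hl]; omega)]
    obtain ⟨l₁, l₂, rfl, rfl, h2⟩ := exists_append hl
    have h3 := delta_ofTuple b ((g :: l₁).getLast (List.cons_ne_nil g l₁)) h2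
    have h4 := delta_ofTuple a g (l := l₁) rfl
    rw [ha] at h4
    have h5 : ofTuple a l₁ = faceL (ofTuple a) g l₁ := by
      rw [← sub_eq_zero, ← h4]
      simp [ofTuple_zero]
    rw [faceL_cupL, ← h3, cupL, cupL, ← h5]
    simp only [List.take_left, List.drop_left, sub_sub_cancel]
    have h7 : (-1 : R) ^ l₁.length * (-1) ^ l₁.length = 1 := by
      rw [← pow_add, ← two_mul, pow_mul, neg_one_sq, one_pow]
    rw [← mul_assoc, h7, one_mul]
    have h6 : g :: (l₁ ++ l₂) = (g :: l₁).dropLast ++ ((g :: l₁).getLast (List.cons_ne_nil g l₁) :: l₂) := by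
      conv_lhs => rw [← List.cons_append, ← List.dropLast_append_getLast (List.cons_ne_nil g l₁)]
      simp
    rw [h6, List.take_left' (by simp), List.drop_left' (by simp)]

end RingCup

/-! ### Exterior derivative, contraction and functoriality for exterior algebras -/

/-- A derivation of an algebra `O` into an `O`-module `M` with a finite generating system, for which
second derivatives are symmetric. -/
structure FormSystem (O M : Type) [CommRing O] [Algebra ℂ O] [AddCommGroup M] [Module O M]
    (I : Type) [Fintype I] where
  d : O → M
  d_add : ∀ f g, d (f + g) = d f + d g
  d_mul : ∀ f g, d (f * g) = f • d g + g • d f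
  d_const : ∀ z : ℂ, d (algebraMap ℂ O z) = 0
  coef : I → M →ₗ[O] O
  base : I → M
  sum_coef : ∀ θ, ∑ i, coef i θ • base i = θ
  symm : ∀ f i j, coef j (d (coef i (d f))) = coef i (d (coef j (d f)))

section Exterior

variable {O M : Type} [CommRing O] [Algebra ℂ O] [AddCommGroup M] [Module O M] [Module ℂ M]
  [IsScalarTower ℂ O M]

local notation "𝐢" => ExteriorAlgebra.ι O (M := M)
local notation "𝐜" => algebraMap O (ExteriorAlgebra O M)

omit [Algebra ℂ O] [Module ℂ M] [IsScalarTower ℂ O M] in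
theorem exterior_induction {P : ExteriorAlgebra O M → Prop} (hc : ∀ f, P (𝐜 f)) (hi : ∀ φ, P (𝐢 φ))
    (hmul : ∀ x y, P x → P y → P (x * y)) (hadd : ∀ x y, P x → P y → P (x + y))
    (x : ExteriorAlgebra O M) : P x :=
  ExteriorAlgebra.induction (C := P) hc hi hmul hadd x

omit [Algebra ℂ O] [Module ℂ M] [IsScalarTower ℂ O M] in
theorem ι_mul_ι_swap (φ ψ : M) : 𝐢 φ * 𝐢 ψ = - (𝐢 ψ * 𝐢 φ) :=
  eq_neg_of_add_eq_zero_left (ExteriorAlgebra.ι_add_mul_swap φ ψ)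

namespace FormSystem

variable {I : Type} [Fintype I] (S : FormSystem O M I)

/-- The exterior derivative of a 1-form. -/
def dForm (φ : M) : ExteriorAlgebra O M := ∑ i, 𝐢 (S.d (S.coef i φ)) * 𝐢 (S.base i)

omit [Module ℂ M] [IsScalarTower ℂ O M] in
theorem ι_eq (φ : M) : 𝐢 φ = ∑ i, 𝐜 (S.coef i φ) * 𝐢 (S.base i) := by
  conv_lhs => rw [← S.sum_coef φ, map_sum]
  simp only [map_smul, Algebra.smul_def]

omit [Module ℂ M] [IsScalarTower ℂ O M] in
theorem dForm_add (φ ψ : M) : S.dForm (φ + ψ) = S.dForm φ + S.dForm ψ := by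
  simp only [dForm, map_add, S.d_add, add_mul, Finset.sum_add_distrib]

omit [Module ℂ M] [IsScalarTower ℂ O M] in
theorem dForm_smul (f : O) (φ : M) :
    S.dForm (f • φ) = 𝐜 f * S.dForm φ + 𝐢 (S.d f) * 𝐢 φ := by
  rw [S.ι_eq φ, dForm, dForm, Finset.mul_sum, Finset.mul_sum, ← Finset.sum_add_distrib]
  refine Finset.sum_congr rfl fun i _ => ?_
  rw [map_smul, smul_eq_mul, S.d_mul, map_add, map_smul, map_smul, Algebra.smul_def,
    Algebra.smul_def, add_mul, mul_assoc]
  congr 1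
  rw [Algebra.left_comm, mul_assoc]

omit [Module ℂ M] [IsScalarTower ℂ O M] in
theorem dForm_mul_ι (φ ψ : M) : S.dForm φ * 𝐢 ψ = 𝐢 ψ * S.dForm φ := by
  rw [dForm, Finset.sum_mul, Finset.mul_sum]
  refine Finset.sum_congr rfl fun i _ => ?_
  rw [mul_assoc, ι_mul_ι_swap _ ψ, mul_neg, ← mul_assoc, ι_mul_ι_swap _ ψ, neg_mul, neg_neg,
    mul_assoc]

/-- The homomorphism `f ↦ (f, df; 0, f)`. -/
def dMat : O →+* Matrix (Fin 2) (Fin 2) (ExteriorAlgebra O M) where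
  toFun f := !![𝐜 f, 𝐢 (S.d f); 0, 𝐜 f]
  map_one' := by
    have : S.d (1 : O) = 0 := by
      rw [← map_one (algebraMap ℂ O), S.d_const]
    rw [this, map_one, map_zero, Matrix.one_fin_two]
  map_zero' := by
    have : S.d (0 : O) = 0 := by
      rw [← map_zero (algebraMap ℂ O), S.d_const]
    rw [this, map_zero, map_zero]
    ext i j
    fin_cases i <;> fin_cases j <;> rfl
  map_add' f g := by
    rw [S.d_add]
    ext i j
    fin_cases i <;> fin_cases j <;> simp
  map_mul' f g := by
    rw [Matrix.mul_fin_two, S.d_mul]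
    simp only [map_mul, map_add, map_smul, Algebra.smul_def, mul_zero, zero_mul, add_zero, zero_add]
    rw [Algebra.commutes g]

/-- The ring of matrices that commute with the image of `dMat`. -/
def DMat : Type := Subring.centralizer (Set.range S.dMat)

instance : Ring S.DMat := inferInstanceAs (Ring (Subring.centralizer (Set.range S.dMat)))

/-- The map `dMat` with values in its centralizer. -/
def dMat' : O →+* S.DMat :=
  S.dMat.codRestrict (Subring.centralizer (Set.range S.dMat)) fun f => by
    rintro _ ⟨g, rfl⟩
    rw [← map_mul, ← map_mul, mul_comm]

/-- The universal property of the exterior algebra needs an algebra in which `O` is central. The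
matrices `(f, df; 0, f)` are not central among all matrices, hence the restriction to their
centralizer. -/
instance : Algebra O S.DMat :=
  S.dMat'.toAlgebra' fun f x => Subtype.ext (x.2 _ ⟨f, rfl⟩)

/-- The map `θ ↦ (-θ, dθ; 0, θ)`. -/
def dMatForm : M →ₗ[O] S.DMat where
  toFun φ := ⟨!![-𝐢 φ, S.dForm φ; 0, 𝐢 φ], by
    rintro _ ⟨f, rfl⟩
    change !![𝐜 f, 𝐢 (S.d f); 0, 𝐜 f] * !![-𝐢 φ, S.dForm φ; 0, 𝐢 φ] =
      !![-𝐢 φ, S.dForm φ; 0, 𝐢 φ] * !![𝐜 f, 𝐢 (S.d f); 0, 𝐜 f]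
    rw [Matrix.mul_fin_two, Matrix.mul_fin_two]
    simp only [mul_zero, zero_mul, add_zero, zero_add]
    rw [ι_mul_ι_swap, Algebra.commutes, Algebra.commutes, Algebra.commutes, neg_mul, neg_mul,
      add_comm]⟩
  map_add' φ ψ := by
    have : !![-𝐢 (φ + ψ), S.dForm (φ + ψ); 0, 𝐢 (φ + ψ)] =
        !![-𝐢 φ, S.dForm φ; 0, 𝐢 φ] + !![-𝐢 ψ, S.dForm ψ; 0, 𝐢 ψ] := by
      ext i j
      fin_cases i <;> fin_cases j <;> simp [dForm_add, add_comm]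
    exact Subtype.ext this
  map_smul' f φ := by
    have : !![-𝐢 (f • φ), S.dForm (f • φ); 0, 𝐢 (f • φ)] =
        !![𝐜 f, 𝐢 (S.d f); 0, 𝐜 f] * !![-𝐢 φ, S.dForm φ; 0, 𝐢 φ] := by
      rw [Matrix.mul_fin_two, dForm_smul, map_smul, Algebra.smul_def]
      simp
    exact Subtype.ext this

-- The upper right entry is `-φ dφ + dφ φ`, which vanishes because 2-forms commute with 1-forms.
omit [Module ℂ M] [IsScalarTower ℂ O M] in
theorem dMatForm_mul_self (φ : M) : S.dMatForm φ * S.dMatForm φ = 0 := by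
  have : !![-𝐢 φ, S.dForm φ; 0, 𝐢 φ] * !![-𝐢 φ, S.dForm φ; 0, 𝐢 φ] = 0 := by
    rw [Matrix.mul_fin_two]
    ext i j
    fin_cases i <;> fin_cases j <;> simp [dForm_mul_ι]
  exact Subtype.ext this

/-- The homomorphism `x ↦ (x̄, dx; 0, x)` with values in `DMat`. -/
def dHom' : ExteriorAlgebra O M →ₐ[O] S.DMat :=
  ExteriorAlgebra.lift O ⟨S.dMatForm, S.dMatForm_mul_self⟩

omit [Module ℂ M] [IsScalarTower ℂ O M] in
theorem dHom'_c (f : O) : (S.dHom' (𝐜 f)).1 = !![𝐜 f, 𝐢 (S.d f); 0, 𝐜 f] :=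
  congrArg Subtype.val (S.dHom'.commutes f)

omit [Module ℂ M] [IsScalarTower ℂ O M] in
theorem dHom'_ι (φ : M) : (S.dHom' (𝐢 φ)).1 = !![-𝐢 φ, S.dForm φ; 0, 𝐢 φ] :=
  congrArg Subtype.val (ExteriorAlgebra.lift_ι_apply O S.dMatForm S.dMatForm_mul_self φ)

/-- The homomorphism `x ↦ (x̄, dx; 0, x)`, where `x ↦ x̄` is the grade involution. -/
def dHom : ExteriorAlgebra O M →ₐ[ℂ] Matrix (Fin 2) (Fin 2) (ExteriorAlgebra O M) :=
  { ((Subring.centralizer (Set.range S.dMat)).subtype.comp S.dHom'.toRingHom) with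
    commutes' := fun z => by
      have h1 : algebraMap ℂ (ExteriorAlgebra O M) z = 𝐜 (algebraMap ℂ O z) :=
        IsScalarTower.algebraMap_apply ℂ O (ExteriorAlgebra O M) z
      rw [h1]
      refine (S.dHom'_c _).trans ?_
      rw [S.d_const, map_zero, ← h1]
      ext i j
      fin_cases i <;> fin_cases j <;> simp [Matrix.algebraMap_matrix_apply] }

theorem dHom_c (f : O) : S.dHom (𝐜 f) = !![𝐜 f, 𝐢 (S.d f); 0, 𝐜 f] := S.dHom'_c f

theorem dHom_ι (φ : M) : S.dHom (𝐢 φ) = !![-𝐢 φ, S.dForm φ; 0, 𝐢 φ] := S.dHom'_ι φ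

/-- The exterior derivative. -/
def dr : ExteriorAlgebra O M →ₗ[ℂ] ExteriorAlgebra O M :=
  Matrix.entryLinearMap ℂ (ExteriorAlgebra O M) 0 1 ∘ₗ S.dHom.toLinearMap

/-- The grade involution. -/
def bar : ExteriorAlgebra O M →ₗ[ℂ] ExteriorAlgebra O M :=
  Matrix.entryLinearMap ℂ (ExteriorAlgebra O M) 0 0 ∘ₗ S.dHom.toLinearMap

theorem dHom_apply (x : ExteriorAlgebra O M) : S.dHom x = !![S.bar x, S.dr x; 0, x] := by
  have h : S.dHom x 1 0 = 0 ∧ S.dHom x 1 1 = x := by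
    induction x using exterior_induction with
    | hc f => rw [dHom_c]; simp
    | hi φ => rw [dHom_ι]; simp
    | hmul x y hx hy =>
      rw [map_mul, Matrix.mul_apply, Matrix.mul_apply, Fin.sum_univ_two, Fin.sum_univ_two, hx.1, hx.2,
        hy.1, hy.2]
      simp
    | hadd x y hx hy =>
      rw [map_add, Matrix.add_apply, Matrix.add_apply, hx.1, hx.2, hy.1, hy.2]
      simp
  ext i j
  fin_cases i <;> fin_cases j
  · rfl
  · rfl
  · exact h.1
  · exact h.2

/-- The graded Leibniz rule is the upper right entry of the multiplicativity of `dHom`; encoding `d`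
in a homomorphism also lets it pass to quotient algebras. -/
theorem dr_mul (x y : ExteriorAlgebra O M) : S.dr (x * y) = S.bar x * S.dr y + S.dr x * y := by
  have := map_mul S.dHom x y
  rw [dHom_apply, dHom_apply, dHom_apply, Matrix.mul_fin_two] at this
  simpa using congrFun (congrFun this 0) 1

theorem bar_mul (x y : ExteriorAlgebra O M) : S.bar (x * y) = S.bar x * S.bar y := by
  have := map_mul S.dHom x y
  rw [dHom_apply, dHom_apply, dHom_apply, Matrix.mul_fin_two] at this
  simpa using congrFun (congrFun this 0) 0

theorem dr_c (f : O) : S.dr (𝐜 f) = 𝐢 (S.d f) := by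
  change S.dHom (𝐜 f) 0 1 = _
  rw [dHom_c]; rfl

theorem dr_ι (φ : M) : S.dr (𝐢 φ) = S.dForm φ := by
  change S.dHom (𝐢 φ) 0 1 = _
  rw [dHom_ι]; rfl

theorem bar_c (f : O) : S.bar (𝐜 f) = 𝐜 f := by
  change S.dHom (𝐜 f) 0 0 = _
  rw [dHom_c]; rfl

theorem bar_ι (φ : M) : S.bar (𝐢 φ) = - 𝐢 φ := by
  change S.dHom (𝐢 φ) 0 0 = _
  rw [dHom_ι]; rfl

theorem bar_bar (x : ExteriorAlgebra O M) : S.bar (S.bar x) = x := by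
  induction x using exterior_induction with
  | hc f => rw [bar_c, bar_c]
  | hi φ => rw [bar_ι, map_neg, bar_ι, neg_neg]
  | hmul x y hx hy => rw [bar_mul, bar_mul, hx, hy]
  | hadd x y hx hy => rw [map_add, map_add, hx, hy]

/-- Symmetric second derivatives are paired with anticommuting products of 1-forms, so the sum
equals its own negative. -/
theorem dForm_d (f : O) : S.dForm (S.d f) = 0 := by
  have h2 : S.dForm (S.d f) = - S.dForm (S.d f) := by
    have h : S.dForm (S.d f) = ∑ i, ∑ j, 𝐜 (S.coef j (S.d (S.coef i (S.d f)))) *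
        (𝐢 (S.base j) * 𝐢 (S.base i)) := by
      rw [dForm]
      refine Finset.sum_congr rfl fun i _ => ?_
      rw [S.ι_eq, Finset.sum_mul]
      simp only [mul_assoc]
    conv_lhs => rw [h, Finset.sum_comm]
    rw [h, ← Finset.sum_neg_distrib]
    refine Finset.sum_congr rfl fun i _ => ?_
    rw [← Finset.sum_neg_distrib]
    refine Finset.sum_congr rfl fun j _ => ?_
    rw [S.symm, ι_mul_ι_swap, mul_neg]
  have h3 : (2 : ℂ) • S.dForm (S.d f) = 0 := by
    rw [two_smul]
    conv_lhs => arg 1; rw [h2]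
    exact neg_add_cancel _
  exact (smul_eq_zero.1 h3).resolve_left two_ne_zero

theorem dr_ι_d (f : O) : S.dr (𝐢 (S.d f)) = 0 := by rw [dr_ι, dForm_d]

theorem dForm_bar (φ : M) : S.bar (S.dForm φ) = S.dForm φ := by
  rw [dForm, map_sum]
  refine Finset.sum_congr rfl fun i _ => ?_
  rw [bar_mul, bar_ι, bar_ι, neg_mul_neg]

theorem bar_dr (x : ExteriorAlgebra O M) : S.bar (S.dr x) = - S.dr (S.bar x) := by
  induction x using exterior_induction with
  | hc f => rw [dr_c, bar_c, dr_c, bar_ι]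
  | hi φ => rw [dr_ι, bar_ι, map_neg, dr_ι, neg_neg, dForm_bar]
  | hmul x y hx hy =>
    rw [dr_mul, bar_mul, dr_mul, map_add, bar_mul, bar_mul, hx, hy, bar_bar]
    noncomm_ring
  | hadd x y hx hy => rw [map_add, map_add, map_add, map_add, hx, hy, neg_add]

/-- The contraction with a vector field. -/
abbrev con (X : M →ₗ[O] O) : ExteriorAlgebra O M →ₗ[O] ExteriorAlgebra O M :=
  CliffordAlgebra.contractLeft (Q := 0) X

omit [Algebra ℂ O] [Module ℂ M] [IsScalarTower ℂ O M] in
theorem con_c (X : M →ₗ[O] O) (f : O) : con X (𝐜 f) = 0 :=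
  CliffordAlgebra.contractLeft_algebraMap _ X f

omit [Algebra ℂ O] [Module ℂ M] [IsScalarTower ℂ O M] in
theorem con_ι (X : M →ₗ[O] O) (φ : M) : con X (𝐢 φ) = 𝐜 (X φ) :=
  CliffordAlgebra.contractLeft_ι _ X φ

omit [Algebra ℂ O] [Module ℂ M] [IsScalarTower ℂ O M] in
theorem con_ι_mul (X : M →ₗ[O] O) (φ : M) (y : ExteriorAlgebra O M) :
    con X (𝐢 φ * y) = 𝐜 (X φ) * y - 𝐢 φ * con X y := by
  rw [← Algebra.smul_def]
  exact CliffordAlgebra.contractLeft_ι_mul X φ y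

omit [Algebra ℂ O] [Module ℂ M] [IsScalarTower ℂ O M] in
theorem con_c_mul (X : M →ₗ[O] O) (f : O) (y : ExteriorAlgebra O M) :
    con X (𝐜 f * y) = 𝐜 f * con X y := by
  rw [← Algebra.smul_def, ← Algebra.smul_def, map_smul]

theorem con_mul (X : M →ₗ[O] O) (x y : ExteriorAlgebra O M) :
    con X (x * y) = con X x * y + S.bar x * con X y := by
  revert y
  induction x using exterior_induction with
  | hc f => intro y; rw [con_c_mul, con_c, bar_c, zero_mul, zero_add]
  | hi φ => intro y; rw [con_ι_mul, con_ι, bar_ι, neg_mul, sub_eq_add_neg]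
  | hmul x x' hx hx' =>
    intro y
    rw [mul_assoc, hx, hx', hx, bar_mul]
    noncomm_ring
  | hadd x x' hx hx' =>
    intro y
    rw [add_mul, map_add, hx, hx', map_add, map_add]
    noncomm_ring

theorem con_bar (X : M →ₗ[O] O) (x : ExteriorAlgebra O M) :
    con X (S.bar x) = - S.bar (con X x) := by
  induction x using exterior_induction with
  | hc f => rw [bar_c, con_c, map_zero, neg_zero]
  | hi φ => rw [bar_ι, map_neg, con_ι, bar_c]
  | hmul x y hx hy =>
    rw [bar_mul, S.con_mul, S.con_mul, map_add, bar_mul, bar_mul, hx, hy]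
    noncomm_ring
  | hadd x y hx hy => rw [map_add, map_add, map_add, map_add, hx, hy, neg_add]

/-- The Lie derivative along a vector field. -/
def lie (X : M →ₗ[O] O) (x : ExteriorAlgebra O M) : ExteriorAlgebra O M :=
  con X (S.dr x) + S.dr (con X x)

/-- Both `d` and the contraction are antiderivations and anticommute with the grade involution, so
the cross terms cancel. -/
theorem lie_mul (X : M →ₗ[O] O) (x y : ExteriorAlgebra O M) :
    S.lie X (x * y) = S.lie X x * y + x * S.lie X y := by
  simp only [lie, dr_mul, map_add, S.con_mul, S.con_bar, S.bar_bar, S.bar_dr]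
  rw [show S.dr (S.bar x) = - S.bar (S.dr x) by rw [bar_dr, neg_neg]]
  noncomm_ring

end FormSystem

/-! ### Functoriality -/

variable {O' M' : Type} [CommRing O'] [Algebra ℂ O'] [AddCommGroup M'] [Module O' M']
  [Module ℂ M'] [IsScalarTower ℂ O' M']

/-- The `O'`-algebra structure of an `O`-algebra, for a homomorphism `O' → O`. -/
def Restricted (_ : O' →+* O) (A : Type) : Type := A

instance (φ : O' →+* O) (A : Type) [Ring A] : Ring (Restricted φ A) := inferInstanceAs (Ring A)

instance (φ : O' →+* O) (A : Type) [Ring A] [Algebra O A] : Algebra O' (Restricted φ A) :=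
  ((algebraMap O A).comp φ).toAlgebra' fun f x => Algebra.commutes (A := A) (φ f) x

/-- A semilinear map as a linear map to the exterior algebra. -/
def pullForm (φ : O' →+* O) (ψ : M' →ₛₗ[φ] M) : M' →ₗ[O'] Restricted φ (ExteriorAlgebra O M) where
  toFun θ := (𝐢 (ψ θ) : ExteriorAlgebra O M)
  map_add' θ θ' := by
    rw [map_add]
    exact map_add 𝐢 (ψ θ) (ψ θ')
  map_smul' f θ := by
    rw [map_smulₛₗ]
    refine (map_smul 𝐢 (φ f) (ψ θ)).trans ((Algebra.smul_def (φ f) (𝐢 (ψ θ))).trans ?_)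
    exact (Algebra.smul_def (R := O') (A := Restricted φ (ExteriorAlgebra O M)) f (𝐢 (ψ θ))).symm

omit [Algebra ℂ O] [Algebra ℂ O'] [Module ℂ M] [IsScalarTower ℂ O M] [Module ℂ M']
  [IsScalarTower ℂ O' M'] in
theorem pullForm_mul_self (φ : O' →+* O) (ψ : M' →ₛₗ[φ] M) (θ : M') :
    pullForm φ ψ θ * pullForm φ ψ θ = 0 :=
  ExteriorAlgebra.ι_sq_zero (R := O) (ψ θ)

/-- The homomorphism of exterior algebras induced by a semilinear map, with values in
`Restricted`. -/
def pull' (φ : O' →+* O) (ψ : M' →ₛₗ[φ] M) :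
    ExteriorAlgebra O' M' →ₐ[O'] Restricted φ (ExteriorAlgebra O M) :=
  ExteriorAlgebra.lift O' ⟨pullForm φ ψ, pullForm_mul_self φ ψ⟩

/-- The homomorphism of exterior algebras induced by a semilinear map. -/
def pull (φ : O' →+* O) (ψ : M' →ₛₗ[φ] M) : ExteriorAlgebra O' M' →+* ExteriorAlgebra O M :=
  (pull' φ ψ).toRingHom

omit [Algebra ℂ O] [Algebra ℂ O'] [Module ℂ M] [IsScalarTower ℂ O M] [Module ℂ M']
  [IsScalarTower ℂ O' M'] in
theorem pull_c (φ : O' →+* O) (ψ : M' →ₛₗ[φ] M) (f : O') :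
    pull φ ψ (algebraMap O' _ f) = 𝐜 (φ f) :=
  (pull' φ ψ).commutes f

omit [Algebra ℂ O] [Algebra ℂ O'] [Module ℂ M] [IsScalarTower ℂ O M] [Module ℂ M']
  [IsScalarTower ℂ O' M'] in
theorem pull_ι (φ : O' →+* O) (ψ : M' →ₛₗ[φ] M) (θ : M') :
    pull φ ψ (ExteriorAlgebra.ι O' θ) = 𝐢 (ψ θ) :=
  ExteriorAlgebra.lift_ι_apply O' (pullForm φ ψ) (pullForm_mul_self φ ψ) θ

theorem pull_bar {I I' : Type} [Fintype I] [Fintype I'] (S : FormSystem O M I)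
    (S' : FormSystem O' M' I') (φ : O' →+* O) (ψ : M' →ₛₗ[φ] M) (x : ExteriorAlgebra O' M') :
    pull φ ψ (S'.bar x) = S.bar (pull φ ψ x) := by
  induction x using exterior_induction with
  | hc f => rw [S'.bar_c, pull_c, S.bar_c]
  | hi θ => rw [S'.bar_ι, map_neg, pull_ι, S.bar_ι]
  | hmul x y hx hy => rw [S'.bar_mul, map_mul, map_mul, S.bar_mul, hx, hy]
  | hadd x y hx hy => rw [map_add, map_add, map_add, map_add, hx, hy]

/-- Contractions with related vector fields obey the same antiderivation rule, so agreement on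
functions and 1-forms is enough. -/
theorem pull_con {I I' : Type} [Fintype I] [Fintype I'] (S : FormSystem O M I)
    (S' : FormSystem O' M' I') (φ : O' →+* O) (ψ : M' →ₛₗ[φ] M) {X : M →ₗ[O] O} {X' : M' →ₗ[O'] O'}
    (h : ∀ θ, X (ψ θ) = φ (X' θ)) (x : ExteriorAlgebra O' M') :
    pull φ ψ (FormSystem.con X' x) = FormSystem.con X (pull φ ψ x) := by
  induction x using exterior_induction with
  | hc f => rw [FormSystem.con_c, map_zero, pull_c, FormSystem.con_c]
  | hi θ => rw [FormSystem.con_ι, pull_ι, pull_c, FormSystem.con_ι, h]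
  | hmul x y hx hy =>
    rw [S'.con_mul, map_mul, S.con_mul, map_add, map_mul, map_mul, hx, hy, pull_bar S S']
  | hadd x y hx hy => rw [map_add, map_add, map_add, map_add, hx, hy]

end Exterior

/-! ### Germs of functions and of 1-forms -/

section Germs

variable {V : Type} [NormedAddCommGroup V] [NormedSpace ℂ V] {a : V}

instance : CommRing (HolGerm a) := inferInstance

instance : AddCommGroup (FormGerm a) := inferInstance

instance : Module (HolGerm a) (FormGerm a) := Submodule.module _

instance : SMul (HolGerm a) (FormGerm a) := Module.toDistribMulAction.toSMul

instance : SMul ℂ (FormGerm a) := Module.toDistribMulAction.toSMul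

instance : Ring (DR a) := inferInstance

instance : Algebra (HolGerm a) (DR a) := inferInstance

instance : Algebra ℂ (DR a) := inferInstance

instance : IsScalarTower ℂ (HolGerm a) (DR a) := inferInstance

theorem holGerm_coe {f : V → ℂ} (hf : AnalyticAt ℂ f a) :
    (holGerm a f : Germ (𝓝 a) ℂ) = f := by
  rw [holGerm, dif_pos hf]

theorem formGerm_coe {θ : V → V →L[ℂ] ℂ} (hθ : AnalyticAt ℂ θ a) :
    (formGerm a θ : Germ (𝓝 a) (V →L[ℂ] ℂ)) = θ := by
  rw [formGerm, dif_pos hθ]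

theorem exists_holGerm (φ : HolGerm a) : ∃ f : V → ℂ, AnalyticAt ℂ f a ∧ holGerm a f = φ := by
  obtain ⟨_, f, hf, rfl⟩ := φ
  exact ⟨f, hf, Subtype.ext (holGerm_coe hf)⟩

theorem exists_formGerm (φ : FormGerm a) :
    ∃ θ : V → V →L[ℂ] ℂ, AnalyticAt ℂ θ a ∧ formGerm a θ = φ := by
  obtain ⟨_, θ, hθ, rfl⟩ := φ
  exact ⟨θ, hθ, Subtype.ext (formGerm_coe hθ)⟩

theorem holGerm_congr {f g : V → ℂ} (h : f =ᶠ[𝓝 a] g) : holGerm a f = holGerm a g := by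
  by_cases hf : AnalyticAt ℂ f a
  · refine Subtype.ext ?_
    rw [holGerm_coe hf, holGerm_coe (hf.congr h)]
    exact Germ.coe_eq.2 h
  · rw [holGerm, holGerm, dif_neg hf, dif_neg fun hg => hf (hg.congr h.symm)]

theorem formGerm_congr {θ η : V → V →L[ℂ] ℂ} (h : θ =ᶠ[𝓝 a] η) : formGerm a θ = formGerm a η := by
  by_cases hf : AnalyticAt ℂ θ a
  · refine Subtype.ext ?_
    rw [formGerm_coe hf, formGerm_coe (hf.congr h)]
    exact Germ.coe_eq.2 h
  · rw [formGerm, formGerm, dif_neg hf, dif_neg fun hg => hf (hg.congr h.symm)]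

theorem holGerm_add {f g : V → ℂ} (hf : AnalyticAt ℂ f a) (hg : AnalyticAt ℂ g a) :
    holGerm a (fun e => f e + g e) = holGerm a f + holGerm a g := by
  refine Subtype.ext ?_
  rw [holGerm_coe (hf.fun_add hg), Subring.coe_add, holGerm_coe hf, holGerm_coe hg]
  rfl

theorem holGerm_mul {f g : V → ℂ} (hf : AnalyticAt ℂ f a) (hg : AnalyticAt ℂ g a) :
    holGerm a (fun e => f e * g e) = holGerm a f * holGerm a g := by
  refine Subtype.ext ?_
  rw [holGerm_coe (hf.fun_mul hg), Subring.coe_mul, holGerm_coe hf, holGerm_coe hg]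
  rfl

theorem holGerm_const (z : ℂ) : holGerm a (fun _ => z) = algebraMap ℂ (HolGerm a) z :=
  Subtype.ext (holGerm_coe analyticAt_const)

theorem holGerm_one : holGerm a (fun _ => 1) = 1 := by
  rw [holGerm_const, map_one]

theorem holGerm_sum {ι : Type*} (s : Finset ι) {f : ι → V → ℂ} (hf : ∀ i, AnalyticAt ℂ (f i) a) :
    holGerm a (fun e => ∑ i ∈ s, f i e) = ∑ i ∈ s, holGerm a (f i) := by
  classical
  induction s using Finset.induction_on with
  | empty => simp [holGerm_const]
  | insert i s hi ih =>
    simp only [Finset.sum_insert hi]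
    rw [holGerm_add (hf i) (by fun_prop), ih]

theorem formGerm_add {f g : V → V →L[ℂ] ℂ} (hf : AnalyticAt ℂ f a) (hg : AnalyticAt ℂ g a) :
    formGerm a (fun e => f e + g e) = formGerm a f + formGerm a g := by
  refine Subtype.ext ?_
  rw [formGerm_coe (hf.fun_add hg), Submodule.coe_add, formGerm_coe hf, formGerm_coe hg]
  rfl

theorem formGerm_smul {f : V → ℂ} {θ : V → V →L[ℂ] ℂ} (hf : AnalyticAt ℂ f a)
    (hθ : AnalyticAt ℂ θ a) : formGerm a (fun e => f e • θ e) = holGerm a f • formGerm a θ := by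
  refine Subtype.ext ?_
  have h : ((holGerm a f • formGerm a θ : FormGerm a) : Germ (𝓝 a) (V →L[ℂ] ℂ)) =
      (holGerm a f : Germ (𝓝 a) ℂ) • (formGerm a θ : Germ (𝓝 a) (V →L[ℂ] ℂ)) := rfl
  rw [formGerm_coe (hf.fun_smul hθ), h, formGerm_coe hθ, holGerm_coe hf]
  rfl

theorem formGerm_zero : formGerm a (fun _ => 0) = 0 := by
  have := formGerm_add (a := a) (f := fun _ => 0) (g := fun _ => 0) analyticAt_const analyticAt_const
  simpa using this

theorem formGerm_sum {ι : Type*} (s : Finset ι) {f : ι → V → V →L[ℂ] ℂ}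
    (hf : ∀ i, AnalyticAt ℂ (f i) a) :
    formGerm a (fun e => ∑ i ∈ s, f i e) = ∑ i ∈ s, formGerm a (f i) := by
  classical
  induction s using Finset.induction_on with
  | empty => simpa using formGerm_zero
  | insert i s hi ih =>
    simp only [Finset.sum_insert hi]
    rw [formGerm_add (hf i) (by fun_prop), ih]

theorem pairing_formGerm {X : V → V} (hX : AnalyticAt ℂ X a) {θ : V → V →L[ℂ] ℂ}
    (hθ : AnalyticAt ℂ θ a) : pairing a X hX (formGerm a θ) = holGerm a fun e => θ e (X e) := by
  have h : AnalyticAt ℂ (fun e => θ e (X e)) a :=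
    ((ContinuousLinearMap.id ℂ (V →L[ℂ] ℂ)).analyticAt_bilinear _).comp₂ hθ hX
  refine Subtype.ext ?_
  rw [holGerm_coe h]
  change Germ.map₂ _ (formGerm a θ).1 _ = _
  rw [formGerm_coe hθ]
  rfl

/-- The differential of a germ of a function. -/
def dFun (φ : HolGerm a) : FormGerm a := formGerm a (fderiv ℂ (Classical.choose (exists_holGerm φ)))

/-- The germ of a function determines the germ of its derivative, so the chosen representative does
not matter. -/
theorem dFun_holGerm {f : V → ℂ} (hf : AnalyticAt ℂ f a) :
    dFun (holGerm a f) = formGerm a (fderiv ℂ f) := by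
  obtain ⟨h1, h2⟩ := Classical.choose_spec (exists_holGerm (holGerm a f))
  refine formGerm_congr (EventuallyEq.fderiv ?_)
  have := congrArg Subtype.val h2
  rw [holGerm_coe h1, holGerm_coe hf] at this
  exact Germ.coe_eq.1 this

theorem dFun_add (φ ψ : HolGerm a) : dFun (φ + ψ) = dFun φ + dFun ψ := by
  obtain ⟨f, hf, rfl⟩ := exists_holGerm φ
  obtain ⟨g, hg, rfl⟩ := exists_holGerm ψ
  rw [← holGerm_add hf hg, dFun_holGerm hf, dFun_holGerm hg, dFun_holGerm (hf.fun_add hg),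
    ← formGerm_add hf.fderiv hg.fderiv]
  refine formGerm_congr ?_
  filter_upwards [hf.eventually_analyticAt, hg.eventually_analyticAt] with e h1 h2
  exact fderiv_fun_add h1.differentiableAt h2.differentiableAt

theorem dFun_mul (φ ψ : HolGerm a) : dFun (φ * ψ) = φ • dFun ψ + ψ • dFun φ := by
  obtain ⟨f, hf, rfl⟩ := exists_holGerm φ
  obtain ⟨g, hg, rfl⟩ := exists_holGerm ψ
  rw [← holGerm_mul hf hg, dFun_holGerm hf, dFun_holGerm hg, dFun_holGerm (hf.fun_mul hg),
    ← formGerm_smul hf hg.fderiv, ← formGerm_smul hg hf.fderiv,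
    ← formGerm_add (hf.fun_smul hg.fderiv) (hg.fun_smul hf.fderiv)]
  refine formGerm_congr ?_
  filter_upwards [hf.eventually_analyticAt, hg.eventually_analyticAt] with e h1 h2
  exact fderiv_fun_mul h1.differentiableAt h2.differentiableAt

theorem dFun_algebraMap (z : ℂ) : dFun (algebraMap ℂ (HolGerm a) z) = 0 := by
  rw [← holGerm_const, dFun_holGerm analyticAt_const, ← formGerm_zero]
  congr 1
  funext e
  exact fderiv_const_apply z

end Germs

/-! ### The exterior derivative of germs of forms -/

section ExteriorDerivative

variable {V : Type} [NormedAddCommGroup V] [NormedSpace ℂ V] {a : V}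

local notation "𝐢" => ExteriorAlgebra.ι (HolGerm a)
local notation "𝐜" => algebraMap (HolGerm a) (DR a)

variable [FiniteDimensional ℂ V]

variable (V) in
/-- A basis of `V`. -/
abbrev bas : Module.Basis (Fin (Module.finrank ℂ V)) ℂ V := Module.finBasis ℂ V

variable (V) in
/-- The coordinate functions of `V`. -/
def coo (i : Fin (Module.finrank ℂ V)) : V →L[ℂ] ℂ :=
  LinearMap.toContinuousLinearMap ((bas V).coord i)

theorem sum_coo_smul (v : V) : ∑ i, coo V i v • bas V i = v := (bas V).sum_repr v

theorem sum_smul_coo (l : V →L[ℂ] ℂ) : ∑ i, l (bas V i) • coo V i = l := by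
  ext v
  conv_rhs => rw [← sum_coo_smul v]
  simp [mul_comm]

/-- The coefficients of a germ of a 1-form. -/
def coef (i : Fin (Module.finrank ℂ V)) : FormGerm a →ₗ[HolGerm a] HolGerm a :=
  pairing a (fun _ => bas V i) analyticAt_const

variable (a) in
/-- The germ of `dxᵢ`. -/
def dCoo (i : Fin (Module.finrank ℂ V)) : FormGerm a := formGerm a fun _ => coo V i

theorem coef_formGerm (i : Fin (Module.finrank ℂ V)) {θ : V → V →L[ℂ] ℂ} (hθ : AnalyticAt ℂ θ a) :
    coef i (formGerm a θ) = holGerm a fun e => θ e (bas V i) :=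
  pairing_formGerm _ hθ

omit [FiniteDimensional ℂ V] in
theorem analyticAt_coef {θ : V → V →L[ℂ] ℂ} (hθ : AnalyticAt ℂ θ a) (v : V) :
    AnalyticAt ℂ (fun e => θ e v) a :=
  ((ContinuousLinearMap.apply ℂ ℂ v).analyticAt _).comp hθ

theorem sum_coef_smul (φ : FormGerm a) : ∑ i, coef i φ • dCoo a i = φ := by
  obtain ⟨θ, hθ, rfl⟩ := exists_formGerm φ
  have : ∀ i, AnalyticAt ℂ (fun e => θ e (bas V i) • coo V i) a :=
    fun i => (analyticAt_coef hθ _).smul analyticAt_const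
  calc _ = ∑ i, formGerm a (fun e => θ e (bas V i) • coo V i) := by
        refine Finset.sum_congr rfl fun i _ => ?_
        rw [formGerm_smul (analyticAt_coef hθ _) analyticAt_const, coef_formGerm i hθ]
        rfl
    _ = _ := by
        rw [← formGerm_sum _ this]
        simp only [sum_smul_coo]

theorem coef_dFun_coef {f : V → ℂ} (hf : AnalyticAt ℂ f a) (i j : Fin (Module.finrank ℂ V)) :
    coef j (dFun (coef i (dFun (holGerm a f)))) =
      holGerm a fun e => fderiv ℂ (fderiv ℂ f) e (bas V j) (bas V i) := by
  rw [dFun_holGerm hf, coef_formGerm _ hf.fderiv, dFun_holGerm (analyticAt_coef hf.fderiv _),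
    coef_formGerm _ (analyticAt_coef hf.fderiv _).fderiv]
  refine holGerm_congr ?_
  filter_upwards [hf.eventually_analyticAt] with e he
  have := (ContinuousLinearMap.apply ℂ ℂ (bas V i)).hasFDerivAt.comp e
    he.fderiv.differentiableAt.hasFDerivAt
  change fderiv ℂ ((ContinuousLinearMap.apply ℂ ℂ (bas V i)) ∘ fderiv ℂ f) e _ = _
  rw [this.fderiv]
  rfl

variable (a) in
/-- The differential of germs of functions. -/
def formSystem : FormSystem (HolGerm a) (FormGerm a) (Fin (Module.finrank ℂ V)) where
  d := dFun
  d_add := dFun_add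
  d_mul := dFun_mul
  d_const := dFun_algebraMap
  coef := coef
  base := dCoo a
  sum_coef := sum_coef_smul
  symm f i j := by
    obtain ⟨f, hf, rfl⟩ := exists_holGerm f
    rw [coef_dFun_coef hf, coef_dFun_coef hf]
    refine holGerm_congr ?_
    filter_upwards [hf.eventually_analyticAt] with e he
    have h2 : ContDiffAt ℂ 2 f e := he.contDiffAt
    exact h2.isSymmSndFDerivAt (by simp) _ _

variable (a) in
/-- The exterior derivative of germs of forms. -/
abbrev dr : DR a →ₗ[ℂ] DR a := (formSystem a).dr

theorem dr_list_prod (l : List (HolGerm a)) : dr a (l.map fun f => 𝐢 (dFun f)).prod = 0 := by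
  induction l with
  | nil =>
    have h := (formSystem a).dr_c 1
    rw [map_one] at h
    rw [List.map_nil, List.prod_nil, h]
    have : dFun (1 : HolGerm a) = 0 := by
      rw [← map_one (algebraMap ℂ (HolGerm a)), dFun_algebraMap]
    exact (congrArg _ this).trans (map_zero _)
  | cons f l ih =>
    rw [List.map_cons, List.prod_cons, (formSystem a).dr_mul, ih, mul_zero, zero_add]
    have := (formSystem a).dr_ι_d f
    rw [show (formSystem a).dr (𝐢 (dFun f)) = 0 from this, zero_mul]

omit [FiniteDimensional ℂ V] in
theorem monomial_eq {n : ℕ} (f : V → ℂ) {g : Fin n → V → ℂ} (hg : ∀ k, AnalyticAt ℂ (g k) a) :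
    monomial a f g = 𝐜 (holGerm a f) *
      ((List.ofFn fun k => holGerm a (g k)).map fun f => 𝐢 (dFun f)).prod := by
  rw [monomial, List.map_ofFn]
  simp only [Function.comp_def, dFun_holGerm (hg _)]

theorem dr_monomial {n : ℕ} {f : V → ℂ} (hf : AnalyticAt ℂ f a) {g : Fin n → V → ℂ}
    (hg : ∀ k, AnalyticAt ℂ (g k) a) : dr a (monomial a f g) =
      monomial a (fun _ => 1) (Fin.cons f g : Fin (n + 1) → V → ℂ) := by
  have hfg : ∀ k, AnalyticAt ℂ ((Fin.cons f g : Fin (n + 1) → V → ℂ) k) a :=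
    fun k => Fin.cases hf hg k
  rw [monomial_eq f hg, monomial_eq _ hfg, (formSystem a).dr_mul, dr_list_prod, mul_zero, zero_add,
    (formSystem a).dr_c, holGerm_one, map_one, one_mul, List.ofFn_succ, List.map_cons,
    List.prod_cons]
  rfl

omit [FiniteDimensional ℂ V] in
theorem monomial_mul {n m : ℕ} {f f' : V → ℂ} (hf : AnalyticAt ℂ f a) (hf' : AnalyticAt ℂ f' a)
    (g : Fin n → V → ℂ) (g' : Fin m → V → ℂ) : monomial a f g * monomial a f' g' =
      monomial a (fun e => f e * f' e) (Fin.append g g') := by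
  have h : (fun k => ExteriorAlgebra.ι (HolGerm a) (formGerm a (fderiv ℂ (Fin.append g g' k)))) =
      Fin.append (fun k => 𝐢 (formGerm a (fderiv ℂ (g k))))
        (fun k => 𝐢 (formGerm a (fderiv ℂ (g' k)))) := by
    funext k
    refine Fin.addCases (fun i => ?_) (fun i => ?_) k <;> simp
  rw [monomial, monomial, monomial, h, List.ofFn_fin_append, List.prod_append, holGerm_mul hf hf',
    map_mul, mul_assoc, mul_assoc]
  congr 1
  rw [Algebra.left_comm]

/-- The germs of forms are sums of germs `f dg₁ ∧ ⋯ ∧ dgₙ`. -/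
theorem mem_span_monomial (x : DR a) : x ∈ Submodule.span ℂ {y : DR a | ∃ (n : ℕ) (f : V → ℂ)
    (g : Fin n → V → ℂ), AnalyticAt ℂ f a ∧ (∀ k, AnalyticAt ℂ (g k) a) ∧ y = monomial a f g} := by
  induction x using exterior_induction with
  | hc f =>
    obtain ⟨f, hf, rfl⟩ := exists_holGerm f
    refine Submodule.subset_span ⟨0, f, Fin.elim0, hf, fun k => k.elim0, ?_⟩
    simp [monomial]
  | hi φ =>
    rw [(formSystem a).ι_eq φ]
    refine Submodule.sum_mem _ fun i _ => ?_
    obtain ⟨f, hf, hf'⟩ := exists_holGerm ((formSystem a).coef i φ)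
    refine Submodule.subset_span ⟨1, f, fun _ => coo V i, hf, fun _ => (coo V i).analyticAt a, ?_⟩
    rw [monomial, hf']
    simp only [List.ofFn_succ, List.ofFn_zero, List.prod_cons, List.prod_nil, mul_one]
    congr 3
    change formGerm a _ = _
    congr 1
    funext e
    exact (coo V i).fderiv.symm
  | hmul x y hx hy =>
    have := Submodule.mul_mem_mul hx hy
    rw [Submodule.span_mul_span] at this
    refine Submodule.span_mono ?_ this
    rintro _ ⟨_, ⟨n, f, g, hf, hg, rfl⟩, _, ⟨m, f', g', hf', hg', rfl⟩, rfl⟩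
    refine ⟨n + m, fun e => f e * f' e, Fin.append g g', hf.fun_mul hf', fun k => ?_,
      monomial_mul hf hf' g g'⟩
    refine Fin.addCases (fun i => ?_) (fun i => ?_) k
    · simpa using hg i
    · simpa using hg' i
  | hadd x y hx hy => exact Submodule.add_mem _ hx hy

/-- The relation used to define basic forms is the graph of an operator: `d` has the prescribed
values on monomials, and monomials span. -/
theorem mem_dGraph_iff (q : DR a × DR a) : q ∈ dGraph a ↔ q.2 = dr a q.1 := by
  constructor
  · intro h
    induction h using Submodule.span_induction with
    | mem q hq =>
      obtain ⟨n, f, g, hf, hg, rfl⟩ := hq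
      exact (dr_monomial hf hg).symm
    | zero => simp
    | add q r _ _ hq hr => rw [Prod.snd_add, Prod.fst_add, map_add, hq, hr]
    | smul z q _ hq => rw [Prod.smul_snd, Prod.smul_fst, map_smul, hq]
  · intro h
    have key : ∀ x : DR a, (x, dr a x) ∈ dGraph a := by
      intro x
      have hx := mem_span_monomial x
      induction hx using Submodule.span_induction with
      | mem x hx =>
        obtain ⟨n, f, g, hf, hg, rfl⟩ := hx
        exact Submodule.subset_span ⟨n, f, g, hf, hg, by rw [dr_monomial hf hg]⟩
      | zero =>
        rw [map_zero]
        exact Submodule.zero_mem _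
      | add x y _ _ hx hy =>
        rw [map_add]
        exact Submodule.add_mem _ hx hy
      | smul z x _ hx =>
        rw [map_smul]
        exact Submodule.smul_mem _ z hx
    have := key q.1
    rwa [← h] at this

end ExteriorDerivative

/-! ### Lie derivatives of germs of 1-forms -/

section Lie

variable {V : Type} [NormedAddCommGroup V] [NormedSpace ℂ V] {a : V}

theorem contract_eq {X : V → V} (hX : AnalyticAt ℂ X a) :
    contract a X = FormSystem.con (pairing a X hX) := by
  rw [contract, dif_pos hX]

variable [FiniteDimensional ℂ V]

/-- The Lie derivative of a 1-form along a vector field, in coordinates. -/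
def lieForm (X : V → V) (θ : V → V →L[ℂ] ℂ) (e : V) : V →L[ℂ] ℂ :=
  fderiv ℂ θ e (X e) + (θ e).comp (fderiv ℂ X e)

/-- The Lie derivative is a derivation, acts on functions as `X` does, and takes the closed form
`base i` to the differential of its contraction. -/
theorem FormSystem.lie_ι {O M I : Type} [CommRing O] [Algebra ℂ O] [AddCommGroup M] [Module O M]
    [Module ℂ M] [IsScalarTower ℂ O M] [Fintype I] (S : FormSystem O M I)
    (hS : ∀ i, S.dForm (S.base i) = 0) (X : M →ₗ[O] O) (φ : M) :
    S.lie X (ExteriorAlgebra.ι O φ) = ExteriorAlgebra.ι O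
      (∑ i, (X (S.d (S.coef i φ)) • S.base i + S.coef i φ • S.d (X (S.base i)))) := by
  have h0 : ∀ x : I → ExteriorAlgebra O M, S.lie X (∑ i, x i) = ∑ i, S.lie X (x i) := fun x => by
    simp only [lie, map_sum, Finset.sum_add_distrib]
  have h1 : ∀ f, S.lie X (algebraMap O _ f) = algebraMap O _ (X (S.d f)) := fun f => by
    rw [lie, S.dr_c, con_c, map_zero, add_zero, con_ι]
  have h2 : ∀ i, S.lie X (ExteriorAlgebra.ι O (S.base i)) =
      ExteriorAlgebra.ι O (S.d (X (S.base i))) := fun i => by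
    rw [lie, S.dr_ι, hS, map_zero, zero_add, con_ι, S.dr_c]
  rw [S.ι_eq φ, h0, map_sum]
  refine Finset.sum_congr rfl fun i _ => ?_
  rw [S.lie_mul, h1, h2, map_add, map_smul, map_smul, Algebra.smul_def, Algebra.smul_def]

theorem lie_ι {X : V → V} (hX : AnalyticAt ℂ X a) {θ : V → V →L[ℂ] ℂ} (hθ : AnalyticAt ℂ θ a) :
    (formSystem a).lie (pairing a X hX) (ExteriorAlgebra.ι (HolGerm a) (formGerm a θ)) =
      ExteriorAlgebra.ι (HolGerm a) (formGerm a (lieForm X θ)) := by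
  have hb : ∀ i, (formSystem a).base i = dFun (holGerm a (coo V i)) := fun i => by
    rw [dFun_holGerm ((coo V i).analyticAt a)]
    change formGerm a _ = _
    congr 1
    funext e
    exact (coo V i).fderiv.symm
  have hS : ∀ i, (formSystem a).dForm ((formSystem a).base i) = 0 := fun i => by
    rw [hb]
    exact (formSystem a).dForm_d _
  rw [(formSystem a).lie_ι hS]
  congr 1
  have hc : ∀ i, AnalyticAt ℂ (fun e => θ e (bas V i)) a := fun i => analyticAt_coef hθ _
  have hX' : ∀ i, AnalyticAt ℂ (fun e => coo V i (X e)) a := fun i =>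
    ((coo V i).analyticAt _).comp hX
  have hp : AnalyticAt ℂ (fun e => fderiv ℂ θ e (X e)) a :=
    ((ContinuousLinearMap.id ℂ (V →L[ℂ] (V →L[ℂ] ℂ))).analyticAt_bilinear _).comp₂ hθ.fderiv hX
  have hp' : ∀ i, AnalyticAt ℂ (fun e => fderiv ℂ θ e (X e) (bas V i)) a := fun i =>
    analyticAt_coef hp _
  -- The two terms of index `i` are the components of `Dθ(X)` and of `θ ∘ DX`, which make up
  -- `lieForm`.
  have key : ∀ i, pairing a X hX ((formSystem a).d ((formSystem a).coef i (formGerm a θ))) •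
        (formSystem a).base i + (formSystem a).coef i (formGerm a θ) •
        (formSystem a).d (pairing a X hX ((formSystem a).base i)) =
      formGerm a (fun e => (fderiv ℂ θ e (X e) (bas V i)) • coo V i +
        θ e (bas V i) • (coo V i).comp (fderiv ℂ X e)) := fun i => by
    have e1 : pairing a X hX ((formSystem a).d ((formSystem a).coef i (formGerm a θ))) =
        holGerm a fun e => fderiv ℂ θ e (X e) (bas V i) := by
      change pairing a X hX (dFun (coef i (formGerm a θ))) = _
      rw [coef_formGerm i hθ, dFun_holGerm (hc i), pairing_formGerm hX (hc i).fderiv]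
      refine holGerm_congr ?_
      filter_upwards [hθ.eventually_analyticAt] with e he
      have := (ContinuousLinearMap.apply ℂ ℂ (bas V i)).hasFDerivAt.comp e
        he.differentiableAt.hasFDerivAt
      change fderiv ℂ ((ContinuousLinearMap.apply ℂ ℂ (bas V i)) ∘ θ) e _ = _
      rw [this.fderiv]
      rfl
    have e2 : (formSystem a).d (pairing a X hX ((formSystem a).base i)) =
        formGerm a fun e => (coo V i).comp (fderiv ℂ X e) := by
      change dFun (pairing a X hX (formGerm a fun _ => coo V i)) = _
      rw [pairing_formGerm hX analyticAt_const, dFun_holGerm (hX' i)]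
      refine formGerm_congr ?_
      filter_upwards [hX.eventually_analyticAt] with e he
      exact ((coo V i).hasFDerivAt.comp e he.differentiableAt.hasFDerivAt).fderiv
    have hcX : AnalyticAt ℂ (fun e => (coo V i).comp (fderiv ℂ X e)) a :=
      ((ContinuousLinearMap.compL ℂ V V ℂ (coo V i)).analyticAt _).comp hX.fderiv
    rw [e1, e2]
    change _ • formGerm a _ + coef i (formGerm a θ) • _ = _
    rw [coef_formGerm i hθ, ← formGerm_smul (hp' i) analyticAt_const, ← formGerm_smul (hc i) hcX,
      ← formGerm_add ((hp' i).fun_smul analyticAt_const) ((hc i).fun_smul hcX)]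
  simp only [key]
  rw [← formGerm_sum]
  · congr 1
    funext e
    rw [Finset.sum_add_distrib, sum_smul_coo, lieForm]
    congr 1
    conv_rhs => rw [← sum_smul_coo (θ e)]
    rw [ContinuousLinearMap.finsetSum_comp]
    rfl
  · intro i
    have hcX : AnalyticAt ℂ (fun e => (coo V i).comp (fderiv ℂ X e)) a :=
      ((ContinuousLinearMap.compL ℂ V V ℂ (coo V i)).analyticAt _).comp hX.fderiv
    exact ((hp' i).fun_smul analyticAt_const).fun_add ((hc i).fun_smul hcX)

end Lie

/-! ### Pullback of germs of forms -/

section Pullback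

variable {V V' : Type} [NormedAddCommGroup V] [NormedSpace ℂ V] [NormedAddCommGroup V']
  [NormedSpace ℂ V'] [CompleteSpace V'] {a : V} {a' : V'} {T : V → V'}

/-- The pullback of germs of functions. -/
def pullFun (hT : AnalyticAt ℂ T a) (ha : T a = a') : HolGerm a' →+* HolGerm a where
  toFun φ := ⟨φ.1.compTendsto T (ha ▸ hT.continuousAt.tendsto), by
    obtain ⟨_, f, hf, rfl⟩ := φ
    subst ha
    exact ⟨f ∘ T, hf.comp hT, rfl⟩⟩
  map_one' := rfl
  map_zero' := rfl
  map_add' := by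
    rintro ⟨_, f, hf, rfl⟩ ⟨_, g, hg, rfl⟩
    rfl
  map_mul' := by
    rintro ⟨_, f, hf, rfl⟩ ⟨_, g, hg, rfl⟩
    rfl

omit [CompleteSpace V'] in
theorem pullFun_holGerm (hT : AnalyticAt ℂ T a) (ha : T a = a') {f : V' → ℂ}
    (hf : AnalyticAt ℂ f a') : pullFun hT ha (holGerm a' f) = holGerm a fun e => f (T e) := by
  refine Subtype.ext ?_
  have h : AnalyticAt ℂ (fun e => f (T e)) a := by
    subst ha
    exact hf.comp hT
  rw [holGerm_coe h]
  change Germ.compTendsto (holGerm a' f).1 T (ha ▸ hT.continuousAt.tendsto) = _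
  rw [holGerm_coe hf]
  rfl

/-- The pullback of germs of 1-forms. -/
def pullOne (hT : AnalyticAt ℂ T a) (ha : T a = a') : FormGerm a' →ₛₗ[pullFun hT ha] FormGerm a where
  toFun φ := ⟨Germ.map₂ (fun (l : V' →L[ℂ] ℂ) (D : V →L[ℂ] V') => l.comp D)
    (φ.1.compTendsto T (ha ▸ hT.continuousAt.tendsto)) (fderiv ℂ T : Germ (𝓝 a) (V →L[ℂ] V')), by
    obtain ⟨_, θ, hθ, rfl⟩ := φ
    subst ha
    exact ⟨fun e => (θ (T e)).comp (fderiv ℂ T e),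
      ((ContinuousLinearMap.compL ℂ V V' ℂ).analyticAt_bilinear _).comp₂ (hθ.comp hT) hT.fderiv, rfl⟩⟩
  map_add' := by
    rintro ⟨_, f, hf, rfl⟩ ⟨_, g, hg, rfl⟩
    exact Subtype.ext (congrArg (fun h : V → V →L[ℂ] ℂ => (h : Germ (𝓝 a) (V →L[ℂ] ℂ)))
      (funext fun e => ContinuousLinearMap.add_comp (f (T e)) (g (T e)) (fderiv ℂ T e)))
  map_smul' := by
    rintro ⟨_, f, hf, rfl⟩ ⟨_, g, hg, rfl⟩
    exact Subtype.ext (congrArg (fun h : V → V →L[ℂ] ℂ => (h : Germ (𝓝 a) (V →L[ℂ] ℂ)))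
      (funext fun e => ContinuousLinearMap.smul_comp (f (T e)) (g (T e)) (fderiv ℂ T e)))

theorem pullOne_formGerm (hT : AnalyticAt ℂ T a) (ha : T a = a') {θ : V' → V' →L[ℂ] ℂ}
    (hθ : AnalyticAt ℂ θ a') :
    pullOne hT ha (formGerm a' θ) = formGerm a fun e => (θ (T e)).comp (fderiv ℂ T e) := by
  refine Subtype.ext ?_
  have h : AnalyticAt ℂ (fun e => (θ (T e)).comp (fderiv ℂ T e)) a := by
    subst ha
    exact ((ContinuousLinearMap.compL ℂ V V' ℂ).analyticAt_bilinear _).comp₂ (hθ.comp hT) hT.fderiv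
  rw [formGerm_coe h]
  change Germ.map₂ (fun (l : V' →L[ℂ] ℂ) (D : V →L[ℂ] V') => l.comp D)
    (Germ.compTendsto (formGerm a' θ).1 T (ha ▸ hT.continuousAt.tendsto)) _ = _
  rw [formGerm_coe hθ]
  rfl

/-- The pullback of germs of forms. -/
def pullDR (hT : AnalyticAt ℂ T a) (ha : T a = a') : DR a' →+* DR a :=
  pull (pullFun hT ha) (pullOne hT ha)

theorem pullDR_monomial (hT : AnalyticAt ℂ T a) (ha : T a = a') {n : ℕ} {f : V' → ℂ}
    (hf : AnalyticAt ℂ f a') {g : Fin n → V' → ℂ} (hg : ∀ k, AnalyticAt ℂ (g k) a') :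
    pullDR hT ha (monomial a' f g) = monomial a (fun e => f (T e)) fun k e => g k (T e) := by
  rw [monomial, monomial, pullDR, map_mul, pull_c, pullFun_holGerm hT ha hf, map_list_prod,
    List.map_ofFn]
  congr 3
  funext k
  rw [Function.comp_apply, pull_ι, pullOne_formGerm hT ha (hg k).fderiv]
  congr 1
  refine formGerm_congr ?_
  have h1 := (ha ▸ hT.continuousAt.tendsto : Tendsto T (𝓝 a) (𝓝 a')).eventually
    (hg k).eventually_analyticAt
  filter_upwards [h1, hT.eventually_analyticAt] with e h1 h2
  exact (fderiv_comp e h1.differentiableAt h2.differentiableAt).symm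

theorem pullDR_algebraMap (hT : AnalyticAt ℂ T a) (ha : T a = a') (z : ℂ) :
    pullDR hT ha (algebraMap ℂ (DR a') z) = algebraMap ℂ (DR a) z := by
  rw [IsScalarTower.algebraMap_apply ℂ (HolGerm a') (DR a'), pullDR, pull_c, ← holGerm_const,
    pullFun_holGerm hT ha analyticAt_const, holGerm_const, ← IsScalarTower.algebraMap_apply]

/-- Near `a` the map `T` relates `X` to `X'`, so the pairings with 1-forms correspond and `pull_con`
applies. -/
theorem pullDR_contract [FiniteDimensional ℂ V] [FiniteDimensional ℂ V']
    (hT : AnalyticAt ℂ T a) (ha : T a = a') {X : V → V} (hX : AnalyticAt ℂ X a)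
    {X' : V' → V'} (hX' : AnalyticAt ℂ X' a') (h : ∀ᶠ e in 𝓝 a, fderiv ℂ T e (X e) = X' (T e))
    (x : DR a') : pullDR hT ha (contract a' X' x) = contract a X (pullDR hT ha x) := by
  rw [contract_eq hX, contract_eq hX']
  refine pull_con (formSystem a) (formSystem a') _ _ (fun φ => ?_) x
  obtain ⟨θ, hθ, rfl⟩ := exists_formGerm φ
  have h1 : AnalyticAt ℂ (fun e => (θ (T e)).comp (fderiv ℂ T e)) a := by
    subst ha
    exact ((ContinuousLinearMap.compL ℂ V V' ℂ).analyticAt_bilinear _).comp₂ (hθ.comp hT) hT.fderiv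
  have h2 : AnalyticAt ℂ (fun e => θ e (X' e)) a' :=
    ((ContinuousLinearMap.id ℂ (V' →L[ℂ] ℂ)).analyticAt_bilinear _).comp₂ hθ hX'
  rw [pullOne_formGerm hT ha hθ, pairing_formGerm hX h1, pairing_formGerm hX' hθ,
    pullFun_holGerm hT ha h2]
  refine holGerm_congr ?_
  filter_upwards [h] with e he
  rw [ContinuousLinearMap.comp_apply, he]

end Pullback

/-! ### Hadamard's lemma -/

section Hadamard

variable {V : Type} [NormedAddCommGroup V] [NormedSpace ℂ V]

open scoped NNReal ENNReal

/-- The map `P (x, …, x, ·, y, …, y)` with free `i`-th argument. -/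
def diffTerm {n : ℕ} (P : V [×(n + 1)]→L[ℂ] ℂ) (i : Fin (n + 1)) : (V × V) [×n]→L[ℂ] (V →L[ℂ] ℂ) :=
  (P.curryMid i).flipMultilinear.compContinuousLinearMap fun j =>
    if i.succAbove j < i then ContinuousLinearMap.fst ℂ V V else ContinuousLinearMap.snd ℂ V V

/-- The coefficients of the difference quotient of a power series. -/
def diffSeries (P : FormalMultilinearSeries ℂ V ℂ) :
    FormalMultilinearSeries ℂ (V × V) (V →L[ℂ] ℂ) := fun n => ∑ i, diffTerm (P (n + 1)) i

/-- The arguments `x` are replaced by `y` one at a time, and the differences telescope. -/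
theorem diffSeries_apply (P : FormalMultilinearSeries ℂ V ℂ) (n : ℕ) (x y : V) :
    diffSeries P n (fun _ => (x, y)) (x - y) =
      P (n + 1) (fun _ => x) - P (n + 1) (fun _ => y) := by
  have h := (P (n + 1)).toMultilinearMap.map_sub_map_piecewise (fun _ => x) (fun _ => y) Finset.univ
  rw [Finset.piecewise_univ] at h
  refine Eq.trans ?_ h.symm
  rw [diffSeries, sum_apply, sum_apply]
  refine Finset.sum_congr rfl fun i _ => ?_
  change P (n + 1) _ = P (n + 1) _
  congr 1
  refine (Fin.insertNth_eq_iff).2 ⟨by simp, ?_⟩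
  funext j
  simp only [Fin.removeNth, Finset.mem_univ, forall_const, (Fin.succAbove_ne i j).symm, if_false]
  split_ifs <;> rfl

theorem norm_diffTerm_le {n : ℕ} (P : V [×(n + 1)]→L[ℂ] ℂ) (i : Fin (n + 1)) :
    ‖diffTerm P i‖ ≤ ‖P‖ := by
  refine (ContinuousMultilinearMap.norm_compContinuousLinearMap_le _ _).trans ?_
  have h1 : ‖(P.curryMid i).flipMultilinear‖ ≤ ‖P‖ := by
    rw [← ContinuousMultilinearMap.norm_curryMid i P]
    exact MultilinearMap.mkContinuous_norm_le _ (norm_nonneg _) _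
  have h2 : ∏ j : Fin n, ‖if i.succAbove j < i then ContinuousLinearMap.fst ℂ V V
      else ContinuousLinearMap.snd ℂ V V‖ ≤ 1 := by
    refine Finset.prod_le_one (fun _ _ => norm_nonneg _) fun j _ => ?_
    split_ifs
    · exact ContinuousLinearMap.norm_fst_le _ _ _
    · exact ContinuousLinearMap.norm_snd_le _ _ _
  calc _ ≤ ‖P‖ * 1 := mul_le_mul h1 h2 (Finset.prod_nonneg fun _ _ => norm_nonneg _) (norm_nonneg _)
    _ = _ := mul_one _

theorem norm_diffSeries_le (P : FormalMultilinearSeries ℂ V ℂ) (n : ℕ) :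
    ‖diffSeries P n‖ ≤ (n + 1) * ‖P (n + 1)‖ := by
  refine ContinuousMultilinearMap.opNorm_le_bound (by positivity) fun m => ?_
  rw [diffSeries, sum_apply]
  refine (norm_sum_le _ _).trans ?_
  calc _ ≤ ∑ _ : Fin (n + 1), ‖P (n + 1)‖ * ∏ j, ‖m j‖ := Finset.sum_le_sum fun i _ =>
        (diffTerm (P (n + 1)) i).le_of_opNorm_le (norm_diffTerm_le (P (n + 1)) i) m
    _ = _ := by simp [mul_assoc]

/-- The coefficients grow by a factor of at most `n + 1 ≤ 2^n`, so half of an admissible radius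
still works. -/
theorem radius_diffSeries_pos {P : FormalMultilinearSeries ℂ V ℂ} (hP : 0 < P.radius) :
    0 < (diffSeries P).radius := by
  obtain ⟨r, hr, hrP⟩ := ENNReal.lt_iff_exists_nnreal_btwn.1 hP
  obtain ⟨C, hC, h⟩ := P.norm_mul_pow_le_of_lt_radius hrP
  have hr0 : 0 < (r : ℝ) := by exact_mod_cast hr
  refine lt_of_lt_of_le ?_ ((diffSeries P).le_radius_of_bound (r := r / 2) (C / r) fun n => ?_)
  · exact_mod_cast half_pos (by exact_mod_cast hr0 : 0 < r)
  · have h1 : ((n : ℝ) + 1) ≤ 2 ^ n := by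
      exact_mod_cast Nat.lt_two_pow_self
    push_cast
    rw [le_div_iff₀ hr0, div_pow]
    calc _ ≤ (n + 1) * ‖P (n + 1)‖ * ((r : ℝ) ^ n / 2 ^ n) * r := by
          gcongr
          exact norm_diffSeries_le P n
      _ = ((n + 1) / 2 ^ n) * (‖P (n + 1)‖ * (r : ℝ) ^ (n + 1)) := by ring
      _ ≤ 1 * C := by
          refine mul_le_mul ?_ (h _) (by positivity) zero_le_one
          exact div_le_one_of_le₀ h1 (by positivity)
      _ = C := one_mul C

/-- The difference `f x - f y` is a holomorphic combination of the coordinates of `x - y`. -/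
theorem exists_hadamard {f : V → ℂ} {a : V} (hf : AnalyticAt ℂ f a) :
    ∃ q : V × V → V →L[ℂ] ℂ, AnalyticAt ℂ q (a, a) ∧
      ∀ᶠ z in 𝓝 (a, a), f z.1 - f z.2 = q z (z.1 - z.2) := by
  obtain ⟨P, hP⟩ := hf
  obtain ⟨r, hr⟩ := hP
  have hq := (diffSeries P).hasFPowerSeriesOnBall
    (radius_diffSeries_pos (hr.r_pos.trans_le hr.r_le))
  have ht : AnalyticAt ℂ (fun z : V × V => z - (a, a)) (a, a) := by fun_prop
  have h0 : ((a, a) : V × V) - (a, a) = 0 := sub_self _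
  refine ⟨fun z => (diffSeries P).sum (z - (a, a)), ?_, ?_⟩
  · have := hq.analyticAt
    rw [← h0] at this
    exact AnalyticAt.comp (f := fun z : V × V => z - (a, a)) this ht
  · have e1 : ∀ᶠ z : V × V in 𝓝 (a, a), z - (a, a) ∈ Metric.eball 0 (diffSeries P).radius := by
      refine ht.continuousAt.eventually_mem ?_
      rw [h0]
      exact Metric.eball_mem_nhds _ hq.r_pos
    have e2 : ∀ᶠ z : V × V in 𝓝 (a, a), z.1 ∈ Metric.eball a r :=
      continuousAt_fst.eventually_mem (Metric.eball_mem_nhds _ hr.r_pos)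
    have e3 : ∀ᶠ z : V × V in 𝓝 (a, a), z.2 ∈ Metric.eball a r :=
      continuousAt_snd.eventually_mem (Metric.eball_mem_nhds _ hr.r_pos)
    filter_upwards [e1, e2, e3] with z h1 h2 h3
    have k1 := hq.hasSum h1
    have k2 := (hr.hasSum_sub h2).sub (hr.hasSum_sub h3)
    rw [zero_add] at k1
    have k3 := k1.mapL (ContinuousLinearMap.apply ℂ ℂ (z.1 - z.2))
    refine HasSum.unique ?_ k3
    have k4 := (hasSum_nat_add_iff' 1).2 k2
    -- The constant terms of the two expansions cancel, and the series that remain are indexed from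
    -- degree 1, as in `diffSeries`.
    have hz : ∑ i ∈ Finset.range 1, ((P i fun _ => z.1 - a) - P i fun _ => z.2 - a) = 0 := by
      rw [Finset.sum_range_one, sub_eq_zero]
      congr 1
      exact Subsingleton.elim _ _
    rw [hz, sub_zero] at k4
    refine k4.congr_fun fun n => ?_
    have h := diffSeries_apply P n (z.1 - a) (z.2 - a)
    rw [sub_sub_sub_cancel_right] at h
    exact h

end Hadamard

/-! ### Holomorphic maps to a complex Lie group -/

section HolTo

set_option linter.unusedSectionVars false

variable {E G V W F : Type} [NormedAddCommGroup E] [NormedSpace ℂ E] [FiniteDimensional ℂ E]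
  [TopologicalSpace G] [ChartedSpace E G] [Group G] [LieGroup 𝓘(ℂ, E) ω G]
  [NormedAddCommGroup V] [NormedSpace ℂ V] [NormedAddCommGroup W] [NormedSpace ℂ W]
  [NormedAddCommGroup F] [NormedSpace ℂ F]

variable (E) in
/-- The map `u` to `G` is holomorphic at `e`. -/
def HolTo (u : V → G) (e : V) : Prop := ContMDiffAt 𝓘(ℂ, V) 𝓘(ℂ, E) ω u e

theorem HolTo.mul {u v : V → G} {e : V} (hu : HolTo E u e) (hv : HolTo E v e) :
    HolTo E (fun e => u e * v e) e :=
  ContMDiffAt.mul hu hv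

theorem HolTo.inv {u : V → G} {e : V} (hu : HolTo E u e) : HolTo E (fun e => (u e)⁻¹) e :=
  ContMDiffAt.inv hu

theorem holTo_const (g : G) (e : V) : HolTo E (fun _ => g) e := contMDiffAt_const

theorem HolTo.comp [CompleteSpace W] {u : W → G} {T : V → W} {e : V} (hu : HolTo E u (T e))
    (hT : AnalyticAt ℂ T e) : HolTo E (fun e => u (T e)) e :=
  ContMDiffAt.comp e hu hT.contDiffAt.contMDiffAt

theorem isManifold_of_lieGroup : IsManifold 𝓘(ℂ, E) ω G :=
  (inferInstance : ContMDiffMul 𝓘(ℂ, E) ω G).toIsManifold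

theorem HolTo.chart {u : V → G} {e : V} (hu : HolTo E u e) {g : G}
    (hg : u e ∈ (chartAt E g).source) : AnalyticAt ℂ (fun e' => chartAt E g (u e')) e := by
  have : IsManifold 𝓘(ℂ, E) ω G := isManifold_of_lieGroup
  have := FiniteDimensional.complete ℂ E
  have h := (contMDiffAt_extChartAt' (I := 𝓘(ℂ, E)) (n := ω) hg).comp e hu
  exact (contMDiffAt_iff_contDiffAt.1 h).analyticAt

theorem holTo_chart_symm {g : G} {e : E} (he : e ∈ (chartAt E g).target) :
    HolTo E (chartAt E g).symm e := by
  have : IsManifold 𝓘(ℂ, E) ω G := isManifold_of_lieGroup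
  exact contMDiffOn_chart_symm.contMDiffAt ((chartAt E g).open_target.mem_nhds he)

variable (E G) in
/-- The coordinates of `1`. -/
def k1 : E := chartAt E (1 : G) 1

variable (E G) in
theorem k1_mem : k1 E G ∈ (chartAt E (1 : G)).target := mem_chart_target E 1

variable (E G) in
theorem symm_k1 : (chartAt E (1 : G)).symm (k1 E G) = 1 :=
  (chartAt E (1 : G)).left_inv (mem_chart_source E 1)

theorem holTo_symm : HolTo E (chartAt E (1 : G)).symm (k1 E G) := holTo_chart_symm (k1_mem E G)

theorem HolTo.chart_one {u : V → G} {e : V} (hu : HolTo E u e) (h : u e = 1) :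
    AnalyticAt ℂ (fun e' => chartAt E (1 : G) (u e')) e :=
  hu.chart (by rw [h]; exact mem_chart_source E 1)

theorem HolTo.eventually_mem {u : V → G} {e : V} (hu : HolTo E u e) {g : G}
    (hg : u e ∈ (chartAt E g).source) : ∀ᶠ e' in 𝓝 e, u e' ∈ (chartAt E g).source :=
  hu.continuousAt.eventually_mem ((chartAt E g).open_source.mem_nhds hg)

/-- The manifold derivative is computed in the chart at `u e`; the hypothesis makes this the chart
at 1, in which `𝔤` is identified with `E`. -/
theorem mfderiv_eq_fderiv {u : V → G} {e : V} (hu : HolTo E u e) (h : u e = 1) :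
    (mfderiv 𝓘(ℂ, V) 𝓘(ℂ, E) u e : V →L[ℂ] E) = fderiv ℂ (fun e' => chartAt E (1 : G) (u e')) e := by
  have hd : MDifferentiableAt 𝓘(ℂ, V) 𝓘(ℂ, E) u e := ContMDiffAt.mdifferentiableAt hu (by simp)
  have h1 : (mfderiv 𝓘(ℂ, V) 𝓘(ℂ, E) u e : V →L[ℂ] E) =
      fderivWithin ℂ (writtenInExtChartAt 𝓘(ℂ, V) 𝓘(ℂ, E) e u) (Set.range 𝓘(ℂ, V)) e := by
    unfold mfderiv
    exact if_pos hd
  rw [h1, ← h]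
  simp only [writtenInExtChartAt, mfld_simps, Function.comp_def, fderivWithin_univ]
  rfl

theorem mfderiv_one_eq_fderiv {f : G → F} (hf : MDifferentiableAt 𝓘(ℂ, E) 𝓘(ℂ, F) f 1) :
    (mfderiv 𝓘(ℂ, E) 𝓘(ℂ, F) f 1 : E →L[ℂ] F) =
      fderiv ℂ (fun ε => f ((chartAt E (1 : G)).symm ε)) (k1 E G) := by
  have h1 : (mfderiv 𝓘(ℂ, E) 𝓘(ℂ, F) f 1 : E →L[ℂ] F) =
      fderivWithin ℂ (writtenInExtChartAt 𝓘(ℂ, E) 𝓘(ℂ, F) 1 f) (Set.range 𝓘(ℂ, E)) (k1 E G) := by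
    unfold mfderiv
    exact if_pos hf
  rw [h1]
  simp only [writtenInExtChartAt, mfld_simps, Function.comp_def, fderivWithin_univ]
  rfl

theorem mfderiv_one_eq_fderiv' {f : G → G} (hf : MDifferentiableAt 𝓘(ℂ, E) 𝓘(ℂ, E) f 1)
    (h : f 1 = 1) : (mfderiv 𝓘(ℂ, E) 𝓘(ℂ, E) f 1 : E →L[ℂ] E) =
      fderiv ℂ (fun ε => chartAt E (1 : G) (f ((chartAt E (1 : G)).symm ε))) (k1 E G) := by
  have h1 : (mfderiv 𝓘(ℂ, E) 𝓘(ℂ, E) f 1 : E →L[ℂ] E) =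
      fderivWithin ℂ (writtenInExtChartAt 𝓘(ℂ, E) 𝓘(ℂ, E) 1 f) (Set.range 𝓘(ℂ, E)) (k1 E G) := by
    unfold mfderiv
    exact if_pos hf
  rw [h1]
  simp only [writtenInExtChartAt, mfld_simps, Function.comp_def, fderivWithin_univ, h]
  rfl

/-- The derivative in one variable at a point that moves with the other one. Logarithmic
derivatives, `Ad` and the conjugation field are all of this kind. -/
theorem analyticAt_partial [CompleteSpace F] {f : V → W → F} {b : V → W} {v : V}
    (hf : AnalyticAt ℂ (fun z : V × W => f z.1 z.2) (v, b v)) (hb : AnalyticAt ℂ b v) :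
    AnalyticAt ℂ (fun v => fderiv ℂ (f v) (b v)) v := by
  have hvb : AnalyticAt ℂ (fun v => (v, b v)) v := analyticAt_id.prod hb
  have h1 : AnalyticAt ℂ (fun v => fderiv ℂ (fun z : V × W => f z.1 z.2) (v, b v)) v :=
    hf.fderiv.comp (f := fun v => (v, b v)) hvb
  have h2 : AnalyticAt ℂ (fun v => (fderiv ℂ (fun z : V × W => f z.1 z.2) (v, b v)).comp
      (ContinuousLinearMap.inr ℂ V W)) v :=
    (((ContinuousLinearMap.compL ℂ W (V × W) F).flip (ContinuousLinearMap.inr ℂ V W)).analyticAt _).comp h1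
  refine h2.congr ?_
  filter_upwards [hvb.continuousAt.eventually hf.eventually_analyticAt] with v' hv'
  exact (hv'.differentiableAt.hasFDerivAt.comp (b v') (hasFDerivAt_prodMk_right v' (b v'))).fderiv.symm

/-- The derivative of a product of maps to `G` at a point where both are `1`. -/
theorem fderiv_chart_mul {u v : V → G} {e : V} (hu : HolTo E u e) (hv : HolTo E v e)
    (hu1 : u e = 1) (hv1 : v e = 1) :
    fderiv ℂ (fun e' => chartAt E (1 : G) (u e' * v e')) e =
      fderiv ℂ (fun e' => chartAt E (1 : G) (u e')) e +
      fderiv ℂ (fun e' => chartAt E (1 : G) (v e')) e := by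
  have := FiniteDimensional.complete ℂ E
  set κ := chartAt E (1 : G)
  set k := k1 E G
  let m : E × E → E := fun z => κ (κ.symm z.1 * κ.symm z.2)
  have hm : AnalyticAt ℂ m (k, k) := by
    refine HolTo.chart_one (u := fun z : E × E => κ.symm z.1 * κ.symm z.2) ?_ ?_
    · exact (HolTo.comp (T := Prod.fst) holTo_symm analyticAt_fst).mul
        (HolTo.comp (T := Prod.snd) holTo_symm analyticAt_snd)
    · change κ.symm k * κ.symm k = 1
      rw [symm_k1, one_mul]
  have h0 : κ.symm k = 1 := symm_k1 E G
  have ht : ∀ᶠ x in 𝓝 k, x ∈ κ.target := κ.open_target.mem_nhds (k1_mem E G)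
  -- Multiplication by 1 on either side is the identity, so each partial derivative of the product
  -- at `(1, 1)` is the identity.
  have hl : (fderiv ℂ m (k, k)).comp (ContinuousLinearMap.inl ℂ E E) = ContinuousLinearMap.id ℂ E := by
    have h1 := (HasFDerivAt.comp (f := fun x => (x, k)) k hm.differentiableAt.hasFDerivAt
      (hasFDerivAt_prodMk_left k k)).fderiv
    rw [← h1, ← fderiv_fun_id (𝕜 := ℂ) (x := k)]
    refine EventuallyEq.fderiv_eq ?_
    filter_upwards [ht] with x hx
    change κ (κ.symm x * κ.symm k) = x
    rw [h0, mul_one, κ.right_inv hx]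
  have hr : (fderiv ℂ m (k, k)).comp (ContinuousLinearMap.inr ℂ E E) = ContinuousLinearMap.id ℂ E := by
    have h1 := (HasFDerivAt.comp (f := fun x => (k, x)) k hm.differentiableAt.hasFDerivAt
      (hasFDerivAt_prodMk_right k k)).fderiv
    rw [← h1, ← fderiv_fun_id (𝕜 := ℂ) (x := k)]
    refine EventuallyEq.fderiv_eq ?_
    filter_upwards [ht] with x hx
    change κ (κ.symm k * κ.symm x) = x
    rw [h0, one_mul, κ.right_inv hx]
  have hu2 := (hu.chart_one hu1).differentiableAt.hasFDerivAt
  have hv2 := (hv.chart_one hv1).differentiableAt.hasFDerivAt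
  have e1 : (fun e' => κ (u e' * v e')) =ᶠ[𝓝 e] fun e' => m (κ (u e'), κ (v e')) := by
    filter_upwards [hu.eventually_mem (g := 1) (by rw [hu1]; exact mem_chart_source E 1),
      hv.eventually_mem (g := 1) (by rw [hv1]; exact mem_chart_source E 1)] with e' h1 h2
    change _ = κ (κ.symm (κ (u e')) * κ.symm (κ (v e')))
    rw [κ.left_inv h1, κ.left_inv h2]
  have hm' : HasFDerivAt m (fderiv ℂ m (k, k)) (κ (u e), κ (v e)) := by
    rw [hu1, hv1]
    exact hm.differentiableAt.hasFDerivAt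
  have h2 := hm'.comp e (hu2.prodMk hv2)
  rw [e1.fderiv_eq]
  refine h2.fderiv.trans ?_
  ext x
  have hl' := congrArg (fun T : E →L[ℂ] E => T (fderiv ℂ (fun e' => κ (u e')) e x)) hl
  have hr' := congrArg (fun T : E →L[ℂ] E => T (fderiv ℂ (fun e' => κ (v e')) e x)) hr
  simp only [ContinuousLinearMap.comp_apply, ContinuousLinearMap.inl_apply,
    ContinuousLinearMap.inr_apply, ContinuousLinearMap.id_apply] at hl' hr'
  rw [ContinuousLinearMap.comp_apply, ContinuousLinearMap.prod_apply, add_apply,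
    ← hl', ← hr', ← map_add]
  simp [hl', hr']

/-- The map `h ↦ g h g⁻¹` in the chart at `1`. -/
theorem Ad_eq (g : G) : (Ad g : E →L[ℂ] E) = fderiv ℂ (fun ε => chartAt E (1 : G)
    (g * (chartAt E (1 : G)).symm ε * g⁻¹)) (k1 E G) := by
  refine mfderiv_one_eq_fderiv' (f := fun h : G => g * h * g⁻¹) ?_ (by simp)
  exact ((contMDiff_mul_right (I := 𝓘(ℂ, E)) (n := ω) (a := g⁻¹)).comp
      (contMDiff_mul_left (I := 𝓘(ℂ, E)) (n := ω) (a := g))).mdifferentiable (by simp) _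

/-- The derivative of a conjugate of a map to `G` at a point where it is `1`. -/
theorem fderiv_chart_conj {u : V → G} {e : V} (hu : HolTo E u e) (hu1 : u e = 1) (g : G) :
    fderiv ℂ (fun e' => chartAt E (1 : G) (g * u e' * g⁻¹)) e =
      (Ad g).comp (fderiv ℂ (fun e' => chartAt E (1 : G) (u e')) e) := by
  set κ := chartAt E (1 : G)
  have hu2 := (hu.chart_one hu1).differentiableAt.hasFDerivAt
  have e1 : (fun e' => κ (g * u e' * g⁻¹)) =ᶠ[𝓝 e]
      (fun ε => κ (g * κ.symm ε * g⁻¹)) ∘ fun e' => κ (u e') := by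
    filter_upwards [hu.eventually_mem (g := 1) (by rw [hu1]; exact mem_chart_source E 1)] with e' h1
    change _ = κ (g * κ.symm (κ (u e')) * g⁻¹)
    rw [κ.left_inv h1]
  have hA : AnalyticAt ℂ (fun ε => κ (g * κ.symm ε * g⁻¹)) (κ (u e)) := by
    rw [hu1]
    refine HolTo.chart_one (((holTo_const g _).mul holTo_symm).mul (holTo_const _ _)) ?_
    have : κ.symm (κ 1) = 1 := symm_k1 E G
    simp [this]
  rw [e1.fderiv_eq, (hA.differentiableAt.hasFDerivAt.comp e hu2).fderiv, Ad_eq, hu1]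
  rfl

end HolTo

/-! ### Logarithmic derivatives -/

section Ldv

set_option linter.unusedSectionVars false

variable {E G V W F : Type} [NormedAddCommGroup E] [NormedSpace ℂ E] [FiniteDimensional ℂ E]
  [TopologicalSpace G] [ChartedSpace E G] [Group G] [LieGroup 𝓘(ℂ, E) ω G]
  [NormedAddCommGroup V] [NormedSpace ℂ V] [NormedAddCommGroup W] [NormedSpace ℂ W]
  [NormedAddCommGroup F] [NormedSpace ℂ F]

variable (E) in
/-- The logarithmic derivative `du · u⁻¹` of a map to `G`. -/
def ldv (u : V → G) (e : V) : V →L[ℂ] E :=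
  fderiv ℂ (fun e' => chartAt E (1 : G) (u e' * (u e)⁻¹)) e

theorem ldv_congr {u v : V → G} {e : V} (h : u =ᶠ[𝓝 e] v) : ldv E u e = ldv E v e := by
  refine EventuallyEq.fderiv_eq ?_
  filter_upwards [h] with e' he'
  rw [he', h.eq_of_nhds]

theorem ldv_const (g : G) (e : V) : ldv E (fun _ => g) e = 0 := by
  simp [ldv]

/-- Up to translation, `u'v'(uv)⁻¹` is the product of `u'u⁻¹` with the conjugate of `v'v⁻¹` by `u`,
and at the base point both factors are 1. -/
theorem ldv_mul {u v : V → G} {e : V} (hu : HolTo E u e) (hv : HolTo E v e) :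
    ldv E (fun e => u e * v e) e = ldv E u e + (Ad (u e)).comp (ldv E v e) := by
  have h1 : HolTo E (fun e' => u e' * (u e)⁻¹) e := hu.mul (holTo_const _ _)
  have h2 : HolTo E (fun e' => v e' * (v e)⁻¹) e := hv.mul (holTo_const _ _)
  have h3 : HolTo E (fun e' => u e * (v e' * (v e)⁻¹) * (u e)⁻¹) e :=
    ((holTo_const _ _).mul h2).mul (holTo_const _ _)
  unfold ldv
  rw [← fderiv_chart_conj h2 (mul_inv_cancel _), ← fderiv_chart_mul h1 h3 (mul_inv_cancel _) (by simp)]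
  congr 1
  funext e'
  congr 1
  group

theorem ldv_conj {u : V → G} {e : V} (hu : HolTo E u e) (g : G) :
    ldv E (fun e => g * u e * g⁻¹) e = (Ad g).comp (ldv E u e) := by
  rw [ldv_mul ((holTo_const _ _).mul hu) (holTo_const _ _), ldv_mul (holTo_const _ _) hu, ldv_const,
    ldv_const, zero_add, ContinuousLinearMap.comp_zero, add_zero]

theorem ldv_inv {u : V → G} {e : V} (hu : HolTo E u e) :
    (Ad (u e)).comp (ldv E (fun e => (u e)⁻¹) e) = -ldv E u e := by
  have h := ldv_mul hu hu.inv
  simp only [mul_inv_cancel, ldv_const] at h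
  exact (neg_eq_of_add_eq_zero_right h.symm).symm

theorem analyticAt_ldv {u : V → G} {e : V} (hu : HolTo E u e) [CompleteSpace V] :
    AnalyticAt ℂ (ldv E u) e := by
  have := FiniteDimensional.complete ℂ E
  refine analyticAt_partial (f := fun e e' => chartAt E (1 : G) (u e' * (u e)⁻¹)) (b := fun e => e) ?_
    analyticAt_id
  exact HolTo.chart_one (u := fun z : V × V => u z.2 * (u z.1)⁻¹)
    ((HolTo.comp (T := Prod.snd) hu analyticAt_snd).mul
      (HolTo.comp (T := Prod.fst) hu analyticAt_fst).inv) (mul_inv_cancel _)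

theorem ldv_comp [CompleteSpace W] {u : W → G} {T : V → W} {e : V} (hu : HolTo E u (T e))
    (hT : AnalyticAt ℂ T e) :
    ldv E (fun e => u (T e)) e = (ldv E u (T e)).comp (fderiv ℂ T e) := by
  have h1 : HolTo E (fun e' => u e' * (u (T e))⁻¹) (T e) := hu.mul (holTo_const _ _)
  exact ((h1.chart_one (mul_inv_cancel _)).differentiableAt.hasFDerivAt.comp e
    hT.differentiableAt.hasFDerivAt).fderiv

/-- Expresses `du · u⁻¹` by differentials of chart coordinates of `u`, with holomorphic
coefficients; this provides the local expressions `f dg` required of forms. -/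
theorem ldv_chart {u : V → G} {e : V} (hu : HolTo E u e) {g : G}
    (hg : u e ∈ (chartAt E g).source) : ldv E u e =
      (ldv E (chartAt E g).symm (chartAt E g (u e))).comp
        (fderiv ℂ (fun e => chartAt E g (u e)) e) := by
  have := FiniteDimensional.complete ℂ E
  have h : u =ᶠ[𝓝 e] fun e => (chartAt E g).symm (chartAt E g (u e)) := by
    filter_upwards [hu.eventually_mem hg] with e' he'
    exact ((chartAt E g).left_inv he').symm
  rw [ldv_congr h]
  exact ldv_comp (holTo_chart_symm ((chartAt E g).map_source hg)) (hu.chart hg)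

theorem analyticAt_Ad [CompleteSpace V] {u : V → G} {e : V} (hu : HolTo E u e) :
    AnalyticAt ℂ (fun e => (Ad (u e) : E →L[ℂ] E)) e := by
  have := FiniteDimensional.complete ℂ E
  simp only [Ad_eq]
  refine analyticAt_partial (f := fun e ε => chartAt E (1 : G)
    (u e * (chartAt E (1 : G)).symm ε * (u e)⁻¹)) (b := fun _ => k1 E G) ?_ analyticAt_const
  refine HolTo.chart_one (u := fun z : V × E => u z.1 * (chartAt E (1 : G)).symm z.2 * (u z.1)⁻¹)
    (((HolTo.comp (T := Prod.fst) hu analyticAt_fst).mul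
      (HolTo.comp (T := Prod.snd) holTo_symm analyticAt_snd)).mul
        (HolTo.comp (T := Prod.fst) hu analyticAt_fst).inv) ?_
  change u e * (chartAt E (1 : G)).symm (k1 E G) * (u e)⁻¹ = 1
  rw [symm_k1, mul_one, mul_inv_cancel]

theorem ldv_symm_one : ldv E (chartAt E (1 : G)).symm (k1 E G) = ContinuousLinearMap.id ℂ E := by
  unfold ldv
  rw [symm_k1, ← fderiv_fun_id (𝕜 := ℂ) (x := k1 E G)]
  refine EventuallyEq.fderiv_eq ?_
  filter_upwards [(chartAt E (1 : G)).open_target.mem_nhds (k1_mem E G)] with x hx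
  rw [inv_one, mul_one, (chartAt E (1 : G)).right_inv hx]

/-- The logarithmic derivative at `1` of `h ↦ h g h⁻¹`. -/
theorem ldv_conj_symm (g : G) : ldv E (fun ε => (chartAt E (1 : G)).symm ε * g *
      ((chartAt E (1 : G)).symm ε)⁻¹) (k1 E G) = ContinuousLinearMap.id ℂ E - Ad g := by
  have h := ldv_inv (E := E) (holTo_symm (E := E) (G := G))
  rw [symm_k1, Ad_one, ldv_symm_one, ContinuousLinearMap.id_comp] at h
  rw [ldv_mul (holTo_symm.mul (holTo_const _ _)) holTo_symm.inv,
    ldv_mul holTo_symm (holTo_const _ _), h, ldv_const, ldv_symm_one, symm_k1, one_mul,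
    ContinuousLinearMap.comp_zero, add_zero, sub_eq_add_neg, ContinuousLinearMap.comp_neg,
    ContinuousLinearMap.comp_id]

/-- The derivative of the adjoint action. -/
def ad (G : Type) {E : Type} [NormedAddCommGroup E] [NormedSpace ℂ E] [TopologicalSpace G]
    [ChartedSpace E G] [Group G] (v : E) : E →L[ℂ] E :=
  fderiv ℂ (fun ε => (Ad ((chartAt E (1 : G)).symm ε) : E →L[ℂ] E)) (k1 E G) v

/-- Symmetry of the second derivative of `f` on the product, for one vector along each factor. -/
theorem fderiv_fderiv_comm [CompleteSpace F] {f : V → W → F} {v : V} {w : W}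
    (hf : AnalyticAt ℂ (fun z : V × W => f z.1 z.2) (v, w)) (x : V) (y : W) :
    fderiv ℂ (fun v => fderiv ℂ (f v) w) v x y =
      fderiv ℂ (fun w => fderiv ℂ (fun v => f v w) v x) w y := by
  set g := fun z : V × W => f z.1 z.2
  have hL : AnalyticAt ℂ (fun v' : V => (v', w)) v := analyticAt_id.prod analyticAt_const
  have hR : AnalyticAt ℂ (fun w' : W => (v, w')) w := analyticAt_const.prod analyticAt_id
  have h1 : (fun v => fderiv ℂ (f v) w) =ᶠ[𝓝 v]
      fun v' => (fderiv ℂ g (v', w)).comp (ContinuousLinearMap.inr ℂ V W) := by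
    filter_upwards [hL.continuousAt.eventually hf.eventually_analyticAt] with v' hv'
    exact (hv'.differentiableAt.hasFDerivAt.comp w (hasFDerivAt_prodMk_right v' w)).fderiv
  have h2 : (fun w => fderiv ℂ (fun v => f v w) v x) =ᶠ[𝓝 w]
      fun w' => fderiv ℂ g (v, w') (x, 0) := by
    filter_upwards [hR.continuousAt.eventually hf.eventually_analyticAt] with w' hw'
    have := (HasFDerivAt.comp (f := fun v => (v, w')) v hw'.differentiableAt.hasFDerivAt
      (hasFDerivAt_prodMk_left v w')).fderiv
    change fderiv ℂ (g ∘ fun v => (v, w')) v x = _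
    rw [this]
    rfl
  have hg := hf.fderiv.differentiableAt.hasFDerivAt
  have h3 := HasFDerivAt.comp (f := fun v => (v, w)) v hg (hasFDerivAt_prodMk_left v w)
  have h4 := HasFDerivAt.comp (f := fun w => (v, w)) w hg (hasFDerivAt_prodMk_right v w)
  rw [h1.fderiv_eq, h2.fderiv_eq]
  have h5 := ((ContinuousLinearMap.compL ℂ W (V × W) F).flip
    (ContinuousLinearMap.inr ℂ V W)).hasFDerivAt.comp v h3
  have h6 := (ContinuousLinearMap.apply ℂ F ((x, 0) : V × W)).hasFDerivAt.comp w h4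
  have h7 := congrArg (fun T => T x y) h5.fderiv
  have h8 := congrArg (fun T => T y) h6.fderiv
  refine h7.trans (Eq.trans ?_ h8.symm)
  have hs : ContDiffAt ℂ 2 g (v, w) := hf.contDiffAt
  exact hs.isSymmSndFDerivAt (by simp) (x, 0) (0, y)

end Ldv

/-! ### Words and the conjugation action in product charts -/

section Words

set_option linter.unusedSectionVars false

variable {E G V : Type} [NormedAddCommGroup E] [NormedSpace ℂ E] [FiniteDimensional ℂ E]
  [TopologicalSpace G] [ChartedSpace E G] [Group G] [LieGroup 𝓘(ℂ, E) ω G]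
  [NormedAddCommGroup V] [NormedSpace ℂ V] {p : ℕ}

instance : CompleteSpace (Fin p → E) := FiniteDimensional.complete ℂ _

theorem ev_mul (w w' : FreeGroup (Fin p)) (y : Fin p → G) : ev (w * w') y = ev w y * ev w' y :=
  map_mul (FreeGroup.lift y) w w'

theorem ev_one (y : Fin p → G) : ev 1 y = 1 := map_one (FreeGroup.lift y)

theorem ev_inv (w : FreeGroup (Fin p)) (y : Fin p → G) : ev w⁻¹ y = (ev w y)⁻¹ :=
  map_inv (FreeGroup.lift y) w

theorem ev_of (i : Fin p) (y : Fin p → G) : ev (FreeGroup.of i) y = y i := FreeGroup.lift_apply_of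

theorem ev_map {H : Type} [Group H] (f : G →* H) (w : FreeGroup (Fin p)) (y : Fin p → G) :
    ev w (fun i => f (y i)) = f (ev w y) := by
  have : FreeGroup.lift (fun i => f (y i)) = f.comp (FreeGroup.lift y) :=
    FreeGroup.ext_hom _ _ fun i => by simp
  exact congrArg (fun T => T w) this

theorem ev_conj (w : FreeGroup (Fin p)) (y : Fin p → G) (g : G) :
    ev w (fun i => g * y i * g⁻¹) = g * ev w y * g⁻¹ :=
  ev_map (MulAut.conj g).toMonoidHom w y

theorem ev_pt {Γ : Type} [Group Γ] (π : FreeGroup (Fin p) →* Γ) (ρ : Γ →* G)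
    (w : FreeGroup (Fin p)) : ev w (pt π ρ) = ρ (π w) := by
  have : FreeGroup.lift (pt π ρ) = ρ.comp π := FreeGroup.ext_hom _ _ fun i => by simp [pt]
  exact congrArg (fun T => T w) this

theorem HolTo.ev {y : V → Fin p → G} {e : V} (hy : ∀ i, HolTo E (fun e => y e i) e)
    (w : FreeGroup (Fin p)) : HolTo E (fun e => ev w (y e)) e := by
  induction w using FreeGroup.induction_on with
  | C1 => simpa only [ev_one] using holTo_const _ _
  | of i => simpa only [ev_of] using hy i
  | inv_of i h => simpa only [ev_inv] using h.inv
  | mul v w hv hw => simpa only [ev_mul] using hv.mul hw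

variable (E) in
/-- The domain of the inverse of the product chart at `x`. -/
def chartDom (x : Fin p → G) : Set (Fin p → E) := {e | ∀ i, e i ∈ (chartAt E (x i)).target}

theorem isOpen_chartDom (x : Fin p → G) : IsOpen (chartDom E x) := by
  have : chartDom E x = ⋂ i, (fun e : Fin p → E => e i) ⁻¹' (chartAt E (x i)).target := by
    ext; simp [chartDom]
  rw [this]
  exact isOpen_iInter_of_finite fun i => (chartAt E (x i)).open_target.preimage (continuous_apply i)

theorem center_mem (x : Fin p → G) : center x ∈ chartDom E x := fun i => mem_chart_target E (x i)

theorem eventually_mem_chartDom (x : Fin p → G) : ∀ᶠ e in 𝓝 (center x), e ∈ chartDom E x :=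
  (isOpen_chartDom x).mem_nhds (center_mem x)

theorem param_center (x : Fin p → G) : param x (center (E := E) x) = x :=
  funext fun i => (chartAt E (x i)).left_inv (mem_chart_source E (x i))

theorem analyticAt_apply (i : Fin p) (e : Fin p → E) : AnalyticAt ℂ (fun e : Fin p → E => e i) e :=
  (ContinuousLinearMap.proj (R := ℂ) (φ := fun _ : Fin p => E) i).analyticAt e

theorem holTo_param {x : Fin p → G} {e : Fin p → E} (he : e ∈ chartDom E x) (i : Fin p) :
    HolTo E (fun e => param x e i) e := by
  have := FiniteDimensional.complete ℂ E
  exact HolTo.comp (T := fun e : Fin p → E => e i) (holTo_chart_symm (he i)) (analyticAt_apply i e)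

theorem holTo_ev {x : Fin p → G} {e : Fin p → E} (he : e ∈ chartDom E x) (w : FreeGroup (Fin p)) :
    HolTo E (fun e => ev w (param x e)) e :=
  HolTo.ev (holTo_param he) w

theorem mcForm_eq {x : Fin p → G} {e : Fin p → E} (he : e ∈ chartDom E x)
    (w : FreeGroup (Fin p)) : mcForm x w e = ldv E (fun e => ev w (param x e)) e :=
  mfderiv_eq_fderiv ((holTo_ev he w).mul (holTo_const _ _)) (mul_inv_cancel _)

/-- The conjugation action in the product chart at `x`. -/
def conjFlow (x : Fin p → G) (ε : E) (e : Fin p → E) : Fin p → E := fun i =>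
  chartAt E (x i) ((chartAt E (1 : G)).symm ε * param x e i * ((chartAt E (1 : G)).symm ε)⁻¹)

theorem holTo_conj {x : Fin p → G} {e : Fin p → E} (he : e ∈ chartDom E x) (i : Fin p) :
    HolTo E (fun z : E × (Fin p → E) => (chartAt E (1 : G)).symm z.1 * param x z.2 i *
      ((chartAt E (1 : G)).symm z.1)⁻¹) (k1 E G, e) := by
  have := FiniteDimensional.complete ℂ E
  have h : HolTo E (fun z : E × (Fin p → E) => (chartAt E (1 : G)).symm z.1) (k1 E G, e) :=
    HolTo.comp (T := Prod.fst) holTo_symm analyticAt_fst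
  exact (h.mul (HolTo.comp (T := Prod.snd) (u := fun e => param x e i) (holTo_param he i)
    analyticAt_snd)).mul h.inv

theorem conj_mem {x : Fin p → G} {e : Fin p → E} (he : e ∈ chartDom E x) (i : Fin p) :
    (chartAt E (1 : G)).symm (k1 E G) * param x e i * ((chartAt E (1 : G)).symm (k1 E G))⁻¹ ∈
      (chartAt E (x i)).source := by
  rw [symm_k1, one_mul, inv_one, mul_one]
  exact (chartAt E (x i)).map_target (he i)

theorem analyticAt_conjFlow {x : Fin p → G} {e : Fin p → E} (he : e ∈ chartDom E x) :
    AnalyticAt ℂ (fun z : E × (Fin p → E) => conjFlow x z.1 z.2) (k1 E G, e) :=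
  AnalyticAt.pi fun i => (holTo_conj he i).chart (conj_mem he i)

theorem conjFlow_one {x : Fin p → G} {e : Fin p → E} (he : e ∈ chartDom E x) :
    conjFlow x (k1 E G) e = e := by
  funext i
  simp only [conjFlow, symm_k1, one_mul, inv_one, mul_one]
  exact (chartAt E (x i)).right_inv (he i)

/-- The flow leaves the product chart eventually, so the identity holds only near the unit and near
`e`; this is enough for derivatives. -/
theorem param_conjFlow {x : Fin p → G} {e : Fin p → E} (he : e ∈ chartDom E x) :
    ∀ᶠ z in 𝓝 ((k1 E G, e) : E × (Fin p → E)), param x (conjFlow x z.1 z.2) = fun i =>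
      (chartAt E (1 : G)).symm z.1 * param x z.2 i * ((chartAt E (1 : G)).symm z.1)⁻¹ := by
  have : ∀ᶠ z in 𝓝 ((k1 E G, e) : E × (Fin p → E)), ∀ i, (chartAt E (1 : G)).symm z.1 *
      param x z.2 i * ((chartAt E (1 : G)).symm z.1)⁻¹ ∈ (chartAt E (x i)).source :=
    eventually_all.2 fun i => (holTo_conj he i).eventually_mem (conj_mem he i)
  filter_upwards [this] with z hz
  funext i
  exact (chartAt E (x i)).left_inv (hz i)

theorem conjField_eq {x : Fin p → G} {e : Fin p → E} (he : e ∈ chartDom E x) (v : E) :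
    conjField x v e = fderiv ℂ (fun ε => conjFlow x ε e) (k1 E G) v := by
  have := FiniteDimensional.complete ℂ E
  have hd : AnalyticAt ℂ (fun ε => conjFlow x ε e) (k1 E G) :=
    (analyticAt_conjFlow he).comp (f := fun ε => (ε, e)) (analyticAt_id.prod analyticAt_const)
  funext i
  have h1 := congrArg (fun T => T v) ((ContinuousLinearMap.proj (R := ℂ) (φ := fun _ : Fin p => E)
    i).hasFDerivAt.comp (k1 E G) hd.differentiableAt.hasFDerivAt).fderiv
  refine Eq.trans ?_ h1
  refine congrArg (fun T : E →L[ℂ] E => T v) (mfderiv_one_eq_fderiv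
    (f := fun h : G => chartAt E (x i) (h * param x e i * h⁻¹)) ?_)
  have : IsManifold 𝓘(ℂ, E) ω G := isManifold_of_lieGroup
  have h2 : ContMDiffAt 𝓘(ℂ, E) 𝓘(ℂ, E) ω (fun h : G => h * param x e i * h⁻¹) 1 :=
    (contMDiffAt_id.mul contMDiffAt_const).mul contMDiffAt_id.inv
  have h3 : (1 : G) * param x e i * 1⁻¹ ∈ (chartAt E (x i)).source := by
    rw [one_mul, inv_one, mul_one]
    exact (chartAt E (x i)).map_target (he i)
  exact ((contMDiffAt_extChartAt' (I := 𝓘(ℂ, E)) (n := ω) h3).comp 1 h2).mdifferentiableAt (by simp)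

theorem analyticAt_conjField {x : Fin p → G} {e : Fin p → E} (he : e ∈ chartDom E x) (v : E) :
    AnalyticAt ℂ (conjField x v) e := by
  have := FiniteDimensional.complete ℂ E
  have h1 : AnalyticAt ℂ (fun z : (Fin p → E) × E => conjFlow x z.2 z.1) (e, k1 E G) :=
    AnalyticAt.comp (g := fun z : E × (Fin p → E) => conjFlow x z.1 z.2)
      (f := fun z : (Fin p → E) × E => (z.2, z.1)) (analyticAt_conjFlow he)
      (analyticAt_snd.prod analyticAt_fst)
  have h2 : AnalyticAt ℂ (fun e => fderiv ℂ (fun ε => conjFlow x ε e) (k1 E G)) e :=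
    analyticAt_partial (f := fun e ε => conjFlow x ε e) (b := fun _ => k1 E G) h1 analyticAt_const
  refine ((ContinuousLinearMap.apply ℂ (Fin p → E) v).analyticAt _ |>.comp h2).congr ?_
  filter_upwards [(isOpen_chartDom x).mem_nhds he] with e' he'
  exact (conjField_eq he' v).symm

/-- The contraction of the Maurer-Cartan form with the vector field of the conjugation action. -/
theorem mcForm_conjField {x : Fin p → G} {e : Fin p → E} (he : e ∈ chartDom E x)
    (w : FreeGroup (Fin p)) (v : E) :
    mcForm x w e (conjField x v e) = v - Ad (ev w (param x e)) v := by
  have := FiniteDimensional.complete ℂ E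
  have hd : AnalyticAt ℂ (fun ε => conjFlow x ε e) (k1 E G) :=
    (analyticAt_conjFlow he).comp (f := fun ε => (ε, e)) (analyticAt_id.prod analyticAt_const)
  have hc : ContinuousAt (fun ε : E => (ε, e)) (k1 E G) := by fun_prop
  -- Words commute with simultaneous conjugation. The left-hand side is differentiated by the chain
  -- rule, the right-hand side by `ldv_conj_symm`.
  have h1 : (fun ε => ev w (param x (conjFlow x ε e))) =ᶠ[𝓝 (k1 E G)] fun ε =>
      (chartAt E (1 : G)).symm ε * ev w (param x e) * ((chartAt E (1 : G)).symm ε)⁻¹ := by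
    filter_upwards [hc.eventually (param_conjFlow he)] with ε hε
    rw [hε, ev_conj]
  have h2 := ldv_comp (E := E) (u := fun e => ev w (param x e)) (T := fun ε => conjFlow x ε e)
    (e := k1 E G) (by rw [conjFlow_one he]; exact holTo_ev he w) hd
  rw [ldv_congr h1, ldv_conj_symm, conjFlow_one he] at h2
  rw [mcForm_eq he, conjField_eq he]
  exact (congrArg (fun T : E →L[ℂ] E => T v) h2).symm

/-- The Lie derivative of the Maurer-Cartan form along the vector field of the conjugation
action. -/
theorem lie_mcForm {x : Fin p → G} {e : Fin p → E} (he : e ∈ chartDom E x)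
    (w : FreeGroup (Fin p)) (v : E) :
    fderiv ℂ (mcForm x w) e (conjField x v e) + (mcForm x w e).comp (fderiv ℂ (conjField x v) e) =
      (ad G v).comp (mcForm x w e) := by
  have := FiniteDimensional.complete ℂ E
  set u : (Fin p → E) → G := fun e => ev w (param x e) with hu
  have hmc : mcForm x w =ᶠ[𝓝 e] ldv E u := by
    filter_upwards [(isOpen_chartDom x).mem_nhds he] with e' he'
    exact mcForm_eq he' w
  have hX : conjField x v =ᶠ[𝓝 e] fun e => fderiv ℂ (fun ε => conjFlow x ε e) (k1 E G) v := by
    filter_upwards [(isOpen_chartDom x).mem_nhds he] with e' he'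
    exact conjField_eq he' v
  rw [hmc.fderiv_eq, hX.fderiv_eq, hmc.eq_of_nhds, hX.eq_of_nhds]
  have hd : AnalyticAt ℂ (fun ε => conjFlow x ε e) (k1 E G) :=
    (analyticAt_conjFlow he).comp (f := fun ε => (ε, e)) (analyticAt_id.prod analyticAt_const)
  have hc : ContinuousAt (fun ε : E => (ε, e)) (k1 E G) := by fun_prop
  have hθ : AnalyticAt ℂ (ldv E u) (conjFlow x (k1 E G) e) := by
    rw [conjFlow_one he]
    exact analyticAt_ldv (holTo_ev he w)
  have hD : AnalyticAt ℂ (fun ε => fderiv ℂ (conjFlow x ε) e) (k1 E G) :=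
    analyticAt_partial (f := conjFlow x) (b := fun _ => e) (analyticAt_conjFlow he) analyticAt_const
  have hA : AnalyticAt ℂ (fun ε => (Ad ((chartAt E (1 : G)).symm ε) : E →L[ℂ] E)) (k1 E G) :=
    analyticAt_Ad holTo_symm
  -- The pullback of `dw · w⁻¹` under conjugation by `h` is `Ad(h)` applied to it. The derivative of
  -- this identity at `h = 1` is the claim.
  have key : (fun ε => (ldv E u (conjFlow x ε e)).comp (fderiv ℂ (conjFlow x ε) e)) =ᶠ[𝓝 (k1 E G)]
      fun ε => (Ad ((chartAt E (1 : G)).symm ε)).comp (ldv E u e) := by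
    have h1 : ∀ᶠ ε in 𝓝 (k1 E G), conjFlow x ε e ∈ chartDom E x := by
      refine hd.continuousAt.eventually_mem ((isOpen_chartDom x).mem_nhds ?_)
      rw [conjFlow_one he]
      exact he
    have h2 := (param_conjFlow he).curry_nhds
    have h3 := hc.eventually (analyticAt_conjFlow he).eventually_analyticAt
    filter_upwards [h1, h2, h3] with ε h1 h2 h3
    have h4 : AnalyticAt ℂ (conjFlow x ε) e :=
      h3.comp (f := fun e => (ε, e)) (analyticAt_const.prod analyticAt_id)
    rw [← ldv_comp (holTo_ev h1 w) h4, ← ldv_conj (holTo_ev he w)]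
    refine ldv_congr ?_
    filter_upwards [h2] with e' he'
    rw [he', ev_conj]
  have h1 := (hθ.differentiableAt.hasFDerivAt.comp (k1 E G) hd.differentiableAt.hasFDerivAt).clm_comp
    hD.differentiableAt.hasFDerivAt
  have h2 := hA.differentiableAt.hasFDerivAt.clm_comp (hasFDerivAt_const (ldv E u e) (k1 E G))
  have h3 := congrArg (fun T => T v) ((h1.congr_of_eventuallyEq key.symm).unique h2)
  have hid : fderiv ℂ (conjFlow x (k1 E G)) e = ContinuousLinearMap.id ℂ _ := by
    rw [← fderiv_fun_id (𝕜 := ℂ) (x := e)]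
    refine EventuallyEq.fderiv_eq ?_
    filter_upwards [(isOpen_chartDom x).mem_nhds he] with e' he'
    exact conjFlow_one he'
  ext y
  have h4 := congrArg (fun T => T y) h3
  -- The derivative of the Jacobian of the flow in the group parameter is the Jacobian of the vector
  -- field.
  have h5 := fderiv_fderiv_comm (f := conjFlow x) (analyticAt_conjFlow he) v y
  simp only [Function.comp_apply, add_apply, ContinuousLinearMap.comp_apply,
    ContinuousLinearMap.compL_apply, ContinuousLinearMap.flip_apply, conjFlow_one he, hid,
    ContinuousLinearMap.id_apply, h5, zero_apply, map_zero, zero_add] at h4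
  rw [add_apply, ContinuousLinearMap.comp_apply, ContinuousLinearMap.comp_apply, add_comm, ad]
  simpa using h4

end Words

/-! ### The components of the Maurer-Cartan forms of words -/

section Slot

set_option linter.unusedSectionVars false

variable {E G V : Type} [NormedAddCommGroup E] [NormedSpace ℂ E] [FiniteDimensional ℂ E]
  [TopologicalSpace G] [ChartedSpace E G] [Group G] [LieGroup 𝓘(ℂ, E) ω G] {p : ℕ}

theorem mcForm_mul {x : Fin p → G} {e : Fin p → E} (he : e ∈ chartDom E x)
    (w w' : FreeGroup (Fin p)) :
    mcForm x (w * w') e = mcForm x w e + (Ad (ev w (param x e))).comp (mcForm x w' e) := by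
  rw [mcForm_eq he, mcForm_eq he, mcForm_eq he, ← ldv_mul (holTo_ev he w) (holTo_ev he w')]
  simp only [ev_mul]

theorem mcForm_one {x : Fin p → G} {e : Fin p → E} (he : e ∈ chartDom E x) :
    mcForm x 1 e = 0 := by
  rw [mcForm_eq he]
  simp only [ev_one, ldv_const]

theorem analyticAt_mcForm {x : Fin p → G} {e : Fin p → E} (he : e ∈ chartDom E x)
    (w : FreeGroup (Fin p)) : AnalyticAt ℂ (mcForm x w) e := by
  refine (analyticAt_ldv (holTo_ev he w)).congr ?_
  filter_upwards [(isOpen_chartDom x).mem_nhds he] with e' he'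
  exact (mcForm_eq he' w).symm

theorem analyticAt_Ad_ev {x : Fin p → G} {e : Fin p → E} (he : e ∈ chartDom E x)
    (w : FreeGroup (Fin p)) :
    AnalyticAt ℂ (fun e => (Ad (ev w (param x e)) : E →L[ℂ] E)) e :=
  analyticAt_Ad (holTo_ev he w)

variable (E) in
/-- The matrix entries of the adjoint action of a word. -/
def adEntry (x : Fin p → G) (b c : Fin (Module.finrank ℂ E)) (w : FreeGroup (Fin p))
    (e : Fin p → E) : ℂ :=
  coo E b (Ad (ev w (param x e)) (bas E c))

theorem analyticAt_adEntry {x : Fin p → G} {e : Fin p → E} (he : e ∈ chartDom E x)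
    (b c : Fin (Module.finrank ℂ E)) (w : FreeGroup (Fin p)) :
    AnalyticAt ℂ (adEntry E x b c w) e :=
  ((coo E b).analyticAt _).comp
    (((ContinuousLinearMap.apply ℂ E (bas E c)).analyticAt _).comp (analyticAt_Ad_ev he w))

/-- The components of the forms `Ad(P) dw · w⁻¹`. -/
def slot (x : Fin p → G) (b : Fin (Module.finrank ℂ E)) (P w : FreeGroup (Fin p))
    (e : Fin p → E) : (Fin p → E) →L[ℂ] ℂ :=
  (coo E b).comp ((Ad (ev P (param x e))).comp (mcForm x w e))

theorem analyticAt_slot {x : Fin p → G} {e : Fin p → E} (he : e ∈ chartDom E x)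
    (b : Fin (Module.finrank ℂ E)) (P w : FreeGroup (Fin p)) : AnalyticAt ℂ (slot x b P w) e := by
  have := FiniteDimensional.complete ℂ E
  have h := ((ContinuousLinearMap.compL ℂ (Fin p → E) E E).analyticAt_bilinear _).comp₂
    (analyticAt_Ad_ev he P) (analyticAt_mcForm he w)
  exact ((ContinuousLinearMap.compL ℂ (Fin p → E) E ℂ (coo E b)).analyticAt _).comp h

theorem slot_eq_sum (x : Fin p → G) (b : Fin (Module.finrank ℂ E)) (P w : FreeGroup (Fin p))
    (e : Fin p → E) : slot x b P w e = ∑ c, adEntry E x b c P e • slot x c 1 w e := by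
  ext v
  simp only [slot, adEntry, ContinuousLinearMap.comp_apply, sum_apply,
    smul_apply, ev_one, Ad_one, ContinuousLinearMap.id_apply]
  conv_lhs => rw [← sum_coo_smul (mcForm x w e v)]
  simp [mul_comm]

theorem slot_mul {x : Fin p → G} {e : Fin p → E} (he : e ∈ chartDom E x)
    (b : Fin (Module.finrank ℂ E)) (w w' : FreeGroup (Fin p)) :
    slot x b 1 (w * w') e = slot x b 1 w e + slot x b w w' e := by
  ext v
  simp [slot, ev_one, Ad_one, mcForm_mul he]

/-- Writing `Ad(P) σ(w)` as `σ(Pw) - σ(P)` reduces contraction and Lie derivative to those of `σ`,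
without differentiating `Ad(P)`. -/
theorem slot_eq_sub {x : Fin p → G} {e : Fin p → E} (he : e ∈ chartDom E x)
    (b : Fin (Module.finrank ℂ E)) (P w : FreeGroup (Fin p)) :
    slot x b P w e = (coo E b).comp (mcForm x (P * w) e - mcForm x P e) := by
  ext v
  simp [slot, mcForm_mul he]

theorem slot_conjField {x : Fin p → G} {e : Fin p → E} (he : e ∈ chartDom E x)
    (b : Fin (Module.finrank ℂ E)) (P w : FreeGroup (Fin p)) (v : E) :
    slot x b P w e (conjField x v e) =
      coo E b (Ad (ev P (param x e)) v) - coo E b (Ad (ev (P * w) (param x e)) v) := by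
  rw [slot_eq_sub he, ContinuousLinearMap.comp_apply, sub_apply,
    mcForm_conjField he, mcForm_conjField he, ← map_sub]
  congr 1
  abel

theorem lie_slot {x : Fin p → G} {e : Fin p → E} (he : e ∈ chartDom E x)
    (b : Fin (Module.finrank ℂ E)) (P w : FreeGroup (Fin p)) (v : E) :
    lieForm (conjField x v) (slot x b P w) e =
      ∑ c, coo E b (ad G v (bas E c)) • slot x c P w e := by
  have h1 : slot x b P w =ᶠ[𝓝 e] fun e => (coo E b).comp (mcForm x (P * w) e - mcForm x P e) := by
    filter_upwards [(isOpen_chartDom x).mem_nhds he] with e' he'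
    exact slot_eq_sub he' b P w
  have h2 := (analyticAt_mcForm he (P * w)).differentiableAt.hasFDerivAt.sub
    (analyticAt_mcForm he P).differentiableAt.hasFDerivAt
  have h3 := (ContinuousLinearMap.compL ℂ (Fin p → E) E ℂ (coo E b)).hasFDerivAt.comp e h2
  have h4 : fderiv ℂ (slot x b P w) e (conjField x v e) = (coo E b).comp
      (fderiv ℂ (mcForm x (P * w)) e (conjField x v e) - fderiv ℂ (mcForm x P) e (conjField x v e)) := by
    rw [h1.fderiv_eq]
    exact congrArg (fun T => T (conjField x v e)) h3.fderiv
  have h5 : ∀ w, fderiv ℂ (mcForm x w) e (conjField x v e) = (ad G v).comp (mcForm x w e) -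
      (mcForm x w e).comp (fderiv ℂ (conjField x v) e) := fun w =>
    eq_sub_of_add_eq (lie_mcForm he w v)
  rw [lieForm, h4, h5, h5, slot_eq_sub he]
  ext y
  have h6 : ∀ z : E, coo E b (ad G v z) = ∑ c, coo E b (ad G v (bas E c)) * coo E c z := fun z => by
    conv_lhs => rw [← sum_coo_smul z]
    simp [mul_comm]
  simp only [slot_eq_sub he, add_apply, sub_apply,
    ContinuousLinearMap.comp_apply, sum_apply, smul_apply, map_sub, smul_eq_mul, mul_sub,
    Finset.sum_sub_distrib]
  rw [h6 (mcForm x (P * w) e y), h6 (mcForm x P e y)]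
  ring

/-- The value of the Maurer-Cartan form of a word on the tangent vector of a cocycle. -/
theorem mcForm_tangent {Γ : Type} [Group Γ] (π : FreeGroup (Fin p) →* Γ) (ρ : Γ →* G) {s : Γ → E}
    (hs : ∀ g h, s (g * h) = s g + Ad (ρ g) (s h)) (w : FreeGroup (Fin p)) :
    mcForm (pt π ρ) w (center (pt π ρ)) (tangent π ρ s) = s (π w) := by
  have := FiniteDimensional.complete ℂ E
  set x := pt π ρ with hx
  have he := center_mem (E := E) x
  have h1 : s 1 = 0 := by
    have := hs 1 1
    rw [map_one, Ad_one, mul_one] at this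
    simpa using this
  -- Both sides obey the same cocycle rule in the word, so the claim passes to inverses and products
  -- and only the generators remain.
  have hinv : ∀ w, mcForm x w (center x) (tangent π ρ s) = s (π w) →
      mcForm x w⁻¹ (center x) (tangent π ρ s) = s (π w⁻¹) := fun w hw => by
    have h2 := congrArg (fun T => T (tangent π ρ s)) (mcForm_mul he w⁻¹ w)
    have h3 := hs (π w⁻¹) (π w)
    rw [← map_mul, inv_mul_cancel, map_one, h1] at h3
    simp only [inv_mul_cancel, mcForm_one he, add_apply, ContinuousLinearMap.comp_apply, hw,
      param_center, zero_apply] at h2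
    rw [hx, ev_pt] at h2
    exact add_right_cancel (h2.symm.trans h3)
  induction w using FreeGroup.induction_on with
  | C1 => rw [map_one, h1, mcForm_one he, zero_apply]
  | of i =>
    have h2 : MDifferentiableAt 𝓘(ℂ, E) 𝓘(ℂ, E) (fun h : G => chartAt E (x i) (h * x i)) 1 := by
      have : IsManifold 𝓘(ℂ, E) ω G := isManifold_of_lieGroup
      have h2 : ContMDiffAt 𝓘(ℂ, E) 𝓘(ℂ, E) ω (fun h : G => h * x i) 1 :=
        contMDiffAt_id.mul contMDiffAt_const
      have h3 : (1 : G) * x i ∈ (chartAt E (x i)).source := by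
        rw [one_mul]
        exact mem_chart_source E _
      exact ((contMDiffAt_extChartAt' (I := 𝓘(ℂ, E)) (n := ω) h3).comp 1 h2).mdifferentiableAt (by simp)
    have h3 : tangent π ρ s i = fderiv ℂ (fun ε => chartAt E (x i)
        ((chartAt E (1 : G)).symm ε * x i)) (k1 E G) (s (π (FreeGroup.of i))) :=
      congrArg (fun T : E →L[ℂ] E => T (s (π (FreeGroup.of i)))) (mfderiv_one_eq_fderiv h2)
    have h4 : mcForm x (FreeGroup.of i) (center x) = (ldv E (chartAt E (x i)).symm (center x i)).comp
        (ContinuousLinearMap.proj (R := ℂ) (φ := fun _ : Fin p => E) i) := by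
      rw [mcForm_eq he]
      simp only [ev_of]
      have h5 := ldv_comp (E := E) (u := (chartAt E (x i)).symm) (T := fun e : Fin p → E => e i)
        (holTo_chart_symm (he i)) (analyticAt_apply i (center x))
      refine h5.trans ?_
      congr 1
      exact (ContinuousLinearMap.proj (R := ℂ) (φ := fun _ : Fin p => E) i).fderiv
    have hu : HolTo E (fun ε : E => (chartAt E (1 : G)).symm ε * x i) (k1 E G) :=
      holTo_symm.mul (holTo_const _ _)
    have hux : (chartAt E (1 : G)).symm (k1 E G) * x i = x i := by rw [symm_k1, one_mul]
    -- The curve `h ↦ h xᵢ` has the identity as logarithmic derivative at `h = 1`, and `tangent` is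
    -- its derivative in the chart at `xᵢ`.
    have h6 := ldv_chart hu (g := x i) (by rw [hux]; exact mem_chart_source E _)
    rw [ldv_mul holTo_symm (holTo_const _ _), ldv_const, ldv_symm_one, hux] at h6
    have h7 := congrArg (fun T => T (s (π (FreeGroup.of i)))) h6
    simp only [ContinuousLinearMap.comp_zero, add_zero, ContinuousLinearMap.id_apply] at h7
    rw [h4, ContinuousLinearMap.comp_apply, ContinuousLinearMap.proj_apply, h3]
    exact h7.symm
  | inv_of i h => exact hinv _ h
  | mul v w hv hw =>
    rw [mcForm_mul he, add_apply, ContinuousLinearMap.comp_apply, hv, hw, param_center, map_mul, hs,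
      hx, ev_pt]

/-- The coefficients of the components of `Ad(P) dw · w⁻¹` in terms of the differentials of the
components of `w` in the chart at `g`. -/
def slotFun (g : G) (b j : Fin (Module.finrank ℂ E)) (P w : FreeGroup (Fin p)) (y : Fin p → G) : ℂ :=
  coo E b (Ad (ev P y) (ldv E (chartAt E g).symm (chartAt E g (ev w y)) (bas E j)))

/-- The components of a word in the chart at `g`. -/
def slotCoo (g : G) (j : Fin (Module.finrank ℂ E)) (w : FreeGroup (Fin p)) (y : Fin p → G) : ℂ :=
  coo E j (chartAt E g (ev w y))

theorem holAt_slotFun {g : G} {b j : Fin (Module.finrank ℂ E)} {P w : FreeGroup (Fin p)}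
    {y : Fin p → G} (hy : ev w y ∈ (chartAt E g).source) :
    HolAt (E := E) (slotFun (E := E) g b j P w) y := by
  have := FiniteDimensional.complete ℂ E
  have hw := holTo_ev (center_mem (E := E) y) w
  have hy' : ev w (param y (center (E := E) y)) ∈ (chartAt E g).source := by rwa [param_center]
  have h1 : AnalyticAt ℂ (fun e => ldv E (chartAt E g).symm (chartAt E g (ev w (param y e))))
      (center y) :=
    AnalyticAt.comp (g := ldv E (chartAt E g).symm)
      (analyticAt_ldv (holTo_chart_symm ((chartAt E g).map_source hy'))) (hw.chart hy')
  have h2 := ((ContinuousLinearMap.id ℂ (E →L[ℂ] E)).analyticAt_bilinear _).comp₂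
    (analyticAt_Ad_ev (center_mem (E := E) y) P)
    (((ContinuousLinearMap.apply ℂ E (bas E j)).analyticAt _).comp h1)
  exact ((coo E b).analyticAt _).comp h2

theorem holAt_slotCoo {g : G} {j : Fin (Module.finrank ℂ E)} {w : FreeGroup (Fin p)}
    {y : Fin p → G} (hy : ev w y ∈ (chartAt E g).source) :
    HolAt (E := E) (slotCoo (E := E) g j w) y := by
  have hy' : ev w (param y (center (E := E) y)) ∈ (chartAt E g).source := by rwa [param_center]
  exact ((coo E j).analyticAt _).comp ((holTo_ev (center_mem (E := E) y) w).chart hy')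

/-- The coefficients are functions on all of `G^p` that depend only on the chart at `g`, so one
expression serves at every point whose `w`-value lies in the domain of that chart. -/
theorem formGerm_slot {g : G} (b : Fin (Module.finrank ℂ E)) (P : FreeGroup (Fin p))
    {w : FreeGroup (Fin p)} {y : Fin p → G} (hy : ev w y ∈ (chartAt E g).source) :
    formGerm (center (E := E) y) (slot (E := E) y b P w) =
      ∑ j, holGerm (center (E := E) y) (fun e : Fin p → E => slotFun (E := E) g b j P w (param y e)) •
        formGerm (center (E := E) y) (fderiv ℂ fun e : Fin p → E => slotCoo (E := E) g j w (param y e)) := by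
  have hw := holTo_ev (center_mem (E := E) y) w
  have hy' : ev w (param y (center (E := E) y)) ∈ (chartAt E g).source := by rwa [param_center]
  have hf : ∀ j, AnalyticAt ℂ (fun e : Fin p → E => slotFun (E := E) g b j P w (param y e))
      (center (E := E) y) := fun j => holAt_slotFun hy
  have hc : ∀ j, AnalyticAt ℂ (fderiv ℂ fun e : Fin p → E => slotCoo (E := E) g j w (param y e))
      (center (E := E) y) := fun j => by
    have h : AnalyticAt ℂ (fun e : Fin p → E => slotCoo (E := E) g j w (param y e)) (center (E := E) y) :=
      holAt_slotCoo hy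
    exact h.fderiv
  have ha := fun j => (hf j).fun_smul (hc j)
  have hs := fun j => (formGerm_smul (hf j) (hc j)).symm
  simp only [hs]
  rw [← formGerm_sum _ ha]
  refine formGerm_congr ?_
  filter_upwards [eventually_mem_chartDom (E := E) y, hw.eventually_mem hy'] with e he hge
  have h1 := (holTo_ev he w).chart hge
  have h2 : ∀ j, fderiv ℂ (fun e : Fin p → E => slotCoo (E := E) g j w (param y e)) e =
      (coo E j).comp (fderiv ℂ (fun e => chartAt E g (ev w (param y e))) e) := fun j =>
    ((coo E j).hasFDerivAt.comp e h1.differentiableAt.hasFDerivAt).fderiv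
  ext z
  simp only [h2, sum_apply, smul_apply, slot, ContinuousLinearMap.comp_apply, slotFun]
  rw [mcForm_eq he, ldv_chart (holTo_ev he w) hge, ContinuousLinearMap.comp_apply]
  conv_lhs => rw [← sum_coo_smul (fderiv ℂ (fun e => chartAt E g (ev w (param y e))) e z)]
  simp [mul_comm]

end Slot

/-! ### Polarization of invariant polynomials -/

section Polar

set_option linter.unusedSectionVars false

variable {E G : Type} [NormedAddCommGroup E] [NormedSpace ℂ E] [FiniteDimensional ℂ E]
  [TopologicalSpace G] [ChartedSpace E G] [Group G] [LieGroup 𝓘(ℂ, E) ω G] {n m : ℕ}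

variable (n) in
/-- The symmetric `n`-linear form `φ` with `φ(v, …, v) = Φ(v)` of a homogeneous polynomial `Φ` of
degree `n`. -/
def polar (Φ : E → ℂ) : MultilinearMap ℂ (fun _ : Fin n => E) ℂ :=
  (n.factorial : ℂ)⁻¹ • (iteratedFDeriv ℂ n Φ 0).toMultilinearMap

theorem polar_apply (Φ : E → ℂ) (u : Fin n → E) :
    polar n Φ u = (n.factorial : ℂ)⁻¹ * iteratedFDeriv ℂ n Φ 0 u := rfl

theorem contDiff_invPoly {Φ : E → ℂ} (hΦ : Φ ∈ InvPoly E G n) : ContDiff ℂ ω Φ := by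
  have h := hΦ.1
  clear hΦ
  induction h using Algebra.adjoin_induction with
  | mem f hf =>
    obtain ⟨l, rfl⟩ := hf
    exact l.contDiff
  | algebraMap r => exact contDiff_const
  | add f g _ _ hf hg => exact hf.add hg
  | mul f g _ _ hf hg => exact hf.mul hg

theorem polar_perm {Φ : E → ℂ} (hΦ : Φ ∈ InvPoly E G n) (u : Fin n → E)
    (σ : Equiv.Perm (Fin n)) : polar n Φ (fun k => u (σ k)) = polar n Φ u := by
  rw [polar_apply, polar_apply]
  congr 1
  exact (contDiff_invPoly hΦ).contDiffAt.iteratedFDeriv_comp_perm u σ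

/-- Differentiate `Φ ∘ Ad g = Φ` at 0, which the linear map `Ad g` fixes. -/
theorem polar_Ad {Φ : E → ℂ} (hΦ : Φ ∈ InvPoly E G n) (g : G) (u : Fin n → E) :
    polar n Φ (fun k => Ad g (u k)) = polar n Φ u := by
  rw [polar_apply, polar_apply]
  congr 1
  have h := (Ad g : E →L[ℂ] E).iteratedFDeriv_comp_right (contDiff_invPoly hΦ) 0 (i := n) (by simp)
  have h2 : Φ ∘ (Ad g : E →L[ℂ] E) = Φ := funext fun v => hΦ.2.2 g v
  rw [h2, map_zero] at h
  exact (congrArg (fun T => T u) h).symm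

theorem polar_add {Φ Ψ : E → ℂ} (hΦ : Φ ∈ InvPoly E G n) (hΨ : Ψ ∈ InvPoly E G n) :
    polar n (Φ + Ψ) = polar n Φ + polar n Ψ := by
  have h : ∀ Φ ∈ InvPoly E G n, ContDiffAt ℂ n Φ 0 := fun Φ hΦ =>
    ((contDiff_invPoly hΦ).of_le (by simp)).contDiffAt
  ext u
  rw [polar_apply, iteratedFDeriv_add_apply (h Φ hΦ) (h Ψ hΨ), add_apply, mul_add]
  rfl

theorem polar_smul (c : ℂ) {Φ : E → ℂ} (hΦ : Φ ∈ InvPoly E G n) :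
    polar n (c • Φ) = c • polar n Φ := by
  ext u
  rw [polar_apply, iteratedFDeriv_const_smul_apply
    ((contDiff_invPoly hΦ).of_le (by simp)).contDiffAt, smul_apply, smul_apply, polar_apply,
    smul_eq_mul, smul_eq_mul, mul_left_comm]

/-- Restrict to the line through `v`: by homogeneity `Φ(tv) = tⁿ Φ(v)`, whose `n`-th derivative is
`n! Φ(v)`. -/
theorem polar_self {Φ : E → ℂ} (hΦ : Φ ∈ InvPoly E G n) (v : E) : polar n Φ (fun _ => v) = Φ v := by
  have h := (ContinuousLinearMap.toSpanSingleton ℂ v).iteratedFDeriv_comp_right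
    (contDiff_invPoly hΦ) 0 (i := n) (by simp)
  have h1 : Φ ∘ (ContinuousLinearMap.toSpanSingleton ℂ v) = fun t => Φ v • t ^ n :=
    funext fun t => (hΦ.2.1 t v).trans (mul_comm _ _)
  rw [h1, map_zero] at h
  have h2 := congrArg (fun T => T (fun _ => (1 : ℂ))) h
  have h3 : iteratedDeriv n (fun t : ℂ => Φ v • t ^ n) 0 = Φ v * n.factorial := by
    rw [iteratedDeriv_fun_const_smul_field, iteratedDeriv_fun_pow_zero, if_pos rfl, smul_eq_mul]
  rw [iteratedDeriv_eq_iteratedFDeriv] at h3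
  rw [polar_apply]
  have h4 : iteratedFDeriv ℂ n Φ 0 (fun _ => v) = Φ v * n.factorial := by
    rw [← h3]
    refine Eq.trans ?_ h2.symm
    simp
  rw [h4, mul_comm, mul_assoc, mul_inv_cancel₀ (by exact_mod_cast n.factorial_ne_zero), mul_one]

/-- The product of two multilinear forms. -/
def tprodForm (φ : E [×n]→L[ℂ] ℂ) (ψ : E [×m]→L[ℂ] ℂ) : E [×(n + m)]→L[ℂ] ℂ where
  toMultilinearMap := ((LinearMap.mul' ℂ ℂ).compMultilinearMap
    (φ.toMultilinearMap.domCoprod ψ.toMultilinearMap)).domDomCongr finSumFinEquiv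
  cont := by
    change Continuous fun u : Fin (n + m) → E =>
      φ (fun k => u (Fin.castAdd m k)) * ψ (fun k => u (Fin.natAdd n k))
    exact (φ.cont.comp (by fun_prop)).mul (ψ.cont.comp (by fun_prop))

/-- The product is the restriction to the diagonal of an `(n + m)`-linear form, and the top
derivative of such a restriction is the sum of the form over all orders of its arguments. -/
theorem polar_mul {Φ Ψ : E → ℂ} (hΦ : Φ ∈ InvPoly E G n) (hΨ : Ψ ∈ InvPoly E G m)
    (u : Fin (n + m) → E) : polar (n + m) (Φ * Ψ) u = ((n + m).factorial : ℂ)⁻¹ *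
      ∑ σ : Equiv.Perm (Fin (n + m)), polar n Φ (fun k => u (σ (Fin.castAdd m k))) *
        polar m Ψ (fun k => u (σ (Fin.natAdd n k))) := by
  set f := tprodForm ((n.factorial : ℂ)⁻¹ • iteratedFDeriv ℂ n Φ 0)
    ((m.factorial : ℂ)⁻¹ • iteratedFDeriv ℂ m Ψ 0)
  have h : Φ * Ψ = fun v => f fun _ => v := funext fun v => by
    change Φ v * Ψ v = polar n Φ (fun _ => v) * polar m Ψ (fun _ => v)
    rw [polar_self hΦ, polar_self hΨ]
  rw [polar_apply, h, f.iteratedFDeriv_comp_diagonal]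
  rfl

theorem polar_one (u : Fin 0 → E) : polar 0 (1 : E → ℂ) u = 1 := by
  rw [polar_apply]
  simp

/-- The infinitesimal form of the invariance of a polynomial. -/
theorem sum_polar_ad {Φ : E → ℂ} (hΦ : Φ ∈ InvPoly E G n) (v : E) (u : Fin n → E) :
    ∑ k, polar n Φ (Function.update u k (ad G v (u k))) = 0 := by
  have := FiniteDimensional.complete ℂ E
  set f := iteratedFDeriv ℂ n Φ 0 with hf
  have hA : AnalyticAt ℂ (fun ε => (Ad ((chartAt E (1 : G)).symm ε) : E →L[ℂ] E)) (k1 E G) :=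
    analyticAt_Ad holTo_symm
  have hk : ∀ k, HasFDerivAt (fun ε => (Ad ((chartAt E (1 : G)).symm ε) : E →L[ℂ] E) (u k))
      ((ContinuousLinearMap.apply ℂ E (u k)).comp (fderiv ℂ (fun ε =>
        (Ad ((chartAt E (1 : G)).symm ε) : E →L[ℂ] E)) (k1 E G))) (k1 E G) := fun k =>
    (ContinuousLinearMap.apply ℂ E (u k)).hasFDerivAt.comp _ hA.differentiableAt.hasFDerivAt
  have h1 := HasFDerivAt.multilinear_comp f hk
  -- By invariance the function is constant, so its derivative, a sum over the slots, vanishes.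
  have h2 : (fun ε => f fun k => (Ad ((chartAt E (1 : G)).symm ε) : E →L[ℂ] E) (u k)) =
      fun _ => f u := by
    funext ε
    have h := polar_Ad hΦ ((chartAt E (1 : G)).symm ε) u
    rw [polar_apply, polar_apply] at h
    exact mul_left_cancel₀ (inv_ne_zero (by exact_mod_cast n.factorial_ne_zero)) h
  rw [h2] at h1
  have h3 := congrArg (fun T => T v) (h1.unique (hasFDerivAt_const (f u) (k1 E G)))
  simp only [sum_apply, zero_apply, ContinuousLinearMap.comp_apply,
    ContinuousLinearMap.apply_apply, symm_k1, Ad_one, ContinuousLinearMap.id_apply] at h3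
  simp only [polar_apply, ← Finset.mul_sum]
  refine mul_eq_zero_of_right _ (Eq.trans ?_ h3)
  rfl

end Polar

/-! ### Multilinear forms with values in an algebra -/

section PolyProd

variable {E A : Type} [NormedAddCommGroup E] [NormedSpace ℂ E] [FiniteDimensional ℂ E]
  [Ring A] [Algebra ℂ A] {n : ℕ}

/-- The extension of an `n`-linear form on `E` to vectors with coefficients in an algebra. -/
def polyProd (A : Type) [Ring A] [Algebra ℂ A] (F : MultilinearMap ℂ (fun _ : Fin n => E) ℂ) :
    MultilinearMap ℂ (fun _ : Fin n => Fin (Module.finrank ℂ E) → A) A :=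
  ∑ b : Fin n → Fin (Module.finrank ℂ E), (F fun k => bas E (b k)) •
    (MultilinearMap.mkPiAlgebraFin ℂ n A).compLinearMap fun k => LinearMap.proj (b k)

theorem polyProd_apply (F : MultilinearMap ℂ (fun _ : Fin n => E) ℂ)
    (u : Fin n → Fin (Module.finrank ℂ E) → A) : polyProd A F u =
      ∑ b : Fin n → Fin (Module.finrank ℂ E), (F fun k => bas E (b k)) •
        (List.ofFn fun k => u k (b k)).prod := by
  rw [polyProd, sum_apply]
  rfl

theorem polyProd_add (F F' : MultilinearMap ℂ (fun _ : Fin n => E) ℂ) :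
    polyProd A (F + F') = polyProd A F + polyProd A F' := by
  simp only [polyProd, add_apply, add_smul, Finset.sum_add_distrib]

theorem polyProd_smul (c : ℂ) (F : MultilinearMap ℂ (fun _ : Fin n => E) ℂ) :
    polyProd A (c • F) = c • polyProd A F := by
  simp only [polyProd, smul_apply, smul_assoc, Finset.smul_sum]

theorem polyProd_zero : polyProd A (0 : MultilinearMap ℂ (fun _ : Fin n => E) ℂ) = 0 := by
  have := polyProd_smul (A := A) 0 (0 : MultilinearMap ℂ (fun _ : Fin n => E) ℂ)
  rwa [zero_smul, zero_smul] at this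

theorem polyProd_sum {ι : Type*} (s : Finset ι) (F : ι → MultilinearMap ℂ (fun _ : Fin n => E) ℂ) :
    polyProd A (∑ i ∈ s, F i) = ∑ i ∈ s, polyProd A (F i) := by
  classical
  induction s using Finset.induction_on with
  | empty => simpa using polyProd_zero
  | insert i s hi ih => rw [Finset.sum_insert hi, Finset.sum_insert hi, polyProd_add, ih]

theorem map_polyProd {B : Type} [Ring B] [Algebra ℂ B] (f : A →ₐ[ℂ] B)
    (F : MultilinearMap ℂ (fun _ : Fin n => E) ℂ) (u : Fin n → Fin (Module.finrank ℂ E) → A) :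
    f (polyProd A F u) = polyProd B F fun k b => f (u k b) := by
  rw [polyProd_apply, polyProd_apply, map_sum]
  refine Finset.sum_congr rfl fun b _ => ?_
  rw [map_smul, map_list_prod, List.map_ofFn]
  rfl

/-- The matrix coefficients are central and can be collected in front of the ordered product, so an
identity of scalar components in `O` extends to vectors with entries in `A`. -/
theorem polyProd_mulVec {O : Type} [CommRing O] [Algebra ℂ O] [Algebra O A] [IsScalarTower ℂ O A]
    {F F' : MultilinearMap ℂ (fun _ : Fin n => E) ℂ}
    (M : Fin n → Fin (Module.finrank ℂ E) → Fin (Module.finrank ℂ E) → O)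
    (h : ∀ c : Fin n → Fin (Module.finrank ℂ E),
      ∑ b : Fin n → Fin (Module.finrank ℂ E), algebraMap ℂ O (F fun k => bas E (b k)) *
        ∏ k, M k (b k) (c k) = algebraMap ℂ O (F' fun k => bas E (c k)))
    (u : Fin n → Fin (Module.finrank ℂ E) → A) :
    polyProd A F (fun k b => ∑ c, M k b c • u k c) = polyProd A F' u := by
  have key : ∀ b : Fin n → Fin (Module.finrank ℂ E),
      (List.ofFn fun k => ∑ c, M k (b k) c • u k c).prod =
      ∑ c : Fin n → Fin (Module.finrank ℂ E), (∏ k, M k (b k) (c k)) •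
        (List.ofFn fun k => u k (c k)).prod := fun b => by
    have h1 := (MultilinearMap.mkPiAlgebraFin O n A).map_sum fun k c => M k (b k) c • u k c
    simp only [MultilinearMap.map_smul_univ, MultilinearMap.mkPiAlgebraFin_apply] at h1
    exact h1
  simp only [polyProd_apply, key, Finset.smul_sum]
  rw [Finset.sum_comm]
  refine Finset.sum_congr rfl fun c _ => ?_
  rw [← algebraMap_smul O (F' fun k => bas E (c k)), ← h c, Finset.sum_smul]
  refine Finset.sum_congr rfl fun b _ => ?_
  rw [mul_smul, algebraMap_smul]

theorem polyProd_update_comp (F : MultilinearMap ℂ (fun _ : Fin n => E) ℂ) (T : E →ₗ[ℂ] E)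
    (k : Fin n) (u : Fin n → Fin (Module.finrank ℂ E) → A) :
    polyProd A F (Function.update u k fun b => ∑ c, coo E b (T (bas E c)) • u k c) =
      polyProd A (F.compLinearMap (Function.update (fun _ => LinearMap.id) k T)) u := by
  set T' : Fin n → E →ₗ[ℂ] E := Function.update (fun _ => LinearMap.id) k T
  have h1 := polyProd_mulVec (O := ℂ) (A := A) (F := F) (F' := F.compLinearMap T')
    (fun k b c => coo E b (T' k (bas E c))) (fun c => ?_) u
  · rw [← h1]
    congr 1
    funext j b
    by_cases hj : j = k
    · subst hj
      rw [Function.update_self]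
      simp only [T', Function.update_self]
    · rw [Function.update_of_ne hj]
      simp only [T', Function.update_of_ne hj, LinearMap.id_apply]
      have : ∀ c, coo E b (bas E c) = if b = c then 1 else 0 := fun c => by
        change (bas E).coord b (bas E c) = _
        rw [Module.Basis.coord_apply, Module.Basis.repr_self, Finsupp.single_apply]
        simp only [eq_comm]
      simp [this]
  · have h2 := F.map_sum fun k b => coo E b (T' k (bas E (c k))) • bas E b
    simp only [MultilinearMap.map_smul_univ, sum_coo_smul] at h2
    refine Eq.trans ?_ h2.symm
    simp only [Algebra.algebraMap_self, RingHom.id_apply, smul_eq_mul, mul_comm]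

theorem sum_polyProd_update {F : MultilinearMap ℂ (fun _ : Fin n => E) ℂ} {T : E →ₗ[ℂ] E}
    (hT : ∀ u, ∑ k, F (Function.update u k (T (u k))) = 0)
    (u : Fin n → Fin (Module.finrank ℂ E) → A) :
    ∑ k, polyProd A F (Function.update u k fun b => ∑ c, coo E b (T (bas E c)) • u k c) = 0 := by
  simp only [polyProd_update_comp]
  rw [← sum_apply, ← polyProd_sum]
  have : ∑ k, F.compLinearMap (Function.update (fun _ => LinearMap.id) k T) = 0 := by
    ext v
    rw [sum_apply, zero_apply, ← hT v]
    refine Finset.sum_congr rfl fun k _ => ?_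
    rw [MultilinearMap.compLinearMap_apply]
    congr 1
    funext j
    by_cases hj : j = k
    · subst hj
      simp
    · simp [Function.update_of_ne hj]
  rw [this, polyProd_zero, zero_apply]

theorem polyProd_update (F : MultilinearMap ℂ (fun _ : Fin n => E) ℂ)
    (u : Fin n → Fin (Module.finrank ℂ E) → A) (k : Fin n) (w : Fin (Module.finrank ℂ E) → A) :
    polyProd A F (Function.update u k w) = ∑ b : Fin n → Fin (Module.finrank ℂ E),
      (F fun k => bas E (b k)) •
        (List.ofFn (Function.update (fun j => u j (b j)) k (w (b k)))).prod := by
  rw [polyProd_apply]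
  refine Finset.sum_congr rfl fun b _ => ?_
  congr 3
  funext j
  by_cases hj : j = k
  · subst hj
    simp
  · simp [Function.update_of_ne hj]

omit [Algebra ℂ A] in
theorem list_prod_update_zero (a : Fin (n + 1) → A) (x : A) :
    (List.ofFn (Function.update a 0 x)).prod = x * (List.ofFn fun k => a k.succ).prod := by
  simp [List.ofFn_succ]

omit [Algebra ℂ A] in
theorem list_prod_update_succ (a : Fin (n + 1) → A) (k : Fin n) (x : A) :
    (List.ofFn (Function.update a k.succ x)).prod =
      a 0 * (List.ofFn (Function.update (fun k => a k.succ) k x)).prod := by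
  rw [List.ofFn_succ, List.prod_cons, Function.update_of_ne (Fin.succ_ne_zero k).symm]
  congr 3
  funext j
  by_cases hj : j = k
  · subst hj
    simp
  · rw [Function.update_of_ne fun h => hj (Fin.succ_injective _ h), Function.update_of_ne hj]

omit [Algebra ℂ A] in
/-- The derivative of a product. -/
theorem leibniz_list_prod (D : A → A) (h1 : D 1 = 0) (hD : ∀ x y, D (x * y) = D x * y + x * D y)
    (a : Fin n → A) : D (List.ofFn a).prod =
      ∑ k, (List.ofFn (Function.update a k (D (a k)))).prod := by
  induction n with
  | zero => simpa using h1
  | succ n ih =>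
    rw [List.ofFn_succ, List.prod_cons, hD, ih, Fin.sum_univ_succ, list_prod_update_zero,
      Finset.mul_sum]
    simp only [list_prod_update_succ]

end PolyProd

/-! ### Contraction and Lie derivative of multilinear expressions in 1-forms -/

section ExteriorPolyProd

variable {E O M I : Type} [NormedAddCommGroup E] [NormedSpace ℂ E] [FiniteDimensional ℂ E]
  [CommRing O] [Algebra ℂ O] [AddCommGroup M] [Module O M] [Module ℂ M] [IsScalarTower ℂ O M]
  [Fintype I] {n : ℕ}

omit [Algebra ℂ O] [Module ℂ M] [IsScalarTower ℂ O M] in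
theorem con_list_prod (X : M →ₗ[O] O) (θ : Fin n → M) :
    FormSystem.con X (List.ofFn fun k => ExteriorAlgebra.ι O (θ k)).prod =
      ∑ k : Fin n, (-1 : ℤ) ^ (k : ℕ) • (List.ofFn (Function.update
        (fun k => ExteriorAlgebra.ι O (θ k)) k (algebraMap O _ (X (θ k))))).prod := by
  induction n with
  | zero =>
    simp
  | succ n ih =>
    rw [List.ofFn_succ, List.prod_cons, FormSystem.con_ι_mul, ih, Fin.sum_univ_succ,
      list_prod_update_zero, Finset.mul_sum, sub_eq_add_neg, ← Finset.sum_neg_distrib]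
    simp only [list_prod_update_succ, Fin.val_zero, pow_zero, one_smul, Fin.val_succ, pow_succ,
      mul_neg, mul_one, neg_smul, mul_smul_comm]

theorem con_polyProd (X : M →ₗ[O] O) (F : MultilinearMap ℂ (fun _ : Fin n => E) ℂ)
    (θ : Fin n → Fin (Module.finrank ℂ E) → M) :
    FormSystem.con X (polyProd (ExteriorAlgebra O M) F fun k b => ExteriorAlgebra.ι O (θ k b)) =
      ∑ k : Fin n, (-1 : ℤ) ^ (k : ℕ) • polyProd (ExteriorAlgebra O M) F
        (Function.update (fun k b => ExteriorAlgebra.ι O (θ k b)) k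
          fun b => algebraMap O _ (X (θ k b))) := by
  simp only [polyProd_update]
  rw [polyProd_apply, map_sum]
  simp only [LinearMap.map_smul_of_tower, con_list_prod, Finset.smul_sum]
  rw [Finset.sum_comm]
  exact Finset.sum_congr rfl fun k _ => Finset.sum_congr rfl fun b _ => smul_comm _ _ _

theorem lie_polyProd (S : FormSystem O M I) (X : M →ₗ[O] O)
    (F : MultilinearMap ℂ (fun _ : Fin n => E) ℂ)
    (u : Fin n → Fin (Module.finrank ℂ E) → ExteriorAlgebra O M) :
    S.lie X (polyProd (ExteriorAlgebra O M) F u) = ∑ k : Fin n, polyProd (ExteriorAlgebra O M) F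
        (Function.update u k fun b => S.lie X (u k b)) := by
  have h1 : S.lie X 1 = 0 := by
    have h := S.lie_mul X 1 1
    rw [mul_one, mul_one, one_mul] at h
    exact left_eq_add.1 h
  have h2 : ∀ c : ℂ, ∀ x, S.lie X (c • x) = c • S.lie X x := fun c x => by
    simp only [FormSystem.lie, map_smul, LinearMap.map_smul_of_tower, smul_add]
  have h3 : ∀ (s : Finset (Fin n → Fin (Module.finrank ℂ E))) (x : _ → ExteriorAlgebra O M),
      S.lie X (∑ b ∈ s, x b) = ∑ b ∈ s, S.lie X (x b) := fun s x => by
    simp only [FormSystem.lie, map_sum, Finset.sum_add_distrib]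
  simp only [polyProd_update]
  rw [polyProd_apply]
  simp only [h3, h2, leibniz_list_prod _ h1 (S.lie_mul X), Finset.smul_sum]
  rw [Finset.sum_comm]

end ExteriorPolyProd

/-! ### The stalks of the sheaf of forms on `Hom(Γ, G)` -/

section Stalk

set_option linter.unusedSectionVars false

variable {E G Γ : Type} [NormedAddCommGroup E] [NormedSpace ℂ E] [FiniteDimensional ℂ E]
  [TopologicalSpace G] [ChartedSpace E G] [Group G] [LieGroup 𝓘(ℂ, E) ω G] [Group Γ] {p : ℕ}
  (π : FreeGroup (Fin p) →* Γ) (ρ : Γ →* G)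

theorem res_surjective : Function.Surjective (res (E := E) π ρ) := RingQuot.mkAlgHom_surjective ℂ _

variable {π ρ} in
theorem res_eq_zero {x : DR (center (E := E) (pt π ρ))} (h : StalkRel π ρ x 0) : res π ρ x = 0 := by
  have h1 := RingQuot.mkAlgHom_rel ℂ h
  rw [map_zero] at h1
  exact h1

instance : Algebra (HolGerm (center (E := E) (pt π ρ))) (Stalk E π ρ) :=
  RingHom.toAlgebra' ((res π ρ).toRingHom.comp (algebraMap _ _)) fun f x => by
    obtain ⟨x, rfl⟩ := res_surjective π ρ x
    change res π ρ (algebraMap _ _ f) * res π ρ x = res π ρ x * res π ρ (algebraMap _ _ f)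
    rw [← map_mul, Algebra.commutes, map_mul]

instance (a : Fin p → E) : SMul (HolGerm a) (DR a) := Algebra.toSMul

theorem res_algebraMap (f : HolGerm (center (E := E) (pt π ρ))) :
    res π ρ (algebraMap _ _ f) = algebraMap _ (Stalk E π ρ) f := rfl

instance : IsScalarTower ℂ (HolGerm (center (E := E) (pt π ρ))) (Stalk E π ρ) :=
  IsScalarTower.of_algebraMap_eq fun z => by
    rw [← res_algebraMap, ← IsScalarTower.algebraMap_apply, AlgHom.commutes]

theorem res_smul (f : HolGerm (center (E := E) (pt π ρ))) (x : DR (center (E := E) (pt π ρ))) :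
    res π ρ (f • x) = f • res π ρ x := by
  rw [Algebra.smul_def, Algebra.smul_def, map_mul, res_algebraMap]

theorem analyticAt_comp_ev {f : G → ℂ} {w : FreeGroup (Fin p)} (hw : π w = 1)
    (hf : AnalyticAt ℂ (fun e : E => f ((chartAt E (1 : G)).symm e)) (chartAt E (1 : G) 1)) :
    AnalyticAt ℂ (fun e : Fin p → E => f (ev w (param (pt π ρ) e))) (center (pt π ρ)) := by
  have h1 := holTo_ev (center_mem (E := E) (pt π ρ)) w
  have h2 : ev w (param (pt π ρ) (center (E := E) (pt π ρ))) = 1 := by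
    rw [param_center, ev_pt, hw, map_one]
  have h3 : ev w (param (pt π ρ) (center (E := E) (pt π ρ))) ∈ (chartAt E (1 : G)).source := by
    rw [h2]
    exact mem_chart_source E _
  have h4 : AnalyticAt ℂ (fun e => chartAt E (1 : G) (ev w (param (pt π ρ) e)))
    (center (E := E) (pt π ρ)) := h1.chart h3
  rw [← h2] at hf
  refine (AnalyticAt.comp (g := fun e : E => f ((chartAt E (1 : G)).symm e)) ?_ h4).congr ?_
  · rw [h2] at hf ⊢
    exact hf
  · filter_upwards [h1.eventually_mem h3] with e he
    simp only [Function.comp_apply, (chartAt E (1 : G)).left_inv he]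

/-- The homomorphism `x ↦ !![x̄, dx; 0, x]` for forms on `Hom(Γ, G)`. -/
def matStalk : Stalk E π ρ →ₐ[ℂ] Matrix (Fin 2) (Fin 2) (Stalk E π ρ) :=
  RingQuot.liftAlgHom ℂ ⟨(res π ρ).mapMatrix.comp (formSystem _).dHom, by
    -- The entries of `dHom` at a relation are, up to sign, the function `f ∘ w`, its differential,
    -- or zero, so all of them restrict to zero. Hence `d` and the grade involution descend.
    rintro _ _ (⟨w, f, hw, h1, hf⟩ | ⟨w, f, hw, h1, hf⟩)
    · have h2 := res_eq_zero (StalkRel.zero (ρ := ρ) w f hw h1 hf)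
      have h3 := res_eq_zero (StalkRel.dzero (ρ := ρ) w f hw h1 hf)
      rw [← dFun_holGerm (analyticAt_comp_ev π ρ hw hf)] at h3
      rw [map_zero, AlgHom.comp_apply, FormSystem.dHom_c]
      ext i j
      fin_cases i <;> fin_cases j
      · exact h2
      · exact h3
      · exact map_zero (res π ρ)
      · exact h2
    · have h3 := res_eq_zero (StalkRel.dzero (ρ := ρ) w f hw h1 hf)
      rw [← dFun_holGerm (analyticAt_comp_ev π ρ hw hf)] at h3 ⊢
      rw [map_zero, AlgHom.comp_apply, FormSystem.dHom_ι]
      ext i j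
      fin_cases i <;> fin_cases j
      · exact (map_neg (res π ρ) _).trans (neg_eq_zero.2 h3)
      · exact (congrArg (res π ρ) (FormSystem.dForm_d (formSystem _) _)).trans (map_zero (res π ρ))
      · exact map_zero (res π ρ)
      · exact h3⟩

/-- The exterior derivative on the stalks. -/
def dStalk : Stalk E π ρ →ₗ[ℂ] Stalk E π ρ :=
  Matrix.entryLinearMap ℂ (Stalk E π ρ) 0 1 ∘ₗ (matStalk π ρ).toLinearMap

/-- The grade involution on the stalks. -/
def barStalk : Stalk E π ρ →ₗ[ℂ] Stalk E π ρ :=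
  Matrix.entryLinearMap ℂ (Stalk E π ρ) 0 0 ∘ₗ (matStalk π ρ).toLinearMap

theorem matStalk_res (x : DR (center (E := E) (pt π ρ))) :
    matStalk π ρ (res π ρ x) = (res π ρ).mapMatrix ((formSystem _).dHom x) :=
  RingQuot.liftAlgHom_mkAlgHom_apply ℂ _ _ _

theorem dStalk_res (x : DR (center (E := E) (pt π ρ))) :
    dStalk π ρ (res π ρ x) = res π ρ (dr _ x) :=
  congrArg (fun M : Matrix (Fin 2) (Fin 2) (Stalk E π ρ) => M 0 1) (matStalk_res π ρ x)

theorem barStalk_res (x : DR (center (E := E) (pt π ρ))) :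
    barStalk π ρ (res π ρ x) = res π ρ ((formSystem _).bar x) :=
  congrArg (fun M : Matrix (Fin 2) (Fin 2) (Stalk E π ρ) => M 0 0) (matStalk_res π ρ x)

end Stalk

/-! ### The tautological cocycle on the stalks -/

section Tautological

set_option linter.unusedSectionVars false

theorem holGerm_prod {V ι : Type} [NormedAddCommGroup V] [NormedSpace ℂ V] {a : V} (s : Finset ι)
    {f : ι → V → ℂ} (hf : ∀ i, AnalyticAt ℂ (f i) a) :
    holGerm a (fun e => ∏ i ∈ s, f i e) = ∏ i ∈ s, holGerm a (f i) := by
  classical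
  induction s using Finset.induction_on with
  | empty => simpa using holGerm_one
  | insert i s hi ih =>
    simp only [Finset.prod_insert hi]
    rw [holGerm_mul (hf i) (Finset.analyticAt_fun_prod s fun j _ => hf j), ih]

variable {E G Γ : Type} [NormedAddCommGroup E] [NormedSpace ℂ E] [FiniteDimensional ℂ E]
  [TopologicalSpace G] [ChartedSpace E G] [Group G] [LieGroup 𝓘(ℂ, E) ω G] [Group Γ] {p : ℕ}

theorem coo_bas (b c : Fin (Module.finrank ℂ E)) : coo E b (bas E c) = if b = c then 1 else 0 := by
  change (bas E).coord b (bas E c) = _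
  rw [Module.Basis.coord_apply, Module.Basis.repr_self, Finsupp.single_apply]
  simp only [eq_comm]

theorem sum_adEntry_mul (x : Fin p → G) (b c : Fin (Module.finrank ℂ E))
    (w w' : FreeGroup (Fin p)) (e : Fin p → E) :
    adEntry E x b c (w * w') e = ∑ a, adEntry E x b a w e * adEntry E x a c w' e := by
  simp only [adEntry, ev_mul, Ad_mul, ContinuousLinearMap.comp_apply]
  conv_lhs => rw [← sum_coo_smul (Ad (ev w' (param x e)) (bas E c))]
  simp [mul_comm]

/-- The germ of a matrix entry of the adjoint action of a word. -/
def adGerm (x : Fin p → G) (b c : Fin (Module.finrank ℂ E)) (w : FreeGroup (Fin p)) :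
    HolGerm (center (E := E) x) :=
  holGerm (center (E := E) x) (adEntry E x b c w)

theorem adGerm_mul (x : Fin p → G) (b c : Fin (Module.finrank ℂ E)) (w w' : FreeGroup (Fin p)) :
    adGerm x b c (w * w') = ∑ a, adGerm x b a w * adGerm x a c w' := by
  have h := fun b c w => analyticAt_adEntry (center_mem (E := E) x) b c w
  simp only [adGerm, ← holGerm_mul (h _ _ _) (h _ _ _)]
  rw [← holGerm_sum _ fun a => (h b a w).fun_mul (h a c w')]
  exact congrArg _ (funext fun e => sum_adEntry_mul x b c w w' e)

/-- The germ of a component of `Ad(P) dw · w⁻¹`. -/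
def slotGerm (x : Fin p → G) (b : Fin (Module.finrank ℂ E)) (P w : FreeGroup (Fin p)) :
    FormGerm (center (E := E) x) :=
  formGerm (center (E := E) x) (slot x b P w)

theorem slotGerm_eq_sum (x : Fin p → G) (b : Fin (Module.finrank ℂ E)) (P w : FreeGroup (Fin p)) :
    slotGerm x b P w = ∑ c, adGerm x b c P • slotGerm x c 1 w := by
  have h := fun b c => analyticAt_adEntry (center_mem (E := E) x) b c P
  have h' := fun b => analyticAt_slot (center_mem (E := E) x) b 1 w
  have h2 := fun c => (formGerm_smul (h b c) (h' c)).symm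
  simp only [slotGerm, adGerm, h2]
  rw [← formGerm_sum _ fun c => (h b c).fun_smul (h' c)]
  exact congrArg _ (funext fun e => slot_eq_sum x b P w e)

theorem slotGerm_mul (x : Fin p → G) (b : Fin (Module.finrank ℂ E)) (w w' : FreeGroup (Fin p)) :
    slotGerm x b 1 (w * w') = slotGerm x b 1 w + slotGerm x b w w' := by
  have h' := fun P w => analyticAt_slot (center_mem (E := E) x) b P w
  rw [slotGerm, slotGerm, slotGerm, ← formGerm_add (h' _ _) (h' _ _)]
  refine formGerm_congr ?_
  filter_upwards [eventually_mem_chartDom (E := E) x] with e he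
  exact slot_mul he b w w'

variable (E) in
/-- The components of the `𝔤`-valued form `dw · w⁻¹`. -/
def wordVec (x : Fin p → G) (P w : FreeGroup (Fin p)) (b : Fin (Module.finrank ℂ E)) :
    DR (center (E := E) x) :=
  ExteriorAlgebra.ι _ (slotGerm x b P w)

theorem etaForm_eq (x : Fin p → G) {n : ℕ} (Φ : E → ℂ) (w : Fin n → FreeGroup (Fin p)) :
    etaForm x Φ w = polyProd (DR (center (E := E) x)) (polar n Φ) fun k =>
      wordVec E x (prefixProd w k) (w k) := by
  rw [polyProd_apply]
  rfl

variable (π : FreeGroup (Fin p) →* Γ) (ρ : Γ →* G)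

variable (E) in
/-- Vectors with components in the stalk. -/
abbrev StalkVec : Type := Fin (Module.finrank ℂ E) → Stalk E π ρ

variable (E) in
/-- The adjoint action of a word on vectors with components in the stalk. -/
def wordAct (w : FreeGroup (Fin p)) : Module.End ℂ (StalkVec E π ρ) where
  toFun u b := ∑ c, adGerm (pt π ρ) b c w • u c
  map_add' u v := by
    funext b
    simp only [Pi.add_apply, smul_add, Finset.sum_add_distrib]
  map_smul' z u := by
    funext b
    simp only [Pi.smul_apply, RingHom.id_apply, Finset.smul_sum]
    exact Finset.sum_congr rfl fun c _ => smul_comm _ _ _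

theorem wordAct_apply (w : FreeGroup (Fin p)) (u : StalkVec E π ρ) (b : Fin (Module.finrank ℂ E)) :
    wordAct E π ρ w u b = ∑ c, adGerm (pt π ρ) b c w • u c := rfl

theorem wordAct_mul (w w' : FreeGroup (Fin p)) :
    wordAct E π ρ (w * w') = wordAct E π ρ w * wordAct E π ρ w' := by
  refine LinearMap.ext fun u => funext fun b => ?_
  simp only [Module.End.mul_apply, wordAct_apply, adGerm_mul, Finset.sum_smul, Finset.smul_sum,
    mul_smul]
  exact Finset.sum_comm

/-- The entry of `Ad` minus its value at 1 is a function on `G` vanishing at 1, so its pullback by a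
word in the kernel is a relation. -/
theorem algebraMap_adGerm {w : FreeGroup (Fin p)} (hw : π w = 1)
    (b c : Fin (Module.finrank ℂ E)) :
    algebraMap _ (Stalk E π ρ) (adGerm (pt π ρ) b c w) = if b = c then 1 else 0 := by
  set f : G → ℂ := fun g => coo E b (Ad g (bas E c)) - if b = c then 1 else 0 with hf
  have hf1 : f 1 = 0 := by
    simp only [hf, Ad_one, ContinuousLinearMap.id_apply, coo_bas, sub_self]
  have hfa : AnalyticAt ℂ (fun e : E => f ((chartAt E (1 : G)).symm e)) (chartAt E (1 : G) 1) :=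
    (((coo E b).analyticAt _).comp (((ContinuousLinearMap.apply ℂ E (bas E c)).analyticAt _).comp
      (analyticAt_Ad (E := E) (G := G) holTo_symm))).sub analyticAt_const
  have h1 := res_eq_zero (StalkRel.zero (ρ := ρ) w f hw hf1 hfa)
  have h2 : adGerm (E := E) (pt π ρ) b c w = holGerm (center (E := E) (pt π ρ))
      (fun e => f (ev w (param (pt π ρ) e))) + algebraMap ℂ _ (if b = c then 1 else 0) := by
    rw [← holGerm_const, ← holGerm_add (analyticAt_comp_ev π ρ hw hfa) analyticAt_const]
    refine congrArg _ (funext fun e => ?_)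
    simp only [adEntry, hf]
    ring
  rw [res_algebraMap] at h1
  rw [h2, map_add, h1, zero_add, ← IsScalarTower.algebraMap_apply]
  split_ifs <;> simp

theorem wordAct_eq_one {w : FreeGroup (Fin p)} (hw : π w = 1) : wordAct E π ρ w = 1 := by
  refine LinearMap.ext fun u => funext fun b => ?_
  simp only [wordAct_apply, Algebra.smul_def, algebraMap_adGerm π ρ hw]
  simp

theorem wordAct_congr {w w' : FreeGroup (Fin p)} (h : π w = π w') :
    wordAct E π ρ w = wordAct E π ρ w' := by
  have h1 : wordAct E π ρ (w' * (w'⁻¹ * w)) = wordAct E π ρ w' := by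
    rw [wordAct_mul, wordAct_eq_one π ρ (w := w'⁻¹ * w) (by simp [h]), mul_one]
  rwa [mul_inv_cancel_left] at h1

variable (E) in
/-- The tautological cocycle, as a function of a word. -/
def wordForm (w : FreeGroup (Fin p)) : StalkVec E π ρ := fun b => res π ρ (wordVec E (pt π ρ) 1 w b)

theorem res_wordVec (P w : FreeGroup (Fin p)) (b : Fin (Module.finrank ℂ E)) :
    res π ρ (wordVec E (pt π ρ) P w b) = wordAct E π ρ P (wordForm E π ρ w) b := by
  rw [wordVec, slotGerm_eq_sum, map_sum, map_sum]
  simp only [map_smul, res_smul]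
  rfl

theorem wordForm_mul (w w' : FreeGroup (Fin p)) :
    wordForm E π ρ (w * w') = wordForm E π ρ w + wordAct E π ρ w (wordForm E π ρ w') := by
  funext b
  rw [Pi.add_apply, ← res_wordVec, wordForm, wordVec, slotGerm_mul, map_add, map_add]
  rfl

/-- Near `ρ`, the components of `dw · w⁻¹` are combinations of differentials of chart coordinates of
`w`. Subtracting the coordinates of 1 does not change the differentials and turns them into
relations. -/
theorem wordForm_eq_zero {w : FreeGroup (Fin p)} (hw : π w = 1) : wordForm E π ρ w = 0 := by
  have h0 : ev w (pt π ρ) = 1 := by rw [ev_pt, hw, map_one]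
  have h1 : ev w (pt π ρ) ∈ (chartAt E (1 : G)).source := by
    rw [h0]
    exact mem_chart_source E _
  funext b
  rw [wordForm, wordVec, slotGerm, formGerm_slot b 1 h1, map_sum, map_sum]
  refine Finset.sum_eq_zero fun j _ => ?_
  rw [map_smul, res_smul]
  set f : G → ℂ := fun g => coo E j (chartAt E (1 : G) g) - coo E j (chartAt E (1 : G) 1) with hf
  have hfa : AnalyticAt ℂ (fun e : E => f ((chartAt E (1 : G)).symm e)) (chartAt E (1 : G) 1) := by
    refine AnalyticAt.sub (((coo E j).analyticAt _).congr ?_) analyticAt_const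
    filter_upwards [(chartAt E (1 : G)).open_target.mem_nhds (mem_chart_target E (1 : G))] with e he
    rw [(chartAt E (1 : G)).right_inv he]
  have h2 := res_eq_zero (StalkRel.dzero (ρ := ρ) w f hw (sub_self _) hfa)
  have h3 : (fderiv ℂ fun e : Fin p → E => slotCoo (E := E) (1 : G) j w (param (pt π ρ) e)) =
      fderiv ℂ fun e : Fin p → E => f (ev w (param (pt π ρ) e)) := by
    funext e
    rw [hf, fderiv_sub_const]
    rfl
  rw [h3, h2, smul_zero]

/-- The words differ by the factor `w'⁻¹ * w`, which lies in the kernel of `π`. -/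
theorem wordForm_congr {w w' : FreeGroup (Fin p)} (h : π w = π w') :
    wordForm E π ρ w = wordForm E π ρ w' := by
  have h1 : wordForm E π ρ (w' * (w'⁻¹ * w)) = wordForm E π ρ w' := by
    rw [wordForm_mul, wordForm_eq_zero π ρ (w := w'⁻¹ * w) (by simp [h]), map_zero, add_zero]
  rwa [mul_inv_cancel_left] at h1

variable {π} (hπ : Function.Surjective π)

variable (E) in
/-- The adjoint action of `Γ` on vectors with components in the stalk. -/
def act : Γ →* Module.End ℂ (StalkVec E π ρ) where
  toFun γ := wordAct E π ρ (Function.surjInv hπ γ)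
  map_one' := wordAct_eq_one π ρ (Function.surjInv_eq hπ 1)
  map_mul' γ δ := by
    rw [← wordAct_mul]
    exact wordAct_congr π ρ (by simp only [map_mul, Function.surjInv_eq hπ])

variable (E) in
/-- The tautological cocycle. -/
def tautCocycle (γ : Γ) : StalkVec E π ρ := wordForm E π ρ (Function.surjInv hπ γ)

theorem act_apply (w : FreeGroup (Fin p)) : act E ρ hπ (π w) = wordAct E π ρ w :=
  wordAct_congr π ρ (Function.surjInv_eq hπ _)

theorem tautCocycle_apply (w : FreeGroup (Fin p)) :
    tautCocycle E ρ hπ (π w) = wordForm E π ρ w :=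
  wordForm_congr π ρ (Function.surjInv_eq hπ _)

theorem tautCocycle_mul (g h : Γ) : tautCocycle E ρ hπ (g * h) =
    tautCocycle E ρ hπ g + act E ρ hπ g (tautCocycle E ρ hπ h) := by
  obtain ⟨v, rfl⟩ := hπ g
  obtain ⟨w, rfl⟩ := hπ h
  rw [← map_mul, tautCocycle_apply, tautCocycle_apply, tautCocycle_apply, act_apply, wordForm_mul]

variable (E) in
/-- The multilinear form on vectors with components in the stalk given by an invariant
polynomial. -/
abbrev stalkForm (n : ℕ) (Φ : E → ℂ) :
    MultilinearMap ℂ (fun _ : Fin n => StalkVec E π ρ) (Stalk E π ρ) :=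
  polyProd (Stalk E π ρ) (polar n Φ)

/-- The invariance of `F` under `Ad` of the value of the word, at each point of the chart, is an
identity of germs of functions; `polyProd_mulVec` carries it to the stalk. -/
theorem polyProd_act {n : ℕ} {F : MultilinearMap ℂ (fun _ : Fin n => E) ℂ}
    (hF : ∀ (g : G) u, F (fun k => Ad g (u k)) = F u) (g : Γ) :
    (polyProd (Stalk E π ρ) F).compLinearMap (fun _ => act E ρ hπ g) = polyProd (Stalk E π ρ) F := by
  obtain ⟨w, rfl⟩ := hπ g
  refine MultilinearMap.ext fun u => ?_
  rw [MultilinearMap.compLinearMap_apply]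
  simp only [act_apply]
  refine polyProd_mulVec (fun _ b c => adGerm (pt π ρ) b c w) (fun c => ?_) u
  have ha := fun b c => analyticAt_adEntry (center_mem (E := E) (pt π ρ)) b c w
  have h2 : ∀ b : Fin n → Fin (Module.finrank ℂ E),
      AnalyticAt ℂ (fun e => ∏ k, adEntry E (pt π ρ) (b k) (c k) w e) (center (pt π ρ)) := fun b =>
    Finset.analyticAt_fun_prod _ fun k _ => ha (b k) (c k)
  simp only [adGerm, ← holGerm_prod Finset.univ fun k => ha _ (c k), ← holGerm_const]
  have h3 := fun b => (holGerm_mul (a := center (pt π ρ)) (f := fun _ => F fun k => bas E (b k))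
    analyticAt_const (h2 b)).symm
  simp only [h3]
  rw [← holGerm_sum _ fun b => AnalyticAt.fun_mul analyticAt_const (h2 b)]
  refine congrArg _ (funext fun e => ?_)
  rw [← hF (ev w (param (pt π ρ) e))]
  have h4 := F.map_sum fun k b => coo E b (Ad (ev w (param (pt π ρ) e)) (bas E (c k))) • bas E b
  simp only [MultilinearMap.map_smul_univ, sum_coo_smul] at h4
  refine Eq.trans ?_ h4.symm
  simp only [adEntry, smul_eq_mul, mul_comm]

theorem res_etaForm {n : ℕ} (Φ : E → ℂ) (w : Fin n → FreeGroup (Fin p)) :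
    res π ρ (etaForm (pt π ρ) Φ w) =
      cupC (act E ρ hπ) (stalkForm E ρ n Φ) (fun _ => tautCocycle E ρ hπ) fun k => π (w k) := by
  rw [etaForm_eq, map_polyProd]
  change _ = polyProd _ _ _
  congr 1
  funext k b
  rw [res_wordVec, id, ← map_prefixProd, act_apply, ← tautCocycle_apply ρ hπ]

end Tautological

/-! ### Contraction and Lie derivative of the form `η_Φ` -/

section Contraction

set_option linter.unusedSectionVars false

variable {E G Γ : Type} [NormedAddCommGroup E] [NormedSpace ℂ E] [FiniteDimensional ℂ E]
  [TopologicalSpace G] [ChartedSpace E G] [Group G] [LieGroup 𝓘(ℂ, E) ω G] [Group Γ] {p : ℕ}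

theorem pairing_slotGerm (x : Fin p → G) (v : E) (b : Fin (Module.finrank ℂ E))
    (P w : FreeGroup (Fin p)) :
    pairing (center x) (conjField x v) (analyticAt_conjField (center_mem x) v) (slotGerm x b P w) =
      ∑ c, adGerm x b c P * algebraMap ℂ _ (coo E c v) -
        ∑ c, adGerm x b c (P * w) * algebraMap ℂ _ (coo E c v) := by
  have ha := fun c w => analyticAt_adEntry (center_mem (E := E) x) b c w
  have hs := analyticAt_slot (center_mem (E := E) x) b P w
  have h1 : ∀ w, ∑ c, adGerm x b c w * algebraMap ℂ _ (coo E c v) =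
      holGerm (center (E := E) x) (fun e => ∑ c, adEntry E x b c w e * coo E c v) := fun w => by
    simp only [adGerm, ← holGerm_const]
    have h2 := fun c => (holGerm_mul (ha c w) (g := fun _ => coo E c v) analyticAt_const).symm
    simp only [h2]
    exact (holGerm_sum _ fun c => AnalyticAt.fun_mul (ha c w) analyticAt_const).symm
  have h3 : ∀ w, AnalyticAt ℂ (fun e => ∑ c, adEntry E x b c w e * coo E c v) (center (E := E) x) :=
    fun w => Finset.analyticAt_fun_sum _ fun c _ => AnalyticAt.fun_mul (ha c w) analyticAt_const
  have h4 : ∀ w e, ∑ c, adEntry E x b c w e * coo E c v = coo E b (Ad (ev w (param x e)) v) :=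
    fun w e => by
      conv_rhs => rw [← sum_coo_smul v]
      simp [adEntry, mul_comm]
  have h5 : AnalyticAt ℂ (fun e => slot x b P w e (conjField x v e)) (center (E := E) x) :=
    ((ContinuousLinearMap.id ℂ ((Fin p → E) →L[ℂ] ℂ)).analyticAt_bilinear _).comp₂ hs
      (analyticAt_conjField (center_mem x) v)
  rw [slotGerm, pairing_formGerm _ hs, h1, h1]
  refine eq_sub_of_add_eq ?_
  rw [← holGerm_add h5 (h3 _)]
  refine holGerm_congr ?_
  filter_upwards [eventually_mem_chartDom (E := E) x] with e he
  rw [slot_conjField he, h4, h4, sub_add_cancel]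

theorem lie_wordVec (x : Fin p → G) (v : E) (P w : FreeGroup (Fin p))
    (b : Fin (Module.finrank ℂ E)) :
    (formSystem _).lie (pairing (center x) (conjField x v) (analyticAt_conjField (center_mem x) v))
      (wordVec E x P w b) = ∑ c, coo E b (ad G v (bas E c)) • wordVec E x P w c := by
  have ha := fun b => analyticAt_slot (center_mem (E := E) x) b P w
  have h1 : ∀ c, coo E b (ad G v (bas E c)) • wordVec E x P w c =
      ExteriorAlgebra.ι _ (formGerm (center (E := E) x)
        fun e => coo E b (ad G v (bas E c)) • slot x c P w e) := fun c => by
    have h2 := formGerm_smul (f := fun _ => coo E b (ad G v (bas E c))) analyticAt_const (ha c)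
    rw [wordVec, slotGerm, h2, holGerm_const, map_smul, algebraMap_smul]
  rw [wordVec, slotGerm, lie_ι _ (ha b)]
  simp only [h1]
  rw [← map_sum, ← formGerm_sum _ fun c => AnalyticAt.fun_smul analyticAt_const (ha c)]
  refine congrArg _ (formGerm_congr ?_)
  filter_upwards [eventually_mem_chartDom (E := E) x] with e he
  exact lie_slot he b P w v

/-- Each factor is transformed by the same matrix of `ad v`, so the sum over the factors vanishes by
infinitesimal invariance. This holds already on `G^p`, before restriction. -/
theorem lie_etaForm {n : ℕ} {Φ : E → ℂ} (hΦ : Φ ∈ InvPoly E G n) (x : Fin p → G) (v : E)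
    (w : Fin n → FreeGroup (Fin p)) :
    (formSystem _).lie (pairing (center x) (conjField x v) (analyticAt_conjField (center_mem x) v))
      (etaForm x Φ w) = 0 := by
  rw [etaForm_eq, lie_polyProd]
  simp only [lie_wordVec]
  exact sum_polyProd_update (T := (ad G v).toLinearMap) (fun u => sum_polar_ad hΦ v u) _

variable (π : FreeGroup (Fin p) →* Γ) (ρ : Γ →* G)

variable (E) in
/-- An element of `𝔤`, as a vector with components in the stalk. -/
def constVec (v : E) : StalkVec E π ρ := fun c => algebraMap ℂ _ (coo E c v)

theorem res_pairing (v : E) (P w : FreeGroup (Fin p)) (b : Fin (Module.finrank ℂ E)) :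
    res π ρ (algebraMap _ _ (pairing (center (pt π ρ)) (conjField (pt π ρ) v)
      (analyticAt_conjField (center_mem (pt π ρ)) v) (slotGerm (pt π ρ) b P w))) =
      wordAct E π ρ P (constVec E π ρ v - wordAct E π ρ w (constVec E π ρ v)) b := by
  rw [pairing_slotGerm, res_algebraMap, map_sub, map_sum, map_sum, map_sub,
    ← Module.End.mul_apply, ← wordAct_mul]
  simp only [Pi.sub_apply, wordAct_apply, constVec, Algebra.smul_def, map_mul]
  simp only [← IsScalarTower.algebraMap_apply]

variable {π} (hπ : Function.Surjective π)

theorem res_contract_etaForm {n : ℕ} (Φ : E → ℂ) (v : E) (w : Fin n → FreeGroup (Fin p)) :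
    res π ρ (contract _ (conjField (pt π ρ) v) (etaForm (pt π ρ) Φ w)) =
      ∑ k : Fin n, (-1 : ℤ) ^ (k : ℕ) • cupC (act E ρ hπ) (stalkForm E ρ n Φ)
        (Function.update (fun _ => tautCocycle E ρ hπ) k fun g =>
          constVec E π ρ v - act E ρ hπ g (constVec E π ρ v)) fun k => π (w k) := by
  rw [etaForm_eq, contract_eq (analyticAt_conjField (center_mem (pt π ρ)) v)]
  have h := con_polyProd (pairing (center (pt π ρ)) (conjField (pt π ρ) v)
    (analyticAt_conjField (center_mem (pt π ρ)) v)) (polar n Φ)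
    fun k b => slotGerm (pt π ρ) b (prefixProd w k) (w k)
  refine (congrArg (res π ρ) h).trans ?_
  rw [map_sum]
  refine Finset.sum_congr rfl fun k _ => ?_
  rw [map_zsmul, map_polyProd]
  congr 1
  change _ = polyProd _ _ _
  congr 1
  funext j
  rw [id, ← map_prefixProd, act_apply]
  by_cases hj : j = k
  · subst hj
    rw [Function.update_self, Function.update_self, act_apply]
    funext b
    exact res_pairing π ρ v _ _ b
  · rw [Function.update_of_ne hj, Function.update_of_ne hj, tautCocycle_apply]
    funext b
    exact res_wordVec π ρ _ _ b

/-- In each term of the contraction one factor `σ` is replaced by `γ ↦ v - Ad(γ) v`, the coboundary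
of the constant `-v`. -/
theorem isCob_res_contract (hπ : Function.Surjective π) {n : ℕ} {Φ : E → ℂ} (hΦ : Φ ∈ InvPoly E G n) (v : E)
    {lift : Γ → FreeGroup (Fin p)} (hl : ∀ γ, π (lift γ) = γ) :
    IsCob fun γ : Fin n → Γ => res π ρ (contract _ (conjField (pt π ρ) v)
      (etaForm (pt π ρ) Φ fun k => lift (γ k))) := by
  have h : (fun γ : Fin n → Γ => res π ρ (contract _ (conjField (pt π ρ) v)
      (etaForm (pt π ρ) Φ fun k => lift (γ k)))) =
      ∑ k : Fin n, (-1 : ℂ) ^ (k : ℕ) • cupC (act E ρ hπ) (stalkForm E ρ n Φ)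
        (Function.update (fun _ => tautCocycle E ρ hπ) k fun g =>
          constVec E π ρ v - act E ρ hπ g (constVec E π ρ v)) := by
    funext γ
    rw [res_contract_etaForm ρ hπ, Finset.sum_apply]
    refine Finset.sum_congr rfl fun k _ => ?_
    rw [Pi.smul_apply]
    simp only [hl]
    rw [← Int.cast_smul_eq_zsmul ℂ, Int.cast_pow, Int.cast_neg, Int.cast_one]
  rw [h]
  refine IsCob.sum _ fun k _ => IsCob.smul _ (isCob_cupC (polyProd_act ρ hπ (polar_Ad hΦ)) ?_ k
    (- constVec E π ρ v) fun g => ?_)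
  · intro j g g'
    by_cases hj : j = k
    · subst hj
      simp only [Function.update_self, map_mul, map_sub, Module.End.mul_apply]
      abel
    · simp only [Function.update_of_ne hj, tautCocycle_mul]
  · simp only [Function.update_self, map_neg]
    abel

/-- The Lie derivative is zero, so by Cartan's formula this is `-d` of the previous contraction, and
`d` acts linearly on the stalk. -/
theorem isCob_res_contract_dr (hπ : Function.Surjective π) {n : ℕ} {Φ : E → ℂ} (hΦ : Φ ∈ InvPoly E G n) (v : E)
    {lift : Γ → FreeGroup (Fin p)} (hl : ∀ γ, π (lift γ) = γ) :
    IsCob fun γ : Fin n → Γ => res π ρ (contract _ (conjField (pt π ρ) v)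
      (dr _ (etaForm (pt π ρ) Φ fun k => lift (γ k)))) := by
  have h := (isCob_res_contract ρ hπ hΦ v hl).map (-dStalk π ρ)
  convert h using 2 with γ
  have h1 := lie_etaForm hΦ (pt π ρ) v fun k => lift (γ k)
  rw [LinearMap.neg_apply, dStalk_res, ← map_neg]
  congr 1
  rw [contract_eq (analyticAt_conjField (center_mem (pt π ρ)) v)]
  exact eq_neg_of_add_eq_zero_left h1

end Contraction

/-! ### Products of forms and the class `η_Φ` -/

section FormsProduct

set_option linter.unusedSectionVars false

variable {E G Γ : Type} [NormedAddCommGroup E] [NormedSpace ℂ E] [FiniteDimensional ℂ E]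
  [TopologicalSpace G] [ChartedSpace E G] [Group G] [LieGroup 𝓘(ℂ, E) ω G] [Group Γ] {p : ℕ}
  {π : FreeGroup (Fin p) →* Γ}

theorem formsOn_mono {n : ℕ} {U W : Set (Fin p → G)} (h : W ⊆ U) :
    formsOn E π n U ≤ formsOn E π n W := by
  refine Submodule.span_mono ?_
  rintro r ⟨f, g, hfg, hr⟩
  exact ⟨f, g, fun y hy => hfg y (h hy), fun ρ hρ => hr ρ (h hρ)⟩

/-- A family that vanishes at the points over `U` is given there by the monomial with coefficient 0,
whatever its other germs are. -/
theorem formsOn_congr {n : ℕ} {U : Set (Fin p → G)} {s t : Germs E G π} (hs : s ∈ formsOn E π n U)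
    (h : ∀ ρ, pt π ρ ∈ U → t ρ = s ρ) : t ∈ formsOn E π n U := by
  have h1 : t - s ∈ formsOn E π n U := by
    refine Submodule.subset_span ⟨fun _ => 0, fun _ _ => 0, fun y _ =>
      ⟨analyticAt_const, fun _ => analyticAt_const⟩, fun ρ hρ => ?_⟩
    have h0 : holGerm (center (E := E) (pt π ρ)) (fun _ => 0) = 0 := by
      rw [holGerm_const, map_zero]
    rw [Pi.sub_apply, h ρ hρ, sub_self, mono, monomial, h0, map_zero, zero_mul, map_zero]
  simpa using Submodule.add_mem _ h1 hs

theorem mono_mul {ρ : Γ →* G} {n m : ℕ} {f f' : (Fin p → G) → ℂ} (hf : HolAt (E := E) f (pt π ρ))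
    (hf' : HolAt (E := E) f' (pt π ρ)) (g : Fin n → (Fin p → G) → ℂ) (g' : Fin m → (Fin p → G) → ℂ) :
    mono E π ρ f g * mono E π ρ f' g' = mono E π ρ (fun y => f y * f' y) (Fin.append g g') := by
  rw [mono, mono, mono, ← map_mul, monomial_mul hf hf']
  congr 2
  funext k e
  refine Fin.addCases (fun i => ?_) (fun i => ?_) k <;> simp

theorem formsOn_mul {n m : ℕ} {U : Set (Fin p → G)} {s t : Germs E G π} (hs : s ∈ formsOn E π n U)
    (ht : t ∈ formsOn E π m U) : s * t ∈ formsOn E π (n + m) U := by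
  induction hs using Submodule.span_induction with
  | zero => rw [zero_mul]; exact Submodule.zero_mem _
  | add x y _ _ hx hy => rw [add_mul]; exact Submodule.add_mem _ hx hy
  | smul c x _ hx => rw [smul_mul_assoc]; exact Submodule.smul_mem _ c hx
  | mem s hs =>
    obtain ⟨f, g, hfg, hr⟩ := hs
    induction ht using Submodule.span_induction with
    | zero => rw [mul_zero]; exact Submodule.zero_mem _
    | add x y _ _ hx hy => rw [mul_add]; exact Submodule.add_mem _ hx hy
    | smul c x _ hx => rw [mul_smul_comm]; exact Submodule.smul_mem _ c hx
    | mem t ht =>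
      obtain ⟨f', g', hfg', hr'⟩ := ht
      refine Submodule.subset_span ⟨fun y => f y * f' y, Fin.append g g', fun y hy => ⟨?_, ?_⟩, ?_⟩
      · have h1 : AnalyticAt ℂ _ _ := (hfg y hy).1
        exact h1.mul (hfg' y hy).1
      · intro k
        refine Fin.addCases (fun i => ?_) (fun i => ?_) k
        · rw [Fin.append_left]
          exact (hfg y hy).2 i
        · rw [Fin.append_right]
          exact (hfg' y hy).2 i
      · intro ρ hρ
        rw [Pi.mul_apply, hr ρ hρ, hr' ρ hρ, mono_mul (hfg _ hρ).1 (hfg' _ hρ).1]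

theorem forms_mul {n m : ℕ} {s t : Germs E G π} (hs : s ∈ Forms E G π n) (ht : t ∈ Forms E G π m) :
    s * t ∈ Forms E G π (n + m) := by
  intro ρ
  obtain ⟨U, hU, hxU, hsU⟩ := hs ρ
  obtain ⟨W, hW, hxW, htW⟩ := ht ρ
  exact ⟨U ∩ W, hU.inter hW, ⟨hxU, hxW⟩, formsOn_mul (formsOn_mono Set.inter_subset_left hsU)
    (formsOn_mono Set.inter_subset_right htW)⟩

theorem one_mem_forms : (1 : Germs E G π) ∈ Forms E G π 0 := by
  intro ρ
  refine ⟨Set.univ, isOpen_univ, trivial, Submodule.subset_span ⟨fun _ => 1, fun _ _ => 0, fun y _ =>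
    ⟨analyticAt_const, fun _ => analyticAt_const⟩, fun ρ hρ => ?_⟩⟩
  rw [mono, monomial, holGerm_one]
  simp

theorem list_prod_mem_forms {n : ℕ} {s : Fin n → Germs E G π} (hs : ∀ k, s k ∈ Forms E G π 1) :
    (List.ofFn s).prod ∈ Forms E G π n := by
  induction n with
  | zero => simpa using one_mem_forms
  | succ n ih =>
    have h := forms_mul (hs 0) (ih fun k => hs k.succ)
    rw [add_comm 1 n] at h
    rwa [List.ofFn_succ, List.prod_cons]

theorem continuous_ev {G : Type} [TopologicalSpace G] [Group G] [IsTopologicalGroup G]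
    (w : FreeGroup (Fin p)) : Continuous fun y : Fin p → G => ev w y := by
  induction w using FreeGroup.induction_on with
  | C1 => simpa only [ev_one] using continuous_const
  | of i => simpa only [ev_of] using continuous_apply i
  | inv_of i h => simpa only [ev_inv] using h.fun_inv
  | mul v w hv hw => simpa only [ev_mul] using hv.fun_mul hw

/-- On the open set where `w` takes values in a fixed chart domain, `formGerm_slot` gives one
expression valid at all points. -/
theorem wordVec_mem_forms (P w : FreeGroup (Fin p)) (b : Fin (Module.finrank ℂ E)) :
    (fun ρ => res π ρ (wordVec E (pt π ρ) P w b) : Germs E G π) ∈ Forms E G π 1 := by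
  intro ρ
  have : IsTopologicalGroup G := topologicalGroup_of_lieGroup 𝓘(ℂ, E) ω
  set g := ev w (pt π ρ)
  refine ⟨{y | ev w y ∈ (chartAt E g).source}, (chartAt E g).open_source.preimage (continuous_ev w),
    mem_chart_source E g, ?_⟩
  have h1 : (∑ j, fun ρ => mono E π ρ (slotFun (E := E) g b j P w) fun _ : Fin 1 =>
      slotCoo (E := E) g j w : Germs E G π) ∈ formsOn E π 1 {y | ev w y ∈ (chartAt E g).source} :=
    Submodule.sum_mem _ fun j _ => Submodule.subset_span ⟨_, _, fun y hy =>
      ⟨holAt_slotFun hy, fun _ => holAt_slotCoo hy⟩, fun ρ _ => rfl⟩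
  refine formsOn_congr h1 fun ρ hρ => ?_
  rw [wordVec, slotGerm, formGerm_slot b P hρ, map_sum, map_sum, Finset.sum_apply]
  refine Finset.sum_congr rfl fun j _ => ?_
  rw [map_smul, Algebra.smul_def, mono, monomial]
  simp

theorem etaCochain_mem_forms (lift : Γ → FreeGroup (Fin p)) (n : ℕ) (Φ : E → ℂ) (γ : Fin n → Γ) :
    etaCochain π lift n Φ γ ∈ Forms E G π n := by
  have h : etaCochain (G := G) π lift n Φ γ = ∑ b : Fin n → Fin (Module.finrank ℂ E),
      (polar n Φ fun k => bas E (b k)) • (List.ofFn fun k =>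
        (fun ρ => res π ρ (wordVec E (pt π ρ) (prefixProd (fun k => lift (γ k)) k) (lift (γ k)) (b k)) :
          Germs E G π)).prod := by
    funext ρ
    rw [etaCochain, etaForm_eq, map_polyProd, polyProd_apply, Finset.sum_apply]
    refine Finset.sum_congr rfl fun b _ => ?_
    rw [Pi.smul_apply]
    congr 1
    have h2 := map_list_prod (Pi.evalRingHom (fun ρ : Γ →* G => Stalk E π ρ) ρ) (List.ofFn fun k =>
      (fun ρ => res π ρ (wordVec E (pt π ρ) (prefixProd (fun k => lift (γ k)) k) (lift (γ k)) (b k)) :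
          Germs E G π))
    rw [List.map_ofFn] at h2
    exact h2.symm
  rw [h]
  exact Submodule.sum_mem _ fun b _ => Submodule.smul_mem _ _
    (list_prod_mem_forms fun k => wordVec_mem_forms _ _ _)

end FormsProduct

/-! ### Lifting the cup power of the tautological cocycle to basic forms -/

section Class

set_option linter.unusedSectionVars false

variable {E G Γ : Type} [NormedAddCommGroup E] [NormedSpace ℂ E] [FiniteDimensional ℂ E]
  [TopologicalSpace G] [ChartedSpace E G] [Group G] [LieGroup 𝓘(ℂ, E) ω G] [Group Γ] {p : ℕ}
  (π : FreeGroup (Fin p) →* Γ)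

variable (E) in
/-- The germs of forms that are basic with respect to `v ∈ 𝔤`. -/
def basicStalk (ρ : Γ →* G) (v : E) : Submodule ℂ (Stalk E π ρ) where
  carrier := {z | BasicAt π ρ v z}
  zero_mem' := BasicAt.zero π ρ v
  add_mem' := BasicAt.add
  smul_mem' := fun c _ h => h.smul c

-- A germ on `G^p` with both contractions restricting to zero restricts to a basic germ. So its
-- restriction modulo basic germs is a linear function of the two contractions, and this function
-- may be applied to their potentials. Contraction on the stalk itself is not needed.
variable {π} in
theorem isCob_mkQ {ρ : Γ →* G} {v : E} {n : ℕ} {q : (Fin n → Γ) → DR (center (E := E) (pt π ρ))}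
    (h1 : IsCob fun γ => res π ρ (contract _ (conjField (pt π ρ) v) (q γ)))
    (h2 : IsCob fun γ => res π ρ (contract _ (conjField (pt π ρ) v) (dr _ (q γ)))) :
    IsCob fun γ => (basicStalk E π ρ v).mkQ (res π ρ (q γ)) := by
  let C : DR (center (E := E) (pt π ρ)) →ₗ[ℂ] Stalk E π ρ :=
    (res π ρ).toLinearMap ∘ₗ (contract _ (conjField (pt π ρ) v)).restrictScalars ℂ
  obtain ⟨t, ht⟩ := exists_comp_eq (C.prod (C ∘ₗ dr _))
    ((basicStalk E π ρ v).mkQ ∘ₗ (res π ρ).toLinearMap) fun x hx => by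
      refine (Submodule.Quotient.mk_eq_zero _).2 ⟨(x, dr _ x), (mem_dGraph_iff _).2 rfl, rfl, ?_, ?_⟩
      · exact congrArg Prod.fst hx
      · exact congrArg Prod.snd hx
  have h3 : (fun γ => (basicStalk E π ρ v).mkQ (res π ρ (q γ))) =
      (fun γ => (t ∘ₗ LinearMap.inl ℂ _ _) (C (q γ))) +
        fun γ => (t ∘ₗ LinearMap.inr ℂ _ _) ((C ∘ₗ dr _) (q γ)) := by
    funext γ
    have h4 := LinearMap.congr_fun ht (q γ)
    rw [Pi.add_apply, LinearMap.comp_apply t, LinearMap.comp_apply t, ← map_add t]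
    refine h4.symm.trans ?_
    rw [LinearMap.comp_apply t]
    congr 1
    simp
  rw [h3]
  exact (h1.map _).add (h2.map _)

variable {π} (hπ : Function.Surjective π)

theorem etaCochain_apply {lift : Γ → FreeGroup (Fin p)} (hl : ∀ γ, π (lift γ) = γ) {n : ℕ}
    (Φ : E → ℂ) (γ : Fin n → Γ) (ρ : Γ →* G) : etaCochain π lift n Φ γ ρ =
      cupC (act E ρ hπ) (stalkForm E ρ n Φ) (fun _ => tautCocycle E ρ hπ) γ := by
  rw [etaCochain, res_etaForm ρ hπ]
  simp only [hl]

/-- The cochain that represents `η_Φ`. -/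
def formCochain (lift : Γ → FreeGroup (Fin p)) (n : ℕ) (Φ : E → ℂ) (γ : Fin n → Γ) :
    Forms E G π n :=
  ⟨_, etaCochain_mem_forms lift n Φ γ⟩

theorem delta_formCochain (hπ : Function.Surjective π) {lift : Γ → FreeGroup (Fin p)}
    (hl : ∀ γ, π (lift γ) = γ) {n : ℕ} {Φ : E → ℂ} (hΦ : Φ ∈ InvPoly E G n) :
    delta (formCochain (G := G) (π := π) lift n Φ) = 0 := by
  refine delta_of_map (f := (Forms E G π n).subtype) Subtype.val_injective ?_
  funext γ ρ
  have h := congrFun (delta_map (LinearMap.proj (R := ℂ) (φ := fun ρ : Γ →* G => Stalk E π ρ) ρ)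
    (fun γ => (Forms E G π n).subtype (formCochain lift n Φ γ))) γ
  refine h.symm.trans ?_
  have h2 : (fun γ => LinearMap.proj (R := ℂ) (φ := fun ρ : Γ →* G => Stalk E π ρ) ρ
      ((Forms E G π n).subtype (formCochain lift n Φ γ))) =
      cupC (act E ρ hπ) (stalkForm E ρ n Φ) (fun _ => tautCocycle E ρ hπ) :=
    funext fun γ => etaCochain_apply hπ hl Φ γ ρ
  rw [h2, delta_cupC (polyProd_act ρ hπ (polar_Ad hΦ)) fun _ => tautCocycle_mul ρ hπ]
  rfl

/-- The basic forms are the kernel of the map from forms to the product of all quotients by basic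
germs. The image of the cocycle there is a coboundary, so the cocycle can be moved into the kernel
within its class. -/
theorem exists_eta (hπ : Function.Surjective π) {lift : Γ → FreeGroup (Fin p)}
    (hl : ∀ γ, π (lift γ) = γ) {n : ℕ} {Φ : E → ℂ} (hΦ : Φ ∈ InvPoly E G n) :
    ∃ x : H Γ (BasicForms E G π n) n, Represents (formCochain (G := G) (π := π) lift n Φ)
      (coeffMap Γ n (Submodule.inclusion (basicForms_le π n)) x) := by
  let f : Forms E G π n →ₗ[ℂ] ((i : (Γ →* G) × E) → Stalk E π i.1 ⧸ basicStalk E π i.1 i.2) :=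
    LinearMap.pi fun i => (basicStalk E π i.1 i.2).mkQ ∘ₗ
      (LinearMap.proj (R := ℂ) (φ := fun ρ : Γ →* G => Stalk E π ρ) i.1) ∘ₗ (Forms E G π n).subtype
  have h1 : IsCob fun γ => f (formCochain lift n Φ γ) := IsCob.pi fun i =>
    isCob_mkQ (q := fun γ => etaForm (pt π i.1) Φ fun k => lift (γ k))
      (isCob_res_contract i.1 hπ hΦ i.2 hl) (isCob_res_contract_dr i.1 hπ hΦ i.2 hl)
  obtain ⟨c, hc, hc2⟩ := exists_cohomologous_ker h1
  obtain ⟨y, hy⟩ := exists_represents_of_delta (delta_formCochain (G := G) hπ hl hΦ)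
  have hcy := hy.congr hc2
  let c' : (Fin n → Γ) → BasicForms E G π n := fun γ => ⟨(c γ).1, (c γ).2, fun ρ v =>
    (Submodule.Quotient.mk_eq_zero (basicStalk E π ρ v)).1 (congrFun (hc γ) (ρ, v))⟩
  obtain ⟨x, hx⟩ := exists_represents_of_delta (c := c') (delta_of_map
    (f := Submodule.inclusion (basicForms_le π n)) (Submodule.inclusion_injective _) hcy.delta)
  refine ⟨x, ?_⟩
  rw [(hx.map (Submodule.inclusion (basicForms_le π n))).unique hcy]
  exact hy

/-- The linear map `Φ ↦ η_Φ`. -/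
def eta (hπ : Function.Surjective π) (n : ℕ) :
    InvPoly E G n →ₗ[ℂ] H Γ (BasicForms E G π n) n where
  toFun Φ := (exists_eta hπ (Function.surjInv_eq hπ) Φ.2).choose
  map_add' Φ Ψ := by
    -- The chosen lift is the only one, so linearity can be checked on the explicit cochains with
    -- values in all forms.
    refine coeffMap_injective (Submodule.inclusion_injective (basicForms_le π n)) ?_
    refine (exists_eta hπ (Function.surjInv_eq hπ) (Φ + Ψ).2).choose_spec.unique ?_
    rw [map_add]
    convert (exists_eta hπ (Function.surjInv_eq hπ) Φ.2).choose_spec.add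
      (exists_eta hπ (Function.surjInv_eq hπ) Ψ.2).choose_spec using 1
    funext γ
    refine Subtype.ext (funext fun ρ => ?_)
    change etaCochain π _ n _ γ ρ = etaCochain π _ n _ γ ρ + etaCochain π _ n _ γ ρ
    simp only [etaCochain_apply hπ (Function.surjInv_eq hπ)]
    rw [Submodule.coe_add, stalkForm, polar_add Φ.2 Ψ.2, polyProd_add]
    rfl
  map_smul' t Φ := by
    refine coeffMap_injective (Submodule.inclusion_injective (basicForms_le π n)) ?_
    refine (exists_eta hπ (Function.surjInv_eq hπ) (t • Φ).2).choose_spec.unique ?_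
    rw [map_smul, RingHom.id_apply]
    convert (exists_eta hπ (Function.surjInv_eq hπ) Φ.2).choose_spec.smul t using 1
    funext γ
    refine Subtype.ext (funext fun ρ => ?_)
    change etaCochain π _ n _ γ ρ = t • etaCochain π _ n _ γ ρ
    simp only [etaCochain_apply hπ (Function.surjInv_eq hπ)]
    rw [Submodule.coe_smul, stalkForm, polar_smul t Φ.2, polyProd_smul]
    rfl

theorem formCochain_eq (hπ : Function.Surjective π) {lift lift' : Γ → FreeGroup (Fin p)}
    (hl : ∀ γ, π (lift γ) = γ) (hl' : ∀ γ, π (lift' γ) = γ) (n : ℕ) (Φ : E → ℂ) :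
    formCochain (G := G) (π := π) lift n Φ = formCochain lift' n Φ := by
  funext γ
  refine Subtype.ext (funext fun ρ => ?_)
  exact (etaCochain_apply hπ hl Φ γ ρ).trans (etaCochain_apply hπ hl' Φ γ ρ).symm

theorem represents_formCochain (hπ : Function.Surjective π) {lift : Γ → FreeGroup (Fin p)}
    (hl : ∀ γ, π (lift γ) = γ) {n : ℕ} (Φ : InvPoly E G n) :
    Represents (formCochain (G := G) (π := π) lift n Φ)
      (coeffMap Γ n (Submodule.inclusion (basicForms_le π n)) (eta hπ n Φ)) := by
  rw [formCochain_eq hπ hl (Function.surjInv_eq hπ)]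
  exact (exists_eta hπ (Function.surjInv_eq hπ) Φ.2).choose_spec

/-- Basic forms sit inside the product of all stalks, the inclusion splits linearly, and potentials
in a product can be chosen one component at a time; no compatibility between the stalks is required.
-/
theorem represents_eta_iff (hπ : Function.Surjective π) {lift : Γ → FreeGroup (Fin p)}
    (hl : ∀ γ, π (lift γ) = γ) {n : ℕ} (Φ : InvPoly E G n)
    (c : (Fin n → Γ) → BasicForms E G π n) : Represents c (eta hπ n Φ) ↔
      ∀ ρ, IsCob fun γ => (c γ).1 ρ - etaCochain π lift n (Φ : E → ℂ) γ ρ := by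
  have key : ∀ {c : (Fin n → Γ) → BasicForms E G π n}, Represents c (eta hπ n Φ) →
      ∀ ρ, IsCob fun γ => (c γ).1 ρ - etaCochain π lift n (Φ : E → ℂ) γ ρ := fun h ρ =>
    ((h.map (Submodule.inclusion (basicForms_le π n))).isCob_sub
      (represents_formCochain hπ hl Φ)).map
        ((LinearMap.proj (R := ℂ) (φ := fun ρ : Γ →* G => Stalk E π ρ) ρ) ∘ₗ
          (Forms E G π n).subtype)
  refine ⟨key, fun h => ?_⟩
  obtain ⟨c₀, hc₀⟩ := exists_represents (eta hπ n Φ)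
  refine hc₀.congr (IsCob.of_map (f := (BasicForms E G π n).subtype) Subtype.val_injective
    (IsCob.pi fun ρ => ?_))
  have h2 := (h ρ).sub (key hc₀ ρ)
  convert h2 using 1
  funext γ
  exact (sub_sub_sub_cancel_right _ _ _).symm

end Class

/-! ### The alternating map given by a symmetric form and the cup product -/

section Alternating

variable {Γ V W Z M : Type} [Group Γ] [AddCommGroup V] [Module ℂ V] [AddCommGroup W] [Module ℂ W]
  [AddCommGroup Z] [Module ℂ Z] [AddCommGroup M] [Module ℂ M] {n : ℕ}

theorem cupC_update {A : Γ →* Module.End ℂ V} (F : MultilinearMap ℂ (fun _ : Fin n => V) W)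
    (ι : Z →ₗ[ℂ] (Γ → V)) (s : Fin n → Z) (i : Fin n) (x : Z) (γ : Fin n → Γ) :
    cupC A F (fun k => ι (Function.update s i x k)) γ = F (Function.update
      (fun k => A (prefixProd γ k) (ι (s k) (γ k))) i (A (prefixProd γ i) (ι x (γ i)))) := by
  change F _ = F _
  congr 1
  funext k
  by_cases hk : k = i
  · subst hk
    simp
  · simp [Function.update_of_ne hk]

theorem cupP_eq_of_symm {A : Γ →* Module.End ℂ V} {F : MultilinearMap ℂ (fun _ : Fin n => V) W}
    (hsymm : ∀ (u : Fin n → V) (σ : Equiv.Perm (Fin n)), F (fun k => u (σ k)) = F u)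
    (s : Fin n → Γ → V) (τ : Equiv.Perm (Fin n)) (γ : Fin n → Γ) :
    cupP A F s τ γ = F fun k => A (prefixProd γ k) (s (τ⁻¹ k) (γ k)) := by
  rw [cupP, ← hsymm _ τ⁻¹]
  simp

/-- Apply the cup product to cocycles; it depends only on their classes because a coboundary factor
makes it a coboundary. `Z` stands for the cocycles, `M` for `H¹`, and a linear section of `q`
transports the map. -/
theorem exists_alternating {A : Γ →* Module.End ℂ V} {F : MultilinearMap ℂ (fun _ : Fin n => V) W}
    (hF : ∀ g, F.compLinearMap (fun _ => A g) = F)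
    (hsymm : ∀ (u : Fin n → V) (σ : Equiv.Perm (Fin n)), F (fun k => u (σ k)) = F u)
    (ι : Z →ₗ[ℂ] (Γ → V)) (hι : ∀ z g h, ι z (g * h) = ι z g + A g (ι z h))
    (q : Z →ₗ[ℂ] M) (hq : Function.Surjective q)
    (hker : ∀ z, q z = 0 → ∃ m, ∀ g, ι z g = A g m - m) :
    ∃ κ : AlternatingMap ℂ M (H Γ W n) (Fin n), ∀ s : Fin n → Z,
      Represents (cupC A F fun k => ι (s k)) (κ fun k => q (s k)) := by
  have hex : ∀ s : Fin n → Z, ∃ x : H Γ W n, Represents (cupC A F fun k => ι (s k)) x := fun s =>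
    exists_represents_of_delta (delta_cupC hF fun k => hι (s k))
  choose K hK using hex
  let κ₀ : AlternatingMap ℂ Z (H Γ W n) (Fin n) :=
    { toFun := K
      map_update_add' := fun {inst} s i x y => by
        obtain rfl : inst = instDecidableEqFin n := Subsingleton.elim _ _
        refine (hK _).unique ?_
        convert (hK (Function.update s i x)).add (hK (Function.update s i y)) using 1
        funext γ
        rw [Pi.add_apply, cupC_update, cupC_update, cupC_update, map_add, Pi.add_apply, map_add,
          F.map_update_add]
      map_update_smul' := fun {inst} s i c x => by
        obtain rfl : inst = instDecidableEqFin n := Subsingleton.elim _ _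
        refine (hK _).unique ?_
        convert (hK (Function.update s i x)).smul c using 1
        funext γ
        rw [Pi.smul_apply, cupC_update, cupC_update, map_smul, Pi.smul_apply, map_smul,
          F.map_update_smul]
      map_eq_zero_of_eq' := fun s i j hij hne => by
        -- With two equal arguments the transposed cup product is the original one, yet it is
        -- cohomologous to its negative; division by 2 gives zero.
        have h1 := isCob_cupP_sub hF (fun k => hι (s k)) (Equiv.swap i j)
        have h2 : cupP A F (fun k => ι (s k)) (Equiv.swap i j) = cupC A F fun k => ι (s k) := by
          funext γ
          rw [cupP_eq_of_symm hsymm]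
          change F _ = F _
          congr 1
          funext k
          rw [Equiv.swap_inv, id]
          congr 3
          rcases eq_or_ne k i with rfl | hi
          · rw [Equiv.swap_apply_left]
            exact congrArg (fun z => ι z (γ k)) hij.symm
          · rcases eq_or_ne k j with rfl | hj
            · rw [Equiv.swap_apply_right]
              exact congrArg (fun z => ι z (γ k)) hij
            · rw [Equiv.swap_apply_of_ne_of_ne hi hj]
        rw [h2, Equiv.Perm.sign_swap hne] at h1
        have h3 : IsCob (cupC A F fun k => ι (s k)) := by
          convert h1.smul (2 : ℂ)⁻¹ using 1
          funext γ
          simp only [Pi.smul_apply, Units.val_neg, Units.val_one, Int.cast_neg,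
            Int.cast_one, neg_smul, one_smul, sub_neg_eq_add, ← two_smul ℂ]
          rw [smul_smul, inv_mul_cancel₀ two_ne_zero, one_smul]
        exact (hK s).unique h3.represents }
  have hzero : ∀ (s : Fin n → Z) (k : Fin n), q (s k) = 0 → K s = 0 := fun s k hk => by
    obtain ⟨m, hm⟩ := hker _ hk
    exact (hK s).unique (isCob_cupC hF (fun k => hι (s k)) k m hm).represents
  obtain ⟨r, hr⟩ := q.exists_rightInverse_of_surjective (LinearMap.range_eq_top.2 hq)
  refine ⟨κ₀.compLinearMap r, fun s => ?_⟩
  -- Expand multilinearly around the section: every other term contains a factor `s k - r (q (s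
  -- k))`, which is a coboundary.
  have h4 : K s = K fun k => r (q (s k)) := by
    have h5 := κ₀.toMultilinearMap.map_add_univ (fun k => r (q (s k)))
      fun k => s k - r (q (s k))
    have h6 : ((fun k => r (q (s k))) + fun k => s k - r (q (s k))) = s :=
      funext fun k => add_sub_cancel _ _
    rw [h6, Finset.sum_eq_single Finset.univ, Finset.piecewise_univ] at h5
    · exact h5
    · intro t _ ht
      obtain ⟨k, hk⟩ := not_forall.1 fun h => ht (Finset.eq_univ_iff_forall.2 h)
      refine hzero _ k ?_
      rw [Finset.piecewise_eq_of_notMem _ _ _ hk, map_sub, sub_eq_zero]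
      exact (LinearMap.congr_fun hr (q (s k))).symm
    · intro h
      exact absurd (Finset.mem_univ _) h
  have h7 := hK s
  rw [h4] at h7
  exact h7

/-- Evaluation is defined for germs on `G^p`, so an equality up to coboundary on the stalk has to be
lifted to germs on `G^p` first. -/
theorem exists_lift_isCob {f : V →ₗ[ℂ] W} (hf : Function.Surjective f) {q : (Fin n → Γ) → V}
    {c : (Fin n → Γ) → W} (h : IsCob fun γ => c γ - f (q γ)) :
    ∃ q' : (Fin n → Γ) → V, (∀ γ, f (q' γ) = c γ) ∧ IsCob (q' - q) := by
  obtain ⟨g, hg⟩ := f.exists_rightInverse_of_surjective (LinearMap.range_eq_top.2 hf)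
  refine ⟨fun γ => q γ + g (c γ - f (q γ)), fun γ => ?_, ?_⟩
  · rw [map_add, ← LinearMap.comp_apply f g, hg, LinearMap.id_apply, add_sub_cancel]
  · convert h.map g using 1
    funext γ
    exact add_sub_cancel_left _ _

end Alternating

/-! ### The values of `η_Φ` -/

section Values

set_option linter.unusedSectionVars false

section Germs

variable {V : Type} [NormedAddCommGroup V] [NormedSpace ℂ V] {a : V} {n : ℕ}

/-- The value of germs of functions at `a`, as a ring homomorphism. -/
def valueHom (a : V) : HolGerm a →+* ℂ := Germ.valueRingHom.comp (HolGerm a).subtype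

theorem valueHom_holGerm {f : V → ℂ} (hf : AnalyticAt ℂ f a) : valueHom a (holGerm a f) = f a := by
  change Germ.value (holGerm a f).1 = _
  rw [holGerm_coe hf]
  rfl

/-- The evaluation of forms on tangent vectors, as a linear map. -/
def evalLin (a : V) (ξ : Fin n → V) : DR a →ₗ[ℂ] ℂ where
  toFun := evalAt a ξ
  map_add' x y := by
    simp only [evalAt, map_add]
    exact map_add (valueHom a) _ _
  map_smul' z x := by
    have h : z • x = algebraMap ℂ (HolGerm a) z • x := (algebraMap_smul _ z x).symm
    simp only [evalAt, h, map_smul]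
    exact map_mul (valueHom a) _ _

theorem evalLin_list_prod (ξ : Fin n → V) {θ : Fin n → V → V →L[ℂ] ℂ}
    (hθ : ∀ k, AnalyticAt ℂ (θ k) a) :
    evalLin a ξ (List.ofFn fun k => ExteriorAlgebra.ι (HolGerm a) (formGerm a (θ k))).prod =
      ∑ σ : Equiv.Perm (Fin n), ((Equiv.Perm.sign σ : ℤ) : ℂ) * ∏ k, θ k a (ξ (σ k)) := by
  rw [← ExteriorAlgebra.ιMulti_apply]
  change valueHom a (ExteriorAlgebra.liftAlternating _ _) = _
  rw [ExteriorAlgebra.liftAlternating_apply_ιMulti, Pi.single_eq_same]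
  change valueHom a (Matrix.det (Matrix.of fun i j =>
    pairing a (fun _ => ξ j) analyticAt_const (formGerm a (θ i)))) = _
  rw [← Matrix.det_transpose, Matrix.det_apply', map_sum]
  refine Finset.sum_congr rfl fun σ _ => ?_
  rw [map_mul, map_intCast, map_prod]
  congr 1
  refine Finset.prod_congr rfl fun k _ => ?_
  change valueHom a (pairing a (fun _ => ξ (σ k)) analyticAt_const (formGerm a (θ k))) = _
  rw [pairing_formGerm _ (hθ k), valueHom_holGerm]
  exact ((ContinuousLinearMap.apply ℂ ℂ (ξ (σ k))).analyticAt _).comp (hθ k)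

end Germs

variable {E G Γ : Type} [NormedAddCommGroup E] [NormedSpace ℂ E] [FiniteDimensional ℂ E]
  [TopologicalSpace G] [ChartedSpace E G] [Group G] [LieGroup 𝓘(ℂ, E) ω G] [Group Γ] {p : ℕ}
  (π : FreeGroup (Fin p) →* Γ) (ρ : Γ →* G) {n : ℕ}

variable (E) in
/-- The adjoint action of `Γ` on `𝔤`. -/
def adAct : Γ →* Module.End ℂ E where
  toFun γ := (Ad (ρ γ) : E →L[ℂ] E).toLinearMap
  map_one' := by rw [map_one, Ad_one]; rfl
  map_mul' γ δ := by rw [map_mul, Ad_mul]; rfl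

/-- The value of `σ(w)` on the tangent vector of a cocycle `s` is `s(π(w))` by `mcForm_tangent`, and
a product of 1-forms is evaluated as a determinant. -/
theorem evalLin_etaForm {s : Fin n → Γ → E}
    (hs : ∀ k g h, s k (g * h) = s k g + adAct E ρ g (s k h)) {Φ : E → ℂ} (hΦ : Φ ∈ InvPoly E G n)
    (w : Fin n → FreeGroup (Fin p)) :
    evalLin (center (pt π ρ)) (fun k => tangent π ρ (s k)) (etaForm (pt π ρ) Φ w) =
      ∑ σ : Equiv.Perm (Fin n), ((Equiv.Perm.sign σ : ℤ) : ℂ) •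
        cupP (adAct E ρ) (polar n Φ) s σ fun k => π (w k) := by
  have h1 : ∀ b : Fin n → Fin (Module.finrank ℂ E), evalLin (center (pt π ρ))
      (fun k => tangent π ρ (s k)) (List.ofFn fun k => wordVec E (pt π ρ) (prefixProd w k) (w k) (b k)).prod =
      ∑ σ : Equiv.Perm (Fin n), ((Equiv.Perm.sign σ : ℤ) : ℂ) * ∏ k, coo E (b k)
        (adAct E ρ (prefixProd (fun k => π (w k)) k) (s (σ k) (π (w k)))) := fun b => by
    refine (evalLin_list_prod _ fun k => analyticAt_slot (center_mem (E := E) (pt π ρ)) _ _ _).trans ?_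
    refine Finset.sum_congr rfl fun σ _ => congrArg _ (Finset.prod_congr rfl fun k _ => ?_)
    rw [slot, ContinuousLinearMap.comp_apply, ContinuousLinearMap.comp_apply,
      mcForm_tangent π ρ (hs (σ k)), param_center, ev_pt, map_prefixProd]
    rfl
  rw [etaForm_eq, polyProd_apply, map_sum]
  simp only [map_smul, h1, Finset.smul_sum]
  -- The determinant permutes the vectors, while `cupP` permutes the positions of the group
  -- elements; by symmetry of the form these are inverse to each other, with equal signs.
  rw [Finset.sum_comm, ← Equiv.sum_comp (Equiv.inv (Equiv.Perm (Fin n)))]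
  refine Finset.sum_congr rfl fun σ _ => ?_
  rw [cupP_eq_of_symm (polar_perm hΦ)]
  have h2 := (polar n Φ).map_sum fun k b => coo E b
    (adAct E ρ (prefixProd (fun k => π (w k)) k) (s (σ⁻¹ k) (π (w k)))) • bas E b
  simp only [MultilinearMap.map_smul_univ, sum_coo_smul] at h2
  rw [h2, Finset.smul_sum]
  refine Finset.sum_congr rfl fun b _ => ?_
  simp only [Equiv.inv_apply, Equiv.Perm.sign_inv, smul_eq_mul]
  ring

-- A representing cocycle of basic forms is lifted to germs on `G^p` cohomologous to the explicit
-- ones. Evaluation gives `n!` signed cup products with the symmetric form, all of the same class,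
-- which add up to the full polarization.
variable {π} in
theorem hasValue_eta (hπ : Function.Surjective π) (Φ : InvPoly E G n) {s : Fin n → Γ → E}
    (hs : ∀ k g h, s k (g * h) = s k g + adAct E ρ g (s k h)) {z : H Γ ℂ n}
    (hz : Represents (cupC (adAct E ρ) (iteratedFDeriv ℂ n (Φ : E → ℂ) 0).toMultilinearMap s) z) :
    HasValue π (eta hπ n Φ) ρ (fun k => tangent π ρ (s k)) z := by
  have hl := Function.surjInv_eq hπ
  obtain ⟨c, hc⟩ := exists_represents (eta hπ n Φ)
  have h1 := (represents_eta_iff hπ hl Φ c).1 hc ρ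
  obtain ⟨q, hq, hq2⟩ := exists_lift_isCob (f := (res (E := E) π ρ).toLinearMap)
    (q := fun γ => etaForm (pt π ρ) (Φ : E → ℂ) fun k => Function.surjInv hπ (γ k))
    (res_surjective π ρ) h1
  refine ⟨c, fun γ => evalLin (center (pt π ρ)) (fun k => tangent π ρ (s k)) (q γ), hc,
    fun γ => ⟨q γ, hq γ, rfl⟩, hz.congr ?_⟩
  have h2 := hq2.map (evalLin (center (pt π ρ)) (fun k => tangent π ρ (s k)))
  have hA : ∀ g, (polar n (Φ : E → ℂ)).compLinearMap (fun _ => adAct E ρ g) = polar n (Φ : E → ℂ) :=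
    fun g => MultilinearMap.ext fun u => polar_Ad Φ.2 (ρ g) u
  have h3 : IsCob (∑ σ : Equiv.Perm (Fin n), ((Equiv.Perm.sign σ : ℤ) : ℂ) •
      (cupP (adAct E ρ) (polar n (Φ : E → ℂ)) s σ -
        ((Equiv.Perm.sign σ : ℤ) : ℂ) • cupC (adAct E ρ) (polar n (Φ : E → ℂ)) s)) :=
    IsCob.sum _ fun σ _ => (isCob_cupP_sub hA hs σ).smul _
  convert h2.add h3 using 1
  funext γ
  have hsign : ∀ σ : Equiv.Perm (Fin n), ((Equiv.Perm.sign σ : ℤ) : ℂ) * ((Equiv.Perm.sign σ : ℤ) : ℂ) = 1 :=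
    fun σ => by
      rw [← Int.cast_mul, ← Units.val_mul, Int.units_mul_self]
      simp
  have h4 : ((n.factorial : ℕ) : ℂ) ≠ 0 := Nat.cast_ne_zero.2 n.factorial_ne_zero
  simp only [Pi.add_apply, Pi.sub_apply, Finset.sum_apply, Pi.smul_apply, smul_sub, map_sub,
    evalLin_etaForm π ρ hs Φ.2, hl, Finset.sum_sub_distrib, smul_smul, hsign, one_smul,
    Finset.sum_const, Finset.card_univ, Fintype.card_perm, Fintype.card_fin, sub_add_sub_cancel]
  congr 1
  rw [← Nat.cast_smul_eq_nsmul ℂ]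
  change _ = _ • ((n.factorial : ℂ)⁻¹ * _)
  rw [smul_eq_mul, mul_inv_cancel_left₀ h4]
  rfl

variable {π} in
theorem exists_values (hπ : Function.Surjective π) (Φ : InvPoly E G n) :
    ∃ κ : AlternatingMap ℂ (groupCohomology.H1 (AdRep (E := E) ρ)) (H Γ ℂ n) (Fin n),
      ∀ s : Fin n → groupCohomology.cocycles₁ (AdRep (E := E) ρ),
        Represents (fun γ => iteratedFDeriv ℂ n (Φ : E → ℂ) 0 fun k =>
          Ad (ρ (prefixProd γ k)) (s k (γ k)))
          (κ fun k => groupCohomology.H1π (AdRep (E := E) ρ) (s k)) ∧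
        HasValue π (eta hπ n Φ) ρ (fun k => tangent π ρ (s k))
          (κ fun k => groupCohomology.H1π (AdRep (E := E) ρ) (s k)) := by
  have h4 : ((n.factorial : ℕ) : ℂ) ≠ 0 := Nat.cast_ne_zero.2 n.factorial_ne_zero
  have hp : (iteratedFDeriv ℂ n (Φ : E → ℂ) 0).toMultilinearMap =
      (n.factorial : ℂ) • polar n (Φ : E → ℂ) := by
    rw [polar, smul_smul, mul_inv_cancel₀ h4, one_smul]
  let ι : groupCohomology.cocycles₁ (AdRep (E := E) ρ) →ₗ[ℂ] (Γ → E) :=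
    (groupCohomology.cocycles₁ (AdRep (E := E) ρ)).subtype
  have hι : ∀ z g h, ι z (g * h) = ι z g + adAct E ρ g (ι z h) := fun z g h =>
    ((groupCohomology.mem_cocycles₁_iff z.1).1 z.2 g h).trans (add_comm _ _)
  obtain ⟨κ, hκ⟩ := exists_alternating (A := adAct E ρ)
    (F := (iteratedFDeriv ℂ n (Φ : E → ℂ) 0).toMultilinearMap)
    (fun g => by
      rw [hp]
      exact MultilinearMap.ext fun u =>
        congrArg ((n.factorial : ℂ) • ·) (polar_Ad Φ.2 (ρ g) u))
    (fun u σ => by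
      rw [hp]
      exact congrArg ((n.factorial : ℂ) • ·) (polar_perm Φ.2 u σ))
    ι hι
    (groupCohomology.H1π (AdRep (E := E) ρ)).hom
    ((ModuleCat.epi_iff_surjective _).1 inferInstance) (fun z hz => by
      obtain ⟨m, hm⟩ := (groupCohomology.H1π_eq_zero_iff z).1 hz
      exact ⟨m, fun g => (congrFun hm g).symm⟩)
  exact ⟨κ, fun s => ⟨hκ s, hasValue_eta ρ hπ Φ (fun k => hι (s k)) (hκ s)⟩⟩

end Values

/-! ### Multiplicativity -/

section TensorForm

variable {E A : Type} [NormedAddCommGroup E] [NormedSpace ℂ E] [FiniteDimensional ℂ E]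
  [Ring A] [Algebra ℂ A] {n m : ℕ}

/-- The product of two multilinear forms, in separate sets of variables. -/
def tensorForm (F : MultilinearMap ℂ (fun _ : Fin n => E) ℂ)
    (F' : MultilinearMap ℂ (fun _ : Fin m => E) ℂ) : MultilinearMap ℂ (fun _ : Fin (n + m) => E) ℂ :=
  (LinearMap.mul' ℂ ℂ).compMultilinearMap ((F.domCoprod F').domDomCongr finSumFinEquiv)

omit [FiniteDimensional ℂ E] in
theorem tensorForm_apply (F : MultilinearMap ℂ (fun _ : Fin n => E) ℂ)
    (F' : MultilinearMap ℂ (fun _ : Fin m => E) ℂ) (u : Fin (n + m) → E) :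
    tensorForm F F' u = F (fun k => u (Fin.castAdd m k)) * F' (fun k => u (Fin.natAdd n k)) := rfl

theorem polyProd_tensorForm (F : MultilinearMap ℂ (fun _ : Fin n => E) ℂ)
    (F' : MultilinearMap ℂ (fun _ : Fin m => E) ℂ)
    (u : Fin (n + m) → Fin (Module.finrank ℂ E) → A) : polyProd A (tensorForm F F') u =
      polyProd A F (fun k => u (Fin.castAdd m k)) * polyProd A F' (fun k => u (Fin.natAdd n k)) := by
  simp only [polyProd_apply, Finset.sum_mul_sum]
  rw [← Finset.sum_product', ← Equiv.sum_comp (Fin.appendEquiv n m)]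
  refine Finset.sum_congr rfl fun b _ => ?_
  have h : (fun k => u k (Fin.append b.1 b.2 k)) = Fin.append (fun k => u (Fin.castAdd m k) (b.1 k))
      (fun k => u (Fin.natAdd n k) (b.2 k)) := by
    funext k
    refine Fin.addCases (fun i => ?_) (fun i => ?_) k <;> simp
  simp only [Fin.appendEquiv_apply, h, List.ofFn_fin_append, List.prod_append, tensorForm_apply,
    Fin.append_left, Fin.append_right, smul_mul_smul_comm]

/-- Permuting the arguments of `F` permutes the 1-forms in the product, which anticommute. -/
theorem polyProd_perm {O M : Type} [CommRing O] [Algebra ℂ O] [AddCommGroup M] [Module O M]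
    [Module ℂ M] [IsScalarTower ℂ O M] {F F' : MultilinearMap ℂ (fun _ : Fin n => E) ℂ} (σ : Equiv.Perm (Fin n))
    (h : ∀ u, F' u = F fun k => u (σ k)) (θ : Fin n → Fin (Module.finrank ℂ E) → M) :
    polyProd (ExteriorAlgebra O M) F (fun k b => ExteriorAlgebra.ι O (θ (σ k) b)) =
      ((Equiv.Perm.sign σ : ℤ) : ℂ) •
        polyProd (ExteriorAlgebra O M) F' fun k b => ExteriorAlgebra.ι O (θ k b) := by
  rw [polyProd_apply, polyProd_apply, Finset.smul_sum,
    ← Equiv.sum_comp (Equiv.arrowCongr σ.symm (Equiv.refl (Fin (Module.finrank ℂ E))))]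
  refine Finset.sum_congr rfl fun b _ => ?_
  have h1 := (ExteriorAlgebra.ιMulti O n).map_perm (fun k => θ k (b k)) σ
  rw [ExteriorAlgebra.ιMulti_apply, ExteriorAlgebra.ιMulti_apply] at h1
  rw [smul_comm, h, Int.cast_smul_eq_zsmul, ← Units.smul_def, ← h1]
  rfl

end TensorForm

/-- Both contractions of the product expand by the antiderivation rules into terms with a factor
that restricts to zero. `hbar` is needed because the grade involution of `i_X x` occurs. -/
theorem FormSystem.map_con_dr_mul {O M I R : Type} [CommRing O] [Algebra ℂ O] [AddCommGroup M]
    [Module O M] [Module ℂ M] [IsScalarTower ℂ O M] [Fintype I] [Ring R] (S : FormSystem O M I)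
    (X : M →ₗ[O] O) (r : ExteriorAlgebra O M →+* R) (hbar : ∀ x, r x = 0 → r (S.bar x) = 0)
    {x y : ExteriorAlgebra O M} (hx : r (con X x) = 0) (hy : r (con X y) = 0)
    (hdx : r (con X (S.dr x)) = 0) (hdy : r (con X (S.dr y)) = 0) :
    r (con X (x * y)) = 0 ∧ r (con X (S.dr (x * y))) = 0 := by
  constructor
  · rw [S.con_mul, map_add, map_mul, map_mul, hx, hy, zero_mul, mul_zero, add_zero]
  · rw [S.dr_mul, map_add, S.con_mul, S.con_mul, S.con_bar, S.bar_bar]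
    simp only [map_add, map_mul, map_neg, hdx, hdy, hy, hbar _ hx]
    simp

theorem prefixProd_castAdd {M : Type} [Monoid M] {n m : ℕ} (γ : Fin (n + m) → M) (k : Fin n) :
    prefixProd γ (Fin.castAdd m k) = prefixProd (fun k => γ (Fin.castAdd m k)) k := by
  have h : List.ofFn γ = List.ofFn (fun k => γ (Fin.castAdd m k)) ++
      List.ofFn fun k => γ (Fin.natAdd n k) := by
    rw [← List.ofFn_fin_append]
    congr 1
    exact (Fin.append_castAdd_natAdd (f := γ)).symm
  rw [prefixProd, prefixProd, h, Fin.val_castAdd, List.take_append_of_le_length (by simp [k.2.le])]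

theorem prefixProd_natAdd {M : Type} [Monoid M] {n m : ℕ} (γ : Fin (n + m) → M) (k : Fin m) :
    prefixProd γ (Fin.natAdd n k) = (List.ofFn fun k => γ (Fin.castAdd m k)).prod *
      prefixProd (fun k => γ (Fin.natAdd n k)) k := by
  have h : List.ofFn γ = List.ofFn (fun k => γ (Fin.castAdd m k)) ++
      List.ofFn fun k => γ (Fin.natAdd n k) := by
    rw [← List.ofFn_fin_append]
    congr 1
    exact (Fin.append_castAdd_natAdd (f := γ)).symm
  have h2 : (List.ofFn fun k => γ (Fin.castAdd m k)).length = n := List.length_ofFn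
  rw [prefixProd, prefixProd, h, Fin.val_natAdd, ← List.prod_append, ← List.take_length_add_append, h2]

/-! ### Products of basic forms and of the classes `η_Φ` -/

section Product

set_option linter.unusedSectionVars false

variable {E G Γ : Type} [NormedAddCommGroup E] [NormedSpace ℂ E] [FiniteDimensional ℂ E]
  [TopologicalSpace G] [ChartedSpace E G] [Group G] [LieGroup 𝓘(ℂ, E) ω G] [Group Γ] {p : ℕ}
  {π : FreeGroup (Fin p) →* Γ} {ρ : Γ →* G} {n m : ℕ}

theorem basicAt_iff {v : E} {z : Stalk E π ρ} : BasicAt π ρ v z ↔ ∃ x : DR (center (E := E) (pt π ρ)),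
    res π ρ x = z ∧ res π ρ (contract _ (conjField (pt π ρ) v) x) = 0 ∧
      res π ρ (contract _ (conjField (pt π ρ) v) (dr _ x)) = 0 := by
  constructor
  · rintro ⟨⟨x, y⟩, hq, h1, h2, h3⟩
    have hy : y = dr _ x := (mem_dGraph_iff _).1 hq
    rw [hy] at h3
    exact ⟨x, h1, h2, h3⟩
  · rintro ⟨x, h1, h2, h3⟩
    exact ⟨(x, dr _ x), (mem_dGraph_iff _).2 rfl, h1, h2, h3⟩

theorem BasicAt.one (v : E) : BasicAt π ρ v 1 := by
  rw [basicAt_iff, contract_eq (analyticAt_conjField (center_mem (pt π ρ)) v)]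
  have h1 : FormSystem.con (pairing (center (pt π ρ)) (conjField (pt π ρ) v)
      (analyticAt_conjField (center_mem (pt π ρ)) v)) 1 = 0 := by
    have h := FormSystem.con_c (pairing (center (pt π ρ)) (conjField (pt π ρ) v)
      (analyticAt_conjField (center_mem (pt π ρ)) v)) 1
    rwa [map_one] at h
  have h2 : dr (center (E := E) (pt π ρ)) 1 = 0 := by
    have h := (formSystem (center (E := E) (pt π ρ))).dr_c 1
    have h3 : (formSystem (center (E := E) (pt π ρ))).d 1 = 0 := by
      have h4 := (formSystem (center (E := E) (pt π ρ))).d_const 1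
      rwa [map_one] at h4
    rwa [map_one, h3, map_zero] at h
  exact ⟨1, map_one _, by rw [h1, map_zero], by rw [h2, map_zero, map_zero]⟩

theorem BasicAt.mul {v : E} {z z' : Stalk E π ρ} (h : BasicAt π ρ v z) (h' : BasicAt π ρ v z') :
    BasicAt π ρ v (z * z') := by
  rw [basicAt_iff, contract_eq (analyticAt_conjField (center_mem (pt π ρ)) v)] at *
  obtain ⟨x, hx, h1, h2⟩ := h
  obtain ⟨y, hy, h3, h4⟩ := h'
  have hbar : ∀ x : DR (center (E := E) (pt π ρ)), res π ρ x = 0 →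
      res π ρ ((formSystem _).bar x) = 0 := fun x hx => by
    rw [← barStalk_res, hx, map_zero]
  have h5 := (formSystem (center (E := E) (pt π ρ))).map_con_dr_mul _ (res π ρ).toRingHom hbar h1 h3 h2 h4
  exact ⟨x * y, (map_mul _ _ _).trans (congrArg₂ _ hx hy), h5.1, h5.2⟩

theorem delta_etaCochain (hπ : Function.Surjective π) {lift : Γ → FreeGroup (Fin p)}
    (hl : ∀ γ, π (lift γ) = γ) {Φ : E → ℂ} (hΦ : Φ ∈ InvPoly E G n) :
    delta (fun γ => etaCochain π lift n Φ γ ρ) = 0 := by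
  simp only [etaCochain_apply hπ hl]
  exact delta_cupC (polyProd_act ρ hπ (polar_Ad hΦ)) fun _ => tautCocycle_mul ρ hπ

/-- The symmetric form of `ΦΨ` averages the product form `T` over all permutations. Each permutation
contributes one sign from the anticommuting 1-forms and the same sign from `isCob_cupP_sub`, so
every term is cohomologous to the cup product. -/
theorem isCob_cupR_sub (hπ : Function.Surjective π) {Φ Ψ : E → ℂ} (hΦ : Φ ∈ InvPoly E G n)
    (hΨ : Ψ ∈ InvPoly E G m) {lift : Γ → FreeGroup (Fin p)} (hl : ∀ γ, π (lift γ) = γ) :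
    IsCob fun γ => cupR (fun γ => etaCochain π lift n Φ γ ρ) (fun γ => etaCochain π lift m Ψ γ ρ) γ -
      etaCochain π lift (n + m) (Φ * Ψ) γ ρ := by
  set T := tensorForm (polar n Φ) (polar m Ψ)
  have hT : ∀ (g : G) u, T (fun k => Ad g (u k)) = T u := fun g u => by
    rw [tensorForm_apply, tensorForm_apply, polar_Ad hΦ g fun k => u (Fin.castAdd m k),
      polar_Ad hΨ g fun k => u (Fin.natAdd n k)]
  have h1 : (fun γ => cupR (fun γ => etaCochain π lift n Φ γ ρ)
      (fun γ => etaCochain π lift m Ψ γ ρ) γ) =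
      cupC (act E ρ hπ) (polyProd (Stalk E π ρ) T) fun _ => tautCocycle E ρ hπ := by
    funext γ
    rw [cupR, etaCochain_apply hπ hl, etaCochain_apply hπ hl]
    change _ = polyProd _ _ _
    rw [polyProd_tensorForm]
    -- In the cup product, all factors of the second block carry in addition the action of the
    -- product of the first block; the invariance of `Ψ` removes it.
    have h2 := polyProd_act ρ hπ (polar_Ad hΨ) (List.ofFn fun k => γ (Fin.castAdd m k)).prod
    have h3 := congrArg (fun F => F fun k => act E ρ hπ (prefixProd (fun k => γ (Fin.natAdd n k)) k)
      (tautCocycle E ρ hπ (γ (Fin.natAdd n k)))) h2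
    simp only [id, prefixProd_castAdd, prefixProd_natAdd, map_mul]
    exact congrArg _ h3.symm
  have h4 : (fun γ => etaCochain π lift (n + m) (Φ * Ψ) γ ρ) = (((n + m).factorial : ℂ)⁻¹) •
      ∑ σ : Equiv.Perm (Fin (n + m)), ((Equiv.Perm.sign σ : ℤ) : ℂ) •
        cupP (act E ρ hπ) (polyProd (Stalk E π ρ) T) (fun _ => tautCocycle E ρ hπ) σ := by
    funext γ
    have hp : polar (n + m) (Φ * Ψ) = (((n + m).factorial : ℂ)⁻¹) •
        ∑ σ : Equiv.Perm (Fin (n + m)), T.domDomCongr σ := by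
      refine MultilinearMap.ext fun u => ?_
      rw [polar_mul hΦ hΨ, smul_apply, sum_apply]
      rfl
    rw [etaCochain, etaForm_eq, hp, polyProd_smul, polyProd_sum, smul_apply, sum_apply, map_smul,
      map_sum, Pi.smul_apply, Finset.sum_apply]
    congr 1
    refine Finset.sum_congr rfl fun σ _ => ?_
    have hs : ((Equiv.Perm.sign σ : ℤ) : ℂ) * ((Equiv.Perm.sign σ : ℤ) : ℂ) = 1 := by
      rw [← Int.cast_mul, ← Units.val_mul, Int.units_mul_self]
      simp
    have h5 := polyProd_perm (O := HolGerm (center (E := E) (pt π ρ))) (F := T)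
      (F' := T.domDomCongr σ) σ (fun u => rfl) fun k b =>
        slotGerm (pt π ρ) b (prefixProd (fun k => lift (γ k)) k) (lift (γ k))
    have h6 := congrArg (fun x => ((Equiv.Perm.sign σ : ℤ) : ℂ) • res π ρ x) h5
    simp only [map_smul, smul_smul, hs, one_smul] at h6
    refine h6.symm.trans ?_
    rw [Pi.smul_apply, map_polyProd]
    congr 1
    change _ = polyProd _ _ _
    congr 1
    funext k
    have h7 := map_prefixProd π (fun k => lift (γ k)) (σ k)
    simp only [hl] at h7
    rw [← h7, act_apply]
    refine funext fun b => (res_wordVec π ρ _ _ b).trans ?_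
    rw [← tautCocycle_apply ρ hπ, hl]
  have h8 : (fun γ => cupR (fun γ => etaCochain π lift n Φ γ ρ)
      (fun γ => etaCochain π lift m Ψ γ ρ) γ - etaCochain π lift (n + m) (Φ * Ψ) γ ρ) =
      -((((n + m).factorial : ℂ)⁻¹) • ∑ σ : Equiv.Perm (Fin (n + m)), ((Equiv.Perm.sign σ : ℤ) : ℂ) •
        (cupP (act E ρ hπ) (polyProd (Stalk E π ρ) T) (fun _ => tautCocycle E ρ hπ) σ -
          ((Equiv.Perm.sign σ : ℤ) : ℂ) • cupC (act E ρ hπ) (polyProd (Stalk E π ρ) T)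
            fun _ => tautCocycle E ρ hπ)) := by
    have hsign : ∀ σ : Equiv.Perm (Fin (n + m)),
        ((Equiv.Perm.sign σ : ℤ) : ℂ) * ((Equiv.Perm.sign σ : ℤ) : ℂ) = 1 := fun σ => by
      rw [← Int.cast_mul, ← Units.val_mul, Int.units_mul_self]
      simp
    have hf : (((n + m).factorial : ℕ) : ℂ) ≠ 0 := Nat.cast_ne_zero.2 (n + m).factorial_ne_zero
    refine (congrArg₂ (· - ·) h1 h4).trans ?_
    simp only [smul_sub, Finset.sum_sub_distrib, smul_smul, hsign, one_smul, Finset.sum_const,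
      Finset.card_univ, Fintype.card_perm, Fintype.card_fin]
    rw [← Nat.cast_smul_eq_nsmul ℂ, smul_smul, inv_mul_cancel₀ hf, one_smul, neg_sub]
  rw [h8]
  exact ((IsCob.sum _ fun σ _ => (isCob_cupP_sub (polyProd_act ρ hπ hT)
    (fun _ => tautCocycle_mul ρ hπ) σ).smul _).smul _).neg

theorem isOne_eta (hπ : Function.Surjective π) :
    IsOne π (eta hπ 0 (⟨1, SetLike.GradedOne.one_mem⟩ : InvPoly E G 0)) := by
  refine ⟨fun _ => ⟨1, one_mem_forms, fun ρ v => BasicAt.one v⟩, fun _ => rfl, ?_⟩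
  rw [represents_eta_iff hπ (Function.surjInv_eq hπ)]
  intro ρ
  funext γ
  rw [etaCochain_apply hπ (Function.surjInv_eq hπ)]
  refine sub_eq_zero.2 ?_
  change _ = polyProd _ _ _
  rw [polyProd_apply]
  simp [polar_one]

/-- On each stalk, replace `a` and then `b` by the explicit cocycle: `(a - η_Φ) ∪ η_Ψ` and `a ∪ (b -
η_Ψ)` are coboundaries, since the other factor is a cocycle in each case. -/
theorem isProduct_eta (hπ : Function.Surjective π) (Φ : InvPoly E G n) (Ψ : InvPoly E G m) :
    IsProduct π (eta hπ n Φ) (eta hπ m Ψ)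
      (eta hπ (n + m) ⟨Φ * Ψ, SetLike.mul_mem_graded Φ.2 Ψ.2⟩) := by
  intro a b ha hb
  have hl := Function.surjInv_eq hπ
  refine ⟨fun γ => ⟨cup π (fun γ => a γ) (fun γ => b γ) γ, forms_mul (a _).2.1 (b _).2.1,
    fun ρ v => ((a _).2.2 ρ v).mul ((b _).2.2 ρ v)⟩, fun _ => rfl, ?_⟩
  rw [represents_eta_iff hπ hl]
  intro ρ
  have h1 := (represents_eta_iff hπ hl Φ a).1 ha ρ
  have h2 := (represents_eta_iff hπ hl Ψ b).1 hb ρ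
  have hd := fun (n : ℕ) (Φ : InvPoly E G n) => delta_etaCochain (ρ := ρ) hπ hl Φ.2
  have h3 := h1.cupR_left (hd m Ψ)
  have hda : delta (fun γ => (a γ).1 ρ) = 0 := by
    have h := delta_map ((LinearMap.proj (R := ℂ) (φ := fun ρ : Γ →* G => Stalk E π ρ) ρ) ∘ₗ
      (BasicForms E G π n).subtype) a
    rw [ha.delta] at h
    refine Eq.trans h (funext fun γ => map_zero _)
  have h4 := IsCob.cupR_right hda h2
  convert (h3.add h4).add (isCob_cupR_sub (ρ := ρ) hπ Φ.2 Ψ.2 hl) using 1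
  funext γ
  simp only [Pi.add_apply, cupR, sub_mul, mul_sub]
  rw [add_comm (_ - _) (_ - _), sub_add_sub_cancel, sub_add_sub_cancel]
  rfl

end Product

/-! ### Maps between powers of `G` given by words -/

section WordMap

set_option linter.unusedSectionVars false

variable {E G : Type} [NormedAddCommGroup E] [NormedSpace ℂ E] [FiniteDimensional ℂ E]
  [TopologicalSpace G] [ChartedSpace E G] [Group G] [LieGroup 𝓘(ℂ, E) ω G] {p : ℕ}
  {w : Fin p → FreeGroup (Fin p)} {x x' : Fin p → G}

theorem ev_lift (v : FreeGroup (Fin p)) (y : Fin p → G) :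
    ev v (fun i => ev (w i) y) = ev (FreeGroup.lift w v) y := by
  have : FreeGroup.lift (fun i => ev (w i) y) = (FreeGroup.lift y).comp (FreeGroup.lift w) :=
    FreeGroup.ext_hom _ _ fun i => by simp [ev]
  exact congrArg (fun T => T v) this

variable (E w x x') in
/-- The map `y ↦ (w₁(y), …, wₚ(y))` in the product charts at `x` and `x'`. -/
def wordMap (e : Fin p → E) : Fin p → E := fun i => chartAt E (x' i) (ev (w i) (param x e))

theorem ev_center_mem (hx : ∀ i, ev (w i) x = x' i) (i : Fin p) :
    ev (w i) (param x (center (E := E) x)) ∈ (chartAt E (x' i)).source := by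
  rw [param_center, hx]
  exact mem_chart_source E _

theorem analyticAt_wordMap (hx : ∀ i, ev (w i) x = x' i) :
    AnalyticAt ℂ (wordMap E w x x') (center x) :=
  AnalyticAt.pi fun i => (holTo_ev (center_mem (E := E) x) (w i)).chart (ev_center_mem hx i)

theorem wordMap_center (hx : ∀ i, ev (w i) x = x' i) :
    wordMap E w x x' (center x) = center x' := by
  funext i
  rw [wordMap, param_center, hx]
  rfl

theorem param_wordMap (hx : ∀ i, ev (w i) x = x' i) :
    ∀ᶠ e in 𝓝 (center (E := E) x), param x' (wordMap E w x x' e) = fun i => ev (w i) (param x e) := by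
  have : ∀ᶠ e in 𝓝 (center (E := E) x), ∀ i, ev (w i) (param x e) ∈ (chartAt E (x' i)).source :=
    eventually_all.2 fun i => (holTo_ev (center_mem (E := E) x) (w i)).eventually_mem
      (ev_center_mem hx i)
  filter_upwards [this] with e he
  exact funext fun i => (chartAt E (x' i)).left_inv (he i)

theorem tendsto_wordMap (hx : ∀ i, ev (w i) x = x' i) :
    Tendsto (wordMap E w x x') (𝓝 (center x)) (𝓝 (center x')) := by
  have h := (analyticAt_wordMap (E := E) hx).continuousAt.tendsto
  rwa [wordMap_center hx] at h

theorem HolAt.comp_word {f : (Fin p → G) → ℂ} (hx : ∀ i, ev (w i) x = x' i)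
    (hf : HolAt (E := E) f x') : HolAt (E := E) (fun y => f fun i => ev (w i) y) x := by
  have h1 : AnalyticAt ℂ (fun e : Fin p → E => f (param x' e)) (wordMap E w x x' (center x)) := by
    rw [wordMap_center hx]
    exact hf
  have h2 : AnalyticAt ℂ (fun e => f (param x' (wordMap E w x x' e))) (center (E := E) x) :=
    AnalyticAt.comp (g := fun e : Fin p → E => f (param x' e)) h1 (analyticAt_wordMap hx)
  refine h2.congr ?_
  filter_upwards [param_wordMap hx] with e he
  rw [he]

theorem monomial_congr {V : Type} [NormedAddCommGroup V] [NormedSpace ℂ V] {a : V} {n : ℕ}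
    {f f' : V → ℂ} {g g' : Fin n → V → ℂ} (hf : f =ᶠ[𝓝 a] f') (hg : ∀ k, g k =ᶠ[𝓝 a] g' k) :
    monomial a f g = monomial a f' g' := by
  rw [monomial, monomial, holGerm_congr hf]
  simp only [formGerm_congr (hg _).fderiv]

variable (E w) in
/-- The pullback of germs of forms along the map given by words. -/
def wordPull (hx : ∀ i, ev (w i) x = x' i) :
    DR (center (E := E) x') →ₐ[ℂ] DR (center (E := E) x) :=
  { pullDR (analyticAt_wordMap hx) (wordMap_center hx) with
    commutes' := pullDR_algebraMap (analyticAt_wordMap hx) (wordMap_center hx) }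

theorem wordPull_monomial (hx : ∀ i, ev (w i) x = x' i) {n : ℕ} {f : (Fin p → E) → ℂ}
    (hf : AnalyticAt ℂ f (center x')) {g : Fin n → (Fin p → E) → ℂ}
    (hg : ∀ k, AnalyticAt ℂ (g k) (center x')) :
    wordPull E w hx (monomial _ f g) =
      monomial _ (fun e => f (wordMap E w x x' e)) fun k e => g k (wordMap E w x x' e) :=
  pullDR_monomial (analyticAt_wordMap hx) (wordMap_center hx) hf hg

theorem wordPull_monomial_param (hx : ∀ i, ev (w i) x = x' i) {n : ℕ} {f : (Fin p → G) → ℂ}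
    (hf : HolAt (E := E) f x') {g : Fin n → (Fin p → G) → ℂ} (hg : ∀ k, HolAt (E := E) (g k) x') :
    wordPull E w hx (monomial _ (fun e => f (param x' e)) fun k e => g k (param x' e)) =
      monomial _ (fun e => f fun i => ev (w i) (param x e)) fun k e => g k fun i => ev (w i) (param x e) := by
  rw [wordPull_monomial hx hf hg]
  refine monomial_congr ?_ fun k => ?_
  · filter_upwards [param_wordMap hx] with e he
    rw [he]
  · filter_upwards [param_wordMap hx] with e he
    rw [he]

theorem wordPull_dr (hx : ∀ i, ev (w i) x = x' i) (z : DR (center (E := E) x')) :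
    wordPull E w hx (dr _ z) = dr _ (wordPull E w hx z) := by
  induction mem_span_monomial z using Submodule.span_induction with
  | zero => simp only [map_zero]
  | add y z _ _ hy hz => simp only [map_add, hy, hz]
  | smul c y _ hy => simp only [map_smul, hy]
  | mem y hy =>
    obtain ⟨n, f, g, hf, hg, rfl⟩ := hy
    have hT := analyticAt_wordMap (E := E) hx
    have hc : ∀ {f : (Fin p → E) → ℂ}, AnalyticAt ℂ f (center x') →
        AnalyticAt ℂ (fun e => f (wordMap E w x x' e)) (center x) := fun {f} hf => by
      rw [← wordMap_center hx] at hf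
      exact AnalyticAt.comp (g := f) hf hT
    rw [dr_monomial hf hg, wordPull_monomial hx hf hg, dr_monomial (hc hf) fun k => hc (hg k),
      wordPull_monomial hx analyticAt_const fun k => ?_]
    · congr 1
      funext k
      refine Fin.cases rfl (fun k => rfl) k
    · refine Fin.cases hf (fun k => hg k) k

/-- The word map is equivariant for simultaneous conjugation, so it relates the two vector fields;
differentiate the intertwined flows at the unit. -/
theorem fderiv_wordMap_conjField (hx : ∀ i, ev (w i) x = x' i) (v : E) :
    ∀ᶠ e in 𝓝 (center (E := E) x), fderiv ℂ (wordMap E w x x') e (conjField x v e) =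
      conjField x' v (wordMap E w x x' e) := by
  have := FiniteDimensional.complete ℂ E
  filter_upwards [eventually_mem_chartDom (E := E) x, (param_wordMap (E := E) hx).eventually_nhds,
    (tendsto_wordMap hx).eventually (eventually_mem_chartDom (E := E) x'),
    (analyticAt_wordMap (E := E) hx).eventually_analyticAt] with e he h1 he' hT
  have hd : AnalyticAt ℂ (fun ε => conjFlow x ε e) (k1 E G) :=
    (analyticAt_conjFlow he).comp (f := fun ε => (ε, e)) (analyticAt_id.prod analyticAt_const)
  have hd' : AnalyticAt ℂ (fun ε => conjFlow x' ε (wordMap E w x x' e)) (k1 E G) :=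
    (analyticAt_conjFlow he').comp (f := fun ε => (ε, wordMap E w x x' e))
      (analyticAt_id.prod analyticAt_const)
  have hc : ContinuousAt (fun ε : E => (ε, e)) (k1 E G) := by fun_prop
  have h2 : (fun ε => wordMap E w x x' (conjFlow x ε e)) =ᶠ[𝓝 (k1 E G)]
      fun ε => conjFlow x' ε (wordMap E w x x' e) := by
    filter_upwards [hc.eventually (param_conjFlow he)] with ε hε
    funext i
    rw [wordMap, hε, ev_conj, conjFlow, h1.self_of_nhds]
  have h3 : HasFDerivAt (wordMap E w x x') (fderiv ℂ (wordMap E w x x') e)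
      (conjFlow x (k1 E G) e) := by
    rw [conjFlow_one he]
    exact hT.differentiableAt.hasFDerivAt
  have h4 := (HasFDerivAt.comp (k1 E G) h3 hd.differentiableAt.hasFDerivAt).fderiv
  rw [conjField_eq he, conjField_eq he', ← h2.fderiv_eq]
  exact (congrArg (fun T => T v) h4).symm

theorem wordPull_contract (hx : ∀ i, ev (w i) x = x' i) (v : E) (z : DR (center (E := E) x')) :
    wordPull E w hx (contract _ (conjField x' v) z) =
      contract _ (conjField x v) (wordPull E w hx z) :=
  pullDR_contract (analyticAt_wordMap hx) (wordMap_center hx)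
    (analyticAt_conjField (center_mem x) v) (analyticAt_conjField (center_mem x') v)
    (fderiv_wordMap_conjField hx v) z

theorem wordPull_wordVec (hx : ∀ i, ev (w i) x = x' i) (P v : FreeGroup (Fin p))
    (b : Fin (Module.finrank ℂ E)) :
    wordPull E w hx (wordVec E x' P v b) =
      wordVec E x (FreeGroup.lift w P) (FreeGroup.lift w v) b := by
  refine (pull_ι _ _ _).trans (congrArg _ ?_)
  rw [slotGerm, pullOne_formGerm _ _ (analyticAt_slot (center_mem x') b P v)]
  refine formGerm_congr ?_
  filter_upwards [eventually_mem_chartDom (E := E) x, (param_wordMap (E := E) hx).eventually_nhds,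
    (tendsto_wordMap hx).eventually (eventually_mem_chartDom (E := E) x'),
    (analyticAt_wordMap (E := E) hx).eventually_analyticAt] with e he h1 he' hT
  have h2 : mcForm x (FreeGroup.lift w v) e =
      (mcForm x' v (wordMap E w x x' e)).comp (fderiv ℂ (wordMap E w x x') e) := by
    rw [mcForm_eq he, mcForm_eq he', ← ldv_comp (holTo_ev he' v) hT]
    refine ldv_congr ?_
    filter_upwards [h1] with e' he'
    rw [he', ev_lift]
  rw [slot, slot, h2, h1.self_of_nhds, ev_lift]
  rfl

theorem wordPull_etaForm (hx : ∀ i, ev (w i) x = x' i) {n : ℕ} (Φ : E → ℂ)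
    (v : Fin n → FreeGroup (Fin p)) :
    wordPull E w hx (etaForm x' Φ v) = etaForm x Φ fun k => FreeGroup.lift w (v k) := by
  rw [etaForm_eq, etaForm_eq, map_polyProd]
  congr 1
  funext k b
  rw [wordPull_wordVec, map_prefixProd]

end WordMap

/-! ### Pullback of forms along automorphisms of `Γ` -/

section StalkPull

set_option linter.unusedSectionVars false

variable {E G Γ : Type} [NormedAddCommGroup E] [NormedSpace ℂ E] [FiniteDimensional ℂ E]
  [TopologicalSpace G] [ChartedSpace E G] [Group G] [LieGroup 𝓘(ℂ, E) ω G] [Group Γ] {p : ℕ}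
  {π : FreeGroup (Fin p) →* Γ} {ρ : Γ →* G}

/-- The elements of the kernel of `O → A` that are annihilated by a derivation with values in `A`. -/
def derKer {O A : Type} [CommRing O] [Ring A] [Algebra O A] (D : O → A)
    (h_add : ∀ f g, D (f + g) = D f + D g) (h_mul : ∀ f g, D (f * g) = f • D g + g • D f) :
    Ideal O where
  carrier := {f | algebraMap O A f = 0 ∧ D f = 0}
  zero_mem' := ⟨map_zero _, by simpa using h_add 0 0⟩
  add_mem' := by
    rintro f g ⟨h1, h2⟩ ⟨h3, h4⟩
    exact ⟨by rw [map_add, h1, h3, add_zero], by rw [h_add, h2, h4, add_zero]⟩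
  smul_mem' := by
    rintro f g ⟨h1, h2⟩
    exact ⟨by rw [smul_eq_mul, map_mul, h1, mul_zero],
      by rw [smul_eq_mul, h_mul, h2, smul_zero, zero_add, Algebra.smul_def, h1, zero_mul]⟩

variable (E π ρ) in
/-- The differential of a function, restricted to `Hom(Γ, G)`. -/
def resD (φ : HolGerm (center (E := E) (pt π ρ))) : Stalk E π ρ :=
  res π ρ (ExteriorAlgebra.ι (HolGerm (center (E := E) (pt π ρ))) (dFun φ))

theorem resD_add (φ ψ : HolGerm (center (E := E) (pt π ρ))) :
    resD E π ρ (φ + ψ) = resD E π ρ φ + resD E π ρ ψ := by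
  rw [resD, dFun_add, map_add, map_add]
  rfl

theorem resD_mul (φ ψ : HolGerm (center (E := E) (pt π ρ))) :
    resD E π ρ (φ * ψ) = φ • resD E π ρ ψ + ψ • resD E π ρ φ := by
  have h := (ExteriorAlgebra.ι (HolGerm (center (E := E) (pt π ρ)))).map_add (φ • dFun ψ) (ψ • dFun φ)
  rw [(ExteriorAlgebra.ι (HolGerm (center (E := E) (pt π ρ)))).map_smul,
    (ExteriorAlgebra.ι (HolGerm (center (E := E) (pt π ρ)))).map_smul] at h
  rw [resD, dFun_mul, h, map_add]
  exact congrArg₂ _ (res_smul π ρ φ _) (res_smul π ρ ψ _)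

variable (E π ρ) in
/-- The germs of functions whose value and differential vanish on `Hom(Γ, G)`. -/
def relIdeal : Ideal (HolGerm (center (E := E) (pt π ρ))) := derKer (resD E π ρ) resD_add resD_mul

theorem holGerm_mem_relIdeal {w : FreeGroup (Fin p)} (hw : π w = 1) {f : G → ℂ} (h1 : f 1 = 0)
    (hf : AnalyticAt ℂ (fun e : E => f ((chartAt E (1 : G)).symm e)) (chartAt E (1 : G) 1)) :
    holGerm (center (E := E) (pt π ρ)) (fun e => f (ev w (param (pt π ρ) e))) ∈ relIdeal E π ρ := by
  refine ⟨res_eq_zero (.zero w f hw h1 hf), ?_⟩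
  rw [resD, dFun_holGerm (analyticAt_comp_ev π ρ hw hf)]
  exact res_eq_zero (.dzero w f hw h1 hf)

/-- The coordinates of `w` relative to those of 1 are the relations to which all others are reduced
by Hadamard's lemma. -/
theorem coo_mem_relIdeal {w : FreeGroup (Fin p)} (hw : π w = 1) (j : Fin (Module.finrank ℂ E)) :
    AnalyticAt ℂ (fun e : Fin p → E => coo E j (chartAt E (1 : G) (ev w (param (pt π ρ) e)) - k1 E G))
      (center (pt π ρ)) ∧
    holGerm (center (E := E) (pt π ρ)) (fun e => coo E j (chartAt E (1 : G) (ev w (param (pt π ρ) e)) - k1 E G)) ∈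
      relIdeal E π ρ := by
  have hf : AnalyticAt ℂ (fun e : E => coo E j (chartAt E (1 : G) ((chartAt E (1 : G)).symm e) -
      k1 E G)) (chartAt E (1 : G) 1) := by
    have h1 : AnalyticAt ℂ (fun e : E => coo E j (e - k1 E G)) (chartAt E (1 : G) 1) :=
      ((coo E j).analyticAt _).comp (f := fun e : E => e - k1 E G)
        (analyticAt_id.sub analyticAt_const)
    refine h1.congr ?_
    filter_upwards [(chartAt E (1 : G)).open_target.mem_nhds (mem_chart_target E 1)] with e he
    rw [(chartAt E (1 : G)).right_inv he]
  exact ⟨analyticAt_comp_ev π ρ hw (f := fun g => coo E j (chartAt E (1 : G) g - k1 E G)) hf,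
    holGerm_mem_relIdeal hw (f := fun g => coo E j (chartAt E (1 : G) g - k1 E G))
      (by simp [k1]) hf⟩

/-- Right translation in the product chart at `x`. -/
def translate (x : Fin p → G) (z : (Fin p → E) × (Fin p → E)) : Fin p → E := fun i =>
  chartAt E (x i) (param x z.1 i * (chartAt E (1 : G)).symm (z.2 i))

theorem analyticAt_translate (x : Fin p → G) :
    AnalyticAt ℂ (translate (E := E) x) (center x, fun _ => k1 E G) := by
  have := FiniteDimensional.complete ℂ E
  refine AnalyticAt.pi fun i => ?_
  have h1 : HolTo E (fun z : (Fin p → E) × (Fin p → E) => param x z.1 i)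
      (center x, fun _ => k1 E G) :=
    HolTo.comp (u := fun e : Fin p → E => param x e i)
      (T := fun z : (Fin p → E) × (Fin p → E) => z.1) (holTo_param (center_mem x) i) analyticAt_fst
  have h2 : HolTo E (fun z : (Fin p → E) × (Fin p → E) => (chartAt E (1 : G)).symm (z.2 i))
      (center x, fun _ => k1 E G) :=
    HolTo.comp (T := fun z : (Fin p → E) × (Fin p → E) => z.2 i) holTo_symm
      ((analyticAt_apply i _).comp (f := Prod.snd) analyticAt_snd)
  refine (h1.mul h2).chart ?_
  rw [symm_k1, mul_one, param_center]
  exact mem_chart_source E _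

theorem translate_one {x : Fin p → G} {e : Fin p → E} (he : e ∈ chartDom E x) :
    translate x (e, fun _ => k1 E G) = e := by
  funext i
  rw [translate, symm_k1, mul_one]
  exact (chartAt E (x i)).right_inv (he i)

/-- The generators of the ideal involve one word at a time, whereas `f` depends on all `p` words
jointly. Hadamard's lemma writes the difference as a combination, with holomorphic coefficients, of
coordinates of single words in the kernel. -/
theorem holGerm_sub_mem_relIdeal {w w' : Fin p → FreeGroup (Fin p)} {x' : Fin p → G}
    (hw : ∀ i, π (w' i) = π (w i)) (hx : ∀ i, ev (w i) (pt π ρ) = x' i) {f : (Fin p → E) → ℂ} (hf : AnalyticAt ℂ f (center x')) :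
    holGerm (center (pt π ρ)) (fun e => f (wordMap E w' (pt π ρ) x' e)) -
      holGerm (center (pt π ρ)) (fun e => f (wordMap E w (pt π ρ) x' e)) ∈ relIdeal E π ρ := by
  set x := pt π ρ
  set a : Fin p → E := fun _ => k1 E G
  have hT := analyticAt_wordMap (E := E) hx
  have hTc := wordMap_center (E := E) hx
  -- The words `w'` are right translates of `w` by words in the kernel, so `f ∘ w'` and `f ∘ w` are
  -- values of one function of a base point and a translation, at `u` and at 1.
  let u : Fin p → FreeGroup (Fin p) := fun i => (w i)⁻¹ * w' i
  have hu : ∀ i, π (u i) = 1 := fun i => by simp [u, hw]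
  have hh : AnalyticAt ℂ (fun z => f (translate x' z)) (center x', a) := by
    have h1 : translate x' (center x', a) = center x' := translate_one (center_mem x')
    rw [← h1] at hf
    exact AnalyticAt.comp (g := f) hf (analyticAt_translate x')
  obtain ⟨q, hq, hq2⟩ := exists_hadamard hh
  let U : (Fin p → E) → Fin p → E := fun e i => chartAt E (1 : G) (ev (u i) (param x e))
  have hu1 : ∀ i, ev (u i) (param x (center (E := E) x)) = 1 := fun i => by
    rw [param_center, ev_pt, hu, map_one]
  have hU : AnalyticAt ℂ U (center x) := AnalyticAt.pi fun i =>
    (holTo_ev (center_mem x) (u i)).chart_one (hu1 i)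
  have hUc : U (center x) = a := funext fun i => congrArg (chartAt E (1 : G)) (hu1 i)
  let z : (Fin p → E) → ((Fin p → E) × (Fin p → E)) × ((Fin p → E) × (Fin p → E)) := fun e =>
    ((wordMap E w x x' e, U e), (wordMap E w x x' e, a))
  have hz : AnalyticAt ℂ z (center x) := (hT.prod hU).prod (hT.prod analyticAt_const)
  have hzc : z (center x) = ((center x', a), (center x', a)) := by
    simp only [z, hTc, hUc]
  have hqz : AnalyticAt ℂ (fun e => q (z e)) (center x) := by
    rw [← hzc] at hq
    exact hq.comp hz
  let c : Fin p → Fin (Module.finrank ℂ E) → (Fin p → E) → ℂ := fun i j e =>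
    q (z e) (0, Pi.single i (bas E j))
  have hc : ∀ i j, AnalyticAt ℂ (c i j) (center x) := fun i j =>
    ((ContinuousLinearMap.apply ℂ ℂ ((0, Pi.single i (bas E j)) : (Fin p → E) × (Fin p → E))).analyticAt
      _).comp hqz
  let v : Fin p → Fin (Module.finrank ℂ E) → (Fin p → E) → ℂ := fun i j e =>
    coo E j (chartAt E (1 : G) (ev (u i) (param x e)) - k1 E G)
  have hv : ∀ i j, AnalyticAt ℂ (v i j) (center x) := fun i j => (coo_mem_relIdeal (hu i) j).1
  have key : ∀ᶠ e in 𝓝 (center (E := E) x), f (wordMap E w' x x' e) =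
      f (wordMap E w x x' e) + ∑ i, ∑ j, c i j e * v i j e := by
    have e1 := hz.continuousAt.tendsto
    rw [hzc] at e1
    filter_upwards [e1.eventually hq2, param_wordMap (E := E) hx,
      (tendsto_wordMap hx).eventually (eventually_mem_chartDom (E := E) x'),
      eventually_all.2 fun i => (holTo_ev (center_mem (E := E) x) (u i)).eventually_mem
        (g := 1) (by rw [hu1 i]; exact mem_chart_source E _)] with e h1 h2 h3 h4
    have h5 : translate x' (z e).1 = wordMap E w' x x' e := by
      funext i
      change chartAt E (x' i) (param x' (wordMap E w x x' e) i *
        (chartAt E (1 : G)).symm (chartAt E (1 : G) (ev (u i) (param x e)))) = _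
      rw [h2, (chartAt E (1 : G)).left_inv (h4 i), ← ev_mul, mul_inv_cancel_left]
      rfl
    have h6 : translate x' (z e).2 = wordMap E w x x' e := translate_one h3
    rw [h5, h6] at h1
    rw [← sub_eq_iff_eq_add', h1]
    -- The two points differ only in the translation part, whose components are the coordinates of
    -- the words `u i`.
    have h7 : (z e).1 - (z e).2 = ∑ i, ∑ j, v i j e • ((0 : Fin p → E), Pi.single i (bas E j)) := by
      have h8 : U e - a = ∑ i, ∑ j, v i j e • (Pi.single i (bas E j) : Fin p → E) := by
        conv_lhs => rw [← Finset.univ_sum_single (U e - a)]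
        refine Finset.sum_congr rfl fun i _ => ?_
        have h9 : (U e - a) i = ∑ j, v i j e • bas E j := (sum_coo_smul _).symm
        rw [h9]
        simp only [← LinearMap.coe_single ℂ (fun _ : Fin p => E), map_sum, map_smul]
      refine Prod.ext ?_ ?_
      · simp [z, Prod.fst_sum]
      · simp only [Prod.snd_sum, Prod.smul_snd]
        exact h8
    rw [h7, map_sum]
    refine Finset.sum_congr rfl fun i _ => ?_
    rw [map_sum]
    refine Finset.sum_congr rfl fun j _ => ?_
    rw [map_smul, smul_eq_mul, mul_comm]
  have hfT : AnalyticAt ℂ (fun e => f (wordMap E w x x' e)) (center x) := by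
    rw [← hTc] at hf
    exact AnalyticAt.comp (g := f) hf hT
  have hcv : ∀ i j, AnalyticAt ℂ (fun e => c i j e * v i j e) (center x) := fun i j =>
    (hc i j).fun_mul (hv i j)
  have hs : ∀ i, AnalyticAt ℂ (fun e => ∑ j, c i j e * v i j e) (center x) := fun i =>
    Finset.analyticAt_fun_sum _ fun j _ => hcv i j
  rw [holGerm_congr key, holGerm_add hfT (Finset.analyticAt_fun_sum _ fun i _ => hs i),
    add_sub_cancel_left, holGerm_sum _ hs]
  refine Ideal.sum_mem _ fun i _ => ?_
  rw [holGerm_sum _ (hcv i)]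
  refine Ideal.sum_mem _ fun j _ => ?_
  rw [holGerm_mul (hc i j) (hv i j)]
  exact Ideal.mul_mem_left _ _ (coo_mem_relIdeal (hu i) j).2

theorem res_monomial {n : ℕ} (f : (Fin p → E) → ℂ) {g : Fin n → (Fin p → E) → ℂ}
    (hg : ∀ k, AnalyticAt ℂ (g k) (center (pt π ρ))) :
    res π ρ (monomial _ f g) = algebraMap _ (Stalk E π ρ) (holGerm (center (pt π ρ)) f) *
      (List.ofFn fun k => resD E π ρ (holGerm (center (pt π ρ)) (g k))).prod := by
  rw [monomial, map_mul, map_list_prod, List.map_ofFn, res_algebraMap]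
  simp only [Function.comp_def, resD, dFun_holGerm (hg _)]

theorem AnalyticAt.comp_wordMap {w : Fin p → FreeGroup (Fin p)} {x x' : Fin p → G}
    (hx : ∀ i, ev (w i) x = x' i) {f : (Fin p → E) → ℂ} (hf : AnalyticAt ℂ f (center x')) :
    AnalyticAt ℂ (fun e => f (wordMap E w x x' e)) (center x) := by
  rw [← wordMap_center hx] at hf
  exact AnalyticAt.comp (g := f) hf (analyticAt_wordMap hx)

/-- By the previous lemma the functions and their differentials have equal restrictions, hence so do
the monomials, which span. -/
theorem res_wordPull_eq {w w' : Fin p → FreeGroup (Fin p)} {x' : Fin p → G}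
    (hw : ∀ i, π (w' i) = π (w i)) (hx : ∀ i, ev (w i) (pt π ρ) = x' i)
    (hx' : ∀ i, ev (w' i) (pt π ρ) = x' i) (z : DR (center (E := E) x')) :
    res π ρ (wordPull E w' hx' z) = res π ρ (wordPull E w hx z) := by
  induction mem_span_monomial z using Submodule.span_induction with
  | zero => simp only [map_zero]
  | add y z _ _ hy hz => simp only [map_add, hy, hz]
  | smul c y _ hy => simp only [map_smul, hy]
  | mem y hy =>
    obtain ⟨n, f, g, hf, hg, rfl⟩ := hy
    have h1 := (holGerm_sub_mem_relIdeal hw hx hf).1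
    rw [map_sub, sub_eq_zero] at h1
    have h2 : ∀ k, resD E π ρ (holGerm _ fun e => g k (wordMap E w' (pt π ρ) x' e)) =
        resD E π ρ (holGerm _ fun e => g k (wordMap E w (pt π ρ) x' e)) := fun k => by
      have h := (holGerm_sub_mem_relIdeal hw hx (hg k)).2
      have h3 := resD_add (holGerm (center (pt π ρ)) (fun e => g k (wordMap E w' (pt π ρ) x' e)) -
        holGerm _ (fun e => g k (wordMap E w (pt π ρ) x' e)))
        (holGerm _ (fun e => g k (wordMap E w (pt π ρ) x' e)))
      rwa [sub_add_cancel, h, zero_add] at h3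
    rw [wordPull_monomial hx hf hg, wordPull_monomial hx' hf hg,
      res_monomial _ fun k => AnalyticAt.comp_wordMap hx (hg k),
      res_monomial _ fun k => AnalyticAt.comp_wordMap hx' (hg k), h1]
    simp only [h2]

end StalkPull

/-! ### Invariance under automorphisms of `Γ` -/

section AutCohomology

variable {Γ V : Type} [Group Γ] [AddCommGroup V] [Module ℂ V] {n : ℕ}

theorem Represents.aut {c : (Fin n → Γ) → V} {x : H Γ V n} (h : Represents c x) (α : Γ ≃* Γ) :
    Represents (fun γ => c fun k => α (γ k)) (autMap V n α x) := by
  obtain ⟨z, rfl, rfl⟩ := h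
  let F : Rep.res α.toMonoidHom (Rep.trivial ℂ Γ V) ⟶ Rep.trivial ℂ Γ V :=
    Rep.ofHom ⟨LinearMap.id, fun _ => rfl⟩
  have h1 := HomologicalComplex.cyclesMap_i (groupCohomology.cochainsMap α.toMonoidHom F) n
  have h2 := groupCohomology.π_map_apply α.toMonoidHom F n z
  refine ⟨(groupCohomology.cocyclesMap α.toMonoidHom F n).hom z, ?_, h2.symm⟩
  exact congrArg (fun T => (ModuleCat.Hom.hom T) z) h1

theorem IsCob.aut {c : (Fin n → Γ) → V} (h : IsCob c) (α : Γ ≃* Γ) :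
    IsCob fun γ => c fun k => α (γ k) := by
  have h1 := h.represents.aut α
  rw [map_zero] at h1
  exact h1.isCob

end AutCohomology

/-! ### Pullback along automorphisms on stalks, basic forms and the classes `η_Φ` -/

section AutInvariant

set_option linter.unusedSectionVars false

variable {E G Γ : Type} [NormedAddCommGroup E] [NormedSpace ℂ E] [FiniteDimensional ℂ E]
  [TopologicalSpace G] [ChartedSpace E G] [Group G] [LieGroup 𝓘(ℂ, E) ω G] [Group Γ] {p : ℕ}
  {π : FreeGroup (Fin p) →* Γ} {α : Γ ≃* Γ} {w : Fin p → FreeGroup (Fin p)}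

/-- The words `wᵢ` lift the elements `α(π(xᵢ))`. -/
def LiftsAut (π : FreeGroup (Fin p) →* Γ) (α : Γ ≃* Γ) (w : Fin p → FreeGroup (Fin p)) : Prop :=
  ∀ i, π (w i) = α (π (FreeGroup.of i))

theorem LiftsAut.lift (hw : LiftsAut π α w) (v : FreeGroup (Fin p)) :
    π (FreeGroup.lift w v) = α (π v) := by
  have : π.comp (FreeGroup.lift w) = α.toMonoidHom.comp π :=
    FreeGroup.ext_hom _ _ fun i => by simpa using hw i
  exact congrArg (fun T => T v) this

theorem LiftsAut.ev_pt (hw : LiftsAut π α w) (ρ : Γ →* G) (i : Fin p) :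
    ev (w i) (pt π ρ) = pt π (ρ.comp α.toMonoidHom) i := by
  rw [CharStack.ev_pt, hw]
  rfl

variable (E) in
/-- The pullback of germs of forms on `Hom(Γ, G)` along `ρ ↦ ρ ∘ α`. -/
def stalkPull (hw : LiftsAut π α w) (ρ : Γ →* G) :
    Stalk E π (ρ.comp α.toMonoidHom) →ₐ[ℂ] Stalk E π ρ :=
  RingQuot.liftAlgHom ℂ ⟨(res π ρ).comp (wordPull E w (hw.ev_pt ρ)), by
    have hT := analyticAt_wordMap (E := E) (hw.ev_pt ρ)
    -- The relation of a word `v` is pulled back to the relation of the substituted word, which lies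
    -- in the kernel of `π` again because `π` intertwines substitution with `α`.
    have key : ∀ (v : FreeGroup (Fin p)) (f : G → ℂ),
        (fun e => f (ev v (param (pt π (ρ.comp α.toMonoidHom)) (wordMap E w (pt π ρ)
          (pt π (ρ.comp α.toMonoidHom)) e)))) =ᶠ[𝓝 (center (E := E) (pt π ρ))]
          fun e => f (ev (FreeGroup.lift w v) (param (pt π ρ) e)) := fun v f => by
      filter_upwards [param_wordMap (E := E) (hw.ev_pt ρ)] with e he
      rw [he, ev_lift]
    rintro _ _ (⟨v, f, hv, h1, hf⟩ | ⟨v, f, hv, h1, hf⟩)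
    · have hv' : π (FreeGroup.lift w v) = 1 := by rw [hw.lift, hv, map_one]
      rw [map_zero, AlgHom.comp_apply]
      refine Eq.trans (congrArg (res π ρ) ?_) (res_eq_zero (.zero _ f hv' h1 hf))
      refine (pull_c _ _ _).trans (congrArg _ ?_)
      rw [pullFun_holGerm _ _ (analyticAt_comp_ev π _ hv hf)]
      exact holGerm_congr (key v f)
    · have hv' : π (FreeGroup.lift w v) = 1 := by rw [hw.lift, hv, map_one]
      rw [map_zero, AlgHom.comp_apply]
      refine Eq.trans (congrArg (res π ρ) ?_) (res_eq_zero (.dzero _ f hv' h1 hf))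
      have h2 : ∀ (x : Fin p → G) {f : (Fin p → E) → ℂ},
          ExteriorAlgebra.ι (HolGerm (center (E := E) x)) (formGerm (center (E := E) x) (fderiv ℂ f)) =
            monomial (center (E := E) x) (fun _ => 1) fun _ : Fin 1 => f := fun x f => by
        simp [monomial, holGerm_one]
      rw [h2, h2, wordPull_monomial _ analyticAt_const fun _ => analyticAt_comp_ev π _ hv hf]
      exact monomial_congr EventuallyEq.rfl fun _ => key v f⟩

theorem stalkPull_res (hw : LiftsAut π α w) (ρ : Γ →* G)
    (x : DR (center (E := E) (pt π (ρ.comp α.toMonoidHom)))) :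
    stalkPull E hw ρ (res π _ x) = res π ρ (wordPull E w (hw.ev_pt ρ) x) :=
  RingQuot.liftAlgHom_mkAlgHom_apply ℂ _ _ _

theorem stalkPull_eq {w' : Fin p → FreeGroup (Fin p)} (hw : LiftsAut π α w)
    (hw' : LiftsAut π α w') (ρ : Γ →* G) : stalkPull E hw' ρ = stalkPull E hw ρ := by
  refine AlgHom.ext fun z => ?_
  obtain ⟨x, rfl⟩ := res_surjective π _ z
  rw [stalkPull_res, stalkPull_res]
  exact res_wordPull_eq (fun i => (hw' i).trans (hw i).symm) _ _ x

theorem stalkPull_mono (hw : LiftsAut π α w) (ρ : Γ →* G) {n : ℕ} {f : (Fin p → G) → ℂ}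
    {g : Fin n → (Fin p → G) → ℂ} (hf : HolAt (E := E) f (pt π (ρ.comp α.toMonoidHom)))
    (hg : ∀ k, HolAt (E := E) (g k) (pt π (ρ.comp α.toMonoidHom))) :
    stalkPull E hw ρ (mono E π (ρ.comp α.toMonoidHom) f g) =
      mono E π ρ (fun y => f fun i => ev (w i) y) fun k y => g k fun i => ev (w i) y := by
  rw [mono, mono, stalkPull_res, wordPull_monomial_param _ hf hg]

variable (E π) in
/-- Every holomorphic function in the chart is the restriction of a function on `G^p`. -/
theorem exists_mono (ρ : Γ →* G) {n : ℕ} {f : (Fin p → E) → ℂ}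
    (hf : AnalyticAt ℂ f (center (pt π ρ))) {g : Fin n → (Fin p → E) → ℂ}
    (hg : ∀ k, AnalyticAt ℂ (g k) (center (pt π ρ))) :
    ∃ (f' : (Fin p → G) → ℂ) (g' : Fin n → (Fin p → G) → ℂ), HolAt (E := E) f' (pt π ρ) ∧
      (∀ k, HolAt (E := E) (g' k) (pt π ρ)) ∧ res π ρ (monomial _ f g) = mono E π ρ f' g' := by
  let A : (Fin p → G) → Fin p → E := fun y i => chartAt E (pt π ρ i) (y i)
  have hA : ∀ f : (Fin p → E) → ℂ, f =ᶠ[𝓝 (center (E := E) (pt π ρ))] fun e => f (A (param (pt π ρ) e)) :=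
    fun f => by
      filter_upwards [eventually_mem_chartDom (E := E) (pt π ρ)] with e he
      exact congrArg f (funext fun i => ((chartAt E (pt π ρ i)).right_inv (he i)).symm)
  exact ⟨fun y => f (A y), fun k y => g k (A y), hf.congr (hA f), fun k => (hg k).congr (hA (g k)),
    congrArg _ (monomial_congr (hA f) fun k => hA (g k))⟩

/-- The property quantifies over all lifts of `α` to words. `stalkPull` is the same for each of
them, and germs on `G^p` are sums of monomials. -/
theorem isPullback_stalkPull (hw : LiftsAut π α w) (s : Germs E G π) :
    IsPullback π α s fun ρ => stalkPull E hw ρ (s (ρ.comp α.toMonoidHom)) := by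
  intro w' hw' ρ
  beta_reduce
  rw [stalkPull_eq hw' hw]
  obtain ⟨x, hx⟩ := res_surjective π _ (s (ρ.comp α.toMonoidHom))
  rw [← hx]
  have h := mem_span_monomial x
  refine Submodule.span_induction (p := fun x _ => (res π (ρ.comp α.toMonoidHom) x,
    stalkPull E hw' ρ (res π (ρ.comp α.toMonoidHom) x)) ∈ Submodule.span ℂ _) ?_ ?_ ?_ ?_ h
  · rintro _ ⟨n, f, g, hf, hg, rfl⟩
    obtain ⟨f', g', hf', hg', h⟩ := exists_mono E π _ hf hg
    rw [h, stalkPull_mono hw' ρ hf' hg']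
    exact Submodule.subset_span ⟨n, f', g', hf', hg', rfl⟩
  · simp only [map_zero]
    exact Submodule.zero_mem _
  · intro x y _ _ hx hy
    simp only [map_add]
    exact Submodule.add_mem _ hx hy
  · intro c x _ hx
    simp only [map_smul]
    exact Submodule.smul_mem _ c hx

theorem stalkPull_mem_formsOn (hw : LiftsAut π α w) {n : ℕ} {U : Set (Fin p → G)}
    {s : Germs E G π} (hs : s ∈ formsOn E π n U) :
    (fun ρ => stalkPull E hw ρ (s (ρ.comp α.toMonoidHom)) : Germs E G π) ∈
      formsOn E π n ((fun y i => ev (w i) y) ⁻¹' U) := by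
  have hpt : ∀ ρ : Γ →* G, (fun i => ev (w i) (pt π ρ)) = pt π (ρ.comp α.toMonoidHom) :=
    fun ρ => funext (hw.ev_pt ρ)
  induction hs using Submodule.span_induction with
  | mem s hs =>
    obtain ⟨f, g, hfg, h⟩ := hs
    refine Submodule.subset_span ⟨fun y => f fun i => ev (w i) y, fun k y => g k fun i => ev (w i) y,
      fun y hy => ⟨(hfg _ hy).1.comp_word fun _ => rfl, fun k => ((hfg _ hy).2 k).comp_word fun _ => rfl⟩,
      fun ρ hρ => ?_⟩
    have hρ' : pt π (ρ.comp α.toMonoidHom) ∈ U := by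
      rw [← hpt]
      exact hρ
    beta_reduce
    rw [h _ hρ', stalkPull_mono hw ρ (hfg _ hρ').1 (hfg _ hρ').2]
  | zero =>
    simp only [Pi.zero_apply, map_zero]
    exact Submodule.zero_mem _
  | add s t _ _ hs ht =>
    simp only [Pi.add_apply, map_add]
    exact Submodule.add_mem _ hs ht
  | smul c s _ hs =>
    simp only [Pi.smul_apply, map_smul]
    exact Submodule.smul_mem _ c hs

theorem BasicAt.stalkPull (hw : LiftsAut π α w) {ρ : Γ →* G} {v : E}
    {z : Stalk E π (ρ.comp α.toMonoidHom)} (h : BasicAt π (ρ.comp α.toMonoidHom) v z) :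
    BasicAt π ρ v (stalkPull E hw ρ z) := by
  rw [basicAt_iff] at *
  obtain ⟨x, rfl, h1, h2⟩ := h
  refine ⟨wordPull E w (hw.ev_pt ρ) x, (stalkPull_res hw ρ x).symm, ?_, ?_⟩
  · rw [← wordPull_contract, ← stalkPull_res hw, h1, map_zero]
  · rw [← wordPull_dr, ← wordPull_contract, ← stalkPull_res hw, h2, map_zero]

variable (E) in
/-- The pullback of basic forms along `ρ ↦ ρ ∘ α`. -/
def basicPull (hw : LiftsAut π α w) (n : ℕ) (s : BasicForms E G π n) : BasicForms E G π n :=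
  ⟨fun ρ => stalkPull E hw ρ (s.1 (ρ.comp α.toMonoidHom)), by
    refine ⟨fun ρ => ?_, fun ρ v => (s.2.2 _ v).stalkPull hw⟩
    have : IsTopologicalGroup G := topologicalGroup_of_lieGroup 𝓘(ℂ, E) ω
    obtain ⟨U, hU, hxU, hsU⟩ := s.2.1 (ρ.comp α.toMonoidHom)
    refine ⟨_, hU.preimage (continuous_pi fun i => continuous_ev (w i)), ?_,
      stalkPull_mem_formsOn hw hsU⟩
    rw [Set.mem_preimage, funext (hw.ev_pt ρ)]
    exact hxU⟩

/-- Substitution of words carries `dv · v⁻¹` to the form of the substituted word, so the equality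
holds for cochains, not only up to coboundaries. -/
theorem stalkPull_etaCochain (hπ : Function.Surjective π) (hw : LiftsAut π α w)
    {lift : Γ → FreeGroup (Fin p)} (hl : ∀ γ, π (lift γ) = γ) {n : ℕ} (Φ : E → ℂ) (γ : Fin n → Γ)
    (ρ : Γ →* G) : stalkPull E hw ρ (etaCochain π lift n Φ γ (ρ.comp α.toMonoidHom)) =
      etaCochain π lift n Φ (fun k => α (γ k)) ρ := by
  rw [etaCochain_apply hπ hl (ρ := ρ), etaCochain, stalkPull_res, wordPull_etaForm, res_etaForm ρ hπ]
  simp only [hw.lift, hl]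

theorem autInvariant_eta (hπ : Function.Surjective π) {n : ℕ} (Φ : InvPoly E G n) :
    AutInvariant π (eta hπ n Φ) := by
  intro α
  obtain ⟨lift, hl⟩ := hπ.hasRightInverse
  have hw : LiftsAut π α fun i => lift (α (π (FreeGroup.of i))) := fun i => hl _
  obtain ⟨c, hc⟩ := exists_represents (eta hπ n Φ)
  have hE := (represents_eta_iff hπ hl Φ c).1 hc
  refine ⟨c, fun γ => basicPull E hw n (c γ), hc, fun γ => isPullback_stalkPull hw _, ?_⟩
  refine (hc.aut α).congr (IsCob.of_map (f := (BasicForms E G π n).subtype) Subtype.val_injective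
    (IsCob.pi fun ρ => ?_))
  -- Both the pulled back cocycle and the cocycle transported by `α` differ by coboundaries from
  -- explicit cochains, and these two explicit cochains coincide.
  have h := ((hE (ρ.comp α.toMonoidHom)).map (stalkPull E hw ρ).toLinearMap).sub ((hE ρ).aut α)
  convert h using 1
  funext γ
  change stalkPull E hw ρ ((c γ).1 (ρ.comp α.toMonoidHom)) - (c fun k => α (γ k)).1 ρ = 
    stalkPull E hw ρ ((c γ).1 (ρ.comp α.toMonoidHom) - etaCochain π lift n Φ γ (ρ.comp α.toMonoidHom)) -
      ((c fun k => α (γ k)).1 ρ - etaCochain π lift n Φ (fun k => α (γ k)) ρ)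
  rw [map_sub, stalkPull_etaCochain hπ hw hl, sub_sub_sub_cancel_right]

end AutInvariant

end CharStack

end

/-! ### The main theorem -/

theorem mainTheorem2 {E G Γ : Type} [NormedAddCommGroup E] [NormedSpace ℂ E]
    [FiniteDimensional ℂ E] [TopologicalSpace G] [ChartedSpace E G] [Group G]
    [LieGroup 𝓘(ℂ, E) ω G] [Group Γ] {p : ℕ} (π : FreeGroup (Fin p) →* Γ)
    (hπ : Function.Surjective π) :
    ∃ η : (n : ℕ) → CharStack.InvPoly E G n →ₗ[ℂ]
        CharStack.H Γ (CharStack.BasicForms E G π n) n,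
      -- `η_Φ` is the class of `Φ` applied to the cup power of the tautological cocycle
      (∀ lift : Γ → FreeGroup (Fin p), (∀ γ, π (lift γ) = γ) →
        ∀ (n : ℕ) (Φ : CharStack.InvPoly E G n),
          ∃ h : ∀ γ, CharStack.etaCochain π lift n (Φ : E → ℂ) γ ∈ CharStack.Forms E G π n,
            CharStack.Represents (fun γ => (⟨_, h γ⟩ : CharStack.Forms E G π n))
              (CharStack.coeffMap Γ n (Submodule.inclusion (CharStack.basicForms_le π n))
                (η n Φ))) ∧
      -- at each `ρ`, `Φ` and the cup product give an alternating map on `H¹(Γ, Ad ρ)`, and this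
      -- map gives the values of `η_Φ` at `ρ`
      (∀ (n : ℕ) (Φ : CharStack.InvPoly E G n) (ρ : Γ →* G),
        ∃ κ : AlternatingMap ℂ (groupCohomology.H1 (CharStack.AdRep (E := E) ρ))
            (CharStack.H Γ ℂ n) (Fin n),
          ∀ s : Fin n → groupCohomology.cocycles₁ (CharStack.AdRep (E := E) ρ),
            CharStack.Represents
              (fun γ => iteratedFDeriv ℂ n (Φ : E → ℂ) 0 fun k =>
                CharStack.Ad (ρ (CharStack.prefixProd γ k)) (s k (γ k)))
              (κ fun k => groupCohomology.H1π (CharStack.AdRep (E := E) ρ) (s k)) ∧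
            CharStack.HasValue π (η n Φ) ρ (fun k => CharStack.tangent π ρ (s k))
              (κ fun k => groupCohomology.H1π (CharStack.AdRep (E := E) ρ) (s k))) ∧
      -- `Aut(Γ)`-invariance
      (∀ (n : ℕ) (Φ : CharStack.InvPoly E G n), CharStack.AutInvariant π (η n Φ)) ∧
      -- `η` is a homomorphism of graded algebras: it is linear, unital and multiplicative
      CharStack.IsOne π (η 0 ⟨1, SetLike.GradedOne.one_mem⟩) ∧
      (∀ (n m : ℕ) (Φ : CharStack.InvPoly E G n) (Ψ : CharStack.InvPoly E G m),
        CharStack.IsProduct π (η n Φ) (η m Ψ) (η (n + m) ⟨Φ * Ψ, SetLike.mul_mem_graded Φ.2 Ψ.2⟩)) ∧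
      -- the tensor product of basic forms with `H^n(Γ, ℂ)` is a subspace of the target, and `η`
      -- takes its values there if `H^n(Γ, ℂ)` is finite-dimensional
      ∀ n : ℕ, Function.Injective (CharStack.tensorMap Γ (CharStack.BasicForms E G π n) n) ∧
        (FiniteDimensional ℂ (CharStack.H Γ ℂ n) →
          ∃ T : CharStack.InvPoly E G n →ₗ[ℂ]
              TensorProduct ℂ (CharStack.BasicForms E G π n) (CharStack.H Γ ℂ n),
            ∀ Φ, CharStack.tensorMap Γ (CharStack.BasicForms E G π n) n (T Φ) = η n Φ) := by
  refine ⟨CharStack.eta hπ, fun lift hl n Φ =>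
    ⟨CharStack.etaCochain_mem_forms (E := E) (G := G) (π := π) lift n (Φ : E → ℂ), ?_⟩,
    fun n Φ ρ => CharStack.exists_values ρ hπ Φ, fun n Φ => CharStack.autInvariant_eta hπ Φ,
    CharStack.isOne_eta hπ, fun n m Φ Ψ => CharStack.isProduct_eta hπ Φ Ψ,
    fun n => ⟨CharStack.tensorMap_injective, fun _ => ?_⟩⟩
  · exact CharStack.represents_formCochain hπ hl Φ
  let T := LinearEquiv.ofBijective (CharStack.tensorMap Γ (CharStack.BasicForms E G π n) n)
    ⟨CharStack.tensorMap_injective, CharStack.tensorMap_surjective⟩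
  exact ⟨T.symm.toLinearMap ∘ₗ CharStack.eta hπ n, fun Φ => T.apply_symm_apply _⟩
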